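/- Let $d\ge 1$, $1/2<H<1$, and let $\alpha$ satisfy $0<\alpha<d$ and $\alpha>d-2$. Let $f(x)=c_{\alpha,d}|x|^{-(d-\alpha)}$ be the Riesz kernel of order $\alpha$ on $\mathbb R^d$, where $c_{\alpha,d}=2^{d-\alpha}\pi^{d/2}\,\Gamma(\frac{d-\alpha}{2})/\Gamma(\frac{\alpha}{2})$ (so that $f$ is the Fourier transform of $\mu(d\xi)=|\xi|^{-\alpha}d\xi$). Let $W=\{W_t(A);\,t\ge 0,\ A\subset\mathbb R^d \text{ bounded Borel}\}$ be a zero-mean Gaussian process on a probability space $(\Omega,\mathcal F,P)$ with covariance $$E[W_t(A)W_s(B)]=\langle 1_{[0,t]\times A},1_{[0,s]\times B}\rangle_{\mathcal{HP}}:=H(2H-1)\int_0^t\!\int_0^s|r-r'|^{2H-2}\,dr'\,dr\ \int_A\!\int_B f(x-y)\,dy\,dx .$$ Let $\mathcal{HP}$ be the Hilbert space completion of the linear span of the indicators $1_{[0,t]\times A}$ for this inner product; its elements, and those of the Hilbert tensor powers $\mathcal{HP}^{\otimes n}$, are identified with distributions, as limits of elementary functions. Let $I_n$ be the multiple Wiener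 integral of order $n$ with respect to $W$, and $\delta$ the Skorohod integral (the adjoint of the Malliavin derivative $D:\mathbb D^{1,2}\to L^2(\Omega;\mathcal{HP})$). Let $G(t,\cdot)$ be the fundamental solution of the wave equation on $\mathbb R^d$, i.e. the tempered distribution with Fourier transform $\xi\mapsto \sin(t|\xi|)/|\xi|$. For $t>0$, $x\in\mathbb R^d$ and $n\ge1$, let $f_n(\cdot,t,x)$ be the distribution formally given by $$f_n(t_1,x_1,\dots,t_n,x_n,t,x)=G(t-t_n,x-x_n)\cdots G(t_2-t_1,x_2-x_1)1_{\{0<t_1<\dots<t_n<t\}} .$$ For fixed $0<t_1<\dots<t_n<t_{n+1}:=t$ its action on $\phi_1\otimes\dots\otimes\phi_n$, with $\phi_k\in C_0^\infty(\mathbb R^d)$, is $\varphi_n(x)$, where $\varphi_0=1$ and $\varphi_k=(\phi_k\varphi_{k-1})*G(t_{k+1}-t_k,\cdot)$. Then, for every $t>0$ and $x\in\mathbb R^d$, $f_n(\cdot,t,x)\in\mathcal{HP}^{\otimes n}$ for all $n\ge 1$, and the series $\sum_{n\ge1}I_n(f_n(\cdot,t,x))$ converges in $L^2(\Omega)$.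 Consequently the equation $$\frac{\partial^2u}{\partial t^2}=\Delta u+u\,\dot W\quad (t>0,\ x\in\mathbb R^d),\qquad u(0,\cdot)=1,\quad \frac{\partial u}{\partial t}(0,\cdot)=0,$$ has a solution in the Skorohod sense. That is, there is a process $u=\{u(t,x);t\ge0,x\in\mathbb R^d\}$ with $u(0,x)=1$ such that, for all $t>0$ and $x\in\mathbb R^d$: $E|u(t,x)|^2<\infty$; $u(t,x)$ is measurable with respect to $\sigma\{W_s(A);0\le s\le t,\ A \text{ bounded Borel}\}$; the process $v^{(t,x)}=G(t-\cdot,x-*)u$ on $(0,t)\times\mathbb R^d$ belongs to $\mathrm{Dom}\,\delta$; and $u(t,x)=1+\delta(v^{(t,x)})$. Here the product of the distribution $G$ with $u$ is the limit, as an $L^2(\Omega)$-valued distribution, of the products $G_\varepsilon(t-\cdot,x-*)u$ as $\varepsilon\downarrow0$, where $G_\varepsilon$ is obtained from $G$ by mollification in space (the limit being the same for every mollifier). Moreover, this solution is given by $u(t,x)=1+\sum_{n\ge1}I_n(f_n(\cdot,t,x))$ for $t>0$, and $\sup_{(t,x)\in[0,T]\times\mathbb R^d}E|u(t,x)|^2<\infty$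 for every $T>0$. -/

import Mathlib

open MeasureTheory ProbabilityTheory Filter Topology Set
open scoped ENNReal FourierTransform RealInnerProductSpace

noncomputable section

namespace FracWave

/-- The space `ℝ^d` with its Euclidean norm. -/
abbrev Sp (d : ℕ) : Type := EuclideanSpace ℝ (Fin d)

/-! ### The noise -/

/-- The constant `c_{α,d}` for which `c_{α,d} |x|^{-(d-α)}` is the Fourier transform
(`∫ e^{-i ξ·x} μ(dξ)` in the sense of tempered distributions) of `μ(dξ) = |ξ|^{-α} dξ`. -/
def rieszConst (d : ℕ) (α : ℝ) : ℝ :=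
  2 ^ ((d : ℝ) - α) * Real.pi ^ ((d : ℝ) / 2) *
    Real.Gamma (((d : ℝ) - α) / 2) / Real.Gamma (α / 2)

/-- The Riesz kernel of order `α` on `ℝ^d`. -/
def rieszKernel (d : ℕ) (α : ℝ) (x : Sp d) : ℝ :=
  rieszConst d α * ‖x‖ ^ (-((d : ℝ) - α))

/-- The covariance `R_H(t,s)` of fractional Brownian motion of index `H > 1/2`. -/
def fbmCov (H t s : ℝ) : ℝ :=
  H * (2 * H - 1) * ∫ r in (0 : ℝ)..t, ∫ r' in (0 : ℝ)..s, |r - r'| ^ (2 * H - 2)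

/-- A set `[0,t] × A` with `t ≥ 0` and `A` a bounded Borel set of `ℝ^d`. -/
structure Rect (d : ℕ) where
  time : ℝ
  time_nonneg : 0 ≤ time
  base : Set (Sp d)
  measurable_base : MeasurableSet base
  bounded_base : Bornology.IsBounded base

/-- The subset of space-time underlying a `Rect`. -/
def Rect.toSet {d : ℕ} (R : Rect d) : Set (ℝ × Sp d) := Icc 0 R.time ×ˢ R.base

/-- The inner product `⟨1_{[0,t]×A}, 1_{[0,s]×B}⟩ = R_H(t,s) ∫_A ∫_B f(x-y) dx dy`,
`f` being the Riesz kernel. -/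
def rectInner {d : ℕ} (H α : ℝ) (R R' : Rect d) : ℝ :=
  fbmCov H R.time R'.time * ∫ x in R.base, ∫ y in R'.base, rieszKernel d α (x - y)

variable {Ω : Type*} [MeasurableSpace Ω]

/-- `W = {W_t(A)}` is a zero-mean Gaussian process, fractional in time with index `H` and
homogeneous in space with covariance kernel the Riesz kernel of order `α`. -/
structure IsNoise {d : ℕ} (H α : ℝ) (W : Rect d → Ω → ℝ) (P : Measure Ω) : Prop where
  measurable : ∀ R, Measurable (W R)
  gaussian : IsGaussianProcess W P
  centered : ∀ R, ∫ ω, W R ω ∂P = 0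
  covariance : ∀ R R', ∫ ω, W R ω * W R' ω ∂P = rectInner H α R R'

/-- The `σ`-field `F_t` generated by `W_s(A)`, `s ≤ t`. -/
abbrev pastSigma {d : ℕ} (W : Rect d → Ω → ℝ) (t : ℝ) : MeasurableSpace Ω :=
  ⨆ R : {R : Rect d // R.time ≤ t}, MeasurableSpace.comap (W R.1) (borel ℝ)

/-- The `σ`-field generated by the whole noise. -/
abbrev fullSigma {d : ℕ} (W : Rect d → Ω → ℝ) : MeasurableSpace Ω :=
  ⨆ R : Rect d, MeasurableSpace.comap (W R) (borel ℝ)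

/-- The Hilbert space `HP`: the completion of the linear span of the indicators `1_{[0,t]×A}` for
the inner product `rectInner`. It is realized through the isometry `1_{[0,t]×A} ↦ W_t(A)` as a
closed subspace of `L²(Ω)`; with this realization the isonormal process `h ↦ W(h)` is the inclusion
of `HP` in `L²(Ω)`. -/
def HP {d : ℕ} (W : Rect d → Ω → ℝ) (P : Measure Ω) : Submodule ℝ (Lp ℝ 2 P) :=
  (Submodule.span ℝ {X : Lp ℝ 2 P | ∃ R : Rect d, (X : Ω → ℝ) =ᵐ[P] W R}).topologicalClosure

/-! ### Distributions and multiple Wiener integrals -/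

/-- Space-time test functions: the space `C_0^∞(ℝ × ℝ^d)`. -/
def IsTest {d : ℕ} (φ : ℝ × Sp d → ℝ) : Prop := ContDiff ℝ (⊤ : ℕ∞) φ ∧ HasCompactSupport φ

/-- `L h = (h, φ)` is the action on the test function `φ` of the elements `h` of `HP`, viewed as
distributions on `ℝ × ℝ^d`: it is the continuous extension of `1_{[0,t]×A} ↦ ∫_{[0,t]×A} φ`. -/
def IsAction {d : ℕ} (W : Rect d → Ω → ℝ) (P : Measure Ω) (φ : ℝ × Sp d → ℝ)
    (L : HP W P →L[ℝ] ℝ) : Prop :=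
  ∀ (h : HP W P) (R : Rect d), ((h : Lp ℝ 2 P) : Ω → ℝ) =ᵐ[P] W R → L h = ∫ z in R.toSet, φ z

/-- Elementary functions of `n` space-time variables: `e` stands for
`∑_R e(R) 1_{R_1} ⊗ ⋯ ⊗ 1_{R_n}`. -/
abbrev Elem (d n : ℕ) : Type := (Fin n → Rect d) →₀ ℝ

/-- The squared norm of an elementary function in the `n`-fold Hilbert tensor power of `HP`. -/
def Elem.normSq {d n : ℕ} (H α : ℝ) (e : Elem d n) : ℝ :=
  e.sum fun R a => e.sum fun R' b => a * b * ∏ i, rectInner H α (R i) (R' i)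

/-- The integral of an elementary function against `φ_1 ⊗ ⋯ ⊗ φ_n`. -/
def Elem.action {d n : ℕ} (e : Elem d n) (φ : Fin n → ℝ × Sp d → ℝ) : ℝ :=
  e.sum fun R a => a * ∏ i, ∫ z in (R i).toSet, φ i z

/-- The multiple Wiener integral `I_n(1_{R_1} ⊗ ⋯ ⊗ 1_{R_n})`, that is the Wick product
`:W(R_1) ⋯ W(R_n):` (the projection of `W(R_1) ⋯ W(R_n)` on the `n`-th Wiener chaos), through the
recursion `I_1(h) I_{n+1}(g) = I_{n+2}(h ⊗ g) + (contractions of h with g)`. -/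
def wick {d : ℕ} (H α : ℝ) (W : Rect d → Ω → ℝ) : (n : ℕ) → (Fin n → Rect d) → Ω → ℝ
  | 0, _, _ => 1
  | 1, R, ω => W (R 0) ω
  | n + 2, R, ω =>
      W (R 0) ω * wick H α W (n + 1) (fun i => R i.succ) ω -
        ∑ j : Fin (n + 1), rectInner H α (R 0) (R j.succ) *
          wick H α W n (fun i => R (j.succAbove i).succ) ω

/-- The multiple Wiener integral `I_n` of an elementary function. -/
def Elem.wienerInt {d n : ℕ} (H α : ℝ) (W : Rect d → Ω → ℝ) (e : Elem d n) (ω : Ω) : ℝ :=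
  e.sum fun R a => a * wick H α W n R ω

/-- The distribution `T` on `(ℝ × ℝ^d)^n`, given by its action on tensor products of test functions,
belongs to the Hilbert tensor power `HP^{⊗n}`, and `X = I_n(T)` is its multiple Wiener integral:
`T` is the limit, as a distribution, of elementary functions that form a Cauchy sequence
for the norm of `HP^{⊗n}`, and `X` is the limit in `L²(Ω)` of their multiple integrals. -/
def IsMultipleIntegral {d : ℕ} (H α : ℝ) (W : Rect d → Ω → ℝ) (P : Measure Ω) (n : ℕ)
    (T : (Fin n → ℝ × Sp d → ℝ) → ℝ) (X : Lp ℝ 2 P) : Prop :=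
  ∃ e : ℕ → Elem d n,
    Tendsto (fun p : ℕ × ℕ => (e p.1 - e p.2).normSq H α) atTop (𝓝 0) ∧
    (∀ φ : Fin n → ℝ × Sp d → ℝ, (∀ i, IsTest (φ i)) →
      Tendsto (fun k => (e k).action φ) atTop (𝓝 (T φ))) ∧
    Tendsto (fun k => eLpNorm (fun ω => (e k).wienerInt H α W ω - X ω) 2 P) atTop (𝓝 0)

/-! ### The wave kernel -/

/-- The convolution `(g * G(t,·))(x)` of a (smooth, rapidly decreasing) function `g` with the
fundamental solution `G(t,·)` of the wave equation on `ℝ^d`, the tempered distribution with Fourier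
transform `ξ ↦ sin(t|ξ|)/|ξ|`. Mathlib's Fourier variable is `ξ/(2π)`, and `sinc r = sin r / r`
with `sinc 0 = 1`. The inverse Fourier transform below is real, since `g` is. -/
def waveConv {d : ℕ} (t : ℝ) (g : Sp d → ℝ) (x : Sp d) : ℝ :=
  (𝓕⁻ (fun ξ : Sp d => ((t * Real.sinc (2 * Real.pi * t * ‖ξ‖) : ℝ) : ℂ) *
    𝓕 (fun y : Sp d => (g y : ℂ)) ξ) x).re

/-- The action of the distribution `f_n(t_1,·,…,t_n,·,t,x)` on `φ_1 ⊗ ⋯ ⊗ φ_n`, where formally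
`f_n = G(t-t_n,x-x_n) G(t_n-t_{n-1},x_n-x_{n-1}) ⋯ G(t_2-t_1,x_2-x_1)`: multiply by `φ_k` and
convolve with `G(t_{k+1}-t_k,·)`, for `k = 1, …, n`, with `t_{n+1} = t`. -/
def kernelAt {d : ℕ} : (n : ℕ) → (Fin n → ℝ) → (Fin n → Sp d → ℝ) → ℝ → Sp d → ℝ
  | 0, _, _, _, _ => 1
  | n + 1, τ, φ, t, x =>
      waveConv (t - τ (Fin.last n))
        (fun y => φ (Fin.last n) y *
          kernelAt n (fun i => τ i.castSucc) (fun i => φ i.castSucc) (τ (Fin.last n)) y) x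

/-- The action of `f_n(·,t,x)`, as a distribution in the `n` space-time variables, on
`φ_1 ⊗ ⋯ ⊗ φ_n`; the kernel vanishes unless `0 < t_1 < ⋯ < t_n < t`. -/
def kernel {d : ℕ} (n : ℕ) (t : ℝ) (x : Sp d) (φ : Fin n → ℝ × Sp d → ℝ) : ℝ :=
  ∫ τ in {τ : Fin n → ℝ | StrictMono τ ∧ ∀ i, 0 < τ i ∧ τ i < t},
    kernelAt n τ (fun i y => φ i (τ i, y)) t x

/-! ### Malliavin derivative and Skorohod integral -/

/-- `F = f(W(h_1),…,W(h_m))` with `f` smooth and bounded together with all its derivatives, and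
`DF = ∑ ∂_i f(W(h_1),…,W(h_m)) h_i`. -/
def IsSmoothFunctional {d : ℕ} (W : Rect d → Ω → ℝ) (P : Measure Ω)
    (F : Ω → ℝ) (DF : Ω → HP W P) : Prop :=
  ∃ (m : ℕ) (f : (Fin m → ℝ) → ℝ) (h : Fin m → HP W P),
    ContDiff ℝ (⊤ : ℕ∞) f ∧ (∀ k : ℕ, ∃ C : ℝ, ∀ y, ‖iteratedFDeriv ℝ k f y‖ ≤ C) ∧
    F = (fun ω => f (fun i => (h i : Lp ℝ 2 P) ω)) ∧
    DF = (fun ω => ∑ i, fderiv ℝ f (fun j => (h j : Lp ℝ 2 P) ω) (Pi.single i 1) • h i)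

/-- `F` belongs to `𝔻^{1,2}` and `DF` is its Malliavin derivative. -/
def IsMalliavinDeriv {d : ℕ} (W : Rect d → Ω → ℝ) (P : Measure Ω)
    (F : Ω → ℝ) (DF : Ω → HP W P) : Prop :=
  MemLp F 2 P ∧ MemLp DF 2 P ∧
  ∃ (Fk : ℕ → Ω → ℝ) (DFk : ℕ → Ω → HP W P),
    (∀ k, IsSmoothFunctional W P (Fk k) (DFk k)) ∧
    Tendsto (fun k => eLpNorm (Fk k - F) 2 P) atTop (𝓝 0) ∧
    Tendsto (fun k => eLpNorm (DFk k - DF) 2 P) atTop (𝓝 0)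

/-- `v ∈ L²(Ω; HP)` belongs to `Dom δ` and `X = δ(v)` is its Skorohod integral: `X` is the element
of `L²(Ω)`, measurable for the noise, with `E[F X] = E⟨DF, v⟩` for all `F ∈ 𝔻^{1,2}`. -/
def IsSkorohod {d : ℕ} (W : Rect d → Ω → ℝ) (P : Measure Ω)
    (v : Ω → HP W P) (X : Ω → ℝ) : Prop :=
  MemLp v 2 P ∧ MemLp X 2 P ∧ AEStronglyMeasurable[fullSigma W] X P ∧
  ∀ (F : Ω → ℝ) (DF : Ω → HP W P), IsMalliavinDeriv W P F DF →
    ∫ ω, F ω * X ω ∂P = ∫ ω, ⟪DF ω, v ω⟫ ∂P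

/-! ### Solutions -/

open Classical in
/-- The class in `L²(Ω)` of a square-integrable random variable. -/
def toL2 (P : Measure Ω) (X : Ω → ℝ) : Lp ℝ 2 P :=
  if hX : MemLp X 2 P then hX.toLp X else 0

/-- `ψ` is a mollifier on `ℝ^d`. -/
def IsMollifier {d : ℕ} (ψ : Sp d → ℝ) : Prop :=
  ContDiff ℝ (⊤ : ℕ∞) ψ ∧ HasCompactSupport ψ ∧ (∀ y, 0 ≤ ψ y) ∧ ∫ y, ψ y = 1

/-- `G_ε(t,·) = ψ_ε * G(t,·)` with `ψ_ε(y) = ε^{-d} ψ(y/ε)`. -/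
def waveReg {d : ℕ} (ψ : Sp d → ℝ) (ε t : ℝ) (x : Sp d) : ℝ :=
  waveConv t (fun y => (ε ^ d)⁻¹ * ψ (ε⁻¹ • y)) x

/-- The random element `v` of `HP` is the product `G(t-·,x-*) u`, restricted to `(0,t) × ℝ^d`, of the
distribution `G(t-·,x-*)` and the random function `u`. As usual for such products, this means
that the functions `G_ε(t-·,x-*) u`, with `G_ε` a regularization of `G` in space, converge to `v` as
distributions on `ℝ × ℝ^d` with values in `L²(Ω)`, for every choice of the mollifier. When
`G(t,·)` is a function (`d ≤ 2`), this is the pointwise product. -/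
def IsWaveProduct {d : ℕ} (W : Rect d → Ω → ℝ) (P : Measure Ω) [IsProbabilityMeasure P]
    (u : ℝ → Sp d → Ω → ℝ) (t : ℝ) (x : Sp d) (v : Ω → HP W P) : Prop :=
  ∀ ψ : Sp d → ℝ, IsMollifier ψ → ∀ φ : ℝ × Sp d → ℝ, IsTest φ →
    (∀ ε : ℝ, 0 < ε → IntegrableOn
      (fun z : ℝ × Sp d => (waveReg ψ ε (t - z.1) (x - z.2) * φ z) • toL2 P (u z.1 z.2))
      (Ioo 0 t ×ˢ univ)) ∧
    ∃ L : HP W P →L[ℝ] ℝ, IsAction W P φ L ∧ MemLp (fun ω => L (v ω)) 2 P ∧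
      Tendsto
        (fun ε : ℝ => ∫ z in Ioo 0 t ×ˢ univ,
          (waveReg ψ ε (t - z.1) (x - z.2) * φ z) • toL2 P (u z.1 z.2))
        (𝓝[>] 0) (𝓝 (toL2 P fun ω => L (v ω)))

/-- `u` is a solution, in the Skorohod sense, of `u_tt = Δu + u Ẇ`, `u(0,·) = 1`, `u_t(0,·) = 0`:
it is adapted, square integrable, and `u(t,x) = 1 + δ(G(t-·,x-*) u)`. -/
structure IsSolution {d : ℕ} (W : Rect d → Ω → ℝ) (P : Measure Ω) [IsProbabilityMeasure P]
    (u : ℝ → Sp d → Ω → ℝ) : Prop where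
  initial : ∀ x ω, u 0 x ω = 1
  square_integrable : ∀ t, 0 < t → ∀ x, MemLp (u t x) 2 P
  adapted : ∀ t, 0 < t → ∀ x, Measurable[pastSigma W t] (u t x)
  equation : ∀ t, 0 < t → ∀ x, ∃ v : Ω → HP W P,
    IsWaveProduct W P u t x v ∧ IsSkorohod W P v (fun ω => u t x ω - 1)

end FracWave

end

set_option linter.unusedSectionVars false

noncomputable section

namespace FracWave

/-! ### Gaussian integration by parts -/

section GaussianIBP

variable {E : Type*} [NormedAddCommGroup E] [NormedSpace ℝ E]

/-! Everything is carried to an explicit weighted `L²` space, by taking Fourier transforms in space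
but not in time. The Riesz kernel becomes the weight `|ξ|^{-α}` (`riesz_spectral`). The time
covariance is not diagonalized but dominated: Schur's test with the weight `e^s` bounds the form
with kernel `|r-r'|^{2H-2}` by a multiple of the `L²` form with weight `e^{2s}`, uniformly over all
time horizons (`exists_time_bound`). This domination is an inequality between positive semidefinite
kernels, so by the Schur product theorem it survives tensor powers: the squared norm of `HP^{⊗n}` is
at most `C^n` times the squared norm of `SpecL2` (`exists_normSq_le`). Consequently `I_n` extends to
a bounded operator `wienerOp` on `SpecL2`, with squared norm at most `n! C^n`. So does the operator
`skorOp`, which integrates only the first `n` of `n+1` variables and keeps the last one as an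
element of `HP`.

On the spectral side the kernel `f_n(·,t,x)` is a genuine function, `fHat`: on the simplex of
ordered times it is a product of wave multipliers evaluated at the partial sums of the frequencies,
times weights, times the character `e^{2πi x·(ξ_1+⋯+ξ_n)}`. Its modulus does not depend on `x`.
Integrating the last frequency first, the condition `α > d - 2` bounds each integral by `C s^γ` with
`γ = α - d + 2 > 0`, uniformly in the shift caused by the other frequencies (`exists_wave_bound`).
The squared norms therefore satisfy a Volterra inequality with kernel `(t-s)^γ`. Because `γ > 0`,
they are small enough that the series converges even after multiplication by `n!` and by any
geometric factor (`exists_ampSq_bound`). This gives the chaos series and its locally uniform moment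
bounds. Membership of `f_n` in the tensor power holds because every square integrable function with
the Hermitian symmetry of transforms of real functions is a limit of transforms of elementary
functions (`mem_closure_range_hatL`), and because the spectral pairing reproduces the action of the
distribution (`kernel_eq`).

For the equation, Gaussian integration by parts in the last Wick factor gives `E[F I_{n+1}(f)] =
E⟨DF, skorOp f⟩` (`skorohod_duality`, `skorOp_duality`). Hence `v = ∑ skorOp f_{n+1}` satisfies
`δ(v) = u - 1`. That `v` is the product `G(t-·,x-*) u` is checked against test functions: mollifying
`G` only inserts a factor `ψ̂(ε·)`, bounded by `1` and tending to `1`, so dominated convergence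
applies in each chaos, and then to the sum over the chaoses. The limit in the `n`-th chaos is the
contraction of `f_{n+1}` with the test function in its last variable, which is also the action of
the test function on `skorOp f_{n+1}` (`compLpL_skorOp`). -/

theorem hasTemperateGrowth_fderiv {F : Type*} [NormedAddCommGroup F] [NormedSpace ℝ F]
    {g : E → F} (hg : g.HasTemperateGrowth) : (fderiv ℝ g).HasTemperateGrowth := by
  refine ⟨(contDiff_infty_iff_fderiv.1 hg.1).2, fun n => ?_⟩
  obtain ⟨k, C, h⟩ := hg.2 (n + 1)
  refine ⟨k, C, fun x => ?_⟩
  rw [norm_iteratedFDeriv_fderiv]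
  exact h x

theorem hasTemperateGrowth_fderiv_apply {F : Type*} [NormedAddCommGroup F] [NormedSpace ℝ F]
    {g : E → F} (hg : g.HasTemperateGrowth) (v : E) :
    (fun x => fderiv ℝ g x v).HasTemperateGrowth := by
  have := (ContinuousLinearMap.hasTemperateGrowth (ContinuousLinearMap.apply ℝ F v)).comp
    (hasTemperateGrowth_fderiv hg)
  exact this

variable [MeasurableSpace E] [BorelSpace E] [SecondCountableTopology E] [CompleteSpace E]

/-- Such a function is dominated by `C (1 + ‖x‖)^k`, and a Gaussian measure has moments of all
orders. -/
theorem memLp_of_hasTemperateGrowth {F : Type*} [NormedAddCommGroup F] [NormedSpace ℝ F]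
    {g : E → F} (hg : g.HasTemperateGrowth)
    (μ : Measure E) [IsGaussian μ] (p : ℝ≥0∞) (hp : p ≠ ∞) : MemLp g p μ := by
  obtain ⟨k, C, h⟩ := hg.2 0
  have hpk : p * (k : ℝ≥0∞) ≠ ∞ := ENNReal.mul_ne_top hp (ENNReal.natCast_ne_top k)
  have h1 : MemLp (fun x : E => 1 + ‖x‖) (p * k) μ :=
    (memLp_const (1 : ℝ)).add (IsGaussian.memLp_id μ (p * k) hpk).norm
  have h2 : MemLp (fun x : E => (1 + ‖x‖) ^ k) p μ := by
    rcases Nat.eq_zero_or_pos k with rfl | hk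
    · simpa using memLp_const (1 : ℝ)
    have hk0 : (k : ℝ≥0∞) ≠ 0 := Nat.cast_ne_zero.2 hk.ne'
    have h3 := (memLp_norm_rpow_iff (q := k) (p := p * k) h1.1 hk0 (ENNReal.natCast_ne_top k)).2 h1
    rw [ENNReal.mul_div_cancel_right hk0 (ENNReal.natCast_ne_top k)] at h3
    refine (memLp_congr_ae (Eventually.of_forall fun x => ?_)).1 h3
    change ‖1 + ‖x‖‖ ^ ((k : ℝ≥0∞).toReal) = (1 + ‖x‖) ^ k
    rw [ENNReal.toReal_natCast, Real.rpow_natCast, Real.norm_of_nonneg (by positivity)]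
  have hgc : Continuous g := hg.1.continuous
  refine MemLp.mono' (h2.const_mul C) hgc.aestronglyMeasurable
    (Eventually.of_forall fun x => ?_)
  have := h x
  rwa [norm_iteratedFDeriv_zero] at this

/-- Stein's identity. -/
theorem integral_mul_gaussianReal {h : ℝ → ℝ} (hh : h.HasTemperateGrowth) {v : NNReal}
    (hv : v ≠ 0) :
    ∫ x, x * h x ∂(gaussianReal 0 v) = v * ∫ x, deriv h x ∂(gaussianReal 0 v) := by
  have hd : (deriv h).HasTemperateGrowth := by
    have := hasTemperateGrowth_fderiv_apply hh (1 : ℝ)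
    exact this
  have hint : ∀ {k : ℝ → ℝ}, k.HasTemperateGrowth →
      Integrable (fun x => k x * gaussianPDFReal 0 v x) := by
    intro k hk
    have h1 := (memLp_of_hasTemperateGrowth hk (gaussianReal 0 v) 1 (by simp)).integrable le_rfl
    rw [gaussianReal_of_var_ne_zero _ hv, integrable_withDensity_iff_integrable_smul'
      (measurable_gaussianPDF 0 v) (by simp [gaussianPDF])] at h1
    refine h1.congr (Eventually.of_forall fun x => ?_)
    simp [toReal_gaussianPDF, mul_comm]
  -- The density solves `p' = -(x/v) p`, so the identity is integration by parts on the line.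
  have hpdf : ∀ x, HasDerivAt (gaussianPDFReal 0 v) (-(x / v) * gaussianPDFReal 0 v x) x := by
    intro x
    rw [gaussianPDFReal_def]
    have h1 : HasDerivAt (fun x : ℝ => -(x - 0) ^ 2 / (2 * (v : ℝ))) (-(x / v)) x := by
      have := (((hasDerivAt_id x).sub_const 0).pow 2).neg.div_const (2 * (v : ℝ))
      refine this.congr_deriv ?_
      have : (v : ℝ) ≠ 0 := by simpa using hv
      simp; field_simp
    have := (h1.exp).const_mul ((√(2 * Real.pi * v))⁻¹)
    refine this.congr_deriv ?_
    simp; ring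
  have hxh : (fun x : ℝ => x * h x).HasTemperateGrowth :=
    Function.HasTemperateGrowth.mul Function.HasTemperateGrowth.id' hh
  have key := integral_mul_deriv_eq_deriv_mul_of_integrable (u := h) (u' := deriv h)
    (v := gaussianPDFReal 0 v) (v' := fun x => -(x / v) * gaussianPDFReal 0 v x)
    (fun x _ => (hh.1.differentiable (by simp) x).hasDerivAt) (fun x _ => hpdf x)
    (by
      have := (hint hxh).const_mul (-(v : ℝ)⁻¹)
      refine this.congr (Eventually.of_forall fun x => ?_)
      simp [div_eq_mul_inv]; ring)
    (hint hd) (hint hh)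
  rw [integral_gaussianReal_eq_integral_smul hv, integral_gaussianReal_eq_integral_smul hv]
  have h2 : ∫ x, gaussianPDFReal 0 v x • (x * h x) =
      -(v : ℝ) * ∫ x, h x * (-(x / v) * gaussianPDFReal 0 v x) := by
    rw [← integral_const_mul]
    congr 1; ext x
    have : (v : ℝ) ≠ 0 := by simpa using hv
    simp; field_simp
  rw [h2, key, neg_mul_neg]
  congr 2; ext x; simp [mul_comm]

variable {Ω : Type*} [MeasurableSpace Ω] {P : Measure Ω}

/-- Gaussian integration by parts. -/
theorem gaussian_ibp {ι : Type*} [Fintype ι] {X : ι → Ω → ℝ}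
    (hX : HasGaussianLaw (fun ω i => X i ω) P) (hc : ∀ i, ∫ ω, X i ω ∂P = 0) (i : ι)
    {g : (ι → ℝ) → ℝ} (hg : g.HasTemperateGrowth) :
    ∫ ω, X i ω * g (fun j => X j ω) ∂P =
      ∫ ω, fderiv ℝ g (fun j => X j ω) (fun j => ∫ ω', X i ω' * X j ω' ∂P) ∂P := by
  have := hX.isProbabilityMeasure
  have hm : ∀ j, MemLp (X j) 2 P := fun j => (hX.eval j).memLp_two
  have hae : AEMeasurable (fun ω i => X i ω) P := hX.aemeasurable
  have hint : ∀ {F : (ι → ℝ) → ℝ}, F.HasTemperateGrowth →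
      Integrable (fun ω => F (fun j => X j ω)) P := by
    intro F hF
    have := hX.isGaussian_map
    have h1 := (memLp_of_hasTemperateGrowth hF (P.map (fun ω i => X i ω)) 1 (by simp)).integrable
      le_rfl
    exact (integrable_map_measure (hF.1.continuous.aestronglyMeasurable) hae).1 h1
  set c : ι → ℝ := fun j => ∫ ω', X i ω' * X j ω' ∂P with hcdef
  -- If the variance of `X i` vanishes then `X i = 0` almost surely, all its covariances vanish, and
  -- both sides are `0`.
  by_cases h0 : c i = 0
  · have hz : X i =ᵐ[P] 0 := by
      have h1 : (fun ω => X i ω * X i ω) =ᵐ[P] 0 :=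
        (integral_eq_zero_iff_of_nonneg (fun ω => mul_self_nonneg _)
          ((hm i).integrable_mul (hm i))).1 h0
      filter_upwards [h1] with ω hω
      simpa using hω
    have hcz : c = 0 := by
      ext j
      simp only [hcdef, Pi.zero_apply]
      rw [integral_eq_zero_of_ae]
      filter_upwards [hz] with ω hω
      simp [hω]
    rw [hcz]
    simp only [map_zero, integral_zero]
    rw [integral_eq_zero_of_ae]
    filter_upwards [hz] with ω hω
    simp [hω]
  · have hci : 0 < c i := lt_of_le_of_ne (integral_nonneg fun ω => mul_self_nonneg _) (Ne.symm h0)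
    -- Regression on `X i`: the residual `Y = X - X_i a` is uncorrelated with `X i`, hence
    -- independent of it by joint Gaussianity. With `Y` frozen, the claim is the one-dimensional
    -- identity along the line of direction `a`, and the covariance vector is `c i • a`.
    set a : ι → ℝ := fun j => c j / c i with ha
    set Y : ι → Ω → ℝ := fun j ω => X j ω - a j * X i ω with hY
    let L : (ι → ℝ) →L[ℝ] (Unit → ℝ) × (ι → ℝ) :=
      ContinuousLinearMap.prod (ContinuousLinearMap.pi fun _ => ContinuousLinearMap.proj i)
        (ContinuousLinearMap.pi fun j =>
          ContinuousLinearMap.proj j - a j • ContinuousLinearMap.proj i)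
    have hL : HasGaussianLaw (fun ω => ((fun _ => X i ω : Unit → ℝ), fun j => Y j ω)) P :=
      hX.map_fun L
    have hind0 := HasGaussianLaw.indepFun_of_covariance_eval (X := fun _ : Unit => X i) (Y := Y) hL
      (by
        intro _ j
        have hYj : MemLp (Y j) 2 P := (hm j).sub ((hm i).const_mul _)
        rw [covariance_eq_sub (hm i) hYj, hc i, zero_mul, sub_zero]
        have : ∫ ω, (X i * Y j) ω ∂P = ∫ ω, (X i ω * X j ω - a j * (X i ω * X i ω)) ∂P := by
          congr 1; ext ω; simp [hY]; ring
        rw [this]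
        rw [integral_sub (f := fun ω => X i ω * X j ω) (g := fun ω => a j * (X i ω * X i ω)) ((hm i).integrable_mul (hm j))
          (((hm i).integrable_mul (hm i)).const_mul _), integral_const_mul]
        change c j - a j * c i = 0
        simp [ha, h0])
    have hind : IndepFun (X i) (fun ω j => Y j ω) P :=
      hind0.comp (φ := fun f : Unit → ℝ => f ()) (ψ := id) (measurable_pi_apply _) measurable_id
    have hYae : AEMeasurable (fun ω j => Y j ω) P := hL.snd.aemeasurable
    have hXi : AEMeasurable (X i) P := (hm i).1.aemeasurable
    have hprod := (indepFun_iff_map_prod_eq_prod_map_map hXi hYae).1 hind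
    have hrec : ∀ ω, (fun j => X j ω) = (fun j => Y j ω) + X i ω • a := by
      intro ω; ext j; simp [hY]; ring
    have hae2 : AEMeasurable (fun ω => (X i ω, fun j => Y j ω)) P := hXi.prodMk hYae
    have hlaw : P.map (X i) = gaussianReal 0 (c i).toNNReal := by
      rw [(hX.eval i).map_eq_gaussianReal, hc i]
      congr 1
      have : Var[X i; P] = c i := by
        rw [variance_eq_sub (hm i), hc i]
        simp [hcdef, pow_two]
      rw [this]
    have hprobY : IsProbabilityMeasure (P.map fun ω j => Y j ω) :=
      Measure.isProbabilityMeasure_map hYae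
    have htrans : ∀ {F : ℝ × (ι → ℝ) → ℝ}, Continuous F →
        Integrable (fun ω => F (X i ω, fun j => Y j ω)) P →
        ∫ ω, F (X i ω, fun j => Y j ω) ∂P =
          ∫ y, ∫ x, F (x, y) ∂(gaussianReal 0 (c i).toNNReal) ∂(P.map fun ω j => Y j ω) := by
      intro F hF hi
      rw [← integral_map (φ := fun ω => (X i ω, fun j => Y j ω)) hae2
        hF.aestronglyMeasurable, hprod, hlaw,
        integral_prod_symm]
      rw [← hlaw, ← hprod]
      exact (integrable_map_measure hF.aestronglyMeasurable hae2).2 hi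
    have hgc : Continuous g := hg.1.continuous
    have hg' : Continuous (fderiv ℝ g) := hg.1.continuous_fderiv (by simp)
    have e1 := htrans (F := fun p => p.1 * g (p.2 + p.1 • a)) (by fun_prop)
      (by
        simp only [← hrec]
        exact hint (F := fun x => x i * g x) (Function.HasTemperateGrowth.mul (f := fun x : ι → ℝ => x i)
          (ContinuousLinearMap.hasTemperateGrowth
            (ContinuousLinearMap.proj (R := ℝ) (φ := fun _ : ι => ℝ) i)) hg))
    have e2 := htrans (F := fun p => fderiv ℝ g (p.2 + p.1 • a) c) (by fun_prop)
      (by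
        simp only [← hrec]
        exact hint (hasTemperateGrowth_fderiv_apply hg c))
    simp only [← hrec] at e1 e2
    rw [e1, e2]
    congr 1; ext y
    have haff : (fun x : ℝ => y + x • a).HasTemperateGrowth :=
      (Function.HasTemperateGrowth.const y).add
        (ContinuousLinearMap.hasTemperateGrowth (ContinuousLinearMap.smulRight (1 : ℝ →L[ℝ] ℝ) a))
    have hcomp : (fun x : ℝ => g (y + x • a)).HasTemperateGrowth := hg.comp haff
    rw [integral_mul_gaussianReal hcomp (by simpa using hci),
      ← integral_const_mul]
    congr 1; ext x
    have hdx : HasDerivAt (fun x : ℝ => g (y + x • a)) (fderiv ℝ g (y + x • a) a) x := by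
      have h1 : HasDerivAt (fun x : ℝ => y + x • a) a x := by
        simpa using ((hasDerivAt_id x).smul_const a).const_add y
      exact ((hg.1.differentiable (by simp) _).hasFDerivAt).comp_hasDerivAt x h1
    rw [hdx.deriv]
    have : c = c i • a := by ext j; simp [ha]; field_simp
    conv_rhs => rw [this]
    rw [map_smul, Real.coe_toNNReal _ hci.le, smul_eq_mul]

end GaussianIBP

/-! ### Wick polynomials of finitely many Gaussian variables -/

section WickPolynomials

/-- The Wick polynomial `:x_{r_1} ⋯ x_{r_n}:` for the covariance `c`. -/
def wickFun {ι : Type*} (c : ι → ι → ℝ) : (n : ℕ) → (Fin n → ι) → (ι → ℝ) → ℝ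
  | 0, _, _ => 1
  | 1, r, x => x (r 0)
  | n + 2, r, x =>
      x (r 0) * wickFun c (n + 1) (fun i => r i.succ) x -
        ∑ j : Fin (n + 1), c (r 0) (r j.succ) *
          wickFun c n (fun i => r (j.succAbove i).succ) x

theorem wick_eq_wickFun {Ω : Type*} {d : ℕ} (H α : ℝ) (W : Rect d → Ω → ℝ) (ω : Ω) :
    ∀ (n : ℕ) (R : Fin n → Rect d),
      wick H α W n R ω = wickFun (rectInner H α) n R (fun R => W R ω)
  | 0, _ => rfl
  | 1, _ => rfl
  | n + 2, R => by
      simp only [wick, wickFun]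
      rw [wick_eq_wickFun H α W ω (n + 1)]
      congr 1
      exact Finset.sum_congr rfl fun j _ => by rw [wick_eq_wickFun H α W ω n]

/-- Reindexing: it moves a tuple of rectangles to a finite index set, so that differential calculus
on `ι → ℝ` becomes available. -/
theorem wickFun_comp {ι κ : Type*} (c : κ → κ → ℝ) (f : ι → κ) (x : κ → ℝ) :
    ∀ (n : ℕ) (r : Fin n → ι),
      wickFun c n (fun i => f (r i)) x =
        wickFun (fun i j => c (f i) (f j)) n r (fun i => x (f i))
  | 0, _ => rfl
  | 1, _ => rfl
  | n + 2, r => by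
      simp only [wickFun]
      rw [wickFun_comp c f x (n + 1) (fun i => r i.succ)]
      congr 1
      exact Finset.sum_congr rfl fun j _ => by
        rw [wickFun_comp c f x n (fun i => r (j.succAbove i).succ)]

variable {ι : Type*} [Fintype ι]

theorem hasTemperateGrowth_eval (i : ι) : (fun x : ι → ℝ => x i).HasTemperateGrowth :=
  ContinuousLinearMap.hasTemperateGrowth (ContinuousLinearMap.proj (R := ℝ) (φ := fun _ : ι => ℝ) i)

theorem hasTemperateGrowth_wickFun (c : ι → ι → ℝ) :
    ∀ (n : ℕ) (r : Fin n → ι), (wickFun c n r).HasTemperateGrowth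
  | 0, _ => Function.HasTemperateGrowth.const 1
  | 1, r => hasTemperateGrowth_eval (r 0)
  | n + 2, r => by
      have h1 := (hasTemperateGrowth_eval (r 0)).mul
        (hasTemperateGrowth_wickFun c (n + 1) (fun i => r i.succ))
      have h2 : (fun x => ∑ j : Fin (n + 1), c (r 0) (r j.succ) *
          wickFun c n (fun i => r (j.succAbove i).succ) x).HasTemperateGrowth :=
        Function.HasTemperateGrowth.sum (s := Finset.univ) fun j _ =>
          (Function.HasTemperateGrowth.const (c (r 0) (r j.succ))).mul
            (hasTemperateGrowth_wickFun c n (fun i => r (j.succAbove i).succ))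
      exact h1.sub h2

theorem fderiv_fderiv_apply_comm {E : Type*} [NormedAddCommGroup E] [NormedSpace ℝ E]
    {g : E → ℝ} (hg : g.HasTemperateGrowth) (u v x : E) :
    fderiv ℝ (fun y => fderiv ℝ g y u) x v = fderiv ℝ (fun y => fderiv ℝ g y v) x u := by
  have hd : DifferentiableAt ℝ (fderiv ℝ g) x :=
    (hasTemperateGrowth_fderiv hg).1.differentiable (by simp) x
  have h1 : ∀ w : E, fderiv ℝ (fun y => fderiv ℝ g y w) x =
      (ContinuousLinearMap.apply ℝ ℝ w).comp (fderiv ℝ (fderiv ℝ g) x) := fun w =>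
    ((ContinuousLinearMap.apply ℝ ℝ w).hasFDerivAt.comp x hd.hasFDerivAt).fderiv
  rw [h1, h1]
  have hs : IsSymmSndFDerivAt ℝ g x :=
    (hg.1.contDiffAt (x := x)).isSymmSndFDerivAt (by
      simp only [minSmoothness_of_isRCLikeNormedField]; exact WithTop.coe_le_coe.2 (le_top (a := (2 : ℕ∞))))
  exact hs v u

/-- The contractions in the recursion are a directional derivative, so that the recursion is the
action of the creation operator `x_{r_0} - ∂_{c(r_0)}`. The derivative formula is taken as a
hypothesis at the point `x` so that this can be used inside the induction that proves it. -/
theorem wickFun_succ_of_fderiv (c : ι → ι → ℝ) (n : ℕ) (r : Fin (n + 1) → ι) (x : ι → ℝ)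
    (h : ∀ k, n = k + 1 → ∀ (s : Fin (k + 1) → ι) (v : ι → ℝ),
      fderiv ℝ (wickFun c (k + 1) s) x v =
        ∑ j, v (s j) * wickFun c k (fun i => s (j.succAbove i)) x) :
    wickFun c (n + 1) r x = x (r 0) * wickFun c n (fun i => r i.succ) x -
      fderiv ℝ (wickFun c n (fun i => r i.succ)) x (c (r 0)) := by
  cases n with
  | zero =>
    have : wickFun c 0 (fun i => r i.succ) = fun _ => (1 : ℝ) := rfl
    rw [this]
    simp [wickFun]
  | succ k => rw [h k rfl]; simp only [wickFun]

/-- Differentiate the recursion `w_{n+2} = x_{r_0} w - ∂_{c(r_0)} w`. Differentiating `x_{r_0}`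
removes the factor `r_0`; in the other terms the two derivatives commute, and applying the recursion
one level down reassembles the Wick polynomial without the factor `r_{j+1}`. -/
theorem fderiv_wickFun_succ (c : ι → ι → ℝ) :
    ∀ (n : ℕ) (r : Fin (n + 1) → ι) (x v : ι → ℝ),
      fderiv ℝ (wickFun c (n + 1) r) x v =
        ∑ j, v (r j) * wickFun c n (fun i => r (j.succAbove i)) x
  | 0, r, x, v => by
      have : wickFun c 1 r = fun x => x (r 0) := rfl
      rw [this]
      have h : fderiv ℝ (fun x : ι → ℝ => x (r 0)) x =
        ContinuousLinearMap.proj (R := ℝ) (φ := fun _ : ι => ℝ) (r 0) :=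
        (ContinuousLinearMap.proj (R := ℝ) (φ := fun _ : ι => ℝ) (r 0)).fderiv
      rw [h]
      simp [wickFun]
  | n + 1, r, x, v => by
      set w := wickFun c (n + 1) (fun i => r i.succ) with hw
      have hwt : w.HasTemperateGrowth := hasTemperateGrowth_wickFun c _ _
      have hrec : wickFun c (n + 2) r = fun y => y (r 0) * w y - fderiv ℝ w y (c (r 0)) := by
        ext y
        rw [hw, fderiv_wickFun_succ c n]
        simp only [wickFun]
      have hwd : DifferentiableAt ℝ w x := hwt.1.differentiable (by simp) x
      have hwd' : DifferentiableAt ℝ (fun y => fderiv ℝ w y (c (r 0))) x :=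
        (hasTemperateGrowth_fderiv_apply hwt _).1.differentiable (by simp) x
      have hdw : (fun y => fderiv ℝ w y v) = fun y => ∑ j : Fin (n + 1), v (r j.succ) *
          wickFun c n (fun i => r (j.succAbove i).succ) y := by
        ext y
        rw [hw, fderiv_wickFun_succ c n]
      have hp : HasFDerivAt (fun y : ι → ℝ => y (r 0))
          (ContinuousLinearMap.proj (R := ℝ) (φ := fun _ : ι => ℝ) (r 0)) x :=
        (ContinuousLinearMap.proj (R := ℝ) (φ := fun _ : ι => ℝ) (r 0)).hasFDerivAt
      have hfd := ((hp.mul hwd.hasFDerivAt).sub hwd'.hasFDerivAt).fderiv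
      rw [hrec]
      change fderiv ℝ ((fun y => y (r 0)) * w - fun y => fderiv ℝ w y (c (r 0))) x v = _
      rw [hfd]
      simp only [_root_.sub_apply, _root_.add_apply,
        _root_.smul_apply, ContinuousLinearMap.proj_apply, smul_eq_mul]
      rw [fderiv_fderiv_apply_comm hwt, hdw]
      have hn : ∀ j : Fin (n + 1), DifferentiableAt ℝ
          (fun y => v (r j.succ) * wickFun c n (fun i => r (j.succAbove i).succ) y) x := fun j =>
        ((hasTemperateGrowth_wickFun c n _).1.differentiable (by simp) x).const_mul _
      rw [fderiv_fun_sum fun j _ => hn j, hw, fderiv_wickFun_succ c n]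
      conv_rhs => rw [Fin.sum_univ_succ]
      simp only [_root_.sum_apply, Fin.succAbove_zero]
      rw [Finset.mul_sum, add_comm (∑ j, _), mul_comm (wickFun c (n + 1) _ x) (v (r 0)),
        add_sub_assoc, ← Finset.sum_sub_distrib]
      congr 1
      refine Finset.sum_congr rfl fun j _ => ?_
      rw [fderiv_const_mul ((hasTemperateGrowth_wickFun c n _).1.differentiable (by simp) x)]
      simp only [_root_.smul_apply, smul_eq_mul]
      rw [wickFun_succ_of_fderiv c n _ x (fun k hk s v => ?_)]
      · simp only [Fin.succ_succAbove_zero, Fin.succ_succAbove_succ]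
        ring
      · subst hk
        exact fderiv_wickFun_succ c k s x v

theorem wickFun_succ (c : ι → ι → ℝ) (n : ℕ) (r : Fin (n + 1) → ι) (x : ι → ℝ) :
    wickFun c (n + 1) r x = x (r 0) * wickFun c n (fun i => r i.succ) x -
      fderiv ℝ (wickFun c n (fun i => r i.succ)) x (c (r 0)) :=
  wickFun_succ_of_fderiv c n r x fun k _ s v => fderiv_wickFun_succ c k s x v

variable {Ω : Type*} [MeasurableSpace Ω] {P : Measure Ω} {X : ι → Ω → ℝ}

theorem memLp_comp_of_hasTemperateGrowth (hX : HasGaussianLaw (fun ω i => X i ω) P)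
    {g : (ι → ℝ) → ℝ} (hg : g.HasTemperateGrowth) (p : ℝ≥0∞) (hp : p ≠ ∞) :
    MemLp (fun ω => g (fun j => X j ω)) p P := by
  have := hX.isGaussian_map
  have h1 := memLp_of_hasTemperateGrowth hg (P.map (fun ω i => X i ω)) p hp
  exact (memLp_map_measure_iff h1.1 hX.aemeasurable).1 h1

/-- Under the Gaussian law `x_{r_0} - ∂_{c(r_0)}` is the adjoint of `∂_{c(r_0)}`: integrate by parts
against the product `g w`, and the term in which `w` is differentiated cancels. -/
theorem integral_mul_wickFun_succ (hX : HasGaussianLaw (fun ω i => X i ω) P)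
    (hc : ∀ i, ∫ ω, X i ω ∂P = 0) {c : ι → ι → ℝ} (hcov : ∀ i j, ∫ ω, X i ω * X j ω ∂P = c i j)
    (n : ℕ) (r : Fin (n + 1) → ι) {g : (ι → ℝ) → ℝ} (hg : g.HasTemperateGrowth) :
    ∫ ω, g (fun j => X j ω) * wickFun c (n + 1) r (fun j => X j ω) ∂P =
      ∫ ω, fderiv ℝ g (fun j => X j ω) (c (r 0)) *
        wickFun c n (fun i => r i.succ) (fun j => X j ω) ∂P := by
  set w := wickFun c n (fun i => r i.succ) with hw
  have hwt : w.HasTemperateGrowth := hasTemperateGrowth_wickFun c _ _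
  have := hX.isProbabilityMeasure
  have hint : ∀ {F : (ι → ℝ) → ℝ}, F.HasTemperateGrowth →
      Integrable (fun ω => F (fun j => X j ω)) P := fun hF =>
    (memLp_comp_of_hasTemperateGrowth hX hF 1 (by simp)).integrable le_rfl
  have hgw := hg.mul hwt
  have hibp := gaussian_ibp hX hc (r 0) hgw
  have hcr : (fun j => ∫ ω, X (r 0) ω * X j ω ∂P) = c (r 0) := by ext j; exact hcov _ _
  rw [hcr] at hibp
  have hder : ∀ x, fderiv ℝ (g * w) x (c (r 0)) =
      fderiv ℝ g x (c (r 0)) * w x + g x * fderiv ℝ w x (c (r 0)) := by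
    intro x
    rw [fderiv_mul (hg.1.differentiable (by simp) x) (hwt.1.differentiable (by simp) x)]
    simp; ring
  have h1 : ∀ ω, g (fun j => X j ω) * wickFun c (n + 1) r (fun j => X j ω) =
      X (r 0) ω * (g * w) (fun j => X j ω) -
        g (fun j => X j ω) * fderiv ℝ w (fun j => X j ω) (c (r 0)) := by
    intro ω
    rw [wickFun_succ, ← hw]
    simp only [Pi.mul_apply]; ring
  simp only [h1]
  have i1 := hint (F := fun x => x (r 0) * (g * w) x) ((hasTemperateGrowth_eval (r 0)).mul hgw)
  have i2 := hint (F := fun x => g x * fderiv ℝ w x (c (r 0)))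
    (hg.mul (hasTemperateGrowth_fderiv_apply hwt _))
  have i3 := hint (F := fun x => fderiv ℝ g x (c (r 0)) * w x)
    ((hasTemperateGrowth_fderiv_apply hg _).mul hwt)
  rw [integral_sub i1 i2, hibp]
  simp only [hder]
  rw [integral_add i3 i2, add_sub_cancel_right]

/-- The Skorohod integral acts on the last variable, whereas the recursion removes the first. Rather
than proving that Wick polynomials are symmetric, one removes the first factor on both sides and
exchanges the two derivatives of `g`. -/
theorem integral_mul_wickFun_last (hX : HasGaussianLaw (fun ω i => X i ω) P)
    (hc : ∀ i, ∫ ω, X i ω ∂P = 0) {c : ι → ι → ℝ} (hcov : ∀ i j, ∫ ω, X i ω * X j ω ∂P = c i j) :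
    ∀ (n : ℕ) (r : Fin (n + 1) → ι) {g : (ι → ℝ) → ℝ}, g.HasTemperateGrowth →
    ∫ ω, g (fun j => X j ω) * wickFun c (n + 1) r (fun j => X j ω) ∂P =
      ∫ ω, fderiv ℝ g (fun j => X j ω) (c (r (Fin.last n))) *
        wickFun c n (fun i => r i.castSucc) (fun j => X j ω) ∂P
  | 0, r, g, hg => integral_mul_wickFun_succ hX hc hcov 0 r hg
  | n + 1, r, g, hg => by
      rw [integral_mul_wickFun_succ hX hc hcov (n + 1) r hg,
        integral_mul_wickFun_last hX hc hcov n _ (hasTemperateGrowth_fderiv_apply hg (c (r 0))),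
        integral_mul_wickFun_succ hX hc hcov n _
          (hasTemperateGrowth_fderiv_apply hg (c (r (Fin.last (n + 1)))))]
      congr 1; ext ω
      rw [fderiv_fderiv_apply_comm hg]
      rfl

/-- The permutations of `Fin n`, listed by successive insertion. -/
def insertPerms : (n : ℕ) → List (Equiv.Perm (Fin n))
  | 0 => [1]
  | n + 1 => (List.finRange (n + 1)).flatMap fun j => (insertPerms n).map fun σ =>
      ((finSuccEquiv' 0).trans (Equiv.optionCongr σ)).trans (finSuccEquiv' j).symm

theorem length_insertPerms : ∀ n, (insertPerms n).length = n.factorial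
  | 0 => rfl
  | n + 1 => by
      simp [insertPerms, List.length_flatMap, length_insertPerms n, Nat.factorial_succ]

/-- Taking the adjoint of the first factor of `r` differentiates the other polynomial, which pairs
`r_0` with each `s_j` in turn and leaves degree `n`. The list of permutations is built by the same
insertion, so the induction closes directly; later only its length `n!` is used. -/
theorem integral_wickFun_mul_wickFun (hX : HasGaussianLaw (fun ω i => X i ω) P)
    (hc : ∀ i, ∫ ω, X i ω ∂P = 0) {c : ι → ι → ℝ} (hcov : ∀ i j, ∫ ω, X i ω * X j ω ∂P = c i j) :
    ∀ (n : ℕ) (r s : Fin n → ι),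
    ∫ ω, wickFun c n r (fun j => X j ω) * wickFun c n s (fun j => X j ω) ∂P =
      ((insertPerms n).map fun σ => ∏ i, c (r i) (s (σ i))).sum
  | 0, r, s => by
      have := hX.isProbabilityMeasure
      simp [wickFun, insertPerms]
  | n + 1, r, s => by
      have h1 : ∀ ω, wickFun c (n + 1) r (fun j => X j ω) * wickFun c (n + 1) s (fun j => X j ω) =
        wickFun c (n + 1) s (fun j => X j ω) * wickFun c (n + 1) r (fun j => X j ω) :=
        fun ω => mul_comm _ _
      simp only [h1]
      rw [integral_mul_wickFun_succ hX hc hcov n r (hasTemperateGrowth_wickFun c _ _)]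
      simp only [fderiv_wickFun_succ, Finset.sum_mul]
      rw [integral_finsetSum]
      · have h2 : ∀ j : Fin (n + 1), ∫ ω, c (r 0) (s j) *
            wickFun c n (fun i => s (j.succAbove i)) (fun j => X j ω) *
            wickFun c n (fun i => r i.succ) (fun j => X j ω) ∂P =
            c (r 0) (s j) * ((insertPerms n).map fun σ =>
              ∏ i : Fin n, c (r i.succ) (s (j.succAbove (σ i)))).sum := by
          intro j
          rw [← integral_wickFun_mul_wickFun hX hc hcov n (fun i => r i.succ)
            (fun i => s (j.succAbove i)), ← integral_const_mul]
          congr 1; ext ω; ring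
        simp only [h2]
        simp only [insertPerms, List.map_flatMap, List.map_map, Function.comp_def]
        rw [List.flatMap_def, List.sum_flatten, List.map_map]
        rw [← List.sum_ofFn, List.ofFn_eq_map]
        congr 1
        refine List.map_congr_left fun j _ => ?_
        rw [← List.sum_map_mul_left]
        congr 1
        refine List.map_congr_left fun σ _ => ?_
        rw [Fin.prod_univ_succ]
        congr 1
      · intro j _
        have := hX.isProbabilityMeasure
        have := (memLp_comp_of_hasTemperateGrowth hX
          (((Function.HasTemperateGrowth.const (c (r 0) (s j))).mul
            (hasTemperateGrowth_wickFun c n (fun i => s (j.succAbove i)))).mul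
            (hasTemperateGrowth_wickFun c n (fun i => r i.succ))) 1 (by simp)).integrable le_rfl
        exact this

end WickPolynomials

/-! ### Elements of `HP` are jointly Gaussian -/

section HPGaussian

variable {Ω : Type*} [MeasurableSpace Ω] {P : Measure Ω} [IsProbabilityMeasure P]

theorem integral_norm_le_norm_Lp {E : Type*} [NormedAddCommGroup E] (Z : Lp E 2 P) :
    ∫ ω, ‖Z ω‖ ∂P ≤ ‖Z‖ := by
  have h1 : eLpNorm Z 1 P ≤ eLpNorm Z 2 P :=
    eLpNorm_le_eLpNorm_of_exponent_le (by norm_num) (Lp.aestronglyMeasurable Z)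
  rw [integral_norm_eq_lintegral_enorm (Lp.aestronglyMeasurable Z), ← eLpNorm_one_eq_lintegral_enorm,
    Lp.norm_def]
  exact ENNReal.toReal_mono (Lp.eLpNorm_ne_top Z) h1

theorem norm_cexp_sub_cexp_le (a b : ℝ) :
    ‖Complex.exp (a * Complex.I) - Complex.exp (b * Complex.I)‖ ≤ |a - b| := by
  have h : Complex.exp (a * Complex.I) - Complex.exp (b * Complex.I) =
      Complex.exp (b * Complex.I) * (Complex.exp (Complex.I * ((a - b : ℝ) : ℂ)) - 1) := by
    rw [mul_sub, ← Complex.exp_add, mul_one]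
    congr 2
    push_cast; ring
  rw [h, norm_mul, Complex.norm_exp_ofReal_mul_I, one_mul]
  have := Real.norm_exp_I_mul_ofReal_sub_one_le (x := a - b)
  simpa using this

theorem integrable_cexp_Lp (X : Lp ℝ 2 P) (t : ℝ) :
    Integrable (fun ω => Complex.exp (((t * X ω : ℝ) : ℂ) * Complex.I)) P := by
  refine Integrable.of_bound (C := 1) ?_ (Eventually.of_forall fun ω => ?_)
  · have h : Continuous fun x : ℝ => Complex.exp (((t * x : ℝ) : ℂ) * Complex.I) := by fun_prop
    exact h.comp_aestronglyMeasurable (Lp.aestronglyMeasurable X)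
  · rw [Complex.norm_exp_ofReal_mul_I]

/-- Lipschitz with constant `|t|`, since the `L¹` norm is at most the `L²` norm under a probability.
This is what lets Gaussianity pass to `L²` limits. -/
theorem continuous_integral_cexp_Lp (t : ℝ) :
    Continuous fun X : Lp ℝ 2 P => ∫ ω, Complex.exp (((t * X ω : ℝ) : ℂ) * Complex.I) ∂P := by
  refine (LipschitzWith.of_dist_le_mul (K := ‖t‖₊) fun X Y => ?_).continuous
  rw [dist_eq_norm, dist_eq_norm, ← integral_sub (integrable_cexp_Lp X t) (integrable_cexp_Lp Y t)]
  refine (norm_integral_le_integral_norm _).trans ?_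
  have h1 : ∫ ω, ‖Complex.exp (((t * X ω : ℝ) : ℂ) * Complex.I) -
      Complex.exp (((t * Y ω : ℝ) : ℂ) * Complex.I)‖ ∂P ≤ ∫ ω, |t| * ‖(X - Y : Lp ℝ 2 P) ω‖ ∂P := by
    refine integral_mono_ae ((integrable_cexp_Lp X t).sub (integrable_cexp_Lp Y t)).norm
      (((Lp.memLp (X - Y)).integrable (by norm_num)).norm.const_mul _) ?_
    filter_upwards [Lp.coeFn_sub X Y] with ω hω
    rw [hω]
    refine (norm_cexp_sub_cexp_le _ _).trans ?_
    rw [← mul_sub, abs_mul]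
    rfl
  refine h1.trans ?_
  rw [integral_const_mul]
  exact mul_le_mul_of_nonneg_left (integral_norm_le_norm_Lp _) (abs_nonneg _)

variable {d : ℕ} {H α : ℝ} {W : Rect d → Ω → ℝ}

theorem IsNoise.memLp (hW : IsNoise H α W P) (R : Rect d) : MemLp (W R) 2 P :=
  (hW.gaussian.hasGaussianLaw_eval R).memLp_two

theorem integral_sq_Lp (X : Lp ℝ 2 P) : ∫ ω, X ω * X ω ∂P = ‖X‖ ^ 2 := by
  rw [← real_inner_self_eq_norm_sq, L2.inner_def]
  rfl

theorem map_eq_gaussianReal_of_mem_span (hW : IsNoise H α W P) (X : Lp ℝ 2 P)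
    (hX : X ∈ Submodule.span ℝ {X : Lp ℝ 2 P | ∃ R : Rect d, (X : Ω → ℝ) =ᵐ[P] W R}) :
    P.map X = gaussianReal 0 (‖X‖ ^ 2).toNNReal := by
  classical
  have key : ∃ c : Rect d →₀ ℝ, (X : Ω → ℝ) =ᵐ[P] fun ω => c.sum fun R a => a * W R ω := by
    induction hX using Submodule.span_induction with
    | mem Y hY =>
      obtain ⟨R, hR⟩ := hY
      exact ⟨Finsupp.single R 1, by simpa using hR⟩
    | zero => exact ⟨0, by simp only [Finsupp.sum_zero_index]; exact Lp.coeFn_zero ℝ 2 P⟩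
    | add Y Z _ _ hY hZ =>
      obtain ⟨c, hc⟩ := hY
      obtain ⟨c', hc'⟩ := hZ
      refine ⟨c + c', ?_⟩
      filter_upwards [hc, hc', Lp.coeFn_add Y Z] with ω h1 h2 h3
      rw [h3, Pi.add_apply, h1, h2, Finsupp.sum_add_index' (by simp) (by intros; ring)]
    | smul a Y _ hY =>
      obtain ⟨c, hc⟩ := hY
      refine ⟨a • c, ?_⟩
      filter_upwards [hc, Lp.coeFn_smul a Y] with ω h1 h3
      rw [h3, Pi.smul_apply, h1, Finsupp.sum_smul_index' (by simp), smul_eq_mul, Finsupp.mul_sum]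
      simp [mul_assoc]
  obtain ⟨c, hc⟩ := key
  have hg : HasGaussianLaw (fun ω => c.sum fun R a => a * W R ω) P :=
    (hW.gaussian.smul c).hasGaussianLaw_fun_sum (I := c.support)
  have hgX : HasGaussianLaw (X : Ω → ℝ) P := hg.congr hc.symm
  have hmean : ∫ ω, X ω ∂P = 0 := by
    rw [integral_congr_ae hc]
    simp only [Finsupp.sum]
    rw [integral_finsetSum _ fun R _ => ((hW.memLp R).integrable (by norm_num)).const_mul _]
    refine Finset.sum_eq_zero fun R _ => ?_
    rw [integral_const_mul, hW.centered, mul_zero]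
  rw [hgX.map_eq_gaussianReal, hmean]
  congr 2
  rw [variance_eq_sub (Lp.memLp X), hmean, ← integral_sq_Lp]
  simp [pow_two]

/-- With the variance written as `‖X‖²`, being a centred Gaussian becomes a family of equations
between continuous functions of `X`, hence a closed condition. -/
theorem charFun_eq_iff_map_eq_gaussianReal (X : Lp ℝ 2 P) :
    P.map X = gaussianReal 0 (‖X‖ ^ 2).toNNReal ↔
      ∀ t : ℝ, ∫ ω, Complex.exp (((t * X ω : ℝ) : ℂ) * Complex.I) ∂P =
        Complex.exp (-(((‖X‖ ^ 2 : ℝ) : ℂ) * t ^ 2 / 2)) := by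
  have hXm : AEMeasurable (X : Ω → ℝ) P := (Lp.aestronglyMeasurable X).aemeasurable
  have h1 : ∀ t, charFun (P.map X) t =
      ∫ ω, Complex.exp (((t * X ω : ℝ) : ℂ) * Complex.I) ∂P := by
    intro t
    rw [charFun_apply_real, integral_map hXm (by fun_prop)]
    congr 1; ext ω; push_cast; rfl
  have h2 : ∀ t : ℝ, charFun (gaussianReal 0 (‖X‖ ^ 2).toNNReal) t =
      Complex.exp (-(((‖X‖ ^ 2 : ℝ) : ℂ) * t ^ 2 / 2)) := by
    intro t
    rw [charFun_gaussianReal]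
    congr 1
    have : (((‖X‖ ^ 2).toNNReal : ℝ) : ℂ) = ((‖X‖ ^ 2 : ℝ) : ℂ) := by
      rw [Real.coe_toNNReal _ (sq_nonneg _)]
    rw [← this]
    simp
  have : IsProbabilityMeasure (P.map X) := Measure.isProbabilityMeasure_map hXm
  constructor
  · intro h t
    rw [← h1, h, h2]
  · intro h
    refine Measure.ext_of_charFun ?_
    ext t
    rw [h1, h2, h]

theorem map_eq_gaussianReal_of_mem_HP (hW : IsNoise H α W P) (h : HP W P) :
    P.map (h : Lp ℝ 2 P) = gaussianReal 0 (‖h‖ ^ 2).toNNReal := by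
  change P.map (h : Lp ℝ 2 P) = gaussianReal 0 (‖(h : Lp ℝ 2 P)‖ ^ 2).toNNReal
  rw [charFun_eq_iff_map_eq_gaussianReal]
  have hcl : IsClosed {X : Lp ℝ 2 P | ∀ t : ℝ,
      ∫ ω, Complex.exp (((t * X ω : ℝ) : ℂ) * Complex.I) ∂P =
        Complex.exp (-(((‖X‖ ^ 2 : ℝ) : ℂ) * t ^ 2 / 2))} := by
    rw [ofPred_forall]
    exact isClosed_iInter fun t => isClosed_eq (continuous_integral_cexp_Lp t) (by fun_prop)
  have hsub : (Submodule.span ℝ {X : Lp ℝ 2 P | ∃ R : Rect d, (X : Ω → ℝ) =ᵐ[P] W R} :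
      Set (Lp ℝ 2 P)) ⊆ _ := fun X hX =>
    (charFun_eq_iff_map_eq_gaussianReal X).1 (map_eq_gaussianReal_of_mem_span hW X hX)
  have := closure_minimal hsub hcl h.2
  exact this

theorem integral_HP (hW : IsNoise H α W P) (h : HP W P) :
    ∫ ω, (h : Lp ℝ 2 P) ω ∂P = 0 := by
  have hm : AEMeasurable ((h : Lp ℝ 2 P) : Ω → ℝ) P :=
    (Lp.aestronglyMeasurable (h : Lp ℝ 2 P)).aemeasurable
  rw [← integral_map (φ := ((h : Lp ℝ 2 P) : Ω → ℝ)) (f := fun x => x) hm (by fun_prop),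
    map_eq_gaussianReal_of_mem_HP hW, integral_id_gaussianReal]

theorem integral_HP_mul_HP (h h' : HP W P) :
    ∫ ω, (h : Lp ℝ 2 P) ω * (h' : Lp ℝ 2 P) ω ∂P = ⟪h, h'⟫ := by
  rw [Submodule.coe_inner, L2.inner_def]
  congr 1; ext ω
  exact mul_comm _ _

/-- Every linear functional of the vector is itself an element of `HP`, so one-dimensional
Gaussianity suffices. -/
theorem hasGaussianLaw_HP (hW : IsNoise H α W P) {ι : Type*} [Fintype ι] (h : ι → HP W P) :
    HasGaussianLaw (fun ω i => (h i : Lp ℝ 2 P) ω) P := by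
  classical
  have hm : AEMeasurable (fun ω i => (h i : Lp ℝ 2 P) ω) P :=
    aemeasurable_pi_lambda _ fun i => (Lp.aestronglyMeasurable (h i : Lp ℝ 2 P)).aemeasurable
  refine ⟨isGaussian_of_map_eq_gaussianReal fun L =>
    ⟨0, (‖∑ i, L (Pi.single i 1) • h i‖ ^ 2).toNNReal, ?_⟩⟩
  · rw [AEMeasurable.map_map_of_aemeasurable L.continuous.measurable.aemeasurable hm,
      ← map_eq_gaussianReal_of_mem_HP hW]
    refine Measure.map_congr ?_
    have hs : ∀ s : Finset ι, ((∑ i ∈ s, L (Pi.single i 1) • h i : HP W P) : Lp ℝ 2 P) =ᵐ[P]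
        fun ω => ∑ i ∈ s, L (Pi.single i 1) * (h i : Lp ℝ 2 P) ω := by
      intro s
      induction s using Finset.induction_on with
      | empty => simp only [Finset.sum_empty]; exact Lp.coeFn_zero ℝ 2 P
      | insert i s hi ih =>
        rw [Finset.sum_insert hi]
        filter_upwards [ih, Lp.coeFn_add (L (Pi.single i 1) • (h i : Lp ℝ 2 P))
          ((∑ i ∈ s, L (Pi.single i 1) • h i : HP W P) : Lp ℝ 2 P),
          Lp.coeFn_smul (L (Pi.single i 1)) (h i : Lp ℝ 2 P)] with ω h1 h2 h3
        rw [Finset.sum_insert hi, ← h1]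
        change (L (Pi.single i 1) • (h i : Lp ℝ 2 P) +
          ((∑ i ∈ s, L (Pi.single i 1) • h i : HP W P) : Lp ℝ 2 P) : Lp ℝ 2 P) ω = _
        rw [h2, Pi.add_apply, h3]
        rfl
    filter_upwards [hs Finset.univ] with ω hω
    rw [hω]
    simp only [Function.comp]
    conv_lhs => rw [pi_eq_sum_univ' (fun i => (h i : Lp ℝ 2 P) ω)]
    rw [map_sum]
    refine Finset.sum_congr rfl fun i _ => ?_
    rw [map_smul, smul_eq_mul, mul_comm]

/-- The element `1_R` of `HP`. -/
def noiseVec (hW : IsNoise H α W P) (R : Rect d) : HP W P :=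
  ⟨(hW.memLp R).toLp, Submodule.le_topologicalClosure _
    (Submodule.subset_span ⟨R, (hW.memLp R).coeFn_toLp⟩)⟩

theorem coeFn_noiseVec (hW : IsNoise H α W P) (R : Rect d) :
    ((noiseVec hW R : Lp ℝ 2 P) : Ω → ℝ) =ᵐ[P] W R := (hW.memLp R).coeFn_toLp

theorem inner_noiseVec (hW : IsNoise H α W P) (R R' : Rect d) :
    ⟪noiseVec hW R, noiseVec hW R'⟫ = rectInner H α R R' := by
  rw [← integral_HP_mul_HP, ← hW.covariance]
  refine integral_congr_ae ?_
  filter_upwards [coeFn_noiseVec hW R, coeFn_noiseVec hW R'] with ω h1 h2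
  rw [h1, h2]

theorem eq_noiseVec (hW : IsNoise H α W P) (R : Rect d) (h : HP W P)
    (hh : ((h : Lp ℝ 2 P) : Ω → ℝ) =ᵐ[P] W R) : h = noiseVec hW R := by
  refine Subtype.ext (Lp.ext ?_)
  exact hh.trans (coeFn_noiseVec hW R).symm

end HPGaussian

/-! ### Inequalities between positive semidefinite kernels -/

section QuadraticForms

/-- The quadratic form of a kernel `M` at a finitely supported function. -/
def quadForm {T : Type*} (M : T → T → ℝ) (x : T →₀ ℝ) : ℝ :=
  x.sum fun i a => x.sum fun j b => a * b * M i j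

variable {T : Type*}

theorem posSemidef_of_quadForm_nonneg {M : T → T → ℝ} (hs : ∀ i j, M i j = M j i)
    (h : ∀ x, 0 ≤ quadForm M x) : (Matrix.of M).PosSemidef := by
  refine ⟨?_, fun x => ?_⟩
  · ext i j
    simp [hs i j]
  · refine (h x).trans_eq ?_
    simp only [quadForm, Finsupp.sum]
    refine Finset.sum_congr rfl fun i _ => Finset.sum_congr rfl fun j _ => ?_
    simp; ring

theorem quadForm_nonneg {M : T → T → ℝ} (h : (Matrix.of M).PosSemidef) (x : T →₀ ℝ) :
    0 ≤ quadForm M x := by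
  refine (h.2 x).trans_eq ?_
  simp only [quadForm, Finsupp.sum]
  refine Finset.sum_congr rfl fun i _ => Finset.sum_congr rfl fun j _ => ?_
  simp; ring

theorem symm_of_posSemidef {M : T → T → ℝ} (h : (Matrix.of M).PosSemidef) (i j : T) :
    M i j = M j i := by
  have := h.1.apply j i
  simpa using this

theorem quadForm_sub (M N : T → T → ℝ) (x : T →₀ ℝ) :
    quadForm (fun i j => M i j - N i j) x = quadForm M x - quadForm N x := by
  simp only [quadForm, Finsupp.sum, mul_sub, Finset.sum_sub_distrib]

theorem quadForm_add (M N : T → T → ℝ) (x : T →₀ ℝ) :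
    quadForm (fun i j => M i j + N i j) x = quadForm M x + quadForm N x := by
  simp only [quadForm, Finsupp.sum, mul_add, Finset.sum_add_distrib]

theorem quadForm_const_mul (c : ℝ) (M : T → T → ℝ) (x : T →₀ ℝ) :
    quadForm (fun i j => c * M i j) x = c * quadForm M x := by
  simp only [quadForm, Finsupp.sum, Finset.mul_sum]
  refine Finset.sum_congr rfl fun i _ => Finset.sum_congr rfl fun j _ => ?_
  ring

theorem quadForm_list_sum {κ : Type*} (L : List κ) (M : κ → T → T → ℝ) (x : T →₀ ℝ) :
    quadForm (fun i j => (L.map fun k => M k i j).sum) x =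
      (L.map fun k => quadForm (M k) x).sum := by
  induction L with
  | nil => simp [quadForm]
  | cons k L ih =>
    simp only [List.map_cons, List.sum_cons]
    rw [quadForm_add, ih]

theorem quadForm_inner {E : Type*} [NormedAddCommGroup E] [InnerProductSpace ℝ E] (v : T → E)
    (x : T →₀ ℝ) :
    quadForm (fun i j => ⟪v i, v j⟫) x = ‖Finsupp.linearCombination ℝ v x‖ ^ 2 := by
  rw [← real_inner_self_eq_norm_sq, Finsupp.linearCombination_apply]
  simp only [quadForm, Finsupp.sum, sum_inner, inner_sum, real_inner_smul_left,
    real_inner_smul_right]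
  refine Finset.sum_congr rfl fun i _ => Finset.sum_congr rfl fun j _ => ?_
  rw [real_inner_comm]
  ring

theorem posSemidef_inner {E : Type*} [NormedAddCommGroup E] [InnerProductSpace ℝ E] (v : T → E) :
    (Matrix.of fun i j => ⟪v i, v j⟫).PosSemidef :=
  posSemidef_of_quadForm_nonneg (fun i j => real_inner_comm _ _) fun x => by
    rw [quadForm_inner]; positivity

theorem posSemidef_comap {S : Type*} {M : T → T → ℝ} (h : (Matrix.of M).PosSemidef) (f : S → T) :
    (Matrix.of fun i j => M (f i) (f j)).PosSemidef :=
  h.submatrix f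

theorem posSemidef_mul {M N : T → T → ℝ} (hM : (Matrix.of M).PosSemidef)
    (hN : (Matrix.of N).PosSemidef) : (Matrix.of fun i j => M i j * N i j).PosSemidef :=
  hM.hadamard hN

theorem posSemidef_one : (Matrix.of fun _ _ : T => (1 : ℝ)).PosSemidef := by
  have := posSemidef_inner (fun _ : T => (1 : ℝ))
  simpa using this

theorem posSemidef_add {M N : T → T → ℝ} (hM : (Matrix.of M).PosSemidef)
    (hN : (Matrix.of N).PosSemidef) : (Matrix.of fun i j => M i j + N i j).PosSemidef :=
  hM.add hN

theorem posSemidef_const_mul {c : ℝ} (hc : 0 ≤ c) {M : T → T → ℝ} (hM : (Matrix.of M).PosSemidef) :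
    (Matrix.of fun i j => c * M i j).PosSemidef :=
  posSemidef_of_quadForm_nonneg (fun i j => by rw [symm_of_posSemidef hM]) fun x => by
    rw [quadForm_const_mul]
    exact mul_nonneg hc (quadForm_nonneg hM x)

theorem posSemidef_prod {ι : Type*} (s : Finset ι) {M : ι → T → T → ℝ}
    (hM : ∀ k, (Matrix.of (M k)).PosSemidef) :
    (Matrix.of fun i j => ∏ k ∈ s, M k i j).PosSemidef := by
  classical
  induction s using Finset.induction_on with
  | empty => simpa using posSemidef_one
  | insert k s hk ih =>
    simp only [Finset.prod_insert hk]
    exact posSemidef_mul (hM k) ih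

/-- The difference telescopes as `C N·C^s∏N - M·∏M = (C N - M)·C^s∏N + M·(C^s∏N - ∏M)`, and both
terms are positive semidefinite by the Schur product theorem. This is how a comparison of
covariances passes to tensor powers. -/
theorem posSemidef_prod_sub_prod {ι : Type*} (s : Finset ι) {M N : ι → T → T → ℝ} {C : ℝ}
    (hC : 0 ≤ C) (hM : ∀ k, (Matrix.of (M k)).PosSemidef) (hN : ∀ k, (Matrix.of (N k)).PosSemidef)
    (hMN : ∀ k, (Matrix.of fun i j => C * N k i j - M k i j).PosSemidef) :
    (Matrix.of fun i j =>
      C ^ s.card * ∏ k ∈ s, N k i j - ∏ k ∈ s, M k i j).PosSemidef := by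
  classical
  induction s using Finset.induction_on with
  | empty =>
    have := posSemidef_const_mul le_rfl (posSemidef_one (T := T))
    simpa using this
  | insert k s hk ih =>
    have h1 := posSemidef_mul (hMN k)
      (posSemidef_const_mul (pow_nonneg hC s.card) (posSemidef_prod s hN))
    have h2 := posSemidef_mul (hM k) ih
    convert posSemidef_add h1 h2 using 4 with i j
    rw [Finset.prod_insert hk, Finset.prod_insert hk, Finset.card_insert_of_notMem hk]
    ring

theorem sum_sum_nonneg_of_posSemidef {M : T → T → ℝ} (h : (Matrix.of M).PosSemidef)
    {κ : Type*} [Fintype κ] (v : κ → T) (a : κ → ℝ) :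
    0 ≤ ∑ k, ∑ l, a k * a l * M (v k) (v l) := by
  have := quadForm_nonneg (posSemidef_comap h v) (Finsupp.equivFunOnFinite.symm a)
  simpa [quadForm, Finsupp.sum_fintype] using this

/-- For a positive semidefinite kernel that is invariant under a bijection `f`, twisting one
variable by `f` decreases the quadratic form. -/
theorem quadForm_twist_le {M : T → T → ℝ} (h : (Matrix.of M).PosSemidef) (f : T → T)
    (hf : ∀ i j, M (f i) (f j) = M i j) (x : T →₀ ℝ) :
    quadForm (fun i j => M i (f j)) x ≤ quadForm M x := by
  -- Positivity is applied to the coefficients `x` at the points `i` and `-x` at the points `f i`.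
  -- By invariance the two diagonal blocks are equal, and by symmetry so are the two off-diagonal
  -- ones.
  have h1 := sum_sum_nonneg_of_posSemidef h (κ := x.support ⊕ x.support)
    (Sum.elim (fun i => (i : T)) (fun i => f i)) (Sum.elim (fun i => x i) (fun i => -x i))
  simp only [Fintype.sum_sum_type, Sum.elim_inl, Sum.elim_inr, hf] at h1
  simp only [Finset.sum_add_distrib, mul_neg, neg_mul, neg_neg, Finset.sum_neg_distrib] at h1
  have h2 : ∀ N : T → T → ℝ, ∑ i : x.support, ∑ j : x.support, x i * x j * N i j =
      quadForm N x := by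
    intro N
    simp only [quadForm, Finsupp.sum]
    rw [← Finset.sum_coe_sort x.support (fun i => ∑ j ∈ x.support, x i * x j * N i j)]
    refine Finset.sum_congr rfl fun i _ => ?_
    rw [← Finset.sum_coe_sort x.support]
  have h3 : ∑ i : x.support, ∑ j : x.support, x i * x j * M (f i) j =
      quadForm (fun i j => M i (f j)) x := by
    rw [← h2, Finset.sum_comm]
    refine Finset.sum_congr rfl fun i _ => Finset.sum_congr rfl fun j _ => ?_
    rw [symm_of_posSemidef h (f j) i]; ring
  rw [h3, h2 (fun i j => M i (f j)), h2 M] at h1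
  linarith

/-- The tensor power of a kernel. -/
def tensorKer {T : Type*} (Q : T → T → ℝ) (n : ℕ) (r s : Fin n → T) : ℝ := ∏ i, Q (r i) (s i)

theorem posSemidef_tensorKer {Q : T → T → ℝ} (hQ : (Matrix.of Q).PosSemidef) (n : ℕ) :
    (Matrix.of (tensorKer Q n)).PosSemidef :=
  posSemidef_prod Finset.univ fun i => posSemidef_comap hQ (fun r : Fin n → T => r i)

theorem quadForm_tensorKer_le {Q N : T → T → ℝ} {C : ℝ} (hC : 0 ≤ C)
    (hQ : (Matrix.of Q).PosSemidef) (hN : (Matrix.of N).PosSemidef)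
    (hQN : (Matrix.of fun i j => C * N i j - Q i j).PosSemidef) (n : ℕ) (x : (Fin n → T) →₀ ℝ) :
    quadForm (tensorKer Q n) x ≤ C ^ n * quadForm (tensorKer N n) x := by
  have h := posSemidef_prod_sub_prod (Finset.univ : Finset (Fin n))
    (M := fun k (r s : Fin n → T) => Q (r k) (s k)) (N := fun k r s => N (r k) (s k)) hC
    (fun k => posSemidef_comap hQ (fun r : Fin n → T => r k))
    (fun k => posSemidef_comap hN (fun r : Fin n → T => r k))
    (fun k => posSemidef_comap hQN (fun r : Fin n → T => r k))
  have := quadForm_nonneg h x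
  rw [quadForm_sub, quadForm_const_mul] at this
  simp only [Finset.card_univ, Fintype.card_fin] at this
  change quadForm (fun r s => ∏ k, Q (r k) (s k)) x ≤
    C ^ n * quadForm (fun r s => ∏ k, N (r k) (s k)) x
  linarith

theorem quadForm_perm_le {Q : T → T → ℝ} (hQ : (Matrix.of Q).PosSemidef) (n : ℕ)
    (σ : Equiv.Perm (Fin n)) (x : (Fin n → T) →₀ ℝ) :
    quadForm (fun r s => ∏ i, Q (r i) (s (σ i))) x ≤ quadForm (tensorKer Q n) x :=
  quadForm_twist_le (posSemidef_tensorKer hQ n) (fun s i => s (σ i))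
    (fun r s => Equiv.prod_comp σ fun i => Q (r i) (s i)) x

/-- Extend a densely defined bounded operator, by zero on the orthogonal complement. -/
theorem exists_continuousLinearMap_extension {E V F : Type*} [AddCommGroup E] [Module ℝ E]
    [NormedAddCommGroup V] [InnerProductSpace ℝ V] [CompleteSpace V] [NormedAddCommGroup F]
    [NormedSpace ℝ F] [CompleteSpace F] (e : E →ₗ[ℝ] V) (f : E →ₗ[ℝ] F) {C : ℝ} (hC : 0 ≤ C)
    (h : ∀ x, ‖f x‖ ≤ C * ‖e x‖) :
    ∃ T : V →L[ℝ] F, (∀ y, ‖T y‖ ≤ C * ‖y‖) ∧ ∀ x, T (e x) = f x := by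
  set K := (LinearMap.range e).topologicalClosure with hK
  have hmem : ∀ x, e x ∈ K := fun x => Submodule.le_topologicalClosure _ ⟨x, rfl⟩
  set e' : E →ₗ[ℝ] K := e.codRestrict K hmem with he'
  have : CompleteSpace K := (Submodule.isClosed_topologicalClosure _).completeSpace_coe
  have hd : DenseRange e' := by
    intro y
    have hy : (y : V) ∈ closure (LinearMap.range e : Set V) := y.2
    rw [mem_closure_iff_seq_limit] at hy
    obtain ⟨u, hu, hlim⟩ := hy
    rw [mem_closure_iff_seq_limit]
    choose z hz using hu
    refine ⟨fun n => e' (z n), fun n => ⟨z n, rfl⟩, ?_⟩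
    rw [tendsto_subtype_rng]
    refine hlim.congr fun n => ?_
    rw [← hz n]
    rfl
  have h' : ∀ x, ‖f x‖ ≤ C * ‖e' x‖ := h
  refine ⟨(f.extendOfNorm e').comp K.orthogonalProjectionOnto, fun y => ?_, fun x => ?_⟩
  · refine (LinearMap.norm_extendOfNorm_apply_le hd C h' _).trans ?_
    exact mul_le_mul_of_nonneg_left (Submodule.norm_orthogonalProjectionOnto_apply_le K y) hC
  · have : K.orthogonalProjectionOnto (e x) = e' x :=
      Submodule.orthogonalProjectionOnto_mem_subspace_eq_self (e' x)
    rw [ContinuousLinearMap.comp_apply, this, LinearMap.extendOfNorm_eq hd ⟨C, h'⟩]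

end QuadraticForms

/-! ### Multiple integrals of elementary functions and their duality -/

section WienerIntegrals

variable {Ω : Type*} [MeasurableSpace Ω] {P : Measure Ω} [IsProbabilityMeasure P]
  {d : ℕ} {H α : ℝ} {W : Rect d → Ω → ℝ}

/-- `W R` and the representative of its class in `HP` agree only almost everywhere, but a single
Wick product involves finitely many rectangles. -/
theorem wick_ae_eq_wickFun (hW : IsNoise H α W P) {ι : Type*} (h : ι → HP W P) {n : ℕ}
    (f : Fin n → ι) (R : Fin n → Rect d) (hf : ∀ i, h (f i) = noiseVec hW (R i)) :
    wick H α W n R =ᵐ[P]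
      fun ω => wickFun (fun i j => ⟪h i, h j⟫) n f (fun i => (h i : Lp ℝ 2 P) ω) := by
  have h1 : ∀ᵐ ω ∂P, ∀ i, (noiseVec hW (R i) : Lp ℝ 2 P) ω = W (R i) ω :=
    ae_all_iff.2 fun i => coeFn_noiseVec hW (R i)
  filter_upwards [h1] with ω hω
  rw [wick_eq_wickFun]
  have e1 := wickFun_comp (rectInner H α) R (fun R => W R ω) n id
  have e2 := wickFun_comp (fun i j => ⟪h i, h j⟫) f (fun i => (h i : Lp ℝ 2 P) ω) n id
  simp only [id] at e1 e2
  rw [e1, e2]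
  simp only [hf, inner_noiseVec, hω]

theorem memLp_wick (hW : IsNoise H α W P) (n : ℕ) (R : Fin n → Rect d) :
    MemLp (wick H α W n R) 2 P :=
  (memLp_congr_ae (wick_ae_eq_wickFun hW (fun i => noiseVec hW (R i)) id R fun _ => rfl)).2
    (memLp_comp_of_hasTemperateGrowth (hasGaussianLaw_HP hW fun i => noiseVec hW (R i))
      (hasTemperateGrowth_wickFun _ _ _) 2 (by norm_num))

/-- The Wick product `:W(R_1) ⋯ W(R_n):` as an element of `L²(Ω)`. -/
def wickLp (hW : IsNoise H α W P) (n : ℕ) (R : Fin n → Rect d) : Lp ℝ 2 P :=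
  (memLp_wick hW n R).toLp

theorem coeFn_wickLp (hW : IsNoise H α W P) (n : ℕ) (R : Fin n → Rect d) :
    wickLp hW n R =ᵐ[P] wick H α W n R := (memLp_wick hW n R).coeFn_toLp

/-- The two tuples are put in one Gaussian vector indexed by `Fin n ⊕ Fin n`, to which the formula
for Wick polynomials applies. -/
theorem inner_wickLp (hW : IsNoise H α W P) (n : ℕ) (R R' : Fin n → Rect d) :
    ⟪wickLp hW n R, wickLp hW n R'⟫ =
      ((insertPerms n).map fun σ => ∏ i, rectInner H α (R i) (R' (σ i))).sum := by
  set h : Fin n ⊕ Fin n → HP W P :=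
    Sum.elim (fun i => noiseVec hW (R i)) (fun i => noiseVec hW (R' i)) with hh
  have key := integral_wickFun_mul_wickFun (hasGaussianLaw_HP hW h) (fun i => integral_HP hW (h i))
    (fun i j => integral_HP_mul_HP (h i) (h j)) n Sum.inl Sum.inr
  simp only [hh, Sum.elim_inl, Sum.elim_inr, inner_noiseVec] at key
  rw [← key, L2.inner_def]
  refine integral_congr_ae ?_
  filter_upwards [coeFn_wickLp hW n R, coeFn_wickLp hW n R',
    wick_ae_eq_wickFun hW h Sum.inl R (fun _ => rfl),
    wick_ae_eq_wickFun hW h Sum.inr R' (fun _ => rfl)] with ω h1 h2 h3 h4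
  rw [h1, h2, h3, h4]
  exact mul_comm _ _

theorem posSemidef_rectInner (hW : IsNoise H α W P) :
    (Matrix.of (rectInner (d := d) H α)).PosSemidef := by
  have := posSemidef_inner (noiseVec hW)
  simpa only [inner_noiseVec] using this

/-- The multiple Wiener integral on elementary functions. -/
def wienerL (hW : IsNoise H α W P) (n : ℕ) : Elem d n →ₗ[ℝ] Lp ℝ 2 P :=
  Finsupp.linearCombination ℝ (wickLp hW n)

theorem coeFn_wienerL (hW : IsNoise H α W P) (n : ℕ) (e : Elem d n) :
    wienerL hW n e =ᵐ[P] e.wienerInt H α W := by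
  induction e using Finsupp.induction_linear with
  | zero =>
    rw [map_zero]
    refine (Lp.coeFn_zero ℝ 2 P).trans (Eventually.of_forall fun ω => ?_)
    simp [Elem.wienerInt]
  | add f g hf hg =>
    rw [map_add]
    filter_upwards [hf, hg, Lp.coeFn_add (wienerL hW n f) (wienerL hW n g)] with ω h1 h2 h3
    rw [h3, Pi.add_apply, h1, h2]
    simp only [Elem.wienerInt]
    rw [Finsupp.sum_add_index' (by simp) (by intros; ring)]
  | single R a =>
    filter_upwards [Lp.coeFn_smul a (wickLp hW n R), coeFn_wickLp hW n R] with ω h1 h2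
    simp only [wienerL, Finsupp.linearCombination_single, Elem.wienerInt]
    rw [h1, Pi.smul_apply, h2, Finsupp.sum_single_index (by simp), smul_eq_mul]

/-- Elementary functions are not symmetrized, so the second moment is a sum of `n!` permuted
quadratic forms. Permuting the variables on one side can only decrease the form
(`quadForm_perm_le`), so each term is at most the tensor norm. -/
theorem norm_wienerL_sq_le (hW : IsNoise H α W P) (n : ℕ) (e : Elem d n) :
    ‖wienerL hW n e‖ ^ 2 ≤ n.factorial * e.normSq H α := by
  rw [wienerL, ← quadForm_inner]
  simp only [inner_wickLp]
  rw [quadForm_list_sum (insertPerms n)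
    (fun σ (R R' : Fin n → Rect d) => ∏ i, rectInner H α (R i) (R' (σ i)))]
  have h : ∀ y ∈ (insertPerms n).map (fun σ =>
      quadForm (fun R R' : Fin n → Rect d => ∏ i, rectInner H α (R i) (R' (σ i))) e),
      y ≤ e.normSq H α := by
    intro y hy
    obtain ⟨σ, _, rfl⟩ := List.mem_map.1 hy
    exact quadForm_perm_le (posSemidef_rectInner hW) n σ e
  refine (List.sum_le_card_nsmul _ _ h).trans_eq ?_
  rw [List.length_map, length_insertPerms, nsmul_eq_mul]

/-- The process `∑ a :W(R_1) ⋯ W(R_n): 1_{R_{n+1}}` attached to an elementary function of `n + 1`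
variables. -/
def skorL (hW : IsNoise H α W P) (n : ℕ) : Elem d (n + 1) →ₗ[ℝ] Lp (HP W P) 2 P :=
  Finsupp.linearCombination ℝ fun R =>
    (ContinuousLinearMap.toSpanSingleton ℝ (noiseVec hW (R (Fin.last n)))).compLp
      (wickLp hW n fun i => R i.castSucc)

theorem quadForm_inner_Lp {T K : Type*} [NormedAddCommGroup K] [InnerProductSpace ℝ K]
    (v : T → Lp K 2 P) (x : T →₀ ℝ) :
    quadForm (fun i j => ⟪v i, v j⟫) x = ‖Finsupp.linearCombination ℝ v x‖ ^ 2 :=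
  quadForm_inner v x

theorem tendsto_inner_Lp {K κ : Type*} [NormedAddCommGroup K] [InnerProductSpace ℝ K]
    {l : Filter κ} {f g : κ → Lp K 2 P} {x y : Lp K 2 P} (hf : Tendsto f l (𝓝 x))
    (hg : Tendsto g l (𝓝 y)) : Tendsto (fun k => ⟪f k, g k⟫) l (𝓝 ⟪x, y⟫) :=
  hf.inner hg

theorem inner_zero_right_Lp {K : Type*} [NormedAddCommGroup K] [InnerProductSpace ℝ K]
    (x : Lp K 2 P) : ⟪x, 0⟫ = 0 := inner_zero_right x

theorem inner_add_right_Lp {K : Type*} [NormedAddCommGroup K] [InnerProductSpace ℝ K]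
    (x y z : Lp K 2 P) : ⟪x, y + z⟫ = ⟪x, y⟫ + ⟪x, z⟫ := inner_add_right x y z

theorem inner_smul_right_Lp {K : Type*} [NormedAddCommGroup K] [InnerProductSpace ℝ K]
    (x y : Lp K 2 P) (a : ℝ) : ⟪x, a • y⟫ = a * ⟪x, y⟫ := real_inner_smul_right x y a

theorem inner_compLp_toSpanSingleton (X Y : Lp ℝ 2 P) (h k : HP W P) :
    ⟪(ContinuousLinearMap.toSpanSingleton ℝ h).compLp X,
      (ContinuousLinearMap.toSpanSingleton ℝ k).compLp Y⟫ = ⟪X, Y⟫ * ⟪h, k⟫ := by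
  rw [L2.inner_def, L2.inner_def, ← integral_mul_const]
  refine integral_congr_ae ?_
  filter_upwards [(ContinuousLinearMap.toSpanSingleton ℝ h).coeFn_compLp X,
    (ContinuousLinearMap.toSpanSingleton ℝ k).coeFn_compLp Y] with ω h1 h2
  rw [h1, h2]
  simp only [ContinuousLinearMap.toSpanSingleton_apply, real_inner_smul_left,
    real_inner_smul_right]
  have : ⟪X ω, Y ω⟫ = Y ω * X ω := rfl
  rw [this]; ring

theorem norm_skorL_sq_le (hW : IsNoise H α W P) (n : ℕ) (e : Elem d (n + 1)) :
    ‖skorL hW n e‖ ^ 2 ≤ n.factorial * e.normSq H α := by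
  rw [skorL, ← quadForm_inner_Lp]
  simp only [inner_compLp_toSpanSingleton, inner_wickLp, inner_noiseVec]
  simp only [← List.sum_map_mul_right]
  rw [quadForm_list_sum (insertPerms n)
    (fun σ (R R' : Fin (n + 1) → Rect d) =>
      (∏ i : Fin n, rectInner H α (R i.castSucc) (R' (σ i).castSucc)) *
        rectInner H α (R (Fin.last n)) (R' (Fin.last n)))]
  have h : ∀ y ∈ (insertPerms n).map (fun σ =>
      quadForm (fun R R' : Fin (n + 1) → Rect d =>
        (∏ i : Fin n, rectInner H α (R i.castSucc) (R' (σ i).castSucc)) *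
        rectInner H α (R (Fin.last n)) (R' (Fin.last n))) e),
      y ≤ e.normSq H α := by
    intro y hy
    obtain ⟨σ, _, rfl⟩ := List.mem_map.1 hy
    -- Only the first `n` variables are Wiener-integrated; extending `σ` by fixing the last variable
    -- turns the form into a permuted one on `n + 1` variables.
    let τ : Equiv.Perm (Fin (n + 1)) :=
      ((finSuccEquiv' (Fin.last n)).trans (Equiv.optionCongr σ)).trans
        (finSuccEquiv' (Fin.last n)).symm
    have h1 : τ (Fin.last n) = Fin.last n := by simp [τ]
    have h2 : ∀ i : Fin n, τ i.castSucc = (σ i).castSucc := by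
      intro i
      simp [τ, finSuccEquiv'_last_apply_castSucc]
    have := quadForm_perm_le (posSemidef_rectInner hW) (n + 1) τ e
    simp only [Fin.prod_univ_castSucc, h1, h2] at this
    exact this
  refine (List.sum_le_card_nsmul _ _ h).trans_eq ?_
  rw [List.length_map, length_insertPerms, nsmul_eq_mul]

theorem IsSmoothFunctional.memLp (hW : IsNoise H α W P) {F : Ω → ℝ} {DF : Ω → HP W P}
    (hF : IsSmoothFunctional W P F DF) : MemLp F 2 P ∧ MemLp DF 2 P := by
  obtain ⟨m, f, h, hf, hb, rfl, rfl⟩ := hF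
  have ht : f.HasTemperateGrowth := ⟨hf, fun k => by
    obtain ⟨C, hC⟩ := hb k
    exact ⟨0, C, by simpa using hC⟩⟩
  refine ⟨memLp_comp_of_hasTemperateGrowth (hasGaussianLaw_HP hW h) ht 2 (by norm_num), ?_⟩
  refine memLp_finsetSum _ fun i _ => ?_
  have h1 := memLp_comp_of_hasTemperateGrowth (hasGaussianLaw_HP hW h)
    (hasTemperateGrowth_fderiv_apply ht (Pi.single i 1)) 2 (by norm_num)
  exact (ContinuousLinearMap.toSpanSingleton ℝ (h i)).comp_memLp' h1

/-- Integration by parts in the last Wick factor: the derivative of `F` in the direction of the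
covariances with `W(R_{n+1})` is `⟨DF, 1_{R_{n+1}}⟩`. -/
theorem skorohod_duality_wick (hW : IsNoise H α W P) (n : ℕ) (R : Fin (n + 1) → Rect d)
    {F : Ω → ℝ} {DF : Ω → HP W P} (hF : IsSmoothFunctional W P F DF) :
    ∫ ω, F ω * wick H α W (n + 1) R ω ∂P =
      ∫ ω, ⟪DF ω, noiseVec hW (R (Fin.last n))⟫ * wick H α W n (fun i => R i.castSucc) ω ∂P := by
  obtain ⟨m, f, h, hf, hb, rfl, rfl⟩ := hF
  have ht : f.HasTemperateGrowth := ⟨hf, fun k => by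
    obtain ⟨C, hC⟩ := hb k
    exact ⟨0, C, by simpa using hC⟩⟩
  set k : Fin m ⊕ Fin (n + 1) → HP W P := Sum.elim h (fun i => noiseVec hW (R i)) with hk
  -- `F` depends only on the `h i`, but it must be seen as a function of the larger vector that also
  -- contains the variables `W(R_i)`.
  let L : (Fin m ⊕ Fin (n + 1) → ℝ) →L[ℝ] (Fin m → ℝ) :=
    ContinuousLinearMap.pi fun i => ContinuousLinearMap.proj (Sum.inl i)
  have hg : (fun x => f (L x)).HasTemperateGrowth := ht.comp L.hasTemperateGrowth
  have key := integral_mul_wickFun_last (hasGaussianLaw_HP hW k) (fun i => integral_HP hW (k i))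
    (fun i j => integral_HP_mul_HP (k i) (k j)) n Sum.inr hg
  have hL : ∀ ω, L (fun j => (k j : Lp ℝ 2 P) ω) = fun i => (h i : Lp ℝ 2 P) ω := by
    intro ω; rfl
  have hd : ∀ x v, fderiv ℝ (fun x => f (L x)) x v =
      ∑ i, fderiv ℝ f (L x) (Pi.single i 1) * v (Sum.inl i) := by
    intro x v
    have h1 : fderiv ℝ (fun x => f (L x)) x = (fderiv ℝ f (L x)).comp L :=
      ((hf.differentiable (by simp) (L x)).hasFDerivAt.comp x L.hasFDerivAt).fderiv
    rw [h1, ContinuousLinearMap.comp_apply]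
    conv_lhs => rw [pi_eq_sum_univ' (L v)]
    rw [map_sum]
    refine Finset.sum_congr rfl fun i _ => ?_
    rw [map_smul, smul_eq_mul, mul_comm]
    rfl
  simp only [hd, hL] at key
  refine (integral_congr_ae ?_).trans (key.trans (integral_congr_ae ?_))
  · filter_upwards [wick_ae_eq_wickFun hW k Sum.inr R (fun _ => rfl)] with ω h1
    rw [h1]
  · filter_upwards [wick_ae_eq_wickFun hW k (fun i : Fin n => Sum.inr i.castSucc)
      (fun i => R i.castSucc) (fun _ => rfl)] with ω h1
    rw [h1]
    simp only [sum_inner]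
    congr 1
    refine Finset.sum_congr rfl fun i _ => ?_
    refine Eq.trans ?_ (real_inner_smul_left (h i) (noiseVec hW (R (Fin.last n))) _).symm
    congr 1
    exact real_inner_comm _ _

theorem skorohod_duality_smooth (hW : IsNoise H α W P) (n : ℕ) (e : Elem d (n + 1))
    {F : Ω → ℝ} {DF : Ω → HP W P} (hF : IsSmoothFunctional W P F DF)
    (h1 : MemLp F 2 P) (h2 : MemLp DF 2 P) :
    ⟪h1.toLp, wienerL hW (n + 1) e⟫ = ⟪h2.toLp, skorL hW n e⟫ := by
  induction e using Finsupp.induction_linear with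
  | zero => simp only [map_zero, inner_zero_right_Lp]
  | add f g hf hg => rw [map_add, map_add, inner_add_right_Lp, inner_add_right_Lp, hf, hg]
  | single R a =>
    simp only [wienerL, skorL, Finsupp.linearCombination_single]
    rw [inner_smul_right_Lp, inner_smul_right_Lp]
    congr 1
    rw [L2.inner_def, L2.inner_def]
    refine (integral_congr_ae ?_).trans ((skorohod_duality_wick hW n R hF).trans
      (integral_congr_ae ?_))
    · filter_upwards [h1.coeFn_toLp, coeFn_wickLp hW (n + 1) R] with ω e1 e2
      rw [e1, e2]
      exact mul_comm _ _
    · filter_upwards [h2.coeFn_toLp, coeFn_wickLp hW n (fun i => R i.castSucc),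
        (ContinuousLinearMap.toSpanSingleton ℝ (noiseVec hW (R (Fin.last n)))).coeFn_compLp
          (wickLp hW n fun i => R i.castSucc)] with ω e1 e2 e3
      rw [e1, e3, e2, ContinuousLinearMap.toSpanSingleton_apply, real_inner_smul_right, mul_comm]

theorem skorohod_duality (hW : IsNoise H α W P) (n : ℕ) (e : Elem d (n + 1))
    {F : Ω → ℝ} {DF : Ω → HP W P} (hF : IsMalliavinDeriv W P F DF) :
    ⟪hF.1.toLp, wienerL hW (n + 1) e⟫ = ⟪hF.2.1.toLp, skorL hW n e⟫ := by
  obtain ⟨hF2, hDF2, Fk, DFk, hk, hlim, hDlim⟩ := hF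
  have hm := fun k => (hk k).memLp hW
  have t1 : Tendsto (fun k => (hm k).1.toLp) atTop (𝓝 hF2.toLp) :=
    (Lp.tendsto_Lp_iff_tendsto_eLpNorm'' _ _ _ _).2 hlim
  have t2 : Tendsto (fun k => (hm k).2.toLp) atTop (𝓝 hDF2.toLp) :=
    (Lp.tendsto_Lp_iff_tendsto_eLpNorm'' _ _ _ _).2 hDlim
  refine tendsto_nhds_unique (tendsto_inner_Lp t1 tendsto_const_nhds) ?_
  simp only [fun k => skorohod_duality_smooth hW n e (hk k) (hm k).1 (hm k).2]
  exact tendsto_inner_Lp t2 tendsto_const_nhds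

end WienerIntegrals

/-! ### Fourier representation of the Riesz energy -/

section RieszSpectral

theorem integrableOn_rpow_mul_exp_neg_mul {a r : ℝ} (ha : 0 < a) (hr : 0 < r) :
    IntegrableOn (fun t : ℝ => t ^ (a - 1) * Real.exp (-(r * t))) (Ioi 0) := by
  refine not_imp_comm.1 integral_undef ?_
  rw [Real.integral_rpow_mul_exp_neg_mul_Ioi ha hr]
  have := Real.Gamma_pos_of_pos ha
  positivity

theorem rpow_neg_one_mul_eq {a r x : ℝ} (hx : x ∈ Ioi (0 : ℝ)) :
    (|(-1 : ℝ)| * x ^ ((-1 : ℝ) - 1)) • ((x ^ (-1 : ℝ)) ^ (a - 1) * Real.exp (-(r * x ^ (-1 : ℝ)))) =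
      x ^ (-a - 1) * Real.exp (-(r / x)) := by
  have hx' : (0 : ℝ) < x := hx
  rw [abs_neg, abs_one, one_mul, smul_eq_mul, ← mul_assoc, ← Real.rpow_mul hx'.le,
    ← Real.rpow_add hx', Real.rpow_neg_one]
  ring_nf

/-- The substitution `t ↦ 1/t` reduces this to the Gamma integral. -/
theorem integral_rpow_mul_exp_neg_div {a r : ℝ} (ha : 0 < a) (hr : 0 < r) :
    ∫ t in Ioi (0 : ℝ), t ^ (-a - 1) * Real.exp (-(r / t)) = (1 / r) ^ a * Real.Gamma a := by
  rw [← Real.integral_rpow_mul_exp_neg_mul_Ioi ha hr,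
    ← integral_comp_rpow_Ioi (fun t => t ^ (a - 1) * Real.exp (-(r * t)))
      (by norm_num : (-1 : ℝ) ≠ 0)]
  exact setIntegral_congr_fun measurableSet_Ioi fun x hx => (rpow_neg_one_mul_eq hx).symm

theorem integrableOn_rpow_mul_exp_neg_div {a r : ℝ} (ha : 0 < a) (hr : 0 < r) :
    IntegrableOn (fun t : ℝ => t ^ (-a - 1) * Real.exp (-(r / t))) (Ioi 0) :=
  ((integrableOn_Ioi_comp_rpow_iff _ (by norm_num : (-1 : ℝ) ≠ 0)).2
    (integrableOn_rpow_mul_exp_neg_mul ha hr)).congr_fun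
      (fun _ hx => rpow_neg_one_mul_eq hx) measurableSet_Ioi

variable {V : Type*} [NormedAddCommGroup V] [InnerProductSpace ℝ V] [MeasurableSpace V]
  [BorelSpace V] [FiniteDimensional ℝ V]

/-- The inverse Fourier transform of the indicator function of a set. -/
def indHat (A : Set V) (ξ : V) : ℂ := 𝓕⁻ (A.indicator fun _ => (1 : ℂ)) ξ

theorem indHat_eq {A : Set V} (hA : MeasurableSet A) (ξ : V) :
    indHat A ξ = ∫ x in A, Complex.exp ((2 * Real.pi * ⟪x, ξ⟫ : ℝ) * Complex.I) := by
  rw [indHat, Real.fourierInv_eq', ← integral_indicator hA]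
  congr 1 with x
  by_cases hx : x ∈ A <;> simp [hx]

theorem integrable_indicator_one {A : Set V} (hA : MeasurableSet A) (hb : Bornology.IsBounded A) :
    Integrable (A.indicator fun _ => (1 : ℂ)) :=
  (integrable_indicator_iff hA).2 (integrableOn_const hb.measure_lt_top.ne)

theorem continuous_fourierInv {E : Type*} [NormedAddCommGroup E] [NormedSpace ℂ E] {f : V → E}
    (hf : Integrable f) : Continuous (𝓕⁻ f) := by
  have h : Continuous (𝓕 f) := VectorFourier.fourierIntegral_continuous
    Real.continuous_fourierChar (by exact continuous_inner) hf
  have : 𝓕⁻ f = fun x => 𝓕 f (-x) := funext fun x => Real.fourierInv_eq_fourier_neg f x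
  rw [this]
  exact h.comp continuous_neg

theorem continuous_indHat {A : Set V} (hA : MeasurableSet A) (hb : Bornology.IsBounded A) :
    Continuous (indHat A) := continuous_fourierInv (integrable_indicator_one hA hb)

theorem norm_exp_ofReal_mul_I (r : ℝ) : ‖Complex.exp ((r : ℝ) * Complex.I)‖ = 1 :=
  Complex.norm_exp_ofReal_mul_I r

theorem norm_indHat_le {A : Set V} (hA : MeasurableSet A) (ξ : V) :
    ‖indHat A ξ‖ ≤ volume.real A := by
  rw [indHat_eq hA]
  refine (norm_integral_le_integral_norm _).trans_eq ?_
  simp only [norm_exp_ofReal_mul_I]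
  simp

theorem conj_indHat {A : Set V} (hA : MeasurableSet A) (ξ : V) :
    (starRingEnd ℂ) (indHat A ξ) = indHat A (-ξ) := by
  rw [indHat_eq hA, indHat_eq hA, ← integral_conj]
  congr 1 with x
  rw [← Complex.exp_conj, map_mul, Complex.conj_ofReal, Complex.conj_I, inner_neg_right]
  push_cast
  ring_nf

theorem indHat_mul_conj {A B : Set V} (hA : MeasurableSet A) (hB : MeasurableSet B) (ξ : V) :
    indHat A ξ * (starRingEnd ℂ) (indHat B ξ) =
      ∫ p, Complex.exp ((2 * Real.pi * ⟪p.1 - p.2, ξ⟫ : ℝ) * Complex.I)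
        ∂((volume.restrict A).prod (volume.restrict B)) := by
  rw [conj_indHat hB, indHat_eq hA, indHat_eq hB, ← integral_prod_mul]
  congr 1 with p
  rw [← Complex.exp_add]
  congr 1
  simp only [inner_neg_right, inner_sub_left]
  push_cast
  ring

/-- The inverse Fourier transform of `ξ ↦ e^{-b|ξ|²}`. -/
def gaussKer (V : Type*) [NormedAddCommGroup V] [InnerProductSpace ℝ V] (b : ℝ) (z : V) : ℝ :=
  (Real.pi / b) ^ (Module.finrank ℝ V / 2 : ℝ) * Real.exp (-(Real.pi ^ 2 * ‖z‖ ^ 2 / b))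

theorem integrable_exp_neg_mul_sq {b : ℝ} (hb : 0 < b) :
    Integrable fun ξ : V => Real.exp (-(b * ‖ξ‖ ^ 2)) := by
  have h := (GaussianFourier.integrable_cexp_neg_mul_sq_norm_add (V := V) (b := b)
    (by simpa using hb) 0 0).norm
  refine h.congr (Eventually.of_forall fun ξ => ?_)
  simp only [zero_mul, add_zero, Complex.norm_exp]
  congr 1
  norm_cast
  ring

theorem integral_exp_inner_mul_gauss {b : ℝ} (hb : 0 < b) (z : V) :
    ∫ ξ : V, Complex.exp ((2 * Real.pi * ⟪z, ξ⟫ : ℝ) * Complex.I) *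
      (Real.exp (-(b * ‖ξ‖ ^ 2)) : ℝ) = (gaussKer V b z : ℝ) := by
  have h := fourier_gaussian_innerProductSpace (V := V) (b := (b : ℂ)) (by simpa using hb) (-z)
  rw [Real.fourier_eq'] at h
  rw [gaussKer]
  push_cast
  have e1 : ((Real.pi / b) ^ (Module.finrank ℝ V / 2 : ℝ) : ℝ) =
      ((Real.pi / b : ℂ) ^ (Module.finrank ℝ V / 2 : ℂ)) := by
    rw [Complex.ofReal_cpow (by positivity)]
    push_cast
    rfl
  rw [e1]
  rw [norm_neg] at h
  convert! h using 1
  · congr 1 with ξ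
    rw [smul_eq_mul]
    simp only [inner_neg_right, real_inner_comm z ξ]
    congr 2
    · push_cast; ring
    · ring
  · congr 2
    ring

theorem integral_indHat_mul_conj_mul_gauss {A B : Set V} (hA : MeasurableSet A)
    (hB : MeasurableSet B) (hbA : Bornology.IsBounded A) (hbB : Bornology.IsBounded B)
    {b : ℝ} (hb : 0 < b) :
    ∫ ξ, indHat A ξ * (starRingEnd ℂ) (indHat B ξ) * (Real.exp (-(b * ‖ξ‖ ^ 2)) : ℝ) =
      ((∫ p, gaussKer V b (p.1 - p.2) ∂((volume.restrict A).prod (volume.restrict B)) : ℝ) : ℂ) := by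
  have : IsFiniteMeasure ((volume : Measure V).restrict A) := ⟨by simpa using hbA.measure_lt_top⟩
  have : IsFiniteMeasure ((volume : Measure V).restrict B) := ⟨by simpa using hbB.measure_lt_top⟩
  simp only [indHat_mul_conj hA hB, ← integral_mul_const]
  rw [integral_integral_swap]
  · rw [← integral_complex_ofReal]
    congr 1 with p
    exact integral_exp_inner_mul_gauss hb _
  · have h1 : Integrable (fun q : V × (V × V) => (Real.exp (-(b * ‖q.1‖ ^ 2)) : ℝ))
        (volume.prod ((volume.restrict A).prod (volume.restrict B))) :=
      (integrable_exp_neg_mul_sq hb).comp_fst _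
    refine h1.mono' ?_ (Eventually.of_forall fun q => ?_)
    · exact Continuous.aestronglyMeasurable (by fun_prop)
    · simp only [Function.uncurry]
      rw [norm_mul, norm_exp_ofReal_mul_I, one_mul, Complex.norm_real, Real.norm_of_nonneg
        (Real.exp_pos _).le]

/-- If `A` and `B` lie in a ball of radius `r`, only differences of norm below `2r` occur. The
kernel may be cut off there, where it is integrable, and the claim becomes integrability of a
convolution integrand. -/
theorem integrable_prod_norm_sub_rpow {A B : Set V} (hA : MeasurableSet A)
    (hB : MeasurableSet B) (hbA : Bornology.IsBounded A) (hbB : Bornology.IsBounded B) {γ : ℝ}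
    (h0 : 0 < γ) (hγ : γ < Module.finrank ℝ V) :
    Integrable (fun p : V × V => ‖p.1 - p.2‖ ^ (-γ))
      ((volume.restrict A).prod (volume.restrict B)) := by
  have hd : 1 ≤ Module.finrank ℝ V := by
    have : (0 : ℝ) < Module.finrank ℝ V := h0.trans hγ
    exact_mod_cast this
  obtain ⟨r, hr⟩ := (hbA.union hbB).subset_ball (0 : V)
  have hg : Integrable ((Metric.ball (0 : V) (2 * r)).indicator fun z => ‖z‖ ^ (-γ)) := by
    rw [integrable_indicator_iff measurableSet_ball]
    refine integrableOn_ball_of_norm_le_rpow hd (C := 1) (α := γ) (by linarith) (Eventually.of_forall fun z => ?_) ?_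
    · rw [one_mul, Real.norm_of_nonneg (by positivity)]
    · exact Measurable.aestronglyMeasurable (by fun_prop)
  have hf : Integrable (B.indicator fun _ => (1 : ℝ)) :=
    (integrable_indicator_iff hB).2 (integrableOn_const hbB.measure_lt_top.ne)
  have h := Integrable.convolution_integrand (ContinuousLinearMap.mul ℝ ℝ) hf hg
  have h2 := h.mono_measure (Measure.prod_mono (Measure.restrict_le_self (μ := volume) (s := A))
    (Measure.restrict_le_self (μ := volume) (s := B)))
  refine h2.congr ?_
  rw [Measure.prod_restrict]
  refine (ae_restrict_iff' (hA.prod hB)).2 (Eventually.of_forall fun p hp => ?_)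
  have h3 : p.1 - p.2 ∈ Metric.ball (0 : V) (2 * r) := by
    have ha := hr (Or.inl hp.1)
    have hb := hr (Or.inr hp.2)
    rw [mem_ball_zero_iff] at *
    linarith [norm_sub_le p.1 p.2]
  simp [hp.2, h3]

theorem ae_prod_sub_ne_zero [Nontrivial V] (A B : Set V) :
    ∀ᵐ p ∂((volume.restrict A).prod (volume.restrict B)), p.1 - p.2 ≠ 0 := by
  rw [ae_iff]
  simp only [not_not]
  rw [Measure.measure_prod_null (measurableSet_eq_fun (by fun_prop) (by fun_prop))]
  refine Eventually.of_forall fun x => ?_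
  refine measure_mono_null (t := {x}) (fun y hy => ?_) (measure_singleton x)
  exact (sub_eq_zero.1 hy).symm

theorem rpow_mul_gaussKer (β : ℝ) {b : ℝ} (hb : 0 < b) (z : V) :
    b ^ (β / 2 - 1) * gaussKer V b z = Real.pi ^ (Module.finrank ℝ V / 2 : ℝ) *
      (b ^ (-((Module.finrank ℝ V - β) / 2) - 1) * Real.exp (-(Real.pi ^ 2 * ‖z‖ ^ 2 / b))) := by
  rw [gaussKer, Real.div_rpow Real.pi_pos.le hb.le,
    div_eq_mul_inv (Real.pi ^ (Module.finrank ℝ V / 2 : ℝ)), ← Real.rpow_neg hb.le]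
  have : b ^ (-((Module.finrank ℝ V - β) / 2) - 1) =
      b ^ (β / 2 - 1) * b ^ (-(Module.finrank ℝ V / 2 : ℝ)) := by
    rw [← Real.rpow_add hb]; congr 1; ring
  rw [this]; ring

theorem gaussKer_nonneg {b : ℝ} (hb : 0 < b) (z : V) : 0 ≤ gaussKer V b z := by
  rw [gaussKer]; positivity

/-- The constant of `riesz_spectral`. -/
def spectralConst (D : ℕ) (β : ℝ) : ℝ :=
  Real.pi ^ (D / 2 : ℝ) * (1 / Real.pi ^ 2) ^ ((D - β) / 2) * Real.Gamma ((D - β) / 2)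

theorem spectralConst_pos {D : ℕ} {β : ℝ} (hβ : β < D) : 0 < spectralConst D β := by
  have := Real.Gamma_pos_of_pos (show 0 < (D - β) / 2 by linarith)
  rw [spectralConst]
  positivity

/-- Subordination. Integrated against `b^{β/2-1} db`, the Gaussians `e^{-b|ξ|²}` give a multiple of
`|ξ|^{-β}`, while their transforms give a multiple of `|z|^{-(D-β)}`. The Fourier relation between
the two powers is thereby reduced to that of Gaussians and to Fubini's theorem. -/
theorem integral_rpow_mul_gaussKer {β : ℝ} (hβ : β < Module.finrank ℝ V) {z : V} (hz : z ≠ 0) :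
    ∫ b in Ioi (0 : ℝ), b ^ (β / 2 - 1) * gaussKer V b z =
      spectralConst (Module.finrank ℝ V) β * ‖z‖ ^ (-(Module.finrank ℝ V - β)) := by
  have hz' : 0 < ‖z‖ := norm_pos_iff.2 hz
  rw [setIntegral_congr_fun measurableSet_Ioi fun b hb => rpow_mul_gaussKer β hb z,
    integral_const_mul, integral_rpow_mul_exp_neg_div (by linarith) (by positivity), spectralConst]
  have : (1 / (Real.pi ^ 2 * ‖z‖ ^ 2)) ^ ((Module.finrank ℝ V - β) / 2) =
      (1 / Real.pi ^ 2) ^ ((Module.finrank ℝ V - β) / 2) *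
        ‖z‖ ^ (-(Module.finrank ℝ V - β)) := by
    rw [show 1 / (Real.pi ^ 2 * ‖z‖ ^ 2) = 1 / Real.pi ^ 2 * ‖z‖ ^ (-2 : ℝ) by
      rw [Real.rpow_neg hz'.le]; norm_num; ring, Real.mul_rpow (by positivity) (by positivity),
      ← Real.rpow_mul hz'.le]
    congr 2
    ring
  rw [this]; ring

theorem integrable_rpow_mul_gaussKer {A B : Set V} (hA : MeasurableSet A)
    (hB : MeasurableSet B) (hbA : Bornology.IsBounded A) (hbB : Bornology.IsBounded B) {β : ℝ}
    (h0 : 0 < β) (hβ : β < Module.finrank ℝ V) :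
    Integrable (fun q : ℝ × (V × V) => q.1 ^ (β / 2 - 1) * gaussKer V q.1 (q.2.1 - q.2.2))
      ((volume.restrict (Ioi 0)).prod ((volume.restrict A).prod (volume.restrict B))) := by
  have : Nontrivial V := Module.nontrivial_of_finrank_pos (R := ℝ) (by
    have : (0 : ℝ) < Module.finrank ℝ V := h0.trans hβ
    exact_mod_cast this)
  refine (integrable_prod_iff' (Measurable.aestronglyMeasurable ?_)).2 ⟨?_, ?_⟩
  · unfold gaussKer
    fun_prop
  · filter_upwards [ae_prod_sub_ne_zero A B] with p hp
    have hz' : 0 < ‖p.1 - p.2‖ := norm_pos_iff.2 hp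
    exact IntegrableOn.congr_fun ((integrableOn_rpow_mul_exp_neg_div
      (show 0 < (Module.finrank ℝ V - β) / 2 by linarith)
      (show 0 < Real.pi ^ 2 * ‖p.1 - p.2‖ ^ 2 by positivity)).const_mul _)
      (fun b hb => (rpow_mul_gaussKer β hb _).symm) measurableSet_Ioi
  · refine ((integrable_prod_norm_sub_rpow hA hB hbA hbB (γ := Module.finrank ℝ V - β)
      (by linarith) (by linarith)).const_mul (spectralConst (Module.finrank ℝ V) β)).congr ?_
    filter_upwards [ae_prod_sub_ne_zero A B] with p hp
    rw [← integral_rpow_mul_gaussKer hβ hp]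
    refine setIntegral_congr_fun measurableSet_Ioi fun b hb => ?_
    have hb' : (0 : ℝ) < b := hb
    exact (Real.norm_of_nonneg (mul_nonneg (by positivity) (gaussKer_nonneg hb' _))).symm

theorem integral_rpow_mul_exp_neg_mul_sq {β : ℝ} (h0 : 0 < β) {ξ : V} (hξ : ξ ≠ 0) :
    ∫ b in Ioi (0 : ℝ), b ^ (β / 2 - 1) * Real.exp (-(b * ‖ξ‖ ^ 2)) =
      Real.Gamma (β / 2) * ‖ξ‖ ^ (-β) := by
  have hz' : 0 < ‖ξ‖ := norm_pos_iff.2 hξ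
  simp only [mul_comm _ (‖ξ‖ ^ 2)]
  rw [Real.integral_rpow_mul_exp_neg_mul_Ioi (by linarith) (by positivity), mul_comm]
  rw [show 1 / ‖ξ‖ ^ 2 = ‖ξ‖ ^ (-2 : ℝ) by rw [Real.rpow_neg hz'.le]; norm_num,
    ← Real.rpow_mul hz'.le]
  congr 2
  ring

/-- When the two sets coincide the integrand is nonnegative on `b > 0`, and its integral over
frequencies is the corresponding Gaussian mixture in physical space, already known to be integrable.
The general case follows from `|a b̄| ≤ |a|² + |b|²`. -/
theorem integrable_indHat_mix {A B : Set V} (hA : MeasurableSet A)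
    (hB : MeasurableSet B) (hbA : Bornology.IsBounded A) (hbB : Bornology.IsBounded B) {β : ℝ}
    (h0 : 0 < β) (hβ : β < Module.finrank ℝ V) :
    Integrable (fun q : ℝ × V => indHat A q.2 * (starRingEnd ℂ) (indHat B q.2) *
      (q.1 ^ (β / 2 - 1) * Real.exp (-(q.1 * ‖q.2‖ ^ 2)) : ℝ))
      ((volume.restrict (Ioi 0)).prod volume) := by
  have hmeas : ∀ {A B : Set V}, MeasurableSet A → MeasurableSet B → Bornology.IsBounded A →
      Bornology.IsBounded B → AEStronglyMeasurable
      (fun q : ℝ × V => indHat A q.2 * (starRingEnd ℂ) (indHat B q.2) *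
      (q.1 ^ (β / 2 - 1) * Real.exp (-(q.1 * ‖q.2‖ ^ 2)) : ℝ))
      ((volume.restrict (Ioi 0)).prod volume) := by
    intro A B hA hB hbA hbB
    have hc := (continuous_indHat hA hbA).measurable
    have hc' := (continuous_indHat hB hbB).measurable
    refine Measurable.aestronglyMeasurable ?_
    exact ((hc.comp measurable_snd).mul
      (Complex.continuous_conj.measurable.comp (hc'.comp measurable_snd))).mul
      (Complex.continuous_ofReal.measurable.comp (by fun_prop))
  have diag : ∀ {A : Set V}, MeasurableSet A → Bornology.IsBounded A →
      Integrable (fun q : ℝ × V => indHat A q.2 * (starRingEnd ℂ) (indHat A q.2) *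
      (q.1 ^ (β / 2 - 1) * Real.exp (-(q.1 * ‖q.2‖ ^ 2)) : ℝ))
      ((volume.restrict (Ioi 0)).prod volume) := by
    intro A hA hbA
    have hnorm : ∀ {b : ℝ}, 0 < b → ∀ ξ : V, ‖indHat A ξ * (starRingEnd ℂ) (indHat A ξ) *
        (b ^ (β / 2 - 1) * Real.exp (-(b * ‖ξ‖ ^ 2)) : ℝ)‖ =
        b ^ (β / 2 - 1) * (‖indHat A ξ‖ ^ 2 * Real.exp (-(b * ‖ξ‖ ^ 2))) := by
      intro b hb ξ
      rw [norm_mul, norm_mul, RCLike.norm_conj, Complex.norm_real,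
        Real.norm_of_nonneg (by positivity)]
      ring
    refine (integrable_prod_iff (hmeas hA hA hbA hbA)).2 ⟨?_, ?_⟩
    · refine (ae_restrict_iff' measurableSet_Ioi).2 (Eventually.of_forall fun b hb => ?_)
      have hb' : (0 : ℝ) < b := hb
      refine ((integrable_exp_neg_mul_sq (V := V) hb').const_mul
        (b ^ (β / 2 - 1) * (volume.real A) ^ 2)).mono' ?_ (Eventually.of_forall fun ξ => ?_)
      · have hc := (continuous_indHat hA hbA)
        exact Continuous.aestronglyMeasurable ((hc.mul (Complex.continuous_conj.comp hc)).mul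
          (Complex.continuous_ofReal.comp (show Continuous fun ξ : V =>
            b ^ (β / 2 - 1) * Real.exp (-(b * ‖ξ‖ ^ 2)) by fun_prop)))
      · rw [hnorm hb', ← mul_assoc]
        gcongr
        exact norm_indHat_le hA ξ
    · have h := (integrable_rpow_mul_gaussKer hA hA hbA hbA h0 hβ).integral_prod_left
      refine h.congr ((ae_restrict_iff' measurableSet_Ioi).2 (Eventually.of_forall fun b hb => ?_))
      have hb' : (0 : ℝ) < b := hb
      simp only [hnorm hb', integral_const_mul]
      congr 1
      have := integral_indHat_mul_conj_mul_gauss hA hA hbA hbA hb'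
      rw [← Complex.ofReal_inj, ← this, ← integral_complex_ofReal]
      congr 1 with ξ
      rw [Complex.mul_conj, Complex.normSq_eq_norm_sq]
      push_cast
      ring
  refine ((diag hA hbA).norm.add (diag hB hbB).norm).mono' (hmeas hA hB hbA hbB)
    (Eventually.of_forall fun q => ?_)
  simp only [norm_mul, RCLike.norm_conj, Pi.add_apply, ← add_mul]
  gcongr
  nlinarith [sq_nonneg (‖indHat A q.2‖ - ‖indHat B q.2‖), sq_nonneg ‖indHat A q.2‖,
    sq_nonneg ‖indHat B q.2‖]

theorem integral_indHat_mix {A B : Set V} {β : ℝ} (h0 : 0 < β) {ξ : V} (hξ : ξ ≠ 0) :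
    ∫ b in Ioi (0 : ℝ), indHat A ξ * (starRingEnd ℂ) (indHat B ξ) *
      (b ^ (β / 2 - 1) * Real.exp (-(b * ‖ξ‖ ^ 2)) : ℝ) =
    Real.Gamma (β / 2) * (indHat A ξ * (starRingEnd ℂ) (indHat B ξ) * (‖ξ‖ ^ (-β) : ℝ)) := by
  rw [integral_const_mul, integral_complex_ofReal, integral_rpow_mul_exp_neg_mul_sq h0 hξ]
  push_cast
  ring

theorem integrable_indHat_mul_conj_mul_rpow {A B : Set V} (hA : MeasurableSet A)
    (hB : MeasurableSet B) (hbA : Bornology.IsBounded A) (hbB : Bornology.IsBounded B) {β : ℝ}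
    (h0 : 0 < β) (hβ : β < Module.finrank ℝ V) :
    Integrable fun ξ : V => indHat A ξ * (starRingEnd ℂ) (indHat B ξ) * (‖ξ‖ ^ (-β) : ℝ) := by
  have : Nontrivial V := Module.nontrivial_of_finrank_pos (R := ℝ) (by
    have : (0 : ℝ) < Module.finrank ℝ V := h0.trans hβ
    exact_mod_cast this)
  have hG : (Real.Gamma (β / 2) : ℂ) ≠ 0 :=
    Complex.ofReal_ne_zero.2 (Real.Gamma_pos_of_pos (by linarith)).ne'
  refine (integrable_const_mul_iff hG.isUnit _).1 ?_
  refine (integrable_indHat_mix hA hB hbA hbB h0 hβ).integral_prod_right.congr ?_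
  filter_upwards [Measure.ae_ne volume (0 : V)] with ξ hξ
  exact integral_indHat_mix h0 hξ

/-- The spectral representation of the Riesz energy of two bounded sets. -/
theorem riesz_spectral {A B : Set V} (hA : MeasurableSet A)
    (hB : MeasurableSet B) (hbA : Bornology.IsBounded A) (hbB : Bornology.IsBounded B) {β : ℝ}
    (h0 : 0 < β) (hβ : β < Module.finrank ℝ V) :
    (spectralConst (Module.finrank ℝ V) β *
      ∫ x in A, ∫ y in B, ‖x - y‖ ^ (-(Module.finrank ℝ V - β)) : ℝ) =
    Real.Gamma (β / 2) *
      ∫ ξ : V, indHat A ξ * (starRingEnd ℂ) (indHat B ξ) * (‖ξ‖ ^ (-β) : ℝ) := by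
  have : Nontrivial V := Module.nontrivial_of_finrank_pos (R := ℝ) (by
    have : (0 : ℝ) < Module.finrank ℝ V := h0.trans hβ
    exact_mod_cast this)
  rw [← integral_const_mul (Real.Gamma (β / 2) : ℂ)]
  have e1 : ∫ ξ : V, Real.Gamma (β / 2) *
      (indHat A ξ * (starRingEnd ℂ) (indHat B ξ) * (‖ξ‖ ^ (-β) : ℝ)) =
      ∫ ξ : V, ∫ b in Ioi (0 : ℝ), indHat A ξ * (starRingEnd ℂ) (indHat B ξ) *
      (b ^ (β / 2 - 1) * Real.exp (-(b * ‖ξ‖ ^ 2)) : ℝ) := by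
    refine integral_congr_ae ?_
    filter_upwards [Measure.ae_ne volume (0 : V)] with ξ hξ
    exact (integral_indHat_mix h0 hξ).symm
  rw [e1]
  refine Eq.trans ?_ (integral_integral_swap (integrable_indHat_mix hA hB hbA hbB h0 hβ))
  have e2 : ∫ b in Ioi (0 : ℝ), ∫ ξ : V, indHat A ξ * (starRingEnd ℂ) (indHat B ξ) *
      (b ^ (β / 2 - 1) * Real.exp (-(b * ‖ξ‖ ^ 2)) : ℝ) =
      ∫ b in Ioi (0 : ℝ), ((∫ p, b ^ (β / 2 - 1) * gaussKer V b (p.1 - p.2)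
        ∂((volume.restrict A).prod (volume.restrict B)) : ℝ) : ℂ) := by
    refine setIntegral_congr_fun measurableSet_Ioi fun b hb => ?_
    rw [integral_const_mul, Complex.ofReal_mul,
      ← integral_indHat_mul_conj_mul_gauss hA hB hbA hbB hb, ← integral_const_mul]
    congr 1 with ξ
    push_cast
    ring
  refine Eq.trans ?_ e2.symm
  rw [integral_complex_ofReal]
  congr 1
  refine Eq.trans ?_ (integral_integral_swap
    (integrable_rpow_mul_gaussKer hA hB hbA hbB h0 hβ)).symm
  rw [← integral_prod (f := fun p : V × V => ‖p.1 - p.2‖ ^ (-(Module.finrank ℝ V - β)))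
    (integrable_prod_norm_sub_rpow hA hB hbA hbB (by linarith) (by linarith)),
    ← integral_const_mul]
  refine integral_congr_ae ?_
  filter_upwards [ae_prod_sub_ne_zero A B] with p hp
  exact (integral_rpow_mul_gaussKer hβ hp).symm

end RieszSpectral

/-! ### Schur's test for the time covariance -/

section TimeSchur

theorem quadForm_congr {T : Type*} {M N : T → T → ℝ} {x : T →₀ ℝ}
    (h : ∀ i ∈ x.support, ∀ j ∈ x.support, M i j = N i j) : quadForm M x = quadForm N x :=
  Finset.sum_congr rfl fun i hi => Finset.sum_congr rfl fun j hj => by simp only [h i hi j hj]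

theorem quadForm_integral {T X : Type*} [MeasurableSpace X] {μ : Measure X} {M : X → T → T → ℝ}
    (h : ∀ i j, Integrable (fun z => M z i j) μ) (x : T →₀ ℝ) :
    quadForm (fun i j => ∫ z, M z i j ∂μ) x = ∫ z, quadForm (M z) x ∂μ := by
  simp only [quadForm, Finsupp.sum, ← integral_const_mul]
  rw [integral_finsetSum]
  · refine Finset.sum_congr rfl fun i _ => ?_
    rw [integral_finsetSum]
    exact fun j _ => (h i j).const_mul _
  · exact fun i _ => integrable_finsetSum _ fun j _ => (h i j).const_mul _

theorem quadForm_mul {T : Type*} (f g : T → ℝ) (x : T →₀ ℝ) :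
    quadForm (fun i j => f i * g j) x =
      (x.sum fun i a => a * f i) * (x.sum fun i a => a * g i) := by
  simp only [quadForm, Finsupp.sum, Finset.sum_mul_sum]
  refine Finset.sum_congr rfl fun i _ => Finset.sum_congr rfl fun j _ => ?_
  ring

theorem integrable_prod_abs_sub_rpow {H : ℝ} (h1 : 1 / 2 < H) (h2 : H < 1) (T S : ℝ) :
    Integrable (fun p : ℝ × ℝ => |p.1 - p.2| ^ (2 * H - 2))
      ((volume.restrict (Ioc 0 T)).prod (volume.restrict (Ioc 0 S))) := by
  have := integrable_prod_norm_sub_rpow (V := ℝ) (A := Ioc 0 T) (B := Ioc 0 S) measurableSet_Ioc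
    measurableSet_Ioc (Metric.isBounded_Ioc 0 T) (Metric.isBounded_Ioc 0 S) (γ := 2 - 2 * H)
    (by linarith) (by rw [Module.finrank_self]; norm_num; linarith)
  simpa [Real.norm_eq_abs] using this

/-- Where `|r - r'| < 1` the exponential is at most `1` and the kernel is integrable because `2H - 2
> -1`; elsewhere the kernel is at most `1` and the exponential is integrable. Neither bound sees `r`
or `T`. -/
theorem exists_schur_bound {H : ℝ} (h1 : 1 / 2 < H) (h2 : H < 1) :
    ∃ C : ℝ, 0 ≤ C ∧ ∀ T r : ℝ,
      ∫ r' in Ioc 0 T, |r - r'| ^ (2 * H - 2) * Real.exp (-r') ≤ C := by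
  set f : ℝ → ℝ := (Metric.ball (0 : ℝ) 1).indicator fun u => |u| ^ (2 * H - 2) with hf
  have hfi : Integrable f := by
    rw [hf, integrable_indicator_iff measurableSet_ball]
    refine integrableOn_ball_of_norm_le_rpow (by simp) (C := 1) (α := 2 - 2 * H)
      (by rw [Module.finrank_self]; norm_num; linarith) (Eventually.of_forall fun z => ?_) ?_
    · rw [one_mul, Real.norm_of_nonneg (by positivity), Real.norm_eq_abs]
      apply le_of_eq; congr 1; ring
    · exact Measurable.aestronglyMeasurable (by fun_prop)
  have hf0 : ∀ u, 0 ≤ f u := fun u => indicator_nonneg (fun _ _ => by positivity) u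
  have hexp : IntegrableOn (fun r : ℝ => Real.exp (-r)) (Ioi 0) := by
    simpa using exp_neg_integrableOn_Ioi 0 one_pos
  refine ⟨(∫ u, f u) + 1, add_nonneg (integral_nonneg hf0) zero_le_one, fun T r => ?_⟩
  have hfr : Integrable fun r' => f (r - r') := hfi.comp_sub_left r
  calc ∫ r' in Ioc 0 T, |r - r'| ^ (2 * H - 2) * Real.exp (-r')
      ≤ ∫ r' in Ioc 0 T, (f (r - r') + Real.exp (-r')) := by
        refine integral_mono_of_nonneg (Eventually.of_forall fun r' => by positivity)
          (hfr.integrableOn.add (hexp.mono_set Ioc_subset_Ioi_self)) ?_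
        refine (ae_restrict_iff' measurableSet_Ioc).2 (Eventually.of_forall fun r' hr' => ?_)
        have he : Real.exp (-r') ≤ 1 := Real.exp_le_one_iff.2 (by linarith [hr'.1])
        have he0 := Real.exp_pos (-r')
        by_cases hu : r - r' ∈ Metric.ball (0 : ℝ) 1
        · simp only [hf, indicator_of_mem hu]
          have : 0 ≤ |r - r'| ^ (2 * H - 2) := by positivity
          nlinarith
        · simp only [hf, indicator_of_notMem hu, zero_add]
          have h3 : 1 ≤ |r - r'| := by
            rwa [mem_ball_zero_iff, not_lt, Real.norm_eq_abs] at hu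
          have : |r - r'| ^ (2 * H - 2) ≤ 1 :=
            Real.rpow_le_one_of_one_le_of_nonpos h3 (by linarith)
          nlinarith
    _ = (∫ r' in Ioc 0 T, f (r - r')) + ∫ r' in Ioc 0 T, Real.exp (-r') :=
        integral_add hfr.integrableOn (hexp.mono_set Ioc_subset_Ioi_self)
    _ ≤ (∫ u, f u) + 1 := by
        refine add_le_add ?_ ?_
        · refine (setIntegral_le_integral hfr (Eventually.of_forall fun _ => hf0 _)).trans_eq ?_
          exact integral_sub_left_eq_self f volume r
        · refine (setIntegral_mono_set hexp (Eventually.of_forall fun _ => (Real.exp_pos _).le)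
            (Eventually.of_forall Ioc_subset_Ioi_self)).trans_eq ?_
          simpa using integral_exp_neg_Ioi 0

/-- The double integral of the time covariance. -/
theorem fbmCov_eq_integral_prod {H : ℝ} (h1 : 1 / 2 < H) (h2 : H < 1) {t s T : ℝ}
    (ht : 0 ≤ t) (hs : 0 ≤ s) (htT : t ≤ T) (hsT : s ≤ T) :
    fbmCov H t s = H * (2 * H - 1) *
      ∫ p, |p.1 - p.2| ^ (2 * H - 2) *
        ((Iic t).indicator 1 p.1 * (Iic s).indicator 1 p.2)
        ∂((volume.restrict (Ioc 0 T)).prod (volume.restrict (Ioc 0 T))) := by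
  rw [fbmCov]
  congr 1
  have e : ∀ {t : ℝ}, 0 ≤ t → t ≤ T → (volume.restrict (Ioc 0 t) : Measure ℝ) =
      (volume.restrict (Ioc 0 T)).restrict (Iic t) := by
    intro t ht htT
    rw [Measure.restrict_restrict measurableSet_Iic, Iic_inter_Ioc_of_le htT]
  have h := integral_prod _ (integrable_prod_abs_sub_rpow h1 h2 t s)
  rw [intervalIntegral.integral_of_le ht]
  simp only [intervalIntegral.integral_of_le hs]
  rw [← h, e ht htT, e hs hsT, Measure.prod_restrict, ← integral_indicator
    (measurableSet_Iic.prod measurableSet_Iic)]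
  congr 1 with p
  clear h e
  by_cases hp1 : p.1 ≤ t <;> by_cases hp2 : p.2 ≤ s <;>
    simp [indicator, hp1, hp2, Prod.le_def]

/-- `⟨e^s 1_{[0,t]}, e^s 1_{[0,t']}⟩` in `L²(0,∞)`. -/
def timeEnergy (t s : ℝ) : ℝ := ∫ r in Ioc 0 (min t s), Real.exp r ^ 2

theorem timeEnergy_eq {t s T : ℝ} (htT : t ≤ T) :
    timeEnergy t s = ∫ r in Ioc 0 T, Real.exp r ^ 2 *
      ((Iic t).indicator 1 r * (Iic s).indicator 1 r) := by
  rw [timeEnergy]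
  have e : (volume.restrict (Ioc 0 (min t s)) : Measure ℝ) =
      (volume.restrict (Ioc 0 T)).restrict (Iic (min t s)) := by
    rw [Measure.restrict_restrict measurableSet_Iic,
      Iic_inter_Ioc_of_le (min_le_of_left_le htT)]
  rw [e, ← integral_indicator measurableSet_Iic]
  congr 1 with r
  by_cases hp1 : r ≤ t <;> by_cases hp2 : r ≤ s <;> simp [indicator, hp1, hp2]

theorem fbmCov_symm {H : ℝ} (h1 : 1 / 2 < H) (h2 : H < 1) {t s : ℝ}
    (ht : 0 ≤ t) (hs : 0 ≤ s) : fbmCov H t s = fbmCov H s t := by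
  rw [fbmCov_eq_integral_prod h1 h2 ht hs (le_max_left t s) (le_max_right t s),
    fbmCov_eq_integral_prod h1 h2 hs ht (le_max_right t s) (le_max_left t s)]
  congr 1
  rw [← integral_prod_swap]
  congr 1 with p
  simp only [Prod.fst_swap, Prod.snd_swap, abs_sub_comm p.2 p.1]
  ring

/-- Schur's test with the weight `e^r`. The product `g(r) g(r')` is split by the
arithmetic-geometric inequality into `g(r)² e^{r-r'}` and its mirror image. By symmetry of `κ` both
contribute the same amount, and the integral over `r'` is then bounded by `C`. -/
theorem integral_mul_schur_le {κ : ℝ → ℝ} {μ : Measure ℝ} [IsFiniteMeasure μ]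
    (hκ0 : ∀ u, 0 ≤ κ u) (hκs : ∀ u, κ (-u) = κ u)
    (hκ : Integrable (fun p : ℝ × ℝ => κ (p.1 - p.2)) (μ.prod μ)) {g : ℝ → ℝ} (hg : Measurable g)
    {B T : ℝ} (hB : ∀ r, |g r| ≤ B) (hμ : ∀ᵐ r ∂μ, 0 ≤ r ∧ r ≤ T) {C : ℝ}
    (hC : ∀ r, ∫ r', κ (r - r') * Real.exp (-r') ∂μ ≤ C) (hC0 : 0 ≤ C) :
    ∫ p, κ (p.1 - p.2) * (g p.1 * g p.2) ∂(μ.prod μ) ≤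
      C * ∫ r, Real.exp r ^ 2 * g r ^ 2 ∂μ := by
  have hae1 : ∀ᵐ p ∂(μ.prod μ), 0 ≤ p.1 ∧ p.1 ≤ T := Measure.quasiMeasurePreserving_fst.ae hμ
  have hae2 : ∀ᵐ p ∂(μ.prod μ), 0 ≤ p.2 ∧ p.2 ≤ T := Measure.quasiMeasurePreserving_snd.ae hμ
  have hB0 : 0 ≤ B := (abs_nonneg _).trans (hB 0)
  set F : ℝ × ℝ → ℝ := fun p => (g p.1 ^ 2 * Real.exp p.1) * (κ (p.1 - p.2) * Real.exp (-p.2))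
    with hF
  have hFi : Integrable F (μ.prod μ) := by
    refine (hκ.const_mul (B ^ 2 * Real.exp T)).mono' ?_ ?_
    · refine AEStronglyMeasurable.mul (Measurable.aestronglyMeasurable (by fun_prop))
        (hκ.1.mul (Measurable.aestronglyMeasurable (by fun_prop)))
    · filter_upwards [hae1, hae2] with p h1 h2
      have a1 : g p.1 ^ 2 ≤ B ^ 2 := sq_le_sq' (by linarith [neg_abs_le (g p.1), hB p.1])
        ((le_abs_self _).trans (hB p.1))
      have a2 : Real.exp p.1 ≤ Real.exp T := Real.exp_le_exp.2 h1.2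
      have a3 : Real.exp (-p.2) ≤ 1 := Real.exp_le_one_iff.2 (by linarith)
      have a4 := hκ0 (p.1 - p.2)
      rw [Real.norm_of_nonneg (by positivity)]
      refine mul_le_mul (mul_le_mul a1 a2 (by positivity) (by positivity)) ?_ (by positivity)
        (by positivity)
      nlinarith
  have hFs : Integrable (fun p : ℝ × ℝ => F p.swap) (μ.prod μ) := hFi.swap
  have hFint : ∫ p, F p ∂(μ.prod μ) ≤ C * ∫ r, Real.exp r ^ 2 * g r ^ 2 ∂μ := by
    rw [integral_prod _ hFi, ← integral_const_mul]
    refine integral_mono_ae hFi.integral_prod_left ?_ ?_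
    · refine Integrable.const_mul ?_ _
      refine (integrable_const (Real.exp T ^ 2 * B ^ 2)).mono'
        (Measurable.aestronglyMeasurable (by fun_prop)) ?_
      filter_upwards [hμ] with r h1
      have a1 : g r ^ 2 ≤ B ^ 2 := sq_le_sq' (by linarith [neg_abs_le (g r), hB r])
        ((le_abs_self _).trans (hB r))
      have a2 : Real.exp r ≤ Real.exp T := Real.exp_le_exp.2 h1.2
      rw [Real.norm_of_nonneg (by positivity)]
      gcongr
    · filter_upwards [hμ] with r h1
      simp only [hF, integral_const_mul]
      have a2 : 1 ≤ Real.exp r := Real.one_le_exp h1.1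
      calc g r ^ 2 * Real.exp r * ∫ r', κ (r - r') * Real.exp (-r') ∂μ
          ≤ g r ^ 2 * Real.exp r * C := by gcongr; exact hC r
        -- The test yields the weight `e^r`; as `r ≥ 0` it may be enlarged to `e^{2r}`, the square
        -- of the factor `e^r` carried by the transforms.
        _ ≤ C * (Real.exp r ^ 2 * g r ^ 2) := by
          have : 0 ≤ C * (g r ^ 2 * Real.exp r) * (Real.exp r - 1) :=
            mul_nonneg (by positivity) (by linarith)
          nlinarith
  calc ∫ p, κ (p.1 - p.2) * (g p.1 * g p.2) ∂(μ.prod μ)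
      ≤ ∫ p, (F p + F p.swap) / 2 ∂(μ.prod μ) := by
        refine integral_mono ?_ ((hFi.add hFs).div_const 2) fun p => ?_
        · refine (hκ.mul_const (B ^ 2)).mono' ?_ (Eventually.of_forall fun p => ?_)
          · exact hκ.1.mul (Measurable.aestronglyMeasurable (by fun_prop))
          · rw [norm_mul, Real.norm_of_nonneg (hκ0 _), norm_mul, Real.norm_eq_abs,
              Real.norm_eq_abs, sq]
            have := hκ0 (p.1 - p.2)
            gcongr <;> exact hB _
        · simp only [hF, Prod.fst_swap, Prod.snd_swap]
          have e1 : κ (p.2 - p.1) = κ (p.1 - p.2) := by rw [← hκs, neg_sub]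
          rw [e1]
          set u := Real.exp p.1
          set v := Real.exp p.2
          have hu : 0 < u := Real.exp_pos _
          have hv : 0 < v := Real.exp_pos _
          rw [Real.exp_neg, Real.exp_neg]
          have key : g p.1 * g p.2 ≤ (g p.1 ^ 2 * u * v⁻¹ + g p.2 ^ 2 * v * u⁻¹) / 2 := by
            have : (g p.1 ^ 2 * u * v⁻¹ + g p.2 ^ 2 * v * u⁻¹) / 2 - g p.1 * g p.2 =
                (g p.1 * u - g p.2 * v) ^ 2 / (2 * (u * v)) := by
              field_simp
              ring
            have h2 : 0 ≤ (g p.1 * u - g p.2 * v) ^ 2 / (2 * (u * v)) := by positivity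
            linarith
          nlinarith [mul_le_mul_of_nonneg_left key (hκ0 (p.1 - p.2))]
    _ = ∫ p, F p ∂(μ.prod μ) := by
        rw [integral_div, integral_add hFi hFs, integral_prod_swap F]
        ring
    _ ≤ _ := hFint

/-- For a combination `g` of the indicators `1_{[0,t]}`, the two quadratic forms are the double
integral of `g ⊗ g` against `|r-r'|^{2H-2}` and the weighted integral of `g²`, which Schur's test
compares. -/
theorem exists_time_bound {H : ℝ} (h1 : 1 / 2 < H) (h2 : H < 1) :
    ∃ C : ℝ, 0 ≤ C ∧ (Matrix.of fun t s : {t : ℝ // 0 ≤ t} =>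
      C * timeEnergy t s - fbmCov H t s).PosSemidef := by
  obtain ⟨C, hC0, hC⟩ := exists_schur_bound h1 h2
  have hc : 0 ≤ H * (2 * H - 1) := mul_nonneg (by linarith) (by linarith)
  refine ⟨H * (2 * H - 1) * C, by positivity, posSemidef_of_quadForm_nonneg (fun t s => ?_)
    fun x => ?_⟩
  · rw [fbmCov_symm h1 h2 t.2 s.2, timeEnergy, timeEnergy, min_comm]
  -- A horizon containing all the times involved. It depends on `x`, which is harmless because the
  -- constant `C` does not depend on it.
  obtain ⟨T, hT⟩ := (x.support.image fun t : {t : ℝ // 0 ≤ t} => (t : ℝ)).bddAbove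
  have hT' : ∀ t ∈ x.support, (t : ℝ) ≤ T := fun t ht =>
    hT (Finset.mem_coe.2 (Finset.mem_image_of_mem (fun t : {t : ℝ // 0 ≤ t} => (t : ℝ)) ht))
  set μ : Measure ℝ := volume.restrict (Ioc 0 T) with hμ
  set g : ℝ → ℝ := fun r => x.sum fun t a => a * (Iic (t : ℝ)).indicator 1 r with hg
  have hind : ∀ t : ℝ, Measurable ((Iic t).indicator (1 : ℝ → ℝ)) := fun t =>
    measurable_one.indicator measurableSet_Iic
  have hind1 : ∀ t r : ℝ, |(Iic t).indicator (1 : ℝ → ℝ) r| ≤ 1 := fun t r => by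
    by_cases h : r ≤ t <;> simp [indicator, h]
  have hgm : Measurable g := Finset.measurable_sum _ fun t _ => (hind t).const_mul _
  have hgb : ∀ r, |g r| ≤ ∑ t ∈ x.support, |x t| := fun r => by
    refine (Finset.abs_sum_le_sum_abs _ _).trans (Finset.sum_le_sum fun t _ => ?_)
    rw [abs_mul]
    exact mul_le_of_le_one_right (abs_nonneg _) (hind1 _ _)
  have hκ := integrable_prod_abs_sub_rpow h1 h2 T T
  have e1 : quadForm (fun t s : {t : ℝ // 0 ≤ t} => fbmCov H t s) x = H * (2 * H - 1) *
      ∫ p, |p.1 - p.2| ^ (2 * H - 2) * (g p.1 * g p.2) ∂(μ.prod μ) := by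
    rw [quadForm_congr fun t ht s hs =>
      fbmCov_eq_integral_prod h1 h2 t.2 s.2 (hT' t ht) (hT' s hs), quadForm_const_mul]
    congr 1
    rw [quadForm_integral (M := fun (p : ℝ × ℝ) (t s : {t : ℝ // 0 ≤ t}) =>
      |p.1 - p.2| ^ (2 * H - 2) * ((Iic (t : ℝ)).indicator 1 p.1 * (Iic (s : ℝ)).indicator 1 p.2))]
    · simp only [quadForm_const_mul, quadForm_mul]
      rfl
    · intro t s
      refine hκ.mono ?_ (Eventually.of_forall fun p => ?_)
      · exact hκ.1.mul (Measurable.aestronglyMeasurable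
          (((hind t).comp measurable_fst).mul ((hind s).comp measurable_snd)))
      · rw [norm_mul, norm_mul]
        exact mul_le_of_le_one_right (norm_nonneg _)
          (mul_le_one₀ (hind1 _ _) (norm_nonneg _) (hind1 _ _))
  have e2 : quadForm (fun t s : {t : ℝ // 0 ≤ t} => timeEnergy t s) x =
      ∫ r, Real.exp r ^ 2 * g r ^ 2 ∂μ := by
    rw [quadForm_congr fun (t : {t : ℝ // 0 ≤ t}) ht (s : {t : ℝ // 0 ≤ t}) _ =>
      timeEnergy_eq (s := s) (hT' t ht)]
    rw [quadForm_integral (M := fun (r : ℝ) (t s : {t : ℝ // 0 ≤ t}) =>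
      Real.exp r ^ 2 * ((Iic (t : ℝ)).indicator 1 r * (Iic (s : ℝ)).indicator 1 r))]
    · simp only [quadForm_const_mul, quadForm_mul]
      simp only [hg, hμ, sq]
    · intro t s
      have hc : Integrable (fun r : ℝ => Real.exp r ^ 2) (volume.restrict (Ioc 0 T)) :=
        (Continuous.integrableOn_Icc (by fun_prop)).mono_set Ioc_subset_Icc_self
      refine hc.mono ?_ (Eventually.of_forall fun p => ?_)
      · exact hc.1.mul (Measurable.aestronglyMeasurable ((hind t).mul (hind s)))
      · rw [norm_mul, norm_mul]
        exact mul_le_of_le_one_right (norm_nonneg _)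
          (mul_le_one₀ (hind1 _ _) (norm_nonneg _) (hind1 _ _))
  rw [quadForm_sub (fun t s : {t : ℝ // 0 ≤ t} => H * (2 * H - 1) * C * timeEnergy t s)
    (fun t s : {t : ℝ // 0 ≤ t} => fbmCov H t s), quadForm_const_mul, e1, e2, mul_assoc, ← mul_sub]
  refine mul_nonneg hc (sub_nonneg.2 ?_)
  exact integral_mul_schur_le (κ := fun u => |u| ^ (2 * H - 2)) (fun u => by positivity)
    (fun u => by rw [abs_neg]) hκ hgm hgb (T := T)
    ((ae_restrict_iff' measurableSet_Ioc).2 (Eventually.of_forall fun r hr => ⟨hr.1.le, hr.2⟩))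
    (hC T) hC0

end TimeSchur

/-! ### Tensor products in `L²` -/

section Tensor

theorem memLp_mul_prod {X Y : Type*} [MeasurableSpace X] [MeasurableSpace Y] {μ : Measure X}
    {ν : Measure Y} [SigmaFinite μ] [SigmaFinite ν] {f : X → ℂ} {g : Y → ℂ} (hf : MemLp f 2 μ)
    (hg : MemLp g 2 ν) : MemLp (fun z : X × Y => f z.1 * g z.2) 2 (μ.prod ν) := by
  have hm : AEStronglyMeasurable (fun z : X × Y => f z.1 * g z.2) (μ.prod ν) :=
    hf.1.comp_fst.mul hg.1.comp_snd
  refine (memLp_two_iff_integrable_sq_norm hm).2 ?_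
  simp only [norm_mul, mul_pow]
  exact Integrable.mul_prod ((memLp_two_iff_integrable_sq_norm hf.1).1 hf)
    ((memLp_two_iff_integrable_sq_norm hg.1).1 hg)

theorem memLp_prod_pi {n : ℕ} {X : Type*} [MeasurableSpace X] {μ : Measure X} [SigmaFinite μ]
    {f : Fin n → X → ℂ} (hf : ∀ i, MemLp (f i) 2 μ) :
    MemLp (fun z : Fin n → X => ∏ i, f i (z i)) 2 (Measure.pi fun _ => μ) := by
  have hm : AEStronglyMeasurable (fun z : Fin n → X => ∏ i, f i (z i)) (Measure.pi fun _ => μ) :=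
    Finset.aestronglyMeasurable_fun_prod _ fun i _ =>
      (hf i).1.comp_quasiMeasurePreserving (Measure.quasiMeasurePreserving_eval _ i)
  refine (memLp_two_iff_integrable_sq_norm hm).2 ?_
  simp only [norm_prod, ← Finset.prod_pow]
  exact Integrable.fintype_prod (𝕜 := ℝ) (f := fun i x => ‖f i x‖ ^ 2)
    fun i => (memLp_two_iff_integrable_sq_norm (hf i).1).1 (hf i)

/-- The spectral spaces are used as real Hilbert spaces, because elementary functions have real
coefficients; their inner product is the real part of the hermitian one. -/
theorem inner_toLp_complex {X : Type*} [MeasurableSpace X] {μ : Measure X} {f g : X → ℂ}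
    (hf : MemLp f 2 μ) (hg : MemLp g 2 μ) :
    ⟪hf.toLp, hg.toLp⟫ = (∫ z, (starRingEnd ℂ) (f z) * g z ∂μ).re := by
  have hi : Integrable (fun z => (starRingEnd ℂ) (f z) * g z) μ := by
    have := MemLp.integrable_mul (p := 2) (q := 2) hf.star hg
    exact this
  rw [L2.inner_def]
  refine Eq.trans ?_ (integral_re hi)
  refine integral_congr_ae ?_
  filter_upwards [hf.coeFn_toLp, hg.coeFn_toLp] with z h1 h2
  rw [h1, h2]
  simp [Complex.inner]
  ring

end Tensor

/-! ### The spectral transform and its comparison with the norm of `HP` -/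

section Hat

variable {d : ℕ}

/-- The spectral measure of the time-space domain `(0,∞) × ℝ^d`. -/
abbrev lam (d : ℕ) : Measure (ℝ × Sp d) := (volume.restrict (Ioi (0 : ℝ))).prod volume

/-- The spectral `L²` space of `n` variables. -/
abbrev SpecL2 (d n : ℕ) : Type := Lp ℂ 2 (Measure.pi fun _ : Fin n => lam d)

/-- The weight `e^s |ξ|^{-α/2}`. -/
def wt (α : ℝ) (z : ℝ × Sp d) : ℝ := Real.exp z.1 * ‖z.2‖ ^ (-(α / 2))

theorem wt_nonneg (α : ℝ) (z : ℝ × Sp d) : 0 ≤ wt α z := by unfold wt; positivity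

theorem measurable_wt (α : ℝ) : Measurable (wt (d := d) α) := by unfold wt; fun_prop

/-- The weighted Fourier transform in space of `1_{[0,t] × A}`. -/
def rectHat (α : ℝ) (R : Rect d) (z : ℝ × Sp d) : ℂ :=
  ((Iic R.time).indicator (fun s => (Real.exp s : ℂ)) z.1) *
    ((‖z.2‖ ^ (-(α / 2)) : ℝ) * indHat R.base z.2)

theorem memLp_timeHat (t : ℝ) :
    MemLp ((Iic t).indicator fun s => (Real.exp s : ℂ)) 2 (volume.restrict (Ioi (0 : ℝ))) := by
  have hc : Continuous fun s : ℝ => (Real.exp s : ℂ) :=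
    Complex.continuous_ofReal.comp Real.continuous_exp
  rw [memLp_indicator_iff_restrict measurableSet_Iic,
    Measure.restrict_restrict measurableSet_Iic, Iic_inter_Ioi]
  refine MemLp.of_bound hc.aestronglyMeasurable (Real.exp t)
    ((ae_restrict_iff' measurableSet_Ioc).2 (Eventually.of_forall fun s hs => ?_))
  rw [Complex.norm_real, Real.norm_of_nonneg (Real.exp_pos _).le]
  exact Real.exp_le_exp.2 hs.2

theorem indHat_mul_rpow {V : Type*} [NormedAddCommGroup V] [InnerProductSpace ℝ V]
    [MeasurableSpace V] [BorelSpace V] [FiniteDimensional ℝ V] {α : ℝ} {A B : Set V} {ξ : V} (hξ : ξ ≠ 0) :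
    ((‖ξ‖ ^ (-(α / 2)) : ℝ) * indHat A ξ) *
      (starRingEnd ℂ) ((‖ξ‖ ^ (-(α / 2)) : ℝ) * indHat B ξ) =
      indHat A ξ * (starRingEnd ℂ) (indHat B ξ) * (‖ξ‖ ^ (-α) : ℝ) := by
  have : ‖ξ‖ ^ (-α) = ‖ξ‖ ^ (-(α / 2)) * ‖ξ‖ ^ (-(α / 2)) := by
    rw [← Real.rpow_add (norm_pos_iff.2 hξ)]; congr 1; ring
  rw [this, map_mul, Complex.conj_ofReal]
  push_cast
  ring

theorem memLp_rpow_mul_indHat {V : Type*} [NormedAddCommGroup V] [InnerProductSpace ℝ V]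
    [MeasurableSpace V] [BorelSpace V] [FiniteDimensional ℝ V] {β : ℝ} (h0 : 0 < β)
    (hβ : β < Module.finrank ℝ V) {A : Set V} (hA : MeasurableSet A)
    (hb : Bornology.IsBounded A) :
    MemLp (fun ξ : V => ((‖ξ‖ ^ (-(β / 2)) : ℝ) * indHat A ξ : ℂ)) 2 volume := by
  have : Nontrivial V := Module.nontrivial_of_finrank_pos (R := ℝ) (by
    have : (0 : ℝ) < Module.finrank ℝ V := h0.trans hβ
    exact_mod_cast this)
  have hm : AEStronglyMeasurable (fun ξ : V => ((‖ξ‖ ^ (-(β / 2)) : ℝ) * indHat A ξ : ℂ))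
      volume := by
    refine AEStronglyMeasurable.mul (Measurable.aestronglyMeasurable ?_)
      (continuous_indHat hA hb).aestronglyMeasurable
    exact Complex.continuous_ofReal.measurable.comp (by fun_prop)
  refine (memLp_two_iff_integrable_sq_norm hm).2 ?_
  refine (integrable_indHat_mul_conj_mul_rpow hA hA hb hb h0 hβ).norm.congr ?_
  filter_upwards [Measure.ae_ne volume (0 : V)] with ξ hξ
  rw [← indHat_mul_rpow hξ, norm_mul, RCLike.norm_conj, sq]

theorem integral_conj_rpow_mul_indHat {V : Type*} [NormedAddCommGroup V] [InnerProductSpace ℝ V]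
    [MeasurableSpace V] [BorelSpace V] [FiniteDimensional ℝ V] {β : ℝ} (h0 : 0 < β)
    (hβ : β < Module.finrank ℝ V) {A B : Set V} (hA : MeasurableSet A) (hB : MeasurableSet B)
    (hbA : Bornology.IsBounded A) (hbB : Bornology.IsBounded B) :
    ∫ ξ : V, (starRingEnd ℂ) ((‖ξ‖ ^ (-(β / 2)) : ℝ) * indHat A ξ) *
      ((‖ξ‖ ^ (-(β / 2)) : ℝ) * indHat B ξ) =
      (spectralConst (Module.finrank ℝ V) β / Real.Gamma (β / 2) *
        ∫ x in A, ∫ y in B, ‖x - y‖ ^ (-((Module.finrank ℝ V : ℝ) - β)) : ℝ) := by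
  have : Nontrivial V := Module.nontrivial_of_finrank_pos (R := ℝ) (by
    have : (0 : ℝ) < Module.finrank ℝ V := h0.trans hβ
    exact_mod_cast this)
  have hG : Real.Gamma (β / 2) ≠ 0 := (Real.Gamma_pos_of_pos (by linarith)).ne'
  have h := riesz_spectral hA hB hbA hbB h0 hβ
  have e : ∫ ξ : V, (starRingEnd ℂ) ((‖ξ‖ ^ (-(β / 2)) : ℝ) * indHat A ξ) *
      ((‖ξ‖ ^ (-(β / 2)) : ℝ) * indHat B ξ) =
      (starRingEnd ℂ) (∫ ξ, indHat A ξ * (starRingEnd ℂ) (indHat B ξ) *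
        (‖ξ‖ ^ (-β) : ℝ)) := by
    rw [← integral_conj]
    refine integral_congr_ae ?_
    filter_upwards [Measure.ae_ne volume (0 : V)] with ξ hξ
    rw [← indHat_mul_rpow hξ]
    simp only [map_mul, Complex.conj_conj]
  have h3 : ∫ ξ, indHat A ξ * (starRingEnd ℂ) (indHat B ξ) * (‖ξ‖ ^ (-β) : ℝ) =
      (spectralConst (Module.finrank ℝ V) β / Real.Gamma (β / 2) *
        ∫ x in A, ∫ y in B, ‖x - y‖ ^ (-((Module.finrank ℝ V : ℝ) - β)) : ℝ) := by
    rw [div_mul_eq_mul_div, Complex.ofReal_div, h]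
    field_simp [Complex.ofReal_ne_zero.2 hG]
  rw [e, h3, Complex.conj_ofReal]

theorem finrank_Sp : Module.finrank ℝ (Sp d) = d := by simp

theorem nontrivial_Sp {α : ℝ} (h0 : 0 < α) (hd : α < d) : Nontrivial (Sp d) :=
  Module.nontrivial_of_finrank_pos (R := ℝ) (by
    rw [finrank_Sp]
    have : (0 : ℝ) < d := h0.trans hd
    exact_mod_cast this)

theorem memLp_spaceHat {α : ℝ} (h0 : 0 < α) (hd : α < d) {A : Set (Sp d)}
    (hA : MeasurableSet A) (hb : Bornology.IsBounded A) :
    MemLp (fun ξ : Sp d => ((‖ξ‖ ^ (-(α / 2)) : ℝ) * indHat A ξ : ℂ)) 2 volume :=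
  memLp_rpow_mul_indHat h0 (by rw [finrank_Sp]; exact hd) hA hb

theorem memLp_rectHat {α : ℝ} (h0 : 0 < α) (hd : α < d) (R : Rect d) :
    MemLp (rectHat α R) 2 (lam d) :=
  memLp_mul_prod (memLp_timeHat R.time) (memLp_spaceHat h0 hd R.measurable_base R.bounded_base)

/-- The inner product of two weighted transforms. -/
def hatInner (α : ℝ) (R R' : Rect d) : ℝ :=
  timeEnergy R.time R'.time * (spectralConst d α / Real.Gamma (α / 2) *
    ∫ x in R.base, ∫ y in R'.base, ‖x - y‖ ^ (-((d : ℝ) - α)))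

theorem integral_conj_timeHat (t s : ℝ) :
    ∫ r in Ioi (0 : ℝ), (starRingEnd ℂ) ((Iic t).indicator (fun s => (Real.exp s : ℂ)) r) *
      (Iic s).indicator (fun s => (Real.exp s : ℂ)) r = timeEnergy t s := by
  rw [timeEnergy, ← integral_complex_ofReal, ← Iic_inter_Ioi,
    ← Measure.restrict_restrict measurableSet_Iic, ← integral_indicator measurableSet_Iic]
  congr 1 with r
  by_cases hp1 : r ≤ t <;> by_cases hp2 : r ≤ s <;>
    simp [-Complex.ofReal_exp, indicator, hp1, hp2, sq]

theorem integral_conj_spaceHat {α : ℝ} (h0 : 0 < α) (hd : α < d) (R R' : Rect d) :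
    ∫ ξ : Sp d, (starRingEnd ℂ) ((‖ξ‖ ^ (-(α / 2)) : ℝ) * indHat R.base ξ) *
      ((‖ξ‖ ^ (-(α / 2)) : ℝ) * indHat R'.base ξ) =
      (spectralConst d α / Real.Gamma (α / 2) *
        ∫ x in R.base, ∫ y in R'.base, ‖x - y‖ ^ (-((d : ℝ) - α)) : ℝ) := by
  have h := integral_conj_rpow_mul_indHat h0 (by rw [finrank_Sp]; exact hd) R.measurable_base
    R'.measurable_base R.bounded_base R'.bounded_base
  rwa [finrank_Sp] at h

theorem integral_conj_rectHat {α : ℝ} (h0 : 0 < α) (hd : α < d) (R R' : Rect d) :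
    ∫ z, (starRingEnd ℂ) (rectHat α R z) * rectHat α R' z ∂(lam d) = hatInner α R R' := by
  rw [hatInner, Complex.ofReal_mul, ← integral_conj_timeHat, ← integral_conj_spaceHat h0 hd,
    ← integral_prod_mul]
  congr 1 with z
  simp only [rectHat, map_mul]
  ring

/-- The tensor products `1̂_{R_1} ⊗ ⋯ ⊗ 1̂_{R_n}` of weighted transforms. -/
def rectsHat (α : ℝ) {n : ℕ} (R : Fin n → Rect d) (z : Fin n → ℝ × Sp d) : ℂ :=
  ∏ i, rectHat α (R i) (z i)

theorem memLp_rectsHat {α : ℝ} (h0 : 0 < α) (hd : α < d) {n : ℕ} (R : Fin n → Rect d) :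
    MemLp (rectsHat α R) 2 (Measure.pi fun _ : Fin n => lam d) :=
  memLp_prod_pi fun i => memLp_rectHat h0 hd (R i)

theorem inner_rectsHat {α : ℝ} (h0 : 0 < α) (hd : α < d) {n : ℕ} (R R' : Fin n → Rect d) :
    ⟪(memLp_rectsHat h0 hd R).toLp, (memLp_rectsHat h0 hd R').toLp⟫ =
      tensorKer (hatInner α) n R R' := by
  rw [inner_toLp_complex]
  simp only [rectsHat, map_prod, ← Finset.prod_mul_distrib]
  rw [integral_fintype_prod_eq_prod (𝕜 := ℂ)
    (fun i z => (starRingEnd ℂ) (rectHat α (R i) z) * rectHat α (R' i) z)]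
  simp only [integral_conj_rectHat h0 hd, tensorKer, ← Complex.ofReal_prod, Complex.ofReal_re]

/-- The spectral transform of elementary functions. -/
def hatL {α : ℝ} (h0 : 0 < α) (hd : α < d) (n : ℕ) : Elem d n →ₗ[ℝ] SpecL2 d n :=
  Finsupp.linearCombination ℝ fun R => (memLp_rectsHat h0 hd R).toLp

theorem norm_hatL_sq {α : ℝ} (h0 : 0 < α) (hd : α < d) (n : ℕ) (e : Elem d n) :
    ‖hatL h0 hd n e‖ ^ 2 = quadForm (tensorKer (hatInner α) n) e := by
  rw [hatL, ← quadForm_inner]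
  simp only [inner_rectsHat h0 hd]

theorem posSemidef_spaceEnergy {α : ℝ} (h0 : 0 < α) (hd : α < d) :
    (Matrix.of fun R R' : Rect d => spectralConst d α / Real.Gamma (α / 2) *
      ∫ x in R.base, ∫ y in R'.base, ‖x - y‖ ^ (-((d : ℝ) - α))).PosSemidef := by
  have h := posSemidef_inner fun R : Rect d =>
    (memLp_spaceHat h0 hd R.measurable_base R.bounded_base).toLp
  simpa only [inner_toLp_complex, integral_conj_spaceHat h0 hd, Complex.ofReal_re] using h

theorem posSemidef_timeEnergy : (Matrix.of fun t s : ℝ => timeEnergy t s).PosSemidef := by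
  have h := posSemidef_inner fun t : ℝ => (memLp_timeHat t).toLp
  simpa only [inner_toLp_complex, integral_conj_timeHat, Complex.ofReal_re] using h

theorem posSemidef_hatInner {α : ℝ} (h0 : 0 < α) (hd : α < d) :
    (Matrix.of (hatInner (d := d) α)).PosSemidef :=
  posSemidef_mul (posSemidef_comap posSemidef_timeEnergy fun R : Rect d => R.time)
    (posSemidef_spaceEnergy h0 hd)

theorem rieszConst_pos {α : ℝ} (h0 : 0 < α) (hd : α < d) : 0 < rieszConst d α := by
  have h1 := Real.Gamma_pos_of_pos (show 0 < ((d : ℝ) - α) / 2 by linarith)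
  have h2 := Real.Gamma_pos_of_pos (show 0 < α / 2 by linarith)
  rw [rieszConst]
  positivity

/-- Both inner products factor into a time part and the same space part up to a constant, so the
time comparison is multiplied by the positive semidefinite space energy. -/
theorem exists_posSemidef_sub {H α : ℝ} (h0 : 0 < α) (hd : α < d) (h1 : 1 / 2 < H) (h2 : H < 1) :
    ∃ C : ℝ, 0 ≤ C ∧
      (Matrix.of fun R R' : Rect d => C * hatInner α R R' - rectInner H α R R').PosSemidef := by
  obtain ⟨C, hC, h⟩ := exists_time_bound h1 h2
  have hr := rieszConst_pos h0 hd
  have hs := spectralConst_pos hd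
  have hG := Real.Gamma_pos_of_pos (show 0 < α / 2 by linarith)
  -- Ratio between the normalization of the Riesz kernel and the constant produced by subordination.
  set k : ℝ := rieszConst d α / (spectralConst d α / Real.Gamma (α / 2)) with hk
  refine ⟨k * C, by positivity, ?_⟩
  have h3 := posSemidef_const_mul (c := k) (by positivity) (posSemidef_mul
    (posSemidef_comap h fun R : Rect d => (⟨R.time, R.time_nonneg⟩ : {t : ℝ // 0 ≤ t}))
    (posSemidef_spaceEnergy h0 hd))
  convert! h3 using 2
  ext R R'
  simp only [hatInner, rectInner, rieszKernel, integral_const_mul, hk]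
  field_simp

/-- The norm of an elementary function is controlled by that of its spectral transform. -/
theorem exists_normSq_le {Ω : Type*} [MeasurableSpace Ω] {P : Measure Ω} [IsProbabilityMeasure P]
    {H α : ℝ} {W : Rect d → Ω → ℝ} (hW : IsNoise H α W P) (h0 : 0 < α) (hd : α < d)
    (h1 : 1 / 2 < H) (h2 : H < 1) :
    ∃ C : ℝ, 0 ≤ C ∧ ∀ (n : ℕ) (e : Elem d n),
      e.normSq H α ≤ C ^ n * ‖hatL h0 hd n e‖ ^ 2 := by
  obtain ⟨C, hC, h⟩ := exists_posSemidef_sub h0 hd h1 h2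
  refine ⟨C, hC, fun n e => ?_⟩
  rw [norm_hatL_sq]
  exact quadForm_tensorKer_le hC (posSemidef_rectInner hW) (posSemidef_hatInner h0 hd) h n e

end Hat

/-! ### Action of `HP` on test functions -/

section Action

variable {d : ℕ}

/-- The transform of `1_{[0,t]}`, normalized for the time covariance. -/
def timeSpec (H t : ℝ) (τ : ℝ) : ℂ := (‖τ‖ ^ (-((2 * H - 1) / 2)) : ℝ) * indHat (Icc 0 t) τ

/-- The full spectral transform of `1_{[0,t] × A}`. -/
def rectSpec (H α : ℝ) (R : Rect d) (p : ℝ × Sp d) : ℂ :=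
  timeSpec H R.time p.1 * ((‖p.2‖ ^ (-(α / 2)) : ℝ) * indHat R.base p.2)

theorem memLp_rectSpec {H α : ℝ} (h0 : 0 < α) (hd : α < d) (h1 : 1 / 2 < H) (h2 : H < 1)
    (R : Rect d) : MemLp (rectSpec H α R) 2 (volume.prod volume) :=
  memLp_mul_prod (memLp_rpow_mul_indHat (by linarith) (by simp; linarith) measurableSet_Icc
    (Metric.isBounded_Icc 0 R.time)) (memLp_spaceHat h0 hd R.measurable_base R.bounded_base)

/-- The constant of `rectInner_eq_inner`. -/
def actionConst (d : ℕ) (H α : ℝ) : ℝ :=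
  (H * (2 * H - 1)) / (spectralConst 1 (2 * H - 1) / Real.Gamma ((2 * H - 1) / 2)) *
    (rieszConst d α / (spectralConst d α / Real.Gamma (α / 2)))

theorem actionConst_pos {H α : ℝ} (h0 : 0 < α) (hd : α < d) (h1 : 1 / 2 < H) (h2 : H < 1) :
    0 < actionConst d H α := by
  have hr := rieszConst_pos h0 hd
  have hs := spectralConst_pos hd
  have ht := spectralConst_pos (D := 1) (β := 2 * H - 1) (by norm_num; linarith)
  have hG := Real.Gamma_pos_of_pos (show 0 < α / 2 by linarith)
  have hG' := Real.Gamma_pos_of_pos (show 0 < (2 * H - 1) / 2 by linarith)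
  have hH : 0 < H * (2 * H - 1) := mul_pos (by linarith) (by linarith)
  rw [actionConst]
  positivity

/-- The comparison with `hatInner` bounds the norm of `HP` only from above, whereas continuity of an
action needs a lower bound for it. Here time is Fourier-transformed as well: `|r-r'|^{2H-2}` is a
Riesz kernel on the line, of order `2H - 1`, and the representation becomes an exact isometry up to
a constant. -/
theorem rectInner_eq_inner {H α : ℝ} (h0 : 0 < α) (hd : α < d) (h1 : 1 / 2 < H) (h2 : H < 1)
    (R R' : Rect d) : rectInner H α R R' = actionConst d H α *
      ⟪(memLp_rectSpec h0 hd h1 h2 R).toLp, (memLp_rectSpec h0 hd h1 h2 R').toLp⟫ := by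
  have hr := rieszConst_pos h0 hd
  have hs := spectralConst_pos hd
  have ht := spectralConst_pos (D := 1) (β := 2 * H - 1) (by norm_num; linarith)
  have hG := Real.Gamma_pos_of_pos (show 0 < α / 2 by linarith)
  have hG' := Real.Gamma_pos_of_pos (show 0 < (2 * H - 1) / 2 by linarith)
  have hH : 0 < H * (2 * H - 1) := mul_pos (by linarith) (by linarith)
  have e := integral_conj_rpow_mul_indHat (V := ℝ) (β := 2 * H - 1) (by linarith)
    (by simp; linarith) (measurableSet_Icc (a := 0) (b := R.time)) (measurableSet_Icc (b := R'.time))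
    (Metric.isBounded_Icc 0 _) (Metric.isBounded_Icc 0 _)
  have e' : ∫ z, (starRingEnd ℂ) (rectSpec H α R z) * rectSpec H α R' z ∂(volume.prod volume) =
      ((spectralConst 1 (2 * H - 1) / Real.Gamma ((2 * H - 1) / 2) *
        ∫ x in Icc 0 R.time, ∫ y in Icc 0 R'.time, ‖x - y‖ ^ (-((1 : ℝ) - (2 * H - 1)))) *
      (spectralConst d α / Real.Gamma (α / 2) *
        ∫ x in R.base, ∫ y in R'.base, ‖x - y‖ ^ (-((d : ℝ) - α))) : ℝ) := by
    rw [Module.finrank_self, Nat.cast_one] at e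
    rw [Complex.ofReal_mul, ← e, ← integral_conj_spaceHat h0 hd, ← integral_prod_mul]
    congr 1 with z
    simp only [rectSpec, timeSpec, map_mul]
    ring
  have e3 : fbmCov H R.time R'.time = H * (2 * H - 1) *
      ∫ x in Icc 0 R.time, ∫ y in Icc 0 R'.time, ‖x - y‖ ^ (-((1 : ℝ) - (2 * H - 1))) := by
    rw [fbmCov, intervalIntegral.integral_of_le R.time_nonneg]
    simp only [intervalIntegral.integral_of_le R'.time_nonneg, integral_Icc_eq_integral_Ioc,
      Real.norm_eq_abs]
    rw [show -((1 : ℝ) - (2 * H - 1)) = 2 * H - 2 by ring]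
  rw [inner_toLp_complex, e', Complex.ofReal_re, actionConst, rectInner, e3]
  simp only [rieszKernel, integral_const_mul]
  generalize spectralConst 1 (2 * H - 1) = a at *
  generalize Real.Gamma ((2 * H - 1) / 2) = b at *
  generalize (∫ x in Icc 0 R.time, ∫ y in Icc 0 R'.time, ‖x - y‖ ^ (-((1 : ℝ) - (2 * H - 1)))) = c
    at *
  field_simp

/-- The product of time and space with its Euclidean norm. -/
abbrev EST (d : ℕ) : Type := WithLp 2 (ℝ × Sp d)

theorem integral_EST {E : Type*} [NormedAddCommGroup E] [NormedSpace ℝ E] (g : EST d → E) :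
    ∫ v, g v = ∫ p : ℝ × Sp d, g (WithLp.toLp 2 p) :=
  ((WithLp.volume_preserving_toLp ℝ (Sp d)).integral_comp
    (MeasurableEquiv.toLp 2 (ℝ × Sp d)).measurableEmbedding g).symm

theorem integrable_EST {E : Type*} [NormedAddCommGroup E] {g : EST d → E} :
    Integrable (fun p : ℝ × Sp d => g (WithLp.toLp 2 p)) ↔ Integrable g :=
  (WithLp.volume_preserving_toLp ℝ (Sp d)).integrable_comp_emb
    (MeasurableEquiv.toLp 2 (ℝ × Sp d)).measurableEmbedding

theorem IsTest.hasCompactSupport_EST {φ : ℝ × Sp d → ℝ} (hφ : IsTest φ) :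
    HasCompactSupport fun v : EST d => (φ (WithLp.ofLp v) : ℂ) :=
  (hφ.2.comp_homeomorph (WithLp.prodContinuousLinearEquiv 2 ℝ ℝ (Sp d)).toHomeomorph).comp_left
    Complex.ofReal_zero

theorem IsTest.contDiff_EST {φ : ℝ × Sp d → ℝ} (hφ : IsTest φ) :
    ContDiff ℝ (⊤ : ℕ∞) fun v : EST d => (φ (WithLp.ofLp v) : ℂ) :=
  Complex.ofRealCLM.contDiff.comp
    (hφ.1.comp (WithLp.prodContinuousLinearEquiv 2 ℝ ℝ (Sp d)).contDiff)

/-- A test function as a Schwartz function. -/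
def IsTest.schwartz {φ : ℝ × Sp d → ℝ} (hφ : IsTest φ) : SchwartzMap (EST d) ℂ :=
  hφ.hasCompactSupport_EST.toSchwartzMap hφ.contDiff_EST

theorem fourier_indicator_EST (R : Rect d) (p : ℝ × Sp d) :
    𝓕 ((WithLp.ofLp ⁻¹' R.toSet).indicator fun _ : EST d => (1 : ℂ)) (WithLp.toLp 2 p) =
      (starRingEnd ℂ) (indHat (Icc 0 R.time) p.1 * indHat R.base p.2) := by
  rw [Real.fourier_eq', integral_EST, map_mul, conj_indHat measurableSet_Icc,
    conj_indHat R.measurable_base, indHat_eq measurableSet_Icc, indHat_eq R.measurable_base,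
    ← integral_prod_mul, Measure.prod_restrict,
    ← integral_indicator (measurableSet_Icc.prod R.measurable_base)]
  congr 1 with q
  by_cases hq : q ∈ Icc 0 R.time ×ˢ R.base
  · rw [indicator_of_mem (show (WithLp.toLp 2 q : EST d) ∈ WithLp.ofLp ⁻¹' R.toSet from hq),
      indicator_of_mem hq, ← Complex.exp_add, smul_eq_mul, mul_one, WithLp.prod_inner_apply]
    congr 1
    simp only [inner_neg_right]
    push_cast
    ring
  · rw [indicator_of_notMem (show (WithLp.toLp 2 q : EST d) ∉ WithLp.ofLp ⁻¹' R.toSet from hq),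
      indicator_of_notMem hq, smul_zero]

theorem Rect.measurableSet_toSet (R : Rect d) : MeasurableSet R.toSet :=
  measurableSet_Icc.prod R.measurable_base

theorem Rect.volume_toSet_lt_top (R : Rect d) : volume R.toSet < ⊤ :=
  ((Metric.isBounded_Icc 0 R.time).prod R.bounded_base).measure_lt_top

theorem integral_test_eq {φ : ℝ × Sp d → ℝ} (hφ : IsTest φ) (R : Rect d) :
    ((∫ z in R.toSet, φ z : ℝ) : ℂ) =
      ∫ p : ℝ × Sp d, (starRingEnd ℂ) (indHat (Icc 0 R.time) p.1 * indHat R.base p.2) *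
        (𝓕⁻ hφ.schwartz) (WithLp.toLp 2 p) := by
  have hm : MeasurableSet (WithLp.ofLp ⁻¹' R.toSet : Set (EST d)) :=
    (MeasurableEquiv.toLp 2 (ℝ × Sp d)).symm.measurable R.measurableSet_toSet
  have hI : Integrable ((WithLp.ofLp ⁻¹' R.toSet).indicator fun _ : EST d => (1 : ℂ)) := by
    refine (integrable_indicator_iff hm).2 (integrableOn_const ?_)
    rw [(WithLp.volume_preserving_ofLp ℝ (Sp d)).measure_preimage
      R.measurableSet_toSet.nullMeasurableSet]
    exact R.volume_toSet_lt_top.ne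
  have h := VectorFourier.integral_fourierIntegral_smul_eq_flip (L := innerₗ (EST d))
    Real.continuous_fourierChar continuous_inner (μ := volume) (ν := volume)
    (𝓕⁻ hφ.schwartz).integrable hI
  have e1 : VectorFourier.fourierIntegral Real.fourierChar volume (innerₗ (EST d))
      (⇑(𝓕⁻ hφ.schwartz : SchwartzMap (EST d) ℂ)) = fun v => (φ (WithLp.ofLp v) : ℂ) := by
    have : (𝓕 (𝓕⁻ hφ.schwartz : SchwartzMap (EST d) ℂ) : SchwartzMap (EST d) ℂ) = hφ.schwartz :=
      FourierTransform.fourier_fourierInv_eq _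
    have h2 : (⇑(𝓕 (𝓕⁻ hφ.schwartz : SchwartzMap (EST d) ℂ) : SchwartzMap (EST d) ℂ)) = fun v => (φ (WithLp.ofLp v) : ℂ) := by
      rw [this]; rfl
    rw [SchwartzMap.fourier_coe] at h2
    exact h2
  have e2 : VectorFourier.fourierIntegral Real.fourierChar volume (innerₗ (EST d)).flip
      ((WithLp.ofLp ⁻¹' R.toSet).indicator fun _ : EST d => (1 : ℂ)) =
      𝓕 ((WithLp.ofLp ⁻¹' R.toSet).indicator fun _ : EST d => (1 : ℂ)) := by
    rw [flip_innerₗ]; rfl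
  rw [e1, e2, integral_EST, integral_EST] at h
  simp only [fourier_indicator_EST, smul_eq_mul] at h
  rw [← integral_complex_ofReal, ← integral_indicator R.measurableSet_toSet]
  refine Eq.trans ?_ (h.trans ?_)
  · congr 1 with p
    by_cases hp : p ∈ R.toSet <;> simp [indicator, hp]
  · congr 1 with p
    ring

theorem memLp_weight_mul_schwartz (a b : ℝ) (ha : 0 ≤ a) (hb : 0 ≤ b)
    (f : SchwartzMap (EST d) ℂ) :
    MemLp (fun p : ℝ × Sp d => ((‖p.1‖ ^ a * ‖p.2‖ ^ b : ℝ) : ℂ) * f (WithLp.toLp 2 p)) 2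
      (volume.prod volume) := by
  have hc : Continuous fun p : ℝ × Sp d =>
      ((‖p.1‖ ^ a * ‖p.2‖ ^ b : ℝ) : ℂ) * f (WithLp.toLp 2 p) := by
    refine (Complex.continuous_ofReal.comp ?_).mul (f.continuous.comp
      (WithLp.prodContinuousLinearEquiv 2 ℝ ℝ (Sp d)).symm.continuous)
    exact (continuous_fst.norm.rpow_const fun _ => Or.inr ha).mul
      (continuous_snd.norm.rpow_const fun _ => Or.inr hb)
  refine (memLp_two_iff_integrable_sq_norm hc.aestronglyMeasurable).2 ?_
  obtain ⟨k, hk⟩ := exists_nat_ge (2 * (a + b))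
  obtain ⟨C, hC0, hC⟩ := f.decay 0 0
  have hint : Integrable fun v : EST d => C * (‖f v‖ + ‖v‖ ^ k * ‖f v‖) :=
    (f.integrable.norm.add (f.integrable_pow_mul volume k)).const_mul C
  refine (integrable_EST.2 hint).mono' (hc.norm.pow 2).aestronglyMeasurable
    (Eventually.of_forall fun p => ?_)
  have hf : ‖f (WithLp.toLp 2 p)‖ ≤ C := by simpa using hC (WithLp.toLp 2 p)
  set v : EST d := WithLp.toLp 2 p with hv
  have n1 : ‖p.1‖ ≤ ‖v‖ := WithLp.norm_fst_le (x := v)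
  have n2 : ‖p.2‖ ≤ ‖v‖ := WithLp.norm_snd_le (x := v)
  have key : (‖p.1‖ ^ a * ‖p.2‖ ^ b) ^ 2 ≤ 1 + ‖v‖ ^ k := by
    have h1 : ‖p.1‖ ^ a * ‖p.2‖ ^ b ≤ ‖v‖ ^ (a + b) := by
      rw [Real.rpow_add_of_nonneg (norm_nonneg _) ha hb]
      gcongr
    have h2 : (‖p.1‖ ^ a * ‖p.2‖ ^ b) ^ 2 ≤ ‖v‖ ^ (2 * (a + b)) := by
      have : ‖v‖ ^ (2 * (a + b)) = (‖v‖ ^ (a + b)) ^ 2 := by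
        rw [← Real.rpow_natCast, ← Real.rpow_mul (norm_nonneg _)]; congr 1; push_cast; ring
      rw [this]
      gcongr
    refine h2.trans ?_
    rcases le_total ‖v‖ 1 with hv1 | hv1
    · have : ‖v‖ ^ (2 * (a + b)) ≤ 1 := Real.rpow_le_one (norm_nonneg _) hv1 (by positivity)
      have : 0 ≤ ‖v‖ ^ k := by positivity
      linarith
    · have : ‖v‖ ^ (2 * (a + b)) ≤ ‖v‖ ^ (k : ℝ) := Real.rpow_le_rpow_of_exponent_le hv1 hk
      rw [Real.rpow_natCast] at this
      linarith
  rw [Real.norm_of_nonneg (by positivity), norm_mul, mul_pow, Complex.norm_real,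
    Real.norm_of_nonneg (by positivity)]
  calc (‖p.1‖ ^ a * ‖p.2‖ ^ b) ^ 2 * ‖f v‖ ^ 2 ≤ (1 + ‖v‖ ^ k) * (C * ‖f v‖) := by
        rw [sq ‖f v‖]
        gcongr
    _ = C * (‖f v‖ + ‖v‖ ^ k * ‖f v‖) := by ring

/-- The vector representing the action of a test function. -/
def testSpec (H α : ℝ) {φ : ℝ × Sp d → ℝ} (hφ : IsTest φ) (p : ℝ × Sp d) : ℂ :=
  ((‖p.1‖ ^ ((2 * H - 1) / 2) * ‖p.2‖ ^ (α / 2) : ℝ) : ℂ) *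
    (𝓕⁻ hφ.schwartz) (WithLp.toLp 2 p)

theorem memLp_testSpec {H α : ℝ} (h0 : 0 < α) (h1 : 1 / 2 < H) {φ : ℝ × Sp d → ℝ}
    (hφ : IsTest φ) : MemLp (testSpec H α hφ) 2 (volume.prod volume) :=
  memLp_weight_mul_schwartz _ _ (by linarith) (by linarith) _

/-- Parseval's identity; the positive powers of the frequencies in `testSpec` cancel the negative
ones in `rectSpec` off the null sets where a frequency vanishes. -/
theorem integral_test_eq_inner {H α : ℝ} (h0 : 0 < α) (hd : α < d) (h1 : 1 / 2 < H) (h2 : H < 1)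
    {φ : ℝ × Sp d → ℝ} (hφ : IsTest φ) (R : Rect d) :
    ∫ z in R.toSet, φ z =
      ⟪(memLp_rectSpec h0 hd h1 h2 R).toLp, (memLp_testSpec h0 h1 hφ).toLp⟫ := by
  have := nontrivial_Sp h0 hd
  rw [inner_toLp_complex, ← Complex.ofReal_re (∫ z in R.toSet, φ z), integral_test_eq hφ]
  congr 1
  refine integral_congr_ae ?_
  have hae1 : ∀ᵐ p : ℝ × Sp d ∂(volume.prod volume), p.1 ≠ 0 :=
    Measure.quasiMeasurePreserving_fst.ae (Measure.ae_ne volume (0 : ℝ))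
  have hae2 : ∀ᵐ p : ℝ × Sp d ∂(volume.prod volume), p.2 ≠ 0 :=
    Measure.quasiMeasurePreserving_snd.ae (Measure.ae_ne volume (0 : Sp d))
  filter_upwards [hae1, hae2] with p hp1 hp2
  have e1 : ‖p.1‖ ^ (-((2 * H - 1) / 2)) * ‖p.1‖ ^ ((2 * H - 1) / 2) = 1 := by
    rw [← Real.rpow_add (norm_pos_iff.2 hp1), neg_add_cancel, Real.rpow_zero]
  have e2 : ‖p.2‖ ^ (-(α / 2)) * ‖p.2‖ ^ (α / 2) = 1 := by
    rw [← Real.rpow_add (norm_pos_iff.2 hp2), neg_add_cancel, Real.rpow_zero]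
  simp only [rectSpec, timeSpec, testSpec, map_mul, Complex.conj_ofReal]
  have e3 : (((‖p.1‖ ^ (-((2 * H - 1) / 2)) * ‖p.1‖ ^ ((2 * H - 1) / 2)) *
      (‖p.2‖ ^ (-(α / 2)) * ‖p.2‖ ^ (α / 2)) : ℝ) : ℂ) = 1 := by rw [e1, e2]; simp
  push_cast at e3 ⊢
  linear_combination (-(starRingEnd ℂ) (indHat (Icc 0 R.time) p.1) *
    (starRingEnd ℂ) (indHat R.base p.2) * (𝓕⁻ hφ.schwartz) (WithLp.toLp 2 p)) * e3

variable {Ω : Type*} [MeasurableSpace Ω] {P : Measure Ω} [IsProbabilityMeasure P]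
  {H α : ℝ} {W : Rect d → Ω → ℝ}

/-- The elements of `HP` act on test functions. -/
theorem exists_isAction (hW : IsNoise H α W P) (h0 : 0 < α) (hd : α < d) (h1 : 1 / 2 < H)
    (h2 : H < 1) {φ : ℝ × Sp d → ℝ} (hφ : IsTest φ) :
    ∃ L : HP W P →L[ℝ] ℝ, IsAction W P φ L := by
  set e : (Rect d →₀ ℝ) →ₗ[ℝ] HP W P := Finsupp.linearCombination ℝ (noiseVec hW) with he
  set f : (Rect d →₀ ℝ) →ₗ[ℝ] ℝ :=
    Finsupp.linearCombination ℝ fun R => ∫ z in R.toSet, φ z with hf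
  set u : Rect d → Lp ℂ 2 (volume.prod volume) := fun R => (memLp_rectSpec h0 hd h1 h2 R).toLp
    with hu
  set ψ := (memLp_testSpec (α := α) (H := H) h0 h1 hφ).toLp with hψ
  have hc := actionConst_pos h0 hd h1 h2
  have e1 : ∀ x, ‖e x‖ ^ 2 = actionConst d H α * ‖Finsupp.linearCombination ℝ u x‖ ^ 2 := by
    intro x
    rw [he, ← quadForm_inner, ← quadForm_inner, ← quadForm_const_mul]
    congr 1
    ext R R'
    rw [inner_noiseVec, rectInner_eq_inner h0 hd h1 h2]
  have e2 : ∀ x, f x = ⟪Finsupp.linearCombination ℝ u x, ψ⟫ := by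
    intro x
    simp only [hf, Finsupp.linearCombination_apply, Finsupp.sum, sum_inner,
      real_inner_smul_left, integral_test_eq_inner h0 hd h1 h2 hφ, smul_eq_mul]
    rfl
  have : CompleteSpace (HP W P) :=
    (Submodule.isClosed_topologicalClosure _).completeSpace_coe
  -- The bound is Cauchy-Schwarz against the vector `ψ`; the square root converts the norm of `HP`
  -- into the spectral one.
  obtain ⟨L, _, hL⟩ := exists_continuousLinearMap_extension e f
    (C := ‖ψ‖ / Real.sqrt (actionConst d H α)) (by positivity) (fun x => by
      rw [e2]
      refine (norm_inner_le_norm _ _).trans_eq ?_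
      have : ‖e x‖ = Real.sqrt (actionConst d H α) * ‖Finsupp.linearCombination ℝ u x‖ := by
        rw [← Real.sqrt_sq (norm_nonneg (e x)), e1, Real.sqrt_mul hc.le,
          Real.sqrt_sq (norm_nonneg _)]
      rw [this]
      have := Real.sqrt_pos.2 hc
      field_simp)
  refine ⟨L, fun h R hR => ?_⟩
  have h3 := hL (Finsupp.single R 1)
  rw [he, hf, Finsupp.linearCombination_single, Finsupp.linearCombination_single, one_smul,
    one_smul] at h3
  rw [eq_noiseVec hW R h hR, h3]

end Action

/-! ### Partial integration in `L²` and total families -/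

section CauchySchwarz

variable {X Y : Type*} [MeasurableSpace X] [MeasurableSpace Y]

theorem integrable_mul_of_memLp {μ : Measure X} {f g : X → ℂ} (hf : MemLp f 2 μ)
    (hg : MemLp g 2 μ) : Integrable (fun x => f x * g x) μ :=
  MemLp.integrable_mul (p := 2) (q := 2) hf hg

theorem norm_integral_mul_sq_le {μ : Measure X} {f g : X → ℂ} (hf : MemLp f 2 μ)
    (hg : MemLp g 2 μ) :
    ‖∫ x, f x * g x ∂μ‖ ^ 2 ≤ (∫ x, ‖f x‖ ^ 2 ∂μ) * ∫ x, ‖g x‖ ^ 2 ∂μ := by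
  have h := integral_mul_norm_le_Lp_mul_Lq (μ := μ) (f := f) (g := g)
    Real.HolderConjugate.two_two (by simpa using hf) (by simpa using hg)
  have h1 : ‖∫ x, f x * g x ∂μ‖ ≤ ∫ x, ‖f x‖ * ‖g x‖ ∂μ := by
    refine (norm_integral_le_integral_norm _).trans_eq ?_
    simp only [norm_mul]
  simp only [Real.rpow_two, ← Real.sqrt_eq_rpow] at h
  calc ‖∫ x, f x * g x ∂μ‖ ^ 2 ≤ (√(∫ x, ‖f x‖ ^ 2 ∂μ) * √(∫ x, ‖g x‖ ^ 2 ∂μ)) ^ 2 := by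
        gcongr
        exact h1.trans h
    _ = _ := by
        rw [mul_pow, Real.sq_sqrt (integral_nonneg fun _ => by positivity),
          Real.sq_sqrt (integral_nonneg fun _ => by positivity)]

variable {μ : Measure X} {ν : Measure Y} [SigmaFinite μ] [SigmaFinite ν]

theorem ae_memLp_slice {h : X × Y → ℂ} (hh : MemLp h 2 (μ.prod ν)) :
    ∀ᵐ x ∂μ, MemLp (fun y => h (x, y)) 2 ν := by
  filter_upwards [hh.1.prodMk_left,
    ((memLp_two_iff_integrable_sq_norm hh.1).1 hh).prod_right_ae] with x h1 h2
  exact (memLp_two_iff_integrable_sq_norm h1).2 h2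

theorem memLp_contract {h : X × Y → ℂ} {g : Y → ℂ} (hh : MemLp h 2 (μ.prod ν))
    (hg : MemLp g 2 ν) :
    MemLp (fun x => ∫ y, h (x, y) * g y ∂ν) 2 μ ∧
      ∫ x, ‖∫ y, h (x, y) * g y ∂ν‖ ^ 2 ∂μ ≤
        (∫ p, ‖h p‖ ^ 2 ∂(μ.prod ν)) * ∫ y, ‖g y‖ ^ 2 ∂ν := by
  have hm : AEStronglyMeasurable (fun x => ∫ y, h (x, y) * g y ∂ν) μ :=
    AEStronglyMeasurable.integral_prod_right' (f := fun p : X × Y => h p * g p.2)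
      (hh.1.mul hg.1.comp_snd)
  have hi := (memLp_two_iff_integrable_sq_norm hh.1).1 hh
  have hi' := hi.integral_prod_left.mul_const (∫ y, ‖g y‖ ^ 2 ∂ν)
  have hle : ∀ᵐ x ∂μ, ‖∫ y, h (x, y) * g y ∂ν‖ ^ 2 ≤
      (∫ y, ‖h (x, y)‖ ^ 2 ∂ν) * ∫ y, ‖g y‖ ^ 2 ∂ν := by
    filter_upwards [ae_memLp_slice hh] with x hx
    exact norm_integral_mul_sq_le hx hg
  have hint : Integrable (fun x => ‖∫ y, h (x, y) * g y ∂ν‖ ^ 2) μ :=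
    hi'.mono' (hm.norm.pow 2) (hle.mono fun x hx => by
      rwa [Real.norm_of_nonneg (by positivity)])
  refine ⟨(memLp_two_iff_integrable_sq_norm hm).2 hint, ?_⟩
  refine (integral_mono_ae hint hi' hle).trans_eq ?_
  rw [integral_mul_const, integral_prod _ hi]

/-- A family of functions is total when only `0` is orthogonal to all of them. -/
def IsTotal {ι : Type*} (f : ι → X → ℂ) (μ : Measure X) : Prop :=
  ∀ h : X → ℂ, MemLp h 2 μ → (∀ i, ∫ x, h x * f i x ∂μ = 0) → h =ᵐ[μ] 0

theorem ae_eq_zero_of_ae_slice {h : X × Y → ℂ} (hh : MemLp h 2 (μ.prod ν))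
    (h0 : ∀ᵐ x ∂μ, (fun y => h (x, y)) =ᵐ[ν] 0) : h =ᵐ[μ.prod ν] 0 := by
  have hi := (memLp_two_iff_integrable_sq_norm hh.1).1 hh
  have : ∫ p, ‖h p‖ ^ 2 ∂(μ.prod ν) = 0 := by
    rw [integral_prod _ hi]
    refine integral_eq_zero_of_ae ?_
    filter_upwards [h0] with x hx
    refine integral_eq_zero_of_ae ?_
    filter_upwards [hx] with y hy
    rw [hy]
    simp
  rw [integral_eq_zero_iff_of_nonneg (fun _ => by positivity) hi] at this
  filter_upwards [this] with p hp
  simpa using hp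

/-- Integrating `h` against `g j` in the second variable leaves a function orthogonal to every `f
i`, hence null. Countability of `κ` gives one null set for all `j`, outside of which the slice of
`h` is orthogonal to every `g j` and so vanishes. -/
theorem IsTotal.prod {ι κ : Type*} [Countable κ] {f : ι → X → ℂ} {g : κ → Y → ℂ}
    (hf : IsTotal f μ) (hg : IsTotal g ν) (hfm : ∀ i, MemLp (f i) 2 μ)
    (hgm : ∀ j, MemLp (g j) 2 ν) :
    IsTotal (fun (i : ι × κ) (p : X × Y) => f i.1 p.1 * g i.2 p.2) (μ.prod ν) := by
  intro h hh h0
  have h1 : ∀ j, (fun x => ∫ y, h (x, y) * g j y ∂ν) =ᵐ[μ] 0 := fun j => by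
    refine hf _ (memLp_contract hh (hgm j)).1 fun i => ?_
    rw [← h0 (i, j), integral_prod _
      (integrable_mul_of_memLp hh (memLp_mul_prod (hfm i) (hgm j)))]
    congr 1 with x
    rw [← integral_mul_const]
    congr 1 with y
    ring
  refine ae_eq_zero_of_ae_slice hh ?_
  filter_upwards [ae_all_iff.2 h1, ae_memLp_slice hh] with x hx hm
  exact hg _ hm hx

/-- Appending a last variable. -/
abbrev snocF {X : Type*} {n : ℕ} (z : Fin n → X) (w : X) : Fin (n + 1) → X :=
  Fin.snoc (α := fun _ => X) z w

/-- Splitting off the last variable. -/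
def snocEquiv (X : Type*) [MeasurableSpace X] (n : ℕ) : (Fin n → X) × X ≃ᵐ (Fin (n + 1) → X) :=
  MeasurableEquiv.prodComm.trans (MeasurableEquiv.piFinSuccAbove (fun _ => X) (Fin.last n)).symm

theorem snocEquiv_apply {n : ℕ} (p : (Fin n → X) × X) : snocEquiv X n p = snocF p.1 p.2 := by
  change (Fin.last n).insertNth (α := fun _ => X) p.2 p.1 = _
  rw [Fin.insertNth_last']

theorem measurePreserving_snoc (μ : Measure X) [SigmaFinite μ] (n : ℕ) :
    MeasurePreserving (snocEquiv X n) ((Measure.pi fun _ : Fin n => μ).prod μ)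
      (Measure.pi fun _ : Fin (n + 1) => μ) := by
  have h := (measurePreserving_piFinSuccAbove (fun _ : Fin (n + 1) => μ) (Fin.last n)).symm
  exact h.comp (Measure.measurePreserving_swap (μ := Measure.pi fun _ : Fin n => μ) (ν := μ))

theorem integral_snoc {E : Type*} [NormedAddCommGroup E] [NormedSpace ℝ E] (n : ℕ)
    (f : (Fin (n + 1) → X) → E) :
    ∫ z, f z ∂(Measure.pi fun _ : Fin (n + 1) => μ) =
      ∫ p : (Fin n → X) × X, f (snocF p.1 p.2) ∂((Measure.pi fun _ : Fin n => μ).prod μ) := by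
  rw [← (measurePreserving_snoc μ n).integral_comp (snocEquiv X n).measurableEmbedding]
  simp only [snocEquiv_apply]

theorem memLp_snoc {E : Type*} [NormedAddCommGroup E] {n : ℕ} {p : ℝ≥0∞}
    {f : (Fin (n + 1) → X) → E} :
    MemLp (fun q : (Fin n → X) × X => f (snocF q.1 q.2)) p
      ((Measure.pi fun _ : Fin n => μ).prod μ) ↔ MemLp f p (Measure.pi fun _ => μ) := by
  rw [← (measurePreserving_snoc μ n).map_eq,
    (snocEquiv X n).measurableEmbedding.memLp_map_measure_iff]
  simp only [Function.comp_def, snocEquiv_apply]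

theorem ae_snoc {n : ℕ} {p : (Fin (n + 1) → X) → Prop} :
    (∀ᵐ z ∂(Measure.pi fun _ => μ), p z) ↔
      ∀ᵐ q : (Fin n → X) × X ∂((Measure.pi fun _ : Fin n => μ).prod μ), p (snocF q.1 q.2) := by
  rw [← (measurePreserving_snoc μ n).map_eq, (snocEquiv X n).measurableEmbedding.ae_map_iff]
  simp only [snocEquiv_apply]

theorem prod_snocF {n : ℕ} (f : Fin (n + 1) → X → ℂ) (z : Fin n → X) (w : X) :
    ∏ i, f i (snocF z w i) = (∏ i : Fin n, f i.castSucc (z i)) * f (Fin.last n) w := by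
  rw [Fin.prod_univ_castSucc]
  simp

theorem IsTotal.pi {ι : Type*} [Countable ι] {f : ι → X → ℂ} (hf : IsTotal f μ)
    (hfm : ∀ i, MemLp (f i) 2 μ) (n : ℕ) :
    IsTotal (fun (R : Fin n → ι) (z : Fin n → X) => ∏ i, f (R i) (z i))
      (Measure.pi fun _ => μ) := by
  induction n with
  | zero =>
    intro h hh h0
    have := h0 Fin.elim0
    simp only [Finset.univ_eq_empty, Finset.prod_empty, mul_one] at this
    rw [Measure.pi_of_empty, integral_dirac] at this
    rw [Measure.pi_of_empty]
    rw [EventuallyEq, ae_dirac_eq]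
    exact this
  | succ n ih =>
    intro h hh h0
    have := (ih.prod hf (fun R => memLp_prod_pi fun i => hfm (R i)) hfm)
      (fun q => h (snocF q.1 q.2)) (memLp_snoc.2 hh) (fun i => by
        have := h0 (snocF i.1 i.2)
        rw [integral_snoc] at this
        rw [← this]
        congr 1 with p
        have e := prod_snocF (fun j => f (snocF i.1 i.2 j)) p.1 p.2
        simp only [e]
        simp)
    exact ae_snoc.2 this

end CauchySchwarz

/-! ### Density of the transforms of elementary functions -/

section Total

/-- The rational half-lines form a π-system generating the Borel sets. The total integral, obtained
as a limit along integers, is needed for stability under complements. -/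
theorem ae_eq_zero_of_forall_setIntegral_Iic {μ : Measure ℝ} {F : ℝ → ℂ} (hF : Integrable F μ)
    (h : ∀ q : ℚ, ∫ s in Iic (q : ℝ), F s ∂μ = 0) : F =ᵐ[μ] 0 := by
  have htot : ∫ s, F s ∂μ = 0 := by
    have h1 : Tendsto (fun n : ℕ => ∫ s in Iic ((n : ℚ) : ℝ), F s ∂μ) atTop (𝓝 (∫ s, F s ∂μ)) := by
      have := tendsto_setIntegral_of_monotone (μ := μ) (f := F)
        (s := fun n : ℕ => Iic ((n : ℚ) : ℝ)) (fun _ => measurableSet_Iic)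
        (fun a b hab => Iic_subset_Iic.2 (by exact_mod_cast hab)) hF.integrableOn
      rw [show (⋃ n : ℕ, Iic ((n : ℚ) : ℝ)) = univ by
        refine eq_univ_of_forall fun x => mem_iUnion.2 ?_
        obtain ⟨n, hn⟩ := exists_nat_ge x
        exact ⟨n, by simpa using hn⟩, setIntegral_univ] at this
      exact this
    simp only [h] at h1
    exact tendsto_nhds_unique h1 tendsto_const_nhds |>.symm ▸ rfl
  refine hF.ae_eq_zero_of_forall_setIntegral_eq_zero fun s hs _ => ?_
  refine MeasurableSpace.induction_on_inter (C := fun s _ => ∫ x in s, F x ∂μ = 0)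
    (BorelSpace.measurable_eq.trans Real.borel_eq_generateFrom_Iic_rat) Real.isPiSystem_Iic_rat
    (by simp) ?_ ?_ ?_ s hs
  · intro t ht
    obtain ⟨q, rfl⟩ := by simpa using ht
    exact h q
  · intro t ht h1
    have := integral_add_compl ht hF
    rw [h1, htot, zero_add] at this
    exact this
  · intro f hd hm h1
    rw [integral_iUnion hm hd hF.integrableOn]
    simp [h1]

/-- The exponentially weighted indicator functions of rational times. -/
theorem isTotal_time : IsTotal (fun (q : ℚ) => (Iic (max (q : ℝ) 0)).indicator
    fun s => (Real.exp s : ℂ)) (volume.restrict (Ioi (0 : ℝ))) := by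
  intro h hh h0
  have hI : ∀ q : ℚ, IntegrableOn (fun s => h s * (Real.exp s : ℂ)) (Iic (max (q : ℝ) 0))
      (volume.restrict (Ioi (0 : ℝ))) := fun q => by
    have := integrable_mul_of_memLp hh (memLp_timeHat (max (q : ℝ) 0))
    rw [← integrable_indicator_iff measurableSet_Iic]
    refine this.congr (Eventually.of_forall fun s => ?_)
    by_cases hs : s ∈ Iic (max (q : ℝ) 0) <;>
      simp only [indicator_of_mem, indicator_of_notMem, hs, not_false_eq_true, mul_zero]
  have hS : ∀ q : ℚ, ∫ s in Iic (max (q : ℝ) 0), h s * (Real.exp s : ℂ)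
      ∂(volume.restrict (Ioi (0 : ℝ))) = 0 := fun q => by
    rw [← h0 q, ← integral_indicator measurableSet_Iic]
    congr 1 with s
    by_cases hs : s ∈ Iic (max (q : ℝ) 0) <;>
      simp only [indicator_of_mem, indicator_of_notMem, hs, not_false_eq_true, mul_zero]
  -- The product `h(s) e^s` is known to be integrable only on bounded intervals, so the half-line
  -- criterion is applied after truncation at each integer `n`.
  have key : ∀ n : ℕ, ∀ᵐ s : ℝ ∂(volume.restrict (Ioi (0 : ℝ))), s ≤ n → h s = 0 := fun n => by
    have hn : (max ((n : ℚ) : ℝ) 0) = n := by simp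
    have hi := hI n
    rw [hn] at hi
    have := ae_eq_zero_of_forall_setIntegral_Iic hi fun q => by
      rw [Measure.restrict_restrict measurableSet_Iic, Iic_inter_Iic]
      have e : (volume.restrict (Ioi (0 : ℝ))).restrict (Iic (min (q : ℝ) n)) =
          (volume.restrict (Ioi (0 : ℝ))).restrict (Iic (max ((min q n : ℚ) : ℝ) 0)) := by
        rw [Measure.restrict_restrict measurableSet_Iic, Measure.restrict_restrict measurableSet_Iic]
        congr 1
        ext x
        simp only [mem_inter_iff, mem_Iic, mem_Ioi, Rat.cast_min, Rat.cast_natCast]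
        constructor
        · exact fun hx => ⟨hx.1.trans (le_max_left _ _), hx.2⟩
        · intro hx
          refine ⟨?_, hx.2⟩
          rcases le_max_iff.1 hx.1 with h1 | h1
          · exact h1
          · exact absurd hx.2 (not_lt.2 h1)
      rw [e]
      exact hS _
    filter_upwards [(ae_restrict_iff' measurableSet_Iic).1 this] with s hs (hsn : s ≤ n)
    have h2 := hs hsn
    simpa [-Complex.ofReal_exp, (Real.exp_pos s).ne'] using h2
  filter_upwards [ae_all_iff.2 key] with s hs
  obtain ⟨n, hn⟩ := exists_nat_ge s
  exact hs n hn

variable {V : Type*} [NormedAddCommGroup V] [InnerProductSpace ℝ V] [MeasurableSpace V]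
  [BorelSpace V] [FiniteDimensional ℝ V]

/-- Injectivity by duality: a smooth compactly supported `g` is the transform of a Schwartz
function, so moving the transform across the pairing shows that `f` annihilates every such `g`. -/
theorem ae_eq_zero_of_fourierInv_eq_zero {f : V → ℂ} (hf : Integrable f) (h : 𝓕⁻ f = 0) :
    f =ᵐ[volume] 0 := by
  have hF : 𝓕 f = 0 := by
    ext x
    have := congrFun h (-x)
    rwa [Real.fourierInv_eq_fourier_neg, neg_neg] at this
  refine ae_eq_zero_of_integral_contDiff_smul_eq_zero hf.locallyIntegrable fun g hg hgc => ?_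
  have hc : HasCompactSupport fun x => (g x : ℂ) := hgc.comp_left Complex.ofReal_zero
  have hd : ContDiff ℝ (⊤ : ℕ∞) fun x => (g x : ℂ) := Complex.ofRealCLM.contDiff.comp hg
  set ψ : SchwartzMap V ℂ := hc.toSchwartzMap hd with hψ
  have e0 : (𝓕 (𝓕⁻ ψ : SchwartzMap V ℂ) : SchwartzMap V ℂ) = ψ :=
    FourierTransform.fourier_fourierInv_eq _
  have e1 : VectorFourier.fourierIntegral Real.fourierChar volume (innerₗ V)
      (⇑(𝓕⁻ ψ : SchwartzMap V ℂ)) = fun v => (g v : ℂ) := by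
    have h2 : (⇑(𝓕 (𝓕⁻ ψ : SchwartzMap V ℂ) : SchwartzMap V ℂ)) = fun v => (g v : ℂ) := by
      rw [e0]; rfl
    rw [SchwartzMap.fourier_coe] at h2
    exact h2
  have e2 : VectorFourier.fourierIntegral Real.fourierChar volume (innerₗ V).flip f = 0 := by
    rw [flip_innerₗ]; exact hF
  have h3 := VectorFourier.integral_fourierIntegral_smul_eq_flip (L := innerₗ V)
    Real.continuous_fourierChar continuous_inner (μ := volume) (ν := volume)
    (𝓕⁻ ψ : SchwartzMap V ℂ).integrable hf
  rw [e1, e2] at h3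
  simpa using h3

theorem indHat_ball (x ξ : V) (r : ℝ) : indHat (Metric.ball x r) ξ =
    Complex.exp ((2 * Real.pi * ⟪x, ξ⟫ : ℝ) * Complex.I) * indHat (Metric.ball 0 r) ξ := by
  rw [indHat_eq measurableSet_ball, indHat_eq measurableSet_ball, ← integral_const_mul,
    ← integral_indicator measurableSet_ball, ← integral_indicator measurableSet_ball,
    ← integral_add_left_eq_self _ x]
  congr 1 with y
  by_cases hy : y ∈ Metric.ball (0 : V) r
  · have : x + y ∈ Metric.ball x r := by simpa [mem_ball_iff_norm] using hy
    rw [indicator_of_mem hy, indicator_of_mem this, ← Complex.exp_add]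
    congr 1
    rw [inner_add_left]
    push_cast
    ring
  · have : x + y ∉ Metric.ball x r := by simpa [mem_ball_iff_norm] using hy
    rw [indicator_of_notMem hy, indicator_of_notMem this]

theorem exists_indHat_ball_ne_zero (ξ : V) :
    ∃ k : ℕ, indHat (Metric.ball (0 : V) (1 / ((k : ℝ) + 1))) ξ ≠ 0 := by
  -- For `x` in the ball of radius `1/(k+1)` this choice makes `|2π x·ξ| ≤ 1/2`, so the cosine stays
  -- above `1/2` and the real part of the transform is positive.
  obtain ⟨k, hk⟩ := exists_nat_gt (4 * Real.pi * ‖ξ‖)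
  refine ⟨k, fun h => ?_⟩
  set B := Metric.ball (0 : V) (1 / ((k : ℝ) + 1)) with hB
  have hBm : MeasurableSet B := measurableSet_ball
  have hBf : volume B ≠ ⊤ := Metric.isBounded_ball.measure_lt_top.ne
  have hfin : IsFiniteMeasure ((volume : Measure V).restrict B) := ⟨by simpa using hBf.lt_top⟩
  have hre : 0 < (indHat B ξ).re := by
    have hint : Integrable (fun x => Complex.exp ((2 * Real.pi * ⟪x, ξ⟫ : ℝ) * Complex.I))
        (volume.restrict B) := by
      refine (integrable_const (1 : ℝ)).mono' (Continuous.aestronglyMeasurable (by fun_prop))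
        (Eventually.of_forall fun x => by rw [norm_exp_ofReal_mul_I])
    rw [indHat_eq hBm]
    have : (∫ x in B, Complex.exp ((2 * Real.pi * ⟪x, ξ⟫ : ℝ) * Complex.I)).re =
        ∫ x in B, Real.cos (2 * Real.pi * ⟪x, ξ⟫) := by
      rw [← RCLike.re_eq_complex_re, ← integral_re hint]
      congr 1 with x
      rw [RCLike.re_eq_complex_re, Complex.exp_ofReal_mul_I_re]
    rw [this]
    have hlow : ∀ x ∈ B, (1 / 2 : ℝ) ≤ Real.cos (2 * Real.pi * ⟪x, ξ⟫) := by
      intro x hx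
      have hx' : ‖x‖ < 1 / ((k : ℝ) + 1) := by simpa [hB] using hx
      have h1 : |2 * Real.pi * ⟪x, ξ⟫| ≤ 1 / 2 := by
        rw [abs_mul, abs_of_pos (by positivity : 0 < 2 * Real.pi)]
        have h2 := abs_real_inner_le_norm x ξ
        have h3 : ‖x‖ * ‖ξ‖ * (4 * Real.pi) ≤ 1 := by
          calc ‖x‖ * ‖ξ‖ * (4 * Real.pi) = ‖x‖ * (4 * Real.pi * ‖ξ‖) := by ring
            _ ≤ 1 / ((k : ℝ) + 1) * ((k : ℝ) + 1) := by
                gcongr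
                linarith
            _ = 1 := by field_simp
        have h4 : 2 * Real.pi * |⟪x, ξ⟫| ≤ 2 * Real.pi * (‖x‖ * ‖ξ‖) := by gcongr
        linarith
      have h5 := Real.one_sub_sq_div_two_le_cos (x := 2 * Real.pi * ⟪x, ξ⟫)
      have h6 : (2 * Real.pi * ⟪x, ξ⟫) ^ 2 ≤ (1 / 2) ^ 2 := by
        rw [← sq_abs]; gcongr
      linarith
    have hv : 0 < (volume : Measure V).real B :=
      ENNReal.toReal_pos (Metric.measure_ball_pos volume _ (by positivity)).ne' hBf
    calc (0 : ℝ) < 1 / 2 * (volume : Measure V).real B := by positivity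
      _ = ∫ x in B, (1 / 2 : ℝ) := by simp [mul_comm]
      _ ≤ ∫ x in B, Real.cos (2 * Real.pi * ⟪x, ξ⟫) := by
          refine setIntegral_mono_on (integrable_const _) ?_ hBm hlow
          refine (integrable_const (1 : ℝ)).mono' (Continuous.aestronglyMeasurable (by fun_prop))
            (Eventually.of_forall fun x => Real.abs_cos_le_one _)
  rw [h] at hre
  simp at hre

/-- The transforms of small balls centred in a dense sequence. -/
theorem isTotal_space {β : ℝ} (h0 : 0 < β) (hβ : β < Module.finrank ℝ V) :
    IsTotal (fun (i : ℕ × ℕ) (ξ : V) => ((‖ξ‖ ^ (-(β / 2)) : ℝ) *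
      indHat (Metric.ball (TopologicalSpace.denseSeq V i.1) (1 / ((i.2 : ℝ) + 1))) ξ : ℂ))
      volume := by
  intro h hh hz
  have : Nontrivial V := Module.nontrivial_of_finrank_pos (R := ℝ) (by
    have : (0 : ℝ) < Module.finrank ℝ V := h0.trans hβ
    exact_mod_cast this)
  have key : ∀ k : ℕ, (fun ξ => h ξ * ((‖ξ‖ ^ (-(β / 2)) : ℝ) *
      indHat (Metric.ball (0 : V) (1 / ((k : ℝ) + 1))) ξ)) =ᵐ[volume] 0 := fun k => by
    have hi := integrable_mul_of_memLp hh (memLp_rpow_mul_indHat h0 hβ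
      (measurableSet_ball (x := (0 : V)) (ε := 1 / ((k : ℝ) + 1))) Metric.isBounded_ball)
    refine ae_eq_zero_of_fourierInv_eq_zero hi ?_
    -- Translating a ball multiplies its transform by a character. Orthogonality to the ball centred
    -- at `x_j` thus says that the inverse Fourier transform of `h` times the transform of the
    -- centred ball vanishes at `x_j`; by continuity and density it vanishes identically.
    refine (continuous_fourierInv hi).ext_on (TopologicalSpace.denseRange_denseSeq V)
      continuous_const ?_
    rintro _ ⟨j, rfl⟩
    rw [Real.fourierInv_eq', Pi.zero_apply, ← hz (j, k)]
    congr 1 with ξ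
    beta_reduce
    rw [indHat_ball (TopologicalSpace.denseSeq V j), real_inner_comm, smul_eq_mul]
    ring
  filter_upwards [ae_all_iff.2 key, Measure.ae_ne volume (0 : V)] with ξ hξ hξ0
  obtain ⟨k, hk⟩ := exists_indHat_ball_ne_zero ξ
  have h1 := hξ k
  have h2 : ((‖ξ‖ ^ (-(β / 2)) : ℝ) : ℂ) ≠ 0 :=
    Complex.ofReal_ne_zero.2 (Real.rpow_pos_of_pos (norm_pos_iff.2 hξ0) _).ne'
  rcases mul_eq_zero.1 h1 with h3 | h3
  · exact h3
  · exact absurd h3 (mul_ne_zero h2 hk)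

variable {d : ℕ} {α : ℝ}

/-- A countable family of rectangles. -/
def baseRect (i : ℚ × ℕ × ℕ) : Rect d where
  time := max (i.1 : ℝ) 0
  time_nonneg := le_max_right _ _
  base := Metric.ball (TopologicalSpace.denseSeq (Sp d) i.2.1) (1 / ((i.2.2 : ℝ) + 1))
  measurable_base := measurableSet_ball
  bounded_base := Metric.isBounded_ball

theorem isTotal_rectHat (h0 : 0 < α) (hd : α < d) :
    IsTotal (fun i => rectHat α (baseRect (d := d) i)) (lam d) :=
  IsTotal.prod isTotal_time (isTotal_space h0 (by rw [finrank_Sp]; exact hd))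
    (fun _ => memLp_timeHat _) (fun _ => memLp_spaceHat h0 hd measurableSet_ball
      Metric.isBounded_ball)

theorem isTotal_rectsHat (h0 : 0 < α) (hd : α < d) (n : ℕ) :
    IsTotal (fun R : Fin n → Rect d => rectsHat α R) (Measure.pi fun _ : Fin n => lam d) :=
  fun h hh hz => (isTotal_rectHat h0 hd).pi (fun _ => memLp_rectHat h0 hd _) n h hh
    fun i => hz fun k => baseRect (i k)

/-- The reflection of the frequencies. -/
def refl {n : ℕ} (z : Fin n → ℝ × Sp d) : Fin n → ℝ × Sp d := fun i => ((z i).1, -(z i).2)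

theorem measurePreserving_refl (n : ℕ) :
    MeasurePreserving (refl (d := d) (n := n)) (Measure.pi fun _ => lam d)
      (Measure.pi fun _ => lam d) :=
  measurePreserving_pi (f := fun _ (p : ℝ × Sp d) => (p.1, -p.2)) _ _ fun _ =>
    (MeasurePreserving.id _).prod (Measure.measurePreserving_neg volume)

theorem refl_refl {n : ℕ} (z : Fin n → ℝ × Sp d) : refl (refl z) = z := by
  ext i <;> simp [refl]

theorem measurable_refl {n : ℕ} : Measurable (refl (d := d) (n := n)) :=
  (measurePreserving_refl n).measurable

theorem integral_comp_refl {n : ℕ} (f : (Fin n → ℝ × Sp d) → ℂ) :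
    ∫ z, f (refl z) ∂(Measure.pi fun _ => lam d) = ∫ z, f z ∂(Measure.pi fun _ => lam d) :=
  (measurePreserving_refl n).integral_comp
    (MeasurableEquiv.measurableEmbedding (⟨⟨refl, refl, refl_refl, refl_refl⟩, measurable_refl,
      measurable_refl⟩ : (Fin n → ℝ × Sp d) ≃ᵐ (Fin n → ℝ × Sp d))) f

theorem rectsHat_refl {n : ℕ} (R : Fin n → Rect d) (z : Fin n → ℝ × Sp d) :
    rectsHat α R (refl z) = (starRingEnd ℂ) (rectsHat α R z) := by
  simp only [rectsHat, map_prod]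
  refine Finset.prod_congr rfl fun i _ => ?_
  simp only [rectHat, refl, map_mul, norm_neg, Complex.conj_ofReal,
    conj_indHat (R i).measurable_base]
  congr 1
  by_cases h : (z i).1 ≤ (R i).time <;> simp [-Complex.ofReal_exp, h]

/-- Functions with the symmetry of Fourier transforms of real functions are limits of transforms
of elementary functions. -/
theorem mem_closure_range_hatL (h0 : 0 < α) (hd : α < d) {n : ℕ}
    {g : (Fin n → ℝ × Sp d) → ℂ} (hg : MemLp g 2 (Measure.pi fun _ => lam d))
    (hsym : ∀ z, g (refl z) = (starRingEnd ℂ) (g z)) :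
    hg.toLp ∈ closure (range (hatL h0 hd n)) := by
  have hcl : closure (range (hatL h0 hd n)) =
      ((LinearMap.range (hatL h0 hd n)).topologicalClosure : Set (SpecL2 d n)) := by
    rw [Submodule.topologicalClosure_coe, LinearMap.coe_range]
  rw [hcl, SetLike.mem_coe, ← Submodule.orthogonal_orthogonal_eq_closure,
    Submodule.mem_orthogonal]
  intro h hh
  have hm : MemLp h 2 (Measure.pi fun _ : Fin n => lam d) := Lp.memLp h
  have hconj : MemLp (fun z => (starRingEnd ℂ) (h z)) 2 (Measure.pi fun _ : Fin n => lam d) :=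
    hm.star
  have href : MemLp (fun z => h (refl z)) 2 (Measure.pi fun _ : Fin n => lam d) :=
    hm.comp_measurePreserving (measurePreserving_refl n)
  -- Orthogonality in the real Hilbert space controls only real parts. Replacing `conj h` by `conj h
  -- + h ∘ refl` makes its pairing with any symmetric `f` equal to twice that real part, so that
  -- totality over `ℂ` can be used.
  have hadd : ∀ f : (Fin n → ℝ × Sp d) → ℂ, MemLp f 2 (Measure.pi fun _ => lam d) →
      (∀ z, f (refl z) = (starRingEnd ℂ) (f z)) →
      ∫ z, ((starRingEnd ℂ) (h z) + h (refl z)) * f z ∂(Measure.pi fun _ => lam d) =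
        (2 * (∫ z, (starRingEnd ℂ) (h z) * f z ∂(Measure.pi fun _ => lam d)).re : ℝ) := by
    intro f hf hs
    simp only [add_mul]
    rw [integral_add (integrable_mul_of_memLp hconj hf) (integrable_mul_of_memLp href hf)]
    have : ∫ z, h (refl z) * f z ∂(Measure.pi fun _ => lam d) =
        (starRingEnd ℂ) (∫ z, (starRingEnd ℂ) (h z) * f z ∂(Measure.pi fun _ => lam d)) := by
      rw [← integral_conj, ← integral_comp_refl]
      congr 1 with z
      rw [refl_refl, hs]
      simp
    rw [this, Complex.add_conj]
  have hinner : ∀ {f : (Fin n → ℝ × Sp d) → ℂ} (hf : MemLp f 2 (Measure.pi fun _ => lam d)),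
      ⟪h, hf.toLp⟫ =
        (∫ z, (starRingEnd ℂ) (h z) * f z ∂(Measure.pi fun _ => lam d)).re := fun hf => by
    rw [← inner_toLp_complex hm hf, Lp.toLp_coeFn]
  have hzero : (fun z => (starRingEnd ℂ) (h z) + h (refl z)) =ᵐ[Measure.pi fun _ => lam d] 0 := by
    refine isTotal_rectsHat h0 hd n _ (hconj.add href) fun R => ?_
    rw [hadd _ (memLp_rectsHat h0 hd R) (rectsHat_refl R), ← hinner (memLp_rectsHat h0 hd R)]
    have h1 : (memLp_rectsHat h0 hd R).toLp ∈ LinearMap.range (hatL h0 hd n) :=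
      ⟨Finsupp.single R 1, by rw [hatL, Finsupp.linearCombination_single, one_smul]⟩
    rw [real_inner_comm, (Submodule.mem_orthogonal _ _).1 hh _ h1]
    simp
  have h2 := hadd g hg hsym
  have h3 : ∫ z, ((starRingEnd ℂ) (h z) + h (refl z)) * g z ∂(Measure.pi fun _ => lam d) = 0 := by
    refine integral_eq_zero_of_ae ?_
    filter_upwards [hzero] with z hz
    rw [hz]
    simp
  rw [hinner hg]
  rw [h3, eq_comm, Complex.ofReal_eq_zero] at h2
  linarith

end Total

/-- The admissible parameters. -/
structure Admissible (d : ℕ) (α H : ℝ) : Prop where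
  pos : 0 < α
  lower : (d : ℝ) - 2 < α
  upper : α < d
  H_lower : 1 / 2 < H
  H_upper : H < 1

/-! ### Wiener and Skorohod operators on the spectral space -/

section Operators

variable {Ω : Type*} [MeasurableSpace Ω] {P : Measure Ω} [IsProbabilityMeasure P]
  {d : ℕ} {H α : ℝ} {W : Rect d → Ω → ℝ}

/-- The transform of elementary functions. -/
abbrev Admissible.hat (ha : Admissible d α H) (n : ℕ) : Elem d n →ₗ[ℝ] SpecL2 d n :=
  hatL ha.pos ha.upper n

/-- The comparison constant between the norm of `HP` and the spectral norm. -/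
def specConst (hW : IsNoise H α W P) (ha : Admissible d α H) : ℝ :=
  (exists_normSq_le hW ha.pos ha.upper ha.H_lower ha.H_upper).choose

theorem specConst_nonneg (hW : IsNoise H α W P) (ha : Admissible d α H) :
    0 ≤ specConst hW ha :=
  (exists_normSq_le hW ha.pos ha.upper ha.H_lower ha.H_upper).choose_spec.1

theorem normSq_le (hW : IsNoise H α W P) (ha : Admissible d α H) {n : ℕ} (e : Elem d n) :
    e.normSq H α ≤ specConst hW ha ^ n * ‖ha.hat n e‖ ^ 2 :=
  (exists_normSq_le hW ha.pos ha.upper ha.H_lower ha.H_upper).choose_spec.2 n e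

theorem norm_sq_le_extension {E : Type*} [NormedAddCommGroup E] {T : ℝ} {x : E} {a b : ℝ}
    (ha : 0 ≤ a) (hb : 0 ≤ b) (h : ‖x‖ ^ 2 ≤ a * T) (hT : T ≤ b ^ 2) : ‖x‖ ≤ √a * b := by
  refine abs_le_of_sq_le_sq' ?_ (by positivity) |>.2
  rw [mul_pow, Real.sq_sqrt ha]
  exact h.trans (by gcongr)

theorem exists_wienerOp (hW : IsNoise H α W P) (ha : Admissible d α H) (n : ℕ) :
    ∃ T : SpecL2 d n →L[ℝ] Lp ℝ 2 P,
      (∀ y, ‖T y‖ ≤ √(n.factorial * specConst hW ha ^ n) * ‖y‖) ∧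
      ∀ e, T (ha.hat n e) = wienerL hW n e := by
  refine exists_continuousLinearMap_extension _ _ (Real.sqrt_nonneg _) fun e => ?_
  have hC := specConst_nonneg hW ha
  refine norm_sq_le_extension (T := ‖ha.hat n e‖ ^ 2) (by positivity) (norm_nonneg _) ?_ le_rfl
  rw [mul_assoc]
  refine (norm_wienerL_sq_le hW n e).trans ?_
  gcongr
  exact normSq_le hW ha e

/-- The multiple Wiener integral as an operator on the spectral space. -/
def wienerOp (hW : IsNoise H α W P) (ha : Admissible d α H) (n : ℕ) :
    SpecL2 d n →L[ℝ] Lp ℝ 2 P := (exists_wienerOp hW ha n).choose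

theorem norm_wienerOp_le (hW : IsNoise H α W P) (ha : Admissible d α H) {n : ℕ} (f : SpecL2 d n) :
    ‖wienerOp hW ha n f‖ ≤ √(n.factorial * specConst hW ha ^ n) * ‖f‖ :=
  (exists_wienerOp hW ha n).choose_spec.1 f

theorem wienerOp_hat (hW : IsNoise H α W P) (ha : Admissible d α H) {n : ℕ} (e : Elem d n) :
    wienerOp hW ha n (ha.hat n e) = wienerL hW n e :=
  (exists_wienerOp hW ha n).choose_spec.2 e

theorem exists_extension_Lp {E V K : Type*} [AddCommGroup E] [Module ℝ E]
    [NormedAddCommGroup V] [InnerProductSpace ℝ V] [CompleteSpace V] [NormedAddCommGroup K]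
    [InnerProductSpace ℝ K] [CompleteSpace K] (e : E →ₗ[ℝ] V) (f : E →ₗ[ℝ] Lp K 2 P) {C : ℝ}
    (hC : 0 ≤ C) (h : ∀ x, ‖f x‖ ≤ C * ‖e x‖) :
    ∃ T : V →L[ℝ] Lp K 2 P, (∀ y, ‖T y‖ ≤ C * ‖y‖) ∧ ∀ x, T (e x) = f x :=
  exists_continuousLinearMap_extension e f hC h

theorem exists_skorOp (hW : IsNoise H α W P) (ha : Admissible d α H) (n : ℕ) :
    ∃ T : SpecL2 d (n + 1) →L[ℝ] Lp (HP W P) 2 P,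
      (∀ y, ‖T y‖ ≤ √(n.factorial * specConst hW ha ^ (n + 1)) * ‖y‖) ∧
      ∀ e, T (ha.hat (n + 1) e) = skorL hW n e := by
  have hcomp : CompleteSpace (HP W P) :=
    (Submodule.isClosed_topologicalClosure _).completeSpace_coe
  refine exists_extension_Lp (K := HP W P) (ha.hat (n + 1)) (skorL hW n) (Real.sqrt_nonneg _)
    fun e => ?_
  have hC := specConst_nonneg hW ha
  refine norm_sq_le_extension (x := skorL hW n e) (T := ‖ha.hat (n + 1) e‖ ^ 2) (by positivity) (norm_nonneg _) ?_ le_rfl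
  refine (norm_skorL_sq_le hW n e).trans ?_
  rw [mul_assoc]
  gcongr
  exact normSq_le hW ha e

/-- The operator sending a kernel of `n + 1` variables to the process of the multiple integrals
in the first `n` variables. -/
def skorOp (hW : IsNoise H α W P) (ha : Admissible d α H) (n : ℕ) :
    SpecL2 d (n + 1) →L[ℝ] Lp (HP W P) 2 P := (exists_skorOp hW ha n).choose

theorem norm_skorOp_le (hW : IsNoise H α W P) (ha : Admissible d α H) {n : ℕ}
    (f : SpecL2 d (n + 1)) :
    ‖skorOp hW ha n f‖ ≤ √(n.factorial * specConst hW ha ^ (n + 1)) * ‖f‖ :=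
  (exists_skorOp hW ha n).choose_spec.1 f

theorem skorOp_hat (hW : IsNoise H α W P) (ha : Admissible d α H) {n : ℕ} (e : Elem d (n + 1)) :
    skorOp hW ha n (ha.hat (n + 1) e) = skorL hW n e :=
  (exists_skorOp hW ha n).choose_spec.2 e

theorem exists_seq_hat {ha : Admissible d α H} {n : ℕ} {f : SpecL2 d n}
    (hf : f ∈ closure (range (ha.hat n))) :
    ∃ e : ℕ → Elem d n, Tendsto (fun k => ha.hat n (e k)) atTop (𝓝 f) := by
  obtain ⟨u, hu, hlim⟩ := mem_closure_iff_seq_limit.1 hf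
  choose e he using hu
  exact ⟨e, by simpa only [he] using hlim⟩

/-- Both sides are continuous in `f`, and for transforms of elementary functions this is
`skorohod_duality`. -/
theorem skorOp_duality (hW : IsNoise H α W P) (ha : Admissible d α H) {n : ℕ}
    {f : SpecL2 d (n + 1)} (hf : f ∈ closure (range (ha.hat (n + 1))))
    {F : Ω → ℝ} {DF : Ω → HP W P} (hF : IsMalliavinDeriv W P F DF) :
    ⟪hF.1.toLp, wienerOp hW ha (n + 1) f⟫ = ⟪hF.2.1.toLp, skorOp hW ha n f⟫ := by
  obtain ⟨e, he⟩ := exists_seq_hat hf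
  have t1 := ((wienerOp hW ha (n + 1)).continuous.tendsto f).comp he
  have t2 := ((skorOp hW ha n).continuous.tendsto f).comp he
  refine tendsto_nhds_unique (tendsto_inner_Lp (x := hF.1.toLp) tendsto_const_nhds t1) ?_
  have t3 := tendsto_inner_Lp (x := hF.2.1.toLp) tendsto_const_nhds t2
  refine t3.congr fun k => ?_
  simp only [Function.comp_apply, wienerOp_hat, skorOp_hat, skorohod_duality hW n (e k) hF]

theorem normSq_nonneg (hW : IsNoise H α W P) {n : ℕ} (e : Elem d n) : 0 ≤ e.normSq H α :=
  quadForm_nonneg (posSemidef_tensorKer (posSemidef_rectInner hW) n) e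

/-- Limits of transforms of elementary functions define elements of the tensor powers. -/
theorem isMultipleIntegral_wienerOp (hW : IsNoise H α W P) (ha : Admissible d α H) {n : ℕ}
    {f : SpecL2 d n} (hf : f ∈ closure (range (ha.hat n)))
    {T : (Fin n → ℝ × Sp d → ℝ) → ℝ}
    (hT : ∀ φ : Fin n → ℝ × Sp d → ℝ, (∀ i, IsTest (φ i)) → ∀ e : ℕ → Elem d n,
      Tendsto (fun k => ha.hat n (e k)) atTop (𝓝 f) →
      Tendsto (fun k => (e k).action φ) atTop (𝓝 (T φ))) :
    IsMultipleIntegral H α W P n T (wienerOp hW ha n f) := by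
  obtain ⟨e, he⟩ := exists_seq_hat hf
  refine ⟨e, ?_, fun φ hφ => hT φ hφ e he, ?_⟩
  · have t1 : Tendsto (fun p : ℕ × ℕ => specConst hW ha ^ n *
        ‖ha.hat n (e p.1) - ha.hat n (e p.2)‖ ^ 2) atTop (𝓝 0) := by
      have h1 : Tendsto (fun p : ℕ × ℕ => ha.hat n (e p.1)) atTop (𝓝 f) := by
        rw [← prod_atTop_atTop_eq]; exact he.comp tendsto_fst
      have h2 : Tendsto (fun p : ℕ × ℕ => ha.hat n (e p.2)) atTop (𝓝 f) := by
        rw [← prod_atTop_atTop_eq]; exact he.comp tendsto_snd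
      have := ((h1.sub h2).norm.pow 2).const_mul (specConst hW ha ^ n)
      simpa using this
    refine squeeze_zero (fun p => normSq_nonneg hW _) (fun p => ?_) t1
    rw [← map_sub]
    exact normSq_le hW ha _
  · have t1 := ((wienerOp hW ha n).continuous.tendsto f).comp he
    have t2 := (Lp.tendsto_Lp_iff_tendsto_eLpNorm' _ _).1 t1
    refine t2.congr fun k => eLpNorm_congr_ae ?_
    simp only [Function.comp_apply, wienerOp_hat]
    filter_upwards [coeFn_wienerL hW n (e k)] with ω hω
    rw [Pi.sub_apply, hω]

/-- Truncation of a rectangle in time. -/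
def Rect.trunc (t : ℝ) (ht : 0 ≤ t) (R : Rect d) : Rect d :=
  { R with
    time := min R.time t
    time_nonneg := le_min R.time_nonneg ht }

theorem coeFn_hatL (ha : Admissible d α H) {n : ℕ} (e : Elem d n) :
    ha.hat n e =ᵐ[Measure.pi fun _ => lam d]
      fun z => e.sum fun R a => (a : ℂ) * rectsHat α R z := by
  induction e using Finsupp.induction_linear with
  | zero =>
    rw [map_zero]
    refine (Lp.coeFn_zero ℂ 2 _).trans (Eventually.of_forall fun z => ?_)
    simp
  | add f g hf hg =>
    rw [map_add]
    filter_upwards [hf, hg, Lp.coeFn_add (ha.hat n f) (ha.hat n g)] with z h1 h2 h3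
    rw [h3, Pi.add_apply, h1, h2, Finsupp.sum_add_index' (by simp) (by intros; push_cast; ring)]
  | single R a =>
    filter_upwards [Lp.coeFn_smul a (memLp_rectsHat ha.pos ha.upper R).toLp,
      (memLp_rectsHat ha.pos ha.upper R).coeFn_toLp] with z h1 h2
    simp only [Admissible.hat, hatL, Finsupp.linearCombination_single]
    rw [h1, Pi.smul_apply, h2, Finsupp.sum_single_index (by simp), Complex.real_smul]

open Classical in
theorem rectsHat_trunc {n : ℕ} {t : ℝ} (ht : 0 ≤ t) (R : Fin n → Rect d)
    (z : Fin n → ℝ × Sp d) :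
    rectsHat α (fun i => (R i).trunc t ht) z = if ∀ i, (z i).1 ≤ t then rectsHat α R z else 0 := by
  split_ifs with h
  · refine Finset.prod_congr rfl fun i _ => ?_
    simp only [rectHat, Rect.trunc]
    congr 1
    by_cases h1 : (z i).1 ≤ (R i).time <;> simp [-Complex.ofReal_exp, indicator, h1, h i]
  · push Not at h
    obtain ⟨i, hi⟩ := h
    refine Finset.prod_eq_zero (Finset.mem_univ i) ?_
    simp only [rectHat, Rect.trunc]
    rw [indicator_of_notMem, zero_mul]
    simp [hi]

theorem pastSigma_le (hW : IsNoise H α W P) (t : ℝ) :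
    pastSigma W t ≤ (inferInstance : MeasurableSpace Ω) := by
  refine iSup_le fun R => ?_
  rw [← BorelSpace.measurable_eq (α := ℝ)]
  exact (hW.measurable R.1).comap_le

theorem pastSigma_le_fullSigma (t : ℝ) : pastSigma W t ≤ fullSigma W :=
  iSup_le fun R => le_iSup (fun R => MeasurableSpace.comap (W R) (borel ℝ)) R.1

theorem measurable_pastSigma {t : ℝ} {R : Rect d} (h : R.time ≤ t) :
    Measurable[pastSigma W t] (W R) := by
  refine Measurable.mono (Measurable.of_comap_le le_rfl)
    (le_iSup (fun R : {R : Rect d // R.time ≤ t} => MeasurableSpace.comap (W R.1) (borel ℝ))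
      ⟨R, h⟩) ?_
  exact (BorelSpace.measurable_eq (α := ℝ)).le

theorem measurable_wick {t : ℝ} : ∀ (n : ℕ) (R : Fin n → Rect d), (∀ i, (R i).time ≤ t) →
    Measurable[pastSigma W t] (wick H α W n R)
  | 0, _, _ => measurable_const
  | 1, R, h => measurable_pastSigma (h 0)
  | n + 2, R, h => by
    refine Measurable.sub ((measurable_pastSigma (h 0)).mul
      (measurable_wick (n + 1) _ fun i => h i.succ)) ?_
    exact Finset.measurable_sum _ fun j _ =>
      (measurable_wick n _ fun i => h (j.succAbove i).succ).const_mul _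

/-- The multiple integral of a kernel supported in `[0,t]^n` is measurable for the past of `t`. -/
theorem aestronglyMeasurable_wienerOp (hW : IsNoise H α W P) (ha : Admissible d α H) {n : ℕ}
    {f : SpecL2 d n} (hf : f ∈ closure (range (ha.hat n))) {t : ℝ} (ht : 0 ≤ t)
    (hsupp : ∀ᵐ z ∂(Measure.pi fun _ => lam d), ¬ (∀ i, (z i).1 ≤ t) → f z = 0) :
    AEStronglyMeasurable[pastSigma W t] (wienerOp hW ha n f) P := by
  classical
  obtain ⟨e, he⟩ := exists_seq_hat hf
  -- Truncating all rectangles at time `t` restricts the transforms to `[0,t]^n`. As `f` vanishes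
  -- outside, the truncated approximations are at least as close to `f`, and their integrals involve
  -- the noise only up to time `t`.
  set e' : ℕ → Elem d n := fun k => (e k).mapDomain fun R i => (R i).trunc t ht with he'
  have hae : ∀ k, ha.hat n (e' k) =ᵐ[Measure.pi fun _ => lam d]
      fun z => if ∀ i, (z i).1 ≤ t then ha.hat n (e k) z else 0 := by
    intro k
    filter_upwards [coeFn_hatL ha (e k), coeFn_hatL ha (e' k)] with z h1 h2
    rw [h2, h1, he', Finsupp.sum_mapDomain_index (by simp) (by intros; push_cast; ring)]
    simp only [rectsHat_trunc]
    split_ifs <;> simp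
  have hlim : Tendsto (fun k => ha.hat n (e' k)) atTop (𝓝 f) := by
    rw [tendsto_iff_norm_sub_tendsto_zero] at he ⊢
    refine squeeze_zero (fun _ => norm_nonneg _) (fun k => ?_) he
    refine Lp.norm_le_norm_of_ae_le ?_
    filter_upwards [hae k, Lp.coeFn_sub (ha.hat n (e' k)) f, Lp.coeFn_sub (ha.hat n (e k)) f,
      hsupp] with z h1 h2 h3 h4
    rw [h2, h3, Pi.sub_apply, Pi.sub_apply, h1]
    split_ifs with h
    · exact le_rfl
    · rw [h4 h]
      simp
  have hcl := isClosed_aestronglyMeasurable (F := ℝ) (p := 2) (μ := P) (pastSigma_le hW t)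
  have t1 := ((wienerOp hW ha n).continuous.tendsto f).comp hlim
  refine hcl.mem_of_tendsto t1 (Eventually.of_forall fun k => ?_)
  simp only [Function.comp_apply, wienerOp_hat, mem_ofPred_eq]
  refine AEStronglyMeasurable.congr ?_ (coeFn_wienerL hW n (e' k)).symm
  have hm : Measurable[pastSigma W t] ((e' k).wienerInt H α W) := by
    have : (e' k).wienerInt H α W = fun ω => (e k).sum fun R a =>
        a * wick H α W n (fun i => (R i).trunc t ht) ω := by
      ext ω
      simp only [Elem.wienerInt, he']
      rw [Finsupp.sum_mapDomain_index (by simp) (by intros; ring)]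
    rw [this]
    exact Finset.measurable_sum _ fun R _ =>
      (measurable_wick n _ fun i => min_le_right _ _).const_mul _
  exact (Measurable.stronglyMeasurable hm).aestronglyMeasurable

end Operators

/-! ### Estimates for the wave multiplier -/

section WaveBounds

variable {d : ℕ} {α H : ℝ}

/-- The Fourier multiplier of the wave kernel. -/
def waveMult (t : ℝ) (ξ : Sp d) : ℝ := t * Real.sinc (2 * Real.pi * t * ‖ξ‖)

/-- An upper bound of the multiplier that is monotone in time. -/
def waveBound (t : ℝ) (ξ : Sp d) : ℝ := 2 * t / (1 + t * ‖ξ‖)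

theorem waveBound_nonneg {t : ℝ} (ht : 0 ≤ t) (ξ : Sp d) : 0 ≤ waveBound t ξ := by
  unfold waveBound; positivity

theorem waveBound_mono {s t : ℝ} (hs : 0 ≤ s) (hst : s ≤ t) (ξ : Sp d) :
    waveBound s ξ ≤ waveBound t ξ := by
  have ht : 0 ≤ t := hs.trans hst
  unfold waveBound
  rw [div_le_div_iff₀ (by positivity) (by positivity)]
  nlinarith [norm_nonneg ξ]

/-- With `S` the absolute value of the cardinal sine, `S ≤ 1` and `S · t‖ξ‖ ≤ 1`, so `S (1 + t‖ξ‖) ≤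
2`. The oscillation is lost, but the bound increases with `t`. -/
theorem abs_waveMult_le {t : ℝ} (ht : 0 ≤ t) (ξ : Sp d) : |waveMult t ξ| ≤ waveBound t ξ := by
  rw [waveMult, waveBound, abs_mul, abs_of_nonneg ht, le_div_iff₀ (by positivity)]
  have h1 := Real.abs_sinc_le_one (2 * Real.pi * t * ‖ξ‖)
  have h2 : |Real.sinc (2 * Real.pi * t * ‖ξ‖)| * (t * ‖ξ‖) ≤ 1 := by
    rcases eq_or_ne (2 * Real.pi * t * ‖ξ‖) 0 with h | h
    · have : t * ‖ξ‖ = 0 := by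
        have hp := Real.pi_pos
        have : 2 * Real.pi * (t * ‖ξ‖) = 0 := by rw [← mul_assoc]; exact h
        rcases mul_eq_zero.1 this with h3 | h3
        · linarith
        · exact h3
      rw [this]; simp
    · have hpos : 0 < 2 * Real.pi * t * ‖ξ‖ := lt_of_le_of_ne (by positivity) (Ne.symm h)
      have h3 : |Real.sinc (2 * Real.pi * t * ‖ξ‖)| ≤ (2 * Real.pi * t * ‖ξ‖)⁻¹ := by
        rw [Real.sinc_of_ne_zero h, abs_div, abs_of_pos hpos, div_eq_mul_inv]
        exact mul_le_of_le_one_left (by positivity) (Real.abs_sin_le_one _)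
      have h4 : 0 ≤ t * ‖ξ‖ := by positivity
      have h5 : t * ‖ξ‖ ≤ 2 * Real.pi * t * ‖ξ‖ := by
        have := Real.pi_gt_three
        nlinarith
      calc |Real.sinc (2 * Real.pi * t * ‖ξ‖)| * (t * ‖ξ‖)
          ≤ (2 * Real.pi * t * ‖ξ‖)⁻¹ * (2 * Real.pi * t * ‖ξ‖) := by gcongr
        _ = 1 := inv_mul_cancel₀ h
  nlinarith

theorem waveMult_zero (ξ : Sp d) : waveMult 0 ξ = 0 := by simp [waveMult]

theorem continuous_waveMult : Continuous fun p : ℝ × Sp d => waveMult p.1 p.2 := by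
  unfold waveMult
  exact continuous_fst.mul (Real.continuous_sinc.comp (by fun_prop))

theorem measurable_waveBound : Measurable fun p : ℝ × Sp d => waveBound p.1 p.2 := by
  unfold waveBound
  fun_prop

theorem rpow_neg_mul_rpow_neg_le {a b x y : ℝ} (ha : 1 ≤ a) (hb : 1 ≤ b) (hx : 0 ≤ x)
    (hy : 0 ≤ y) : a ^ (-x) * b ^ (-y) ≤ a ^ (-(x + y)) + b ^ (-(x + y)) := by
  have ha0 : 0 < a := by linarith
  have hb0 : 0 < b := by linarith
  rw [neg_add, Real.rpow_add ha0, Real.rpow_add hb0]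
  rcases le_total a b with h | h
  · have : b ^ (-y) ≤ a ^ (-y) := Real.rpow_le_rpow_of_nonpos ha0 h (by linarith)
    have h2 : a ^ (-x) * b ^ (-y) ≤ a ^ (-x) * a ^ (-y) := by gcongr
    have h3 : 0 ≤ b ^ (-x) * b ^ (-y) := by positivity
    linarith
  · have : a ^ (-x) ≤ b ^ (-x) := Real.rpow_le_rpow_of_nonpos hb0 h (by linarith)
    have h2 : a ^ (-x) * b ^ (-y) ≤ b ^ (-x) * b ^ (-y) := by gcongr
    have h3 : 0 ≤ a ^ (-x) * a ^ (-y) := by positivity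
    linarith

/-- This is where the conditions on `α` enter. Near the origin `‖u‖^{-α}` is integrable because `α <
d`. Away from it, the product of a power of `1 + ‖u‖` and a power of `1 + ‖η + u‖` is at most the
sum of the same powers with total exponent `α + 2`, integrable because `α + 2 > d`. Translation
invariance makes the bound uniform in `η`. -/
theorem exists_shift_bound (ha : Admissible d α H) :
    ∃ C : ℝ, 0 ≤ C ∧ ∀ η : Sp d,
      Integrable (fun u : Sp d => ‖u‖ ^ (-α) * (1 + ‖η + u‖) ^ (-2 : ℝ)) ∧
      ∫ u : Sp d, ‖u‖ ^ (-α) * (1 + ‖η + u‖) ^ (-2 : ℝ) ≤ C := by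
  have hd1 : 1 ≤ Module.finrank ℝ (Sp d) := by
    rw [finrank_Sp]
    have : (0 : ℝ) < d := ha.pos.trans ha.upper
    exact_mod_cast this
  set f : Sp d → ℝ := (Metric.ball (0 : Sp d) 1).indicator fun u => ‖u‖ ^ (-α) with hf
  have hfi : Integrable f := by
    rw [hf, integrable_indicator_iff measurableSet_ball]
    refine integrableOn_ball_of_norm_le_rpow hd1 (C := 1) (α := α)
      (by rw [finrank_Sp]; exact ha.upper) (Eventually.of_forall fun z => ?_) ?_
    · rw [one_mul, Real.norm_of_nonneg (by positivity)]
    · exact Measurable.aestronglyMeasurable (by fun_prop)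
  have hg : Integrable fun u : Sp d => (1 + ‖u‖) ^ (-(α + 2)) :=
    integrable_one_add_norm (by rw [finrank_Sp]; linarith [ha.lower])
  have hpos := ha.pos
  have hF : ∀ η : Sp d, Integrable fun u : Sp d => f u + 2 ^ α * ((1 + ‖u‖) ^ (-(α + 2)) +
      (1 + ‖η + u‖) ^ (-(α + 2))) := fun η =>
    hfi.add ((hg.add (hg.comp_add_left η)).const_mul _)
  have hle : ∀ η u : Sp d, ‖u‖ ^ (-α) * (1 + ‖η + u‖) ^ (-2 : ℝ) ≤
      f u + 2 ^ α * ((1 + ‖u‖) ^ (-(α + 2)) + (1 + ‖η + u‖) ^ (-(α + 2))) := by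
    intro η u
    have h1 : (1 + ‖η + u‖) ^ (-2 : ℝ) ≤ 1 :=
      Real.rpow_le_one_of_one_le_of_nonpos (by linarith [norm_nonneg (η + u)]) (by norm_num)
    have h1' : 0 ≤ (1 + ‖η + u‖) ^ (-2 : ℝ) := by positivity
    have h2 : 0 ≤ ‖u‖ ^ (-α) := by positivity
    by_cases hu : u ∈ Metric.ball (0 : Sp d) 1
    · have h3 : 0 ≤ 2 ^ α * ((1 + ‖u‖) ^ (-(α + 2)) + (1 + ‖η + u‖) ^ (-(α + 2))) := by positivity
      simp only [hf, indicator_of_mem hu]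
      nlinarith
    · simp only [hf, indicator_of_notMem hu, zero_add]
      have hu1 : 1 ≤ ‖u‖ := by simpa using hu
      have h4 : ‖u‖ ^ (-α) ≤ 2 ^ α * (1 + ‖u‖) ^ (-α) := by
        have : (2 * ‖u‖) ^ (-α) ≤ (1 + ‖u‖) ^ (-α) :=
          Real.rpow_le_rpow_of_nonpos (by positivity) (by linarith) (by linarith)
        rw [Real.mul_rpow (by norm_num) (by positivity), Real.rpow_neg (by norm_num)] at this
        have h2a : (0 : ℝ) < 2 ^ α := by positivity
        calc ‖u‖ ^ (-α) = 2 ^ α * ((2 ^ α)⁻¹ * ‖u‖ ^ (-α)) := by field_simp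
          _ ≤ _ := by gcongr
      calc ‖u‖ ^ (-α) * (1 + ‖η + u‖) ^ (-2 : ℝ)
          ≤ 2 ^ α * (1 + ‖u‖) ^ (-α) * (1 + ‖η + u‖) ^ (-2 : ℝ) := by gcongr
        _ = 2 ^ α * ((1 + ‖u‖) ^ (-α) * (1 + ‖η + u‖) ^ (-2 : ℝ)) := by ring
        _ ≤ _ := by
          gcongr
          exact rpow_neg_mul_rpow_neg_le (by linarith) (by linarith [norm_nonneg (η + u)])
            hpos.le (by norm_num)
  have hint : ∀ η : Sp d, Integrable (fun u : Sp d => ‖u‖ ^ (-α) * (1 + ‖η + u‖) ^ (-2 : ℝ)) :=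
    fun η => (hF η).mono' (Measurable.aestronglyMeasurable (by fun_prop))
      (Eventually.of_forall fun u => by
        rw [Real.norm_of_nonneg (by positivity)]
        exact hle η u)
  refine ⟨(∫ u, f u) + 2 ^ α * ((∫ u : Sp d, (1 + ‖u‖) ^ (-(α + 2))) +
    ∫ u : Sp d, (1 + ‖u‖) ^ (-(α + 2))), ?_, fun η => ⟨hint η, ?_⟩⟩
  · have h1 : 0 ≤ ∫ u, f u := integral_nonneg fun u =>
      indicator_nonneg (fun _ _ => by positivity) u
    have h2 : 0 ≤ ∫ u : Sp d, (1 + ‖u‖) ^ (-(α + 2)) := integral_nonneg fun u => by positivity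
    positivity
  · refine (integral_mono (hint η) (hF η) (hle η)).trans_eq ?_
    have e1 := integral_add_left_eq_self (μ := volume)
      (fun u : Sp d => (1 + ‖u‖) ^ (-(α + 2))) η
    have hg1 : Integrable fun u : Sp d => (1 + ‖η + u‖) ^ (-(α + 2)) := hg.comp_add_left η
    have hg2 : Integrable fun u : Sp d => 2 ^ α * ((1 + ‖u‖) ^ (-(α + 2)) +
      (1 + ‖η + u‖) ^ (-(α + 2))) := (hg.add hg1).const_mul _
    rw [integral_add hfi hg2, integral_const_mul, integral_add hg hg1, e1]

theorem wt_sq (z : ℝ × Sp d) : wt α z ^ 2 = Real.exp z.1 ^ 2 * ‖z.2‖ ^ (-α) := by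
  rw [wt, mul_pow]
  congr 1
  rw [← Real.rpow_natCast, ← Real.rpow_mul (norm_nonneg _)]
  congr 1
  push_cast
  ring

/-- The basic integral estimate for the wave multiplier. -/
theorem exists_wave_bound (ha : Admissible d α H) :
    ∃ C : ℝ, 0 ≤ C ∧ ∀ s : ℝ, 0 < s → ∀ η : Sp d,
      ∫⁻ ζ : Sp d, ENNReal.ofReal (waveBound s (η + ζ) ^ 2 * ‖ζ‖ ^ (-α)) ≤
        ENNReal.ofReal (C * s ^ (α - d + 2)) := by
  obtain ⟨C, hC, h⟩ := exists_shift_bound ha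
  refine ⟨4 * C, by positivity, fun s hs η => ?_⟩
  obtain ⟨hi, hle⟩ := h (s • η)
  -- After the scaling `u = s ζ`, the exponent `α - d + 2` collects `2` from the squared bound, `α`
  -- from the weight and `-d` from the Jacobian.
  set f : Sp d → ℝ := fun u => ‖u‖ ^ (-α) * (1 + ‖s • η + u‖) ^ (-2 : ℝ) with hf
  have e : ∀ ζ : Sp d, waveBound s (η + ζ) ^ 2 * ‖ζ‖ ^ (-α) = 4 * s ^ (α + 2) * f (s • ζ) := by
    intro ζ
    simp only [hf, waveBound]
    rw [← smul_add, norm_smul, norm_smul, Real.norm_of_nonneg hs.le,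
      Real.mul_rpow hs.le (norm_nonneg _), Real.rpow_add hs, Real.rpow_neg hs.le,
      Real.rpow_neg (by positivity)]
    have : 0 < s ^ α := by positivity
    norm_num
    field_simp
    norm_num
  have hi' : Integrable fun ζ : Sp d => f (s • ζ) :=
    (integrable_comp_smul_iff volume f hs.ne').2 hi
  simp only [e]
  rw [← ofReal_integral_eq_lintegral_ofReal (hi'.const_mul _)
    (Eventually.of_forall fun ζ => by simp only [hf, Pi.zero_apply]; positivity)]
  refine ENNReal.ofReal_le_ofReal ?_
  rw [integral_const_mul, Measure.integral_comp_smul_of_nonneg volume f s (hR := hs.le), finrank_Sp,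
    smul_eq_mul]
  have e2 : s ^ (α - d + 2) = s ^ (α + 2) * (s ^ d)⁻¹ := by
    rw [show α - d + 2 = (α + 2) + (-(d : ℝ)) by ring, Real.rpow_add hs, Real.rpow_neg hs.le,
      Real.rpow_natCast]
  rw [e2]
  calc 4 * s ^ (α + 2) * ((s ^ d)⁻¹ * ∫ u, f u) ≤ 4 * s ^ (α + 2) * ((s ^ d)⁻¹ * C) := by gcongr
    _ = _ := by ring

end WaveBounds

/-! ### Size of the transforms of the kernels -/

section Amplitude

variable {d : ℕ} {α H : ℝ}

/-- The sum of the frequencies. -/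
def freqSum {n : ℕ} (z : Fin n → ℝ × Sp d) : Sp d := ∑ i, (z i).2

/-- The modulus of the spectral transform of the kernel `f_n(·,t,x)`. -/
def amp (α : ℝ) : (n : ℕ) → (Fin n → ℝ × Sp d) → ℝ → ℝ
  | 0, _, _ => 1
  | n + 1, z, t =>
      if 0 < (z (Fin.last n)).1 ∧ (z (Fin.last n)).1 < t then
        waveMult (t - (z (Fin.last n)).1) (freqSum z) * wt α (z (Fin.last n)) *
          amp α n (fun i => z i.castSucc) (z (Fin.last n)).1
      else 0

/-- An upper bound of `amp`, monotone in time. -/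
def ampBound (α : ℝ) : (n : ℕ) → (Fin n → ℝ × Sp d) → ℝ → ℝ
  | 0, _, _ => 1
  | n + 1, z, t =>
      if 0 < (z (Fin.last n)).1 ∧ (z (Fin.last n)).1 < t then
        waveBound (t - (z (Fin.last n)).1) (freqSum z) * wt α (z (Fin.last n)) *
          ampBound α n (fun i => z i.castSucc) (z (Fin.last n)).1
      else 0

theorem ampBound_nonneg : ∀ (n : ℕ) (z : Fin n → ℝ × Sp d) (t : ℝ), 0 ≤ ampBound α n z t
  | 0, _, _ => zero_le_one
  | n + 1, z, t => by
    rw [ampBound]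
    split_ifs with h
    · exact mul_nonneg (mul_nonneg (waveBound_nonneg (by linarith [h.2]) _) (wt_nonneg _ _))
        (ampBound_nonneg n _ _)
    · exact le_rfl

theorem abs_amp_le : ∀ (n : ℕ) (z : Fin n → ℝ × Sp d) (t : ℝ), |amp α n z t| ≤ ampBound α n z t
  | 0, _, _ => by simp [amp, ampBound]
  | n + 1, z, t => by
    rw [amp, ampBound]
    split_ifs with h
    · rw [abs_mul, abs_mul, abs_of_nonneg (wt_nonneg _ _)]
      exact mul_le_mul (mul_le_mul_of_nonneg_right (abs_waveMult_le (by linarith [h.2]) _)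
        (wt_nonneg _ _)) (abs_amp_le n _ _) (abs_nonneg _)
        (mul_nonneg (waveBound_nonneg (by linarith [h.2]) _) (wt_nonneg _ _))
    · simp

/-- This monotonicity is the reason for replacing `amp` by a cruder bound: the single function
`ampBound α n · T` dominates the kernels at all times `t ≤ T`, and serves in every later dominated
convergence. -/
theorem ampBound_mono {n : ℕ} (z : Fin n → ℝ × Sp d) {s t : ℝ} (hst : s ≤ t) :
    ampBound α n z s ≤ ampBound α n z t := by
  cases n with
  | zero => exact le_rfl
  | succ n =>
    rw [ampBound]
    split_ifs with h
    · rw [ampBound, if_pos ⟨h.1, h.2.trans_le hst⟩]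
      exact mul_le_mul_of_nonneg_right (mul_le_mul_of_nonneg_right
        (waveBound_mono (by linarith [h.2]) (by linarith) _) (wt_nonneg _ _))
        (ampBound_nonneg n _ _)
    · exact ampBound_nonneg _ _ _

theorem measurable_freqSum {n : ℕ} : Measurable (freqSum (d := d) (n := n)) := by
  unfold freqSum
  fun_prop

theorem measurable_ampBound : ∀ n : ℕ,
    Measurable fun p : (Fin n → ℝ × Sp d) × ℝ => ampBound α n p.1 p.2
  | 0 => measurable_const
  | n + 1 => by
    have hs : Measurable fun p : (Fin (n + 1) → ℝ × Sp d) × ℝ => p.1 (Fin.last n) := by fun_prop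
    have h1 := (measurable_ampBound n).comp (g := fun p : (Fin n → ℝ × Sp d) × ℝ =>
      ampBound α n p.1 p.2) (f := fun p : (Fin (n + 1) → ℝ × Sp d) × ℝ =>
      ((fun i : Fin n => p.1 i.castSucc), (p.1 (Fin.last n)).1)) (by fun_prop)
    simp only [ampBound]
    refine Measurable.ite ?_ ?_ measurable_const
    · exact (measurableSet_lt measurable_const hs.fst).inter
        (measurableSet_lt hs.fst measurable_snd)
    · refine Measurable.mul (Measurable.mul ?_ ((measurable_wt α).comp hs)) h1
      exact measurable_waveBound.comp ((measurable_snd.sub hs.fst).prodMk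
        (measurable_freqSum.comp measurable_fst))

theorem measurable_amp : ∀ n : ℕ,
    Measurable fun p : (Fin n → ℝ × Sp d) × ℝ => amp α n p.1 p.2
  | 0 => measurable_const
  | n + 1 => by
    have hs : Measurable fun p : (Fin (n + 1) → ℝ × Sp d) × ℝ => p.1 (Fin.last n) := by fun_prop
    have h1 := (measurable_amp n).comp (g := fun p : (Fin n → ℝ × Sp d) × ℝ =>
      amp α n p.1 p.2) (f := fun p : (Fin (n + 1) → ℝ × Sp d) × ℝ =>
      ((fun i : Fin n => p.1 i.castSucc), (p.1 (Fin.last n)).1)) (by fun_prop)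
    simp only [amp]
    refine Measurable.ite ?_ ?_ measurable_const
    · exact (measurableSet_lt measurable_const hs.fst).inter
        (measurableSet_lt hs.fst measurable_snd)
    · refine Measurable.mul (Measurable.mul ?_ ((measurable_wt α).comp hs)) h1
      exact continuous_waveMult.measurable.comp ((measurable_snd.sub hs.fst).prodMk
        (measurable_freqSum.comp measurable_fst))

theorem freqSum_snocF {n : ℕ} (z : Fin n → ℝ × Sp d) (w : ℝ × Sp d) :
    freqSum (snocF z w) = freqSum z + w.2 := by
  simp [freqSum, Fin.sum_univ_castSucc]

theorem ampBound_snocF {n : ℕ} (z : Fin n → ℝ × Sp d) (w : ℝ × Sp d) (t : ℝ) :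
    ampBound α (n + 1) (snocF z w) t = if 0 < w.1 ∧ w.1 < t then
      waveBound (t - w.1) (freqSum z + w.2) * wt α w * ampBound α n z w.1 else 0 := by
  simp [ampBound, freqSum_snocF]

theorem amp_snocF {n : ℕ} (z : Fin n → ℝ × Sp d) (w : ℝ × Sp d) (t : ℝ) :
    amp α (n + 1) (snocF z w) t = if 0 < w.1 ∧ w.1 < t then
      waveMult (t - w.1) (freqSum z + w.2) * wt α w * amp α n z w.1 else 0 := by
  simp [amp, freqSum_snocF]

/-- The squared `L²` norm of `ampBound`. -/
def ampSq (d : ℕ) (α : ℝ) (n : ℕ) (t : ℝ) : ℝ≥0∞ :=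
  ∫⁻ z : Fin n → ℝ × Sp d, ENNReal.ofReal (ampBound α n z t ^ 2) ∂(Measure.pi fun _ => lam d)

/-- The last frequency is integrated first: the remaining ones enter its factor only through the
shift `freqSum z`, and the estimate `hC` is uniform in that shift. -/
theorem ampSq_succ_le {C : ℝ} (hC : ∀ s : ℝ, 0 < s → ∀ η : Sp d,
      ∫⁻ ζ : Sp d, ENNReal.ofReal (waveBound s (η + ζ) ^ 2 * ‖ζ‖ ^ (-α)) ≤
        ENNReal.ofReal (C * s ^ (α - d + 2))) (n : ℕ) (t : ℝ) :
    ampSq d α (n + 1) t ≤ ∫⁻ s in Ioo 0 t,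
      ENNReal.ofReal (Real.exp s ^ 2) * ENNReal.ofReal (C * (t - s) ^ (α - d + 2)) *
        ampSq d α n s := by
  have hm : Measurable fun p : (Fin n → ℝ × Sp d) × (ℝ × Sp d) =>
      ENNReal.ofReal (ampBound α (n + 1) (snocF p.1 p.2) t ^ 2) := by
    have h1 : Measurable fun p : (Fin n → ℝ × Sp d) × (ℝ × Sp d) => snocF p.1 p.2 := by
      simp only [← snocEquiv_apply]
      exact (snocEquiv (ℝ × Sp d) n).measurable
    exact (((measurable_ampBound (n + 1)).comp (h1.prodMk measurable_const)).pow_const 2).ennreal_ofReal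
  have hm0 : Measurable fun z : Fin (n + 1) → ℝ × Sp d =>
      ENNReal.ofReal (ampBound α (n + 1) z t ^ 2) :=
    (((measurable_ampBound (n + 1)).comp (measurable_id.prodMk measurable_const)).pow_const
      2).ennreal_ofReal
  rw [ampSq, ← (measurePreserving_snoc (lam d) n).lintegral_comp hm0]
  simp only [snocEquiv_apply]
  rw [lintegral_prod_symm _ hm.aemeasurable, lintegral_prod _ (Measurable.aemeasurable
    hm.lintegral_prod_left'), ← lintegral_indicator measurableSet_Ioi,
    ← lintegral_indicator measurableSet_Ioo]
  refine lintegral_mono fun s => ?_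
  by_cases hs : s ∈ Ioo 0 t
  · have hs0 : s ∈ Ioi (0 : ℝ) := hs.1
    rw [indicator_of_mem hs, indicator_of_mem hs0]
    rw [lintegral_lintegral_swap (Measurable.aemeasurable (by
      exact hm.comp (measurable_snd.prodMk (measurable_const.prodMk measurable_fst))))]
    rw [ampSq, ← lintegral_const_mul _ (by
      exact (((measurable_ampBound n).comp (measurable_id.prodMk measurable_const)).pow_const
        2).ennreal_ofReal)]
    refine lintegral_mono fun z => ?_
    simp only [ampBound_snocF, if_pos (show 0 < s ∧ s < t from hs)]
    have e : ∀ ζ : Sp d, ENNReal.ofReal ((waveBound (t - s) (freqSum z + ζ) * wt α (s, ζ) *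
        ampBound α n z s) ^ 2) = ENNReal.ofReal (Real.exp s ^ 2) *
        ENNReal.ofReal (ampBound α n z s ^ 2) *
        ENNReal.ofReal (waveBound (t - s) (freqSum z + ζ) ^ 2 * ‖ζ‖ ^ (-α)) := by
      intro ζ
      rw [← ENNReal.ofReal_mul (by positivity), ← ENNReal.ofReal_mul (by positivity), mul_pow,
        mul_pow, wt_sq]
      congr 1
      ring
    simp only [e]
    rw [lintegral_const_mul _ (by unfold waveBound; fun_prop)]
    calc _ ≤ ENNReal.ofReal (Real.exp s ^ 2) * ENNReal.ofReal (ampBound α n z s ^ 2) *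
          ENNReal.ofReal (C * (t - s) ^ (α - d + 2)) := by
          gcongr
          exact hC _ (sub_pos.2 hs.2) _
      _ = _ := by ring
  · rw [indicator_of_notMem hs]
    refine le_of_eq ?_
    by_cases hs0 : s ∈ Ioi (0 : ℝ)
    · rw [indicator_of_mem hs0]
      have : ¬ (0 < s ∧ s < t) := hs
      simp [ampBound_snocF, this]
    · rw [indicator_of_notMem hs0]

theorem ampSq_zero (t : ℝ) : ampSq d α 0 t = 1 := by
  simp [ampSq, ampBound]

/-- A substitute for Beta integrals. If `t - s ≤ δt`, the first factor gains `δ^γ`; otherwise `s ≤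
(1-δ)t`, and the second factor is geometrically small in `n`. -/
theorem sub_rpow_mul_pow_le {γ δ s t : ℝ} (hγ : 0 < γ) (hδ : 0 < δ) (hδ1 : δ < 1) (hs : 0 < s)
    (hst : s < t) (n : ℕ) :
    (t - s) ^ γ * s ^ n ≤ t ^ γ * (δ ^ γ * s ^ n + ((1 - δ) * t) ^ n) := by
  have ht : 0 < t := hs.trans hst
  have h1 : 0 ≤ (1 - δ) * t := by nlinarith
  rcases le_total (t - s) (δ * t) with h | h
  · have : (t - s) ^ γ ≤ t ^ γ * δ ^ γ := by
      rw [← Real.mul_rpow ht.le hδ.le, mul_comm t]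
      exact Real.rpow_le_rpow (by linarith) h hγ.le
    calc (t - s) ^ γ * s ^ n ≤ t ^ γ * δ ^ γ * s ^ n := by gcongr
      _ ≤ t ^ γ * (δ ^ γ * s ^ n + ((1 - δ) * t) ^ n) := by
        rw [mul_assoc]
        gcongr
        exact le_add_of_nonneg_right (by positivity)
  · have h2 : (t - s) ^ γ ≤ t ^ γ := Real.rpow_le_rpow (by linarith) (by linarith) hγ.le
    have h3 : s ^ n ≤ ((1 - δ) * t) ^ n := by
      gcongr
      linarith
    calc (t - s) ^ γ * s ^ n ≤ t ^ γ * ((1 - δ) * t) ^ n := by gcongr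
      _ ≤ _ := by
        gcongr
        exact le_add_of_nonneg_left (by positivity)

/-- The ratio of consecutive bounds of `ampSq`. -/
def ampRatio (K γ δ : ℝ) (k : ℕ) : ℝ := K * (δ ^ γ + (k + 1) * (1 - δ) ^ k)

theorem ampRatio_nonneg {K γ δ : ℝ} (hK : 0 ≤ K) (hδ : 0 < δ) (hδ1 : δ < 1) (k : ℕ) :
    0 ≤ ampRatio K γ δ k := by
  have : 0 < 1 - δ := by linarith
  unfold ampRatio; positivity

/-- Inserting the split bound in the Volterra inequality and integrating over `[0,t]` gives
`t^{n+1}/(n+1)` times `δ^γ + (n+1)(1-δ)^n`. The factor `n+1` in `ampRatio` compensates for the term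
constant in `s`, whose integral does not produce the denominator. -/
theorem ampSq_le {C T δ : ℝ} (hγ : 0 < α - d + 2) (hC0 : 0 ≤ C)
    (hC : ∀ s : ℝ, 0 < s → ∀ η : Sp d,
      ∫⁻ ζ : Sp d, ENNReal.ofReal (waveBound s (η + ζ) ^ 2 * ‖ζ‖ ^ (-α)) ≤
        ENNReal.ofReal (C * s ^ (α - d + 2))) (hδ : 0 < δ) (hδ1 : δ < 1) :
    ∀ (n : ℕ) {t : ℝ}, 0 ≤ t → t ≤ T → ampSq d α n t ≤
      ENNReal.ofReal (t ^ n * ((∏ k ∈ Finset.range n,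
        ampRatio (Real.exp T ^ 2 * C * T ^ (α - d + 2)) (α - d + 2) δ k) / n.factorial))
  | 0, t, _, _ => by simp [ampSq_zero]
  | n + 1, t, ht, htT => by
    set γ := α - d + 2
    set K := Real.exp T ^ 2 * C * T ^ γ with hKdef
    have hT : 0 ≤ T := ht.trans htT
    have hK : 0 ≤ K := by positivity
    set c := (∏ k ∈ Finset.range n, ampRatio K γ δ k) / n.factorial with hc
    have hc0 : 0 ≤ c := div_nonneg (Finset.prod_nonneg fun k _ => ampRatio_nonneg hK hδ hδ1 k)
      (by positivity)
    have hd1 : 0 < 1 - δ := by linarith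
    refine (ampSq_succ_le hC n t).trans ?_
    have hle : ∀ s ∈ Ioo 0 t, ENNReal.ofReal (Real.exp s ^ 2) * ENNReal.ofReal (C * (t - s) ^ γ) *
        ampSq d α n s ≤ ENNReal.ofReal (K * c * (δ ^ γ * s ^ n + ((1 - δ) * t) ^ n)) := by
      intro s hs
      have hs0 : 0 ≤ s := hs.1.le
      have hts : 0 ≤ t - s := by linarith [hs.2]
      have ih := ampSq_le (T := T) hγ hC0 hC hδ hδ1 n hs0 (hs.2.le.trans htT)
      calc _ ≤ ENNReal.ofReal (Real.exp s ^ 2) * ENNReal.ofReal (C * (t - s) ^ γ) *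
          ENNReal.ofReal (s ^ n * c) := by gcongr
        _ = ENNReal.ofReal (Real.exp s ^ 2 * (C * (t - s) ^ γ) * (s ^ n * c)) := by
          rw [← ENNReal.ofReal_mul (by positivity), ← ENNReal.ofReal_mul (by positivity)]
        _ ≤ _ := by
          refine ENNReal.ofReal_le_ofReal ?_
          have h1 := sub_rpow_mul_pow_le hγ hδ hδ1 hs.1 hs.2 n
          have h2 : Real.exp s ≤ Real.exp T := Real.exp_le_exp.2 (hs.2.le.trans htT)
          have h3 : t ^ γ ≤ T ^ γ := Real.rpow_le_rpow ht htT hγ.le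
          calc Real.exp s ^ 2 * (C * (t - s) ^ γ) * (s ^ n * c)
              = Real.exp s ^ 2 * C * c * ((t - s) ^ γ * s ^ n) := by ring
            _ ≤ Real.exp T ^ 2 * C * c * (T ^ γ * (δ ^ γ * s ^ n + ((1 - δ) * t) ^ n)) := by
              have h4 : (t - s) ^ γ * s ^ n ≤ T ^ γ * (δ ^ γ * s ^ n + ((1 - δ) * t) ^ n) :=
                h1.trans (by gcongr)
              exact mul_le_mul (by gcongr) h4 (by positivity) (by positivity)
            _ = _ := by rw [hKdef]; ring
    refine (setLIntegral_mono' measurableSet_Ioo hle).trans ?_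
    have hcont : Continuous fun s : ℝ => K * c * (δ ^ γ * s ^ n + ((1 - δ) * t) ^ n) := by
      fun_prop
    rw [← ofReal_integral_eq_lintegral_ofReal
      ((hcont.integrableOn_Icc (a := 0) (b := t)).mono_set Ioo_subset_Icc_self)
      ((ae_restrict_iff' measurableSet_Ioo).2 (Eventually.of_forall fun s hs => by
        have := hs.1
        simp only [Pi.zero_apply]
        positivity))]
    refine ENNReal.ofReal_le_ofReal (le_of_eq ?_)
    rw [← integral_Ioc_eq_integral_Ioo, ← intervalIntegral.integral_of_le ht,
      intervalIntegral.integral_const_mul, intervalIntegral.integral_add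
        (Continuous.intervalIntegrable (by fun_prop) _ _)
        (Continuous.intervalIntegrable (by fun_prop) _ _), intervalIntegral.integral_const_mul,
      integral_pow, intervalIntegral.integral_const, Finset.prod_range_succ, ampRatio,
      Nat.factorial_succ, hc]
    push_cast
    have : (n.factorial : ℝ) ≠ 0 := by positivity
    have : (n : ℝ) + 1 ≠ 0 := by positivity
    simp only [zero_pow (Nat.succ_ne_zero n), sub_zero, smul_eq_mul, mul_pow]
    field_simp
    ring

theorem tendsto_ampRatio {K γ δ : ℝ} (hδ : 0 < δ) (hδ1 : δ < 1) :
    Tendsto (ampRatio K γ δ) atTop (𝓝 (K * δ ^ γ)) := by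
  have h0 : |1 - δ| < 1 := by rw [abs_lt]; constructor <;> linarith
  have h1 := tendsto_self_mul_const_pow_of_abs_lt_one h0
  have h2 := tendsto_pow_atTop_nhds_zero_of_abs_lt_one h0
  have h3 : Tendsto (fun k : ℕ => K * (δ ^ γ + (k * (1 - δ) ^ k + (1 - δ) ^ k))) atTop
      (𝓝 (K * (δ ^ γ + (0 + 0)))) := ((h1.add h2).const_add _).const_mul _
  simp only [add_zero] at h3
  refine h3.congr fun k => ?_
  simp only [ampRatio]
  ring

/-- The bounds on `ampSq` are summable against any geometric weight. -/
theorem exists_ampSq_bound (ha : Admissible d α H) {T D : ℝ} (hT : 0 ≤ T) (hD : 0 ≤ D) :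
    ∃ b : ℕ → ℝ, (∀ n, 0 ≤ b n) ∧ (∀ n, ampSq d α n T ≤ ENNReal.ofReal (b n / n.factorial)) ∧
      Summable fun n => √(D ^ n * b n) := by
  have hγ : 0 < α - d + 2 := by linarith [ha.lower]
  obtain ⟨C, hC0, hC⟩ := exists_wave_bound ha
  set γ := α - d + 2
  set K := Real.exp T ^ 2 * C * T ^ γ
  have hK : 0 ≤ K := by positivity
  -- The ratios of consecutive terms of `D^n b n` tend to `D T K δ^γ`, which is below `1` for small
  -- `δ` because `γ > 0`. The denominator `n!` is kept apart from `b`: it will pay for the `n!` in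
  -- the norm of the multiple integral.
  obtain ⟨δ, hδ, hδ1, hlt⟩ : ∃ δ : ℝ, 0 < δ ∧ δ < 1 ∧ D * T * (K * δ ^ γ) < 1 := by
    have h1 : Tendsto (fun δ : ℝ => D * T * (K * δ ^ γ)) (𝓝[>] 0) (𝓝 (D * T * (K * 0 ^ γ))) := by
      refine Tendsto.mono_left ?_ nhdsWithin_le_nhds
      exact (((Real.continuousAt_rpow_const 0 γ (Or.inr hγ.le)).tendsto).const_mul _).const_mul _
    rw [Real.zero_rpow hγ.ne', mul_zero, mul_zero] at h1
    have h2 := h1.eventually (gt_mem_nhds (show (0 : ℝ) < 1 by norm_num))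
    have h3 : ∀ᶠ δ : ℝ in 𝓝[>] 0, δ ∈ Ioo (0 : ℝ) 1 := Ioo_mem_nhdsGT (by norm_num)
    obtain ⟨δ, hδ, hδ'⟩ := (h2.and h3).exists
    exact ⟨δ, hδ'.1, hδ'.2, hδ⟩
  have hr := ampRatio_nonneg (γ := γ) hK hδ hδ1
  refine ⟨fun n => T ^ n * ∏ k ∈ Finset.range n, ampRatio K γ δ k, fun n =>
    mul_nonneg (by positivity) (Finset.prod_nonneg fun k _ => hr k), fun n => ?_, ?_⟩
  · refine (ampSq_le hγ hC0 hC hδ hδ1 n hT le_rfl).trans_eq ?_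
    rw [mul_div_assoc]
  · set q := √(D * T * (K * δ ^ γ)) with hq
    have hq1 : q < 1 := by
      rw [hq, Real.sqrt_lt' one_pos]; simpa using hlt
    obtain ⟨r, hqr, hr1⟩ := exists_between hq1
    have hlim : Tendsto (fun n => √(D * T * ampRatio K γ δ n)) atTop (𝓝 q) :=
      (Real.continuous_sqrt.tendsto _).comp ((tendsto_ampRatio hδ hδ1).const_mul _)
    refine summable_of_ratio_norm_eventually_le hr1 ?_
    filter_upwards [hlim.eventually (gt_mem_nhds hqr)] with n hn
    rw [Real.norm_of_nonneg (Real.sqrt_nonneg _), Real.norm_of_nonneg (Real.sqrt_nonneg _)]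
    have e : D ^ (n + 1) * (T ^ (n + 1) * ∏ k ∈ Finset.range (n + 1), ampRatio K γ δ k) =
        (D * T * ampRatio K γ δ n) * (D ^ n * (T ^ n * ∏ k ∈ Finset.range n, ampRatio K γ δ k)) := by
      rw [Finset.prod_range_succ]; ring
    rw [e, Real.sqrt_mul (mul_nonneg (mul_nonneg hD hT) (hr n))]
    gcongr

theorem memLp_of_le_ampBound {n : ℕ} {T M b : ℝ} (hM : 0 ≤ M) (hb : 0 ≤ b)
    (h : ampSq d α n T ≤ ENNReal.ofReal b) {f : (Fin n → ℝ × Sp d) → ℂ}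
    (hf : AEStronglyMeasurable f (Measure.pi fun _ => lam d))
    (hle : ∀ z, ‖f z‖ ≤ M * ampBound α n z T) :
    ∃ hf : MemLp f 2 (Measure.pi fun _ => lam d), ‖hf.toLp‖ ≤ M * √b := by
  have h1 : eLpNorm f 2 (Measure.pi fun _ => lam d) ≤ ENNReal.ofReal (M * √b) := by
    have h2 : eLpNorm f 2 (Measure.pi fun _ => lam d) ^ (2 : ℝ) ≤
        ENNReal.ofReal (M * √b) ^ (2 : ℝ) := by
      rw [eLpNorm_eq_lintegral_rpow_enorm_toReal (by norm_num) (by norm_num)]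
      simp only [ENNReal.toReal_ofNat]
      rw [← ENNReal.rpow_mul]
      norm_num
      rw [← ENNReal.ofReal_pow (by positivity), mul_pow, Real.sq_sqrt hb,
        ENNReal.ofReal_mul (by positivity)]
      calc _ ≤ ∫⁻ z, ENNReal.ofReal (M ^ 2) * ENNReal.ofReal (ampBound α n z T ^ 2)
            ∂(Measure.pi fun _ : Fin n => lam d) := by
            refine lintegral_mono fun z => ?_
            rw [← ofReal_norm, ← ENNReal.ofReal_pow (norm_nonneg _),
              ← ENNReal.ofReal_mul (by positivity), ← mul_pow]
            exact ENNReal.ofReal_le_ofReal (pow_le_pow_left₀ (norm_nonneg _) (hle z) 2)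
        _ = ENNReal.ofReal (M ^ 2) * ampSq d α n T := by
            rw [lintegral_const_mul, ampSq]
            exact (((measurable_ampBound n).comp
              (measurable_id.prodMk measurable_const)).pow_const 2).ennreal_ofReal
        _ ≤ _ := by gcongr
    exact (ENNReal.rpow_le_rpow_iff (by norm_num)).1 h2
  have hmem : MemLp f 2 (Measure.pi fun _ => lam d) := ⟨hf, h1.trans_lt ENNReal.ofReal_lt_top⟩
  refine ⟨hmem, ?_⟩
  rw [Lp.norm_toLp f hmem]
  exact ENNReal.toReal_le_of_le_ofReal (by positivity) h1

end Amplitude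

/-! ### Dominated convergence in `L²` -/

section DominatedL2

variable {X : Type*} [MeasurableSpace X] {μ : Measure X}

theorem tendsto_toLp_of_dominated {ι : Type*} {l : Filter ι} [l.IsCountablyGenerated]
    {F : ι → X → ℂ} {f : X → ℂ} {g : X → ℝ} (hF : ∀ i, MemLp (F i) 2 μ) (hf : MemLp f 2 μ)
    (hg : MemLp g 2 μ) (hle : ∀ᶠ i in l, ∀ᵐ x ∂μ, ‖F i x‖ ≤ g x)
    (hlim : ∀ᵐ x ∂μ, Tendsto (fun i => F i x) l (𝓝 (f x))) :
    Tendsto (fun i => (hF i).toLp) l (𝓝 hf.toLp) := by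
  rw [Lp.tendsto_Lp_iff_tendsto_eLpNorm'']
  have e : ∀ i, eLpNorm (F i - f) 2 μ = (∫⁻ x, ‖F i x - f x‖ₑ ^ (2 : ℝ) ∂μ) ^ (1 / 2 : ℝ) := by
    intro i
    rw [eLpNorm_eq_lintegral_rpow_enorm_toReal (by norm_num) (by norm_num)]
    simp
  simp only [e]
  have hsum : MemLp (fun x => g x + ‖f x‖) 2 μ := hg.add hf.norm
  have hfin : ∫⁻ x, ‖g x + ‖f x‖‖ₑ ^ (2 : ℝ) ∂μ ≠ ⊤ := by
    have := lintegral_rpow_enorm_lt_top_of_eLpNorm_lt_top (by norm_num) (by norm_num) hsum.2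
    simpa using this.ne
  have h0 : Tendsto (fun i => ∫⁻ x, ‖F i x - f x‖ₑ ^ (2 : ℝ) ∂μ) l (𝓝 (∫⁻ _, 0 ∂μ)) := by
    refine tendsto_lintegral_filter_of_dominated_convergence' _ (Eventually.of_forall fun i =>
      (((hF i).1.sub hf.1).enorm.pow_const _)) ?_ hfin ?_
    · filter_upwards [hle] with i hi
      filter_upwards [hi] with x hx
      gcongr
      rw [enorm_le_iff_norm_le]
      refine (norm_sub_le _ _).trans ((add_le_add_left hx _).trans (le_abs_self _))
    · filter_upwards [hlim] with x hx
      have h1 : Tendsto (fun i => F i x - f x) l (𝓝 0) := by simpa using hx.sub_const (f x)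
      have h2 := (ENNReal.continuous_rpow_const (y := 2)).tendsto ‖(0 : ℂ)‖ₑ
      have h3 := h2.comp ((continuous_enorm.tendsto (0 : ℂ)).comp h1)
      simpa [Function.comp_def] using h3
  have h2 := ((ENNReal.continuous_rpow_const (y := 1 / 2)).tendsto _).comp h0
  simpa [Function.comp_def] using h2

end DominatedL2

/-! ### The kernels in the spectral space -/

section Kernel

variable {d : ℕ} {α H : ℝ}

theorem freqSum_refl {n : ℕ} (z : Fin n → ℝ × Sp d) : freqSum (refl z) = -freqSum z := by
  simp [freqSum, refl]

theorem waveMult_neg (t : ℝ) (ξ : Sp d) : waveMult t (-ξ) = waveMult t ξ := by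
  simp [waveMult]

theorem amp_refl : ∀ (n : ℕ) (z : Fin n → ℝ × Sp d) (t : ℝ), amp α n (refl z) t = amp α n z t
  | 0, _, _ => rfl
  | n + 1, z, t => by
    have h := amp_refl n (fun i => z i.castSucc) (z (Fin.last n)).1
    have h2 : (fun i : Fin n => refl z i.castSucc) = refl fun i => z i.castSucc := rfl
    have h3 : (refl z (Fin.last n)).1 = (z (Fin.last n)).1 := rfl
    have h4 : wt α (refl z (Fin.last n)) = wt α (z (Fin.last n)) := by simp [wt, refl]
    rw [amp, amp, freqSum_refl, waveMult_neg, h2, h3, h, h4]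

/-- The multiplier vanishes at time `0`, so the cutoff `z_n < t` produces no jump: it can be
replaced by the positive part of `t - z_n`. -/
theorem continuous_amp {n : ℕ} (z : Fin n → ℝ × Sp d) : Continuous (amp α n z) := by
  cases n with
  | zero => exact continuous_const
  | succ n =>
    have e : amp α (n + 1) z = fun t => if 0 < (z (Fin.last n)).1 then
        waveMult (max (t - (z (Fin.last n)).1) 0) (freqSum z) * wt α (z (Fin.last n)) *
          amp α n (fun i => z i.castSucc) (z (Fin.last n)).1 else 0 := by
      ext t
      rw [amp]
      by_cases h : 0 < (z (Fin.last n)).1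
      · by_cases h2 : (z (Fin.last n)).1 < t
        · rw [if_pos ⟨h, h2⟩, if_pos h, max_eq_left (by linarith)]
        · rw [if_neg (fun h3 => h2 h3.2), if_pos h, max_eq_right (by linarith), waveMult_zero]
          ring
      · rw [if_neg (fun h3 => h h3.1), if_neg h]
    rw [e]
    split_ifs
    · have : Continuous fun t : ℝ => waveMult (max (t - (z (Fin.last n)).1) 0) (freqSum z) :=
        continuous_waveMult.comp (g := fun p : ℝ × Sp d => waveMult p.1 p.2)
          (f := fun t => (max (t - (z (Fin.last n)).1) 0, freqSum z)) (by fun_prop)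
      fun_prop
    · exact continuous_const

/-- Each level of the recursion is evaluated at the time of the variable above it, so the nested
cutoffs together impose the ordering of all times. -/
theorem amp_eq_zero : ∀ (n : ℕ) (z : Fin n → ℝ × Sp d) {t : ℝ},
    ¬ (StrictMono (fun i => (z i).1) ∧ ∀ i, 0 < (z i).1 ∧ (z i).1 < t) → amp α n z t = 0
  | 0, _, _, h => (h ⟨fun i => i.elim0, fun i => i.elim0⟩).elim
  | n + 1, z, t, h => by
    rw [amp]
    split_ifs with h1
    · rw [amp_eq_zero n, mul_zero]
      rintro ⟨h2, h3⟩
      refine h ⟨?_, fun i => ?_⟩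
      · intro i j hij
        cases i using Fin.lastCases with
        | last => exact absurd hij (Fin.le_last j).not_gt
        | cast i =>
          cases j using Fin.lastCases with
          | last => exact (h3 i).2
          | cast j => exact h2 (Fin.castSucc_lt_castSucc_iff.1 hij)
      · cases i using Fin.lastCases with
        | last => exact h1
        | cast j => exact ⟨(h3 j).1, (h3 j).2.trans h1.2⟩
    · rfl

/-- The spectral transform of the kernel `f_n(·,t,x)`. -/
def fHat (α : ℝ) (n : ℕ) (t : ℝ) (x : Sp d) (z : Fin n → ℝ × Sp d) : ℂ :=
  amp α n z t * Complex.exp ((2 * Real.pi * ⟪x, freqSum z⟫ : ℝ) * Complex.I)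

theorem norm_fHat (n : ℕ) (t : ℝ) (x : Sp d) (z : Fin n → ℝ × Sp d) :
    ‖fHat α n t x z‖ = |amp α n z t| := by
  rw [fHat, norm_mul, norm_exp_ofReal_mul_I, mul_one, Complex.norm_real, Real.norm_eq_abs]

theorem norm_fHat_le {n : ℕ} {t T : ℝ} (h : t ≤ T) (x : Sp d) (z : Fin n → ℝ × Sp d) :
    ‖fHat α n t x z‖ ≤ ampBound α n z T := by
  rw [norm_fHat]
  exact (abs_amp_le n z t).trans (ampBound_mono z h)

theorem fHat_refl (n : ℕ) (t : ℝ) (x : Sp d) (z : Fin n → ℝ × Sp d) :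
    fHat α n t x (refl z) = (starRingEnd ℂ) (fHat α n t x z) := by
  rw [fHat, fHat, amp_refl, freqSum_refl, map_mul, Complex.conj_ofReal, ← Complex.exp_conj,
    map_mul, Complex.conj_ofReal, Complex.conj_I, inner_neg_right]
  congr 2
  push_cast
  ring

theorem measurable_fHat (n : ℕ) : Measurable fun p : (Fin n → ℝ × Sp d) × (ℝ × Sp d) =>
    fHat α n p.2.1 p.2.2 p.1 := by
  unfold fHat
  have h1 : Measurable fun p : (Fin n → ℝ × Sp d) × (ℝ × Sp d) => amp α n p.1 p.2.1 :=
    (measurable_amp n).comp (measurable_fst.prodMk measurable_snd.fst)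
  have h2 : Measurable fun p : (Fin n → ℝ × Sp d) × (ℝ × Sp d) => freqSum p.1 :=
    measurable_freqSum.comp measurable_fst
  fun_prop

theorem continuous_fHat {n : ℕ} (z : Fin n → ℝ × Sp d) :
    Continuous fun p : ℝ × Sp d => fHat α n p.1 p.2 z := by
  unfold fHat
  have h1 : Continuous fun p : ℝ × Sp d => amp α n z p.1 := (continuous_amp z).comp continuous_fst
  fun_prop

theorem measurable_fHat_right (n : ℕ) (t : ℝ) (x : Sp d) : Measurable (fHat (d := d) α n t x) :=
  (measurable_fHat n).comp (f := fun z => (z, (t, x))) (measurable_id.prodMk measurable_const)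

theorem ampSq_lt_top (ha : Admissible d α H) (n : ℕ) (t : ℝ) : ampSq d α n (max t 0) < ⊤ := by
  obtain ⟨b, -, h, -⟩ := exists_ampSq_bound ha (le_max_right t 0) (zero_le_one)
  exact (h n).trans_lt ENNReal.ofReal_lt_top

theorem ampSq_le_toReal (ha : Admissible d α H) (n : ℕ) (t : ℝ) :
    ampSq d α n (max t 0) ≤ ENNReal.ofReal (ampSq d α n (max t 0)).toReal := by
  rw [ENNReal.ofReal_toReal (ampSq_lt_top ha n t).ne]

theorem memLp_ampBound (ha : Admissible d α H) (n : ℕ) (t : ℝ) :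
    MemLp (fun z : Fin n → ℝ × Sp d => ampBound α n z t) 2 (Measure.pi fun _ => lam d) := by
  have hm : Measurable fun z : Fin n → ℝ × Sp d => ampBound α n z t :=
    (measurable_ampBound n).comp (measurable_id.prodMk measurable_const)
  obtain ⟨h, -⟩ := memLp_of_le_ampBound zero_le_one ENNReal.toReal_nonneg (ampSq_le_toReal ha n t)
    (f := fun z => (ampBound α n z t : ℂ))
    (Complex.measurable_ofReal.comp hm).aestronglyMeasurable fun z => by
      rw [Complex.norm_real, Real.norm_of_nonneg (ampBound_nonneg _ _ _), one_mul]
      exact ampBound_mono z (le_max_left _ _)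
  exact h.of_le hm.aestronglyMeasurable (Eventually.of_forall fun z => by simp)

theorem memLp_fHat (ha : Admissible d α H) (n : ℕ) (t : ℝ) (x : Sp d) :
    MemLp (fHat α n t x) 2 (Measure.pi fun _ => lam d) :=
  (memLp_ampBound ha n t).of_le (measurable_fHat_right n t x).aestronglyMeasurable
    (Eventually.of_forall fun z => (norm_fHat_le le_rfl x z).trans (le_abs_self _))

/-- The transform of the kernel `f_n(·,t,x)` as an element of the spectral space. -/
def fSpec (ha : Admissible d α H) (n : ℕ) (t : ℝ) (x : Sp d) : SpecL2 d n :=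
  (memLp_fHat ha n t x).toLp

theorem norm_fSpec_le (ha : Admissible d α H) {n : ℕ} {t T b : ℝ} (h : t ≤ T) (hb : 0 ≤ b)
    (hT : ampSq d α n T ≤ ENNReal.ofReal b) (x : Sp d) : ‖fSpec ha n t x‖ ≤ √b := by
  obtain ⟨h1, h2⟩ := memLp_of_le_ampBound zero_le_one hb hT
    (measurable_fHat_right n t x).aestronglyMeasurable fun z => by
      rw [one_mul]; exact norm_fHat_le h x z
  rw [one_mul] at h2
  exact h2

/-- Pointwise continuity, dominated near `p` by the bound at the later time `p.1 + 1`. -/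
theorem continuous_fSpec (ha : Admissible d α H) (n : ℕ) :
    Continuous fun p : ℝ × Sp d => fSpec ha n p.1 p.2 := by
  rw [continuous_iff_continuousAt]
  intro p
  refine tendsto_toLp_of_dominated (fun q : ℝ × Sp d => memLp_fHat ha n q.1 q.2) _
    (memLp_ampBound ha n (p.1 + 1)) ?_ ?_
  · have : ∀ᶠ q : ℝ × Sp d in 𝓝 p, q.1 < p.1 + 1 :=
      continuous_fst.continuousAt.eventually (gt_mem_nhds (by linarith))
    filter_upwards [this] with q hq
    exact Eventually.of_forall fun z => norm_fHat_le hq.le q.2 z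
  · exact Eventually.of_forall fun z => (continuous_fHat z).tendsto p

theorem fSpec_mem_closure (ha : Admissible d α H) (n : ℕ) (t : ℝ) (x : Sp d) :
    fSpec ha n t x ∈ closure (range (ha.hat n)) :=
  mem_closure_range_hatL ha.pos ha.upper (memLp_fHat ha n t x) (fHat_refl n t x)

theorem fSpec_supp (ha : Admissible d α H) (n : ℕ) (t : ℝ) (x : Sp d) :
    ∀ᵐ z ∂(Measure.pi fun _ => lam d), ¬ (∀ i, (z i).1 ≤ t) → fSpec ha n t x z = 0 := by
  filter_upwards [(memLp_fHat ha n t x).coeFn_toLp] with z hz h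
  rw [fSpec, hz, fHat, amp_eq_zero n z fun h2 => h fun i => (h2.2 i).2.le]
  simp

end Kernel

/-! ### Partial Fourier transforms of test functions -/

section TestTransform

variable {d : ℕ} {α : ℝ}

/-- The Fourier transform of a real function. -/
def ftR (f : Sp d → ℝ) : Sp d → ℂ := 𝓕 fun y => (f y : ℂ)

theorem ftR_eq (f : Sp d → ℝ) (ξ : Sp d) :
    ftR f ξ = ∫ y, Complex.exp ((-2 * Real.pi * ⟪y, ξ⟫ : ℝ) * Complex.I) * f y := by
  rw [ftR, Real.fourier_eq']
  simp only [smul_eq_mul]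

theorem ftR_neg (f : Sp d → ℝ) (ξ : Sp d) : ftR f (-ξ) = (starRingEnd ℂ) (ftR f ξ) := by
  rw [ftR_eq, ftR_eq, ← integral_conj]
  congr 1 with y
  rw [map_mul, Complex.conj_ofReal, ← Complex.exp_conj, map_mul, Complex.conj_ofReal,
    Complex.conj_I, inner_neg_right]
  congr 2
  push_cast
  ring

/-- Smooth compactly supported functions as Schwartz functions. -/
def toSchwartzR {f : Sp d → ℝ} (h1 : ContDiff ℝ (⊤ : ℕ∞) f) (h2 : HasCompactSupport f) :
    SchwartzMap (Sp d) ℂ :=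
  HasCompactSupport.toSchwartzMap (f := fun y => (f y : ℂ))
    (h2.comp_left (g := fun x : ℝ => (x : ℂ)) Complex.ofReal_zero)
    (Complex.ofRealCLM.contDiff.comp h1)

theorem ftR_eq_schwartz {f : Sp d → ℝ} (h1 : ContDiff ℝ (⊤ : ℕ∞) f) (h2 : HasCompactSupport f) :
    ftR f = ⇑(𝓕 (toSchwartzR h1 h2) : SchwartzMap (Sp d) ℂ) := by
  rw [SchwartzMap.fourier_coe]
  rfl

theorem integrable_ftR {f : Sp d → ℝ} (h1 : ContDiff ℝ (⊤ : ℕ∞) f) (h2 : HasCompactSupport f) :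
    Integrable (ftR f) := by
  rw [ftR_eq_schwartz h1 h2]
  exact SchwartzMap.integrable _

theorem continuous_ftR {f : Sp d → ℝ} (h1 : ContDiff ℝ (⊤ : ℕ∞) f) (h2 : HasCompactSupport f) :
    Continuous (ftR f) := by
  rw [ftR_eq_schwartz h1 h2]
  exact SchwartzMap.continuous _

theorem integrable_ofReal_test {f : Sp d → ℝ} (h1 : ContDiff ℝ (⊤ : ℕ∞) f)
    (h2 : HasCompactSupport f) : Integrable fun y => (f y : ℂ) :=
  SchwartzMap.integrable (toSchwartzR h1 h2)

theorem IsTest.contDiff_slice {φ : ℝ × Sp d → ℝ} (hφ : IsTest φ) (s : ℝ) :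
    ContDiff ℝ (⊤ : ℕ∞) fun y => φ (s, y) :=
  hφ.1.comp (contDiff_const.prodMk contDiff_id)

theorem IsTest.exists_bound {φ : ℝ × Sp d → ℝ} (hφ : IsTest φ) :
    ∃ R : ℝ, 0 ≤ R ∧ ∀ s y, R < |s| ∨ R < ‖y‖ → φ (s, y) = 0 := by
  obtain ⟨R, hR⟩ := hφ.2.isCompact.isBounded.subset_closedBall (0 : ℝ × Sp d)
  refine ⟨max R 0, le_max_right _ _, fun s y h => ?_⟩
  by_contra hne
  have h1 := hR (subset_tsupport _ (Function.mem_support.2 hne))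
  rw [mem_closedBall_zero_iff, Prod.norm_def, max_le_iff, Real.norm_eq_abs] at h1
  have := le_max_left R 0
  rcases h with h | h
  · linarith [h1.1]
  · simp only at h1; linarith [h1.2]

theorem IsTest.hasCompactSupport_slice {φ : ℝ × Sp d → ℝ} (hφ : IsTest φ) (s : ℝ) :
    HasCompactSupport fun y => φ (s, y) := by
  obtain ⟨R, _, hR⟩ := hφ.exists_bound
  refine HasCompactSupport.intro (isCompact_closedBall (0 : Sp d) R) fun y hy => hR s y (Or.inr ?_)
  simpa using hy

/-- The partial Fourier transform in space of a test function. -/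
def sliceHat (φ : ℝ × Sp d → ℝ) (z : ℝ × Sp d) : ℂ := ftR (fun y => φ (z.1, y)) z.2

theorem IsTest.measurable_sliceHat {φ : ℝ × Sp d → ℝ} (hφ : IsTest φ) :
    Measurable (sliceHat φ) := by
  have : sliceHat φ = fun z : ℝ × Sp d =>
      ∫ y, Complex.exp ((-2 * Real.pi * ⟪y, z.2⟫ : ℝ) * Complex.I) * φ (z.1, y) :=
    funext fun z => ftR_eq _ _
  rw [this]
  have hc := hφ.1.continuous
  have h : Continuous fun p : (ℝ × Sp d) × Sp d =>
      Complex.exp ((-2 * Real.pi * ⟪p.2, p.1.2⟫ : ℝ) * Complex.I) * φ (p.1.1, p.2) := by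
    fun_prop
  exact (h.stronglyMeasurable.integral_prod_right (f := fun (z : ℝ × Sp d) (y : Sp d) =>
    Complex.exp ((-2 * Real.pi * ⟪y, z.2⟫ : ℝ) * Complex.I) * φ (z.1, y))).measurable

/-- A slice is the composition of `φ` with an affine embedding whose linear part has norm at most
`1`, so a global bound on the derivatives of `φ` serves for all times. -/
theorem IsTest.exists_iteratedFDeriv_slice_le {φ : ℝ × Sp d → ℝ} (hφ : IsTest φ) (k : ℕ) :
    ∃ C : ℝ, 0 ≤ C ∧ ∀ s y, ‖iteratedFDeriv ℝ k (fun y => (φ (s, y) : ℂ)) y‖ ≤ C := by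
  have h1 : ContDiff ℝ (⊤ : ℕ∞) fun p : ℝ × Sp d => (φ p : ℂ) :=
    Complex.ofRealCLM.contDiff.comp hφ.1
  have h2 : HasCompactSupport fun p : ℝ × Sp d => (φ p : ℂ) :=
    hφ.2.comp_left (g := fun x : ℝ => (x : ℂ)) Complex.ofReal_zero
  obtain ⟨C, hC⟩ := (h1.continuous_iteratedFDeriv (m := k)
    (by exact_mod_cast le_top)).bounded_above_of_compact_support (h2.iteratedFDeriv k)
  refine ⟨max C 0, le_max_right _ _, fun s y => ?_⟩
  have e : (fun y => (φ (s, y) : ℂ)) =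
      (fun p : ℝ × Sp d => (φ ((s, 0) + p) : ℂ)) ∘ ContinuousLinearMap.inr ℝ ℝ (Sp d) := by
    ext y; simp
  have h4 : ContDiff ℝ (⊤ : ℕ∞) fun p : ℝ × Sp d => (φ ((s, 0) + p) : ℂ) :=
    h1.comp (contDiff_const.add contDiff_id)
  rw [e, ContinuousLinearMap.iteratedFDeriv_comp_right _ h4 y (i := k) (by exact_mod_cast le_top),
    iteratedFDeriv_comp_add_left (f := fun p : ℝ × Sp d => (φ p : ℂ))]
  refine (ContinuousMultilinearMap.norm_compContinuousLinearMap_le _ _).trans ?_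
  rw [Finset.prod_const]
  have h3 : ‖ContinuousLinearMap.inr ℝ ℝ (Sp d)‖ ≤ 1 :=
    ContinuousLinearMap.norm_inr_le_one ℝ ℝ (Sp d)
  calc _ ≤ max C 0 * 1 ^ _ := by
        gcongr
        exact (hC _).trans (le_max_left _ _)
    _ = _ := by simp

/-- Each power of the frequency costs a derivative in space. The constant is uniform in time because
the derivatives of the slices are uniformly bounded and all slices live in one ball of radius `R`.
-/
theorem IsTest.exists_pow_mul_sliceHat_le {φ : ℝ × Sp d → ℝ} (hφ : IsTest φ) (k : ℕ) :
    ∃ C : ℝ, 0 ≤ C ∧ ∀ z, ‖z.2‖ ^ k * ‖sliceHat φ z‖ ≤ C := by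
  obtain ⟨R, hR0, hR⟩ := hφ.exists_bound
  choose C hC0 hC using fun j => hφ.exists_iteratedFDeriv_slice_le j
  refine ⟨2 ^ k * ∑ j ∈ Finset.range (k + 1), C j * volume.real (Metric.closedBall (0 : Sp d) R),
    by
      have := fun j => mul_nonneg (hC0 j) (measureReal_nonneg (μ := volume)
        (s := Metric.closedBall (0 : Sp d) R))
      exact mul_nonneg (by positivity) (Finset.sum_nonneg fun j _ => this j), fun z => ?_⟩
  have hsm : ContDiff ℝ (⊤ : ℕ∞) fun y => (φ (z.1, y) : ℂ) :=
    Complex.ofRealCLM.contDiff.comp (hφ.contDiff_slice z.1)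
  have hcs : HasCompactSupport fun y => (φ (z.1, y) : ℂ) :=
    (hφ.hasCompactSupport_slice z.1).comp_left (g := fun x : ℝ => (x : ℂ)) Complex.ofReal_zero
  have hcont : ∀ j : ℕ, Continuous (iteratedFDeriv ℝ j fun y => (φ (z.1, y) : ℂ)) := fun j =>
    hsm.continuous_iteratedFDeriv (by exact_mod_cast le_top)
  have h := Real.pow_mul_norm_iteratedFDeriv_fourier_le (K := 0) (N := k)
    (f := fun y => (φ (z.1, y) : ℂ)) (k := 0) (n := k) (hsm.of_le (by exact_mod_cast le_top))
    (fun i j _ _ => by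
      refine Continuous.integrable_of_hasCompactSupport
        ((continuous_norm.pow i).mul (hcont j).norm) ?_
      exact (hcs.iteratedFDeriv j).norm.mul_left) le_rfl le_rfl z.2
  rw [norm_iteratedFDeriv_zero] at h
  refine h.trans ?_
  simp only [zero_add, Finset.range_one, Finset.singleton_product,
    Finset.sum_map, Function.Embedding.coeFn_mk, pow_zero, one_mul, Nat.cast_zero, mul_zero]
  gcongr with j hj
  have hs : ∀ y, y ∉ Metric.closedBall (0 : Sp d) R →
      ‖iteratedFDeriv ℝ j (fun y => (φ (z.1, y) : ℂ)) y‖ = 0 := by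
    intro y hy
    rw [norm_eq_zero]
    have : y ∉ tsupport fun y => (φ (z.1, y) : ℂ) := fun h => hy (by
      refine closure_minimal (fun w hw => ?_) Metric.isClosed_closedBall h
      by_contra hne
      refine hw ?_
      simp only [Complex.ofReal_eq_zero]
      exact hR _ _ (Or.inr (by simpa using hne)))
    exact image_eq_zero_of_notMem_tsupport fun h => this (tsupport_iteratedFDeriv_subset j h)
  rw [← setIntegral_eq_integral_of_forall_compl_eq_zero hs]
  refine (Real.le_norm_self _).trans ?_
  refine norm_setIntegral_le_of_norm_le_const measure_closedBall_lt_top fun y _ => ?_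
  rw [norm_norm]
  exact hC j _ _

theorem IsTest.exists_sliceHat_le {φ : ℝ × Sp d → ℝ} (hφ : IsTest φ) (N : ℕ) :
    ∃ C : ℝ, 0 ≤ C ∧ ∀ z, ‖sliceHat φ z‖ ≤ C * (1 + ‖z.2‖) ^ (-(N : ℝ)) := by
  obtain ⟨C0, hC0, h0⟩ := hφ.exists_pow_mul_sliceHat_le 0
  obtain ⟨C1, hC1, h1⟩ := hφ.exists_pow_mul_sliceHat_le N
  refine ⟨2 ^ (N - 1) * (C0 + C1), by positivity, fun z => ?_⟩
  have h2 := h0 z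
  have h3 := h1 z
  rw [pow_zero, one_mul] at h2
  rw [Real.rpow_neg (by positivity), Real.rpow_natCast, ← div_eq_mul_inv, le_div_iff₀ (by positivity)]
  have h4 := add_pow_le zero_le_one (norm_nonneg z.2) N
  rw [one_pow] at h4
  calc ‖sliceHat φ z‖ * (1 + ‖z.2‖) ^ N ≤ ‖sliceHat φ z‖ * (2 ^ (N - 1) * (1 + ‖z.2‖ ^ N)) := by
        gcongr
    _ = 2 ^ (N - 1) * (‖sliceHat φ z‖ + ‖z.2‖ ^ N * ‖sliceHat φ z‖) := by ring
    _ ≤ _ := by gcongr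

/-- The function representing the action of a test function in the spectral space. -/
def testHat (α : ℝ) (φ : ℝ × Sp d → ℝ) (z : ℝ × Sp d) : ℂ := sliceHat φ z / wt α z

theorem IsTest.measurable_testHat {φ : ℝ × Sp d → ℝ} (hφ : IsTest φ) :
    Measurable (testHat α φ) :=
  hφ.measurable_sliceHat.div (Complex.measurable_ofReal.comp (measurable_wt α))

theorem IsTest.memLp_testHat (h0 : 0 < α) (hd : α < d) {φ : ℝ × Sp d → ℝ} (hφ : IsTest φ) :
    MemLp (testHat α φ) 2 (lam d) := by
  obtain ⟨R, hR0, hR⟩ := hφ.exists_bound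
  -- Of these `2d + 1` powers, `d` absorb the factor `‖ξ‖^{α/2}` coming from division by the weight,
  -- and `d + 1` remain for square integrability.
  obtain ⟨C, hC0, hC⟩ := hφ.exists_sliceHat_le (2 * d + 1)
  have h1 : MemLp ((Iic R).indicator fun _ : ℝ => (1 : ℂ)) 2 (volume.restrict (Ioi (0 : ℝ))) := by
    refine (memLp_indicator_iff_restrict measurableSet_Iic).2 ?_
    have : IsFiniteMeasure ((volume.restrict (Ioi (0 : ℝ))).restrict (Iic R)) := by
      rw [Measure.restrict_restrict measurableSet_Iic, Iic_inter_Ioi]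
      infer_instance
    exact memLp_const _
  have h2 : MemLp (fun ζ : Sp d => (((1 + ‖ζ‖) ^ (-((d : ℝ) + 1)) : ℝ) : ℂ)) 2 := by
    have hm : Measurable (fun ζ : Sp d => (((1 + ‖ζ‖) ^ (-((d : ℝ) + 1)) : ℝ) : ℂ)) :=
      Complex.measurable_ofReal.comp (by fun_prop)
    refine (memLp_two_iff_integrable_sq_norm hm.aestronglyMeasurable).2 ?_
    have e : (fun ζ : Sp d => ‖(((1 + ‖ζ‖) ^ (-((d : ℝ) + 1)) : ℝ) : ℂ)‖ ^ 2) =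
        fun ζ => (1 + ‖ζ‖) ^ (-(2 * ((d : ℝ) + 1))) := by
      ext ζ
      rw [Complex.norm_real, Real.norm_of_nonneg (by positivity), ← Real.rpow_natCast,
        ← Real.rpow_mul (by positivity)]
      congr 1
      push_cast; ring
    rw [e]
    exact integrable_one_add_norm (by rw [finrank_Sp]; linarith [Nat.cast_nonneg (α := ℝ) d])
  refine ((memLp_mul_prod h1 h2).const_mul (C : ℂ)).of_le hφ.measurable_testHat.aestronglyMeasurable
    ?_
  have hpos : ∀ᵐ z ∂(lam d), (0 : ℝ) < z.1 := by
    have : ∀ᵐ s : ℝ ∂(volume.restrict (Ioi (0 : ℝ))), s ∈ Ioi (0 : ℝ) :=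
      ae_restrict_mem measurableSet_Ioi
    exact Measure.quasiMeasurePreserving_fst.ae this
  filter_upwards [hpos] with z hz
  by_cases hzR : z.1 ≤ R
  · rw [indicator_of_mem (show z.1 ∈ Iic R from hzR), one_mul, ← Complex.ofReal_mul, Complex.norm_real,
      Real.norm_of_nonneg (by positivity), testHat, norm_div, Complex.norm_real,
      Real.norm_of_nonneg (wt_nonneg _ _), wt, Real.rpow_neg (norm_nonneg _)]
    have h3 : ‖z.2‖ ^ (α / 2) ≤ (1 + ‖z.2‖) ^ (d : ℝ) :=
      (Real.rpow_le_rpow (norm_nonneg _) (by linarith) (by linarith)).trans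
        (Real.rpow_le_rpow_of_exponent_le (by linarith [norm_nonneg z.2]) (by linarith))
    have h4 : 1 ≤ Real.exp z.1 := Real.one_le_exp hz.le
    calc ‖sliceHat φ z‖ / (Real.exp z.1 * (‖z.2‖ ^ (α / 2))⁻¹)
        = (Real.exp z.1)⁻¹ * (‖sliceHat φ z‖ * ‖z.2‖ ^ (α / 2)) := by
          rw [div_eq_mul_inv, mul_inv, inv_inv]; ring
      _ ≤ 1 * ((C * (1 + ‖z.2‖) ^ (-((2 * d + 1 : ℕ) : ℝ))) * (1 + ‖z.2‖) ^ (d : ℝ)) := by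
          gcongr
          · exact inv_le_one_of_one_le₀ h4
          · exact hC z
      _ = C * (1 + ‖z.2‖) ^ (-((d : ℝ) + 1)) := by
          rw [one_mul, mul_assoc, ← Real.rpow_add (by positivity)]
          congr 2
          push_cast
          ring
  · have : sliceHat φ z = 0 := by
      rw [sliceHat, ftR_eq]
      refine integral_eq_zero_of_ae (Eventually.of_forall fun y => ?_)
      simp [hR z.1 y (Or.inl ((not_le.1 hzR).trans_le (le_abs_self _)))]
    rw [testHat, this]
    simp
    positivity

/-- Parseval's identity between a Schwartz function and an integrable indicator: `f` is written as
the transform of its inverse transform, and the transform is moved to the indicator. -/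
theorem setIntegral_test_eq {f : Sp d → ℝ} (h1 : ContDiff ℝ (⊤ : ℕ∞) f) (h2 : HasCompactSupport f)
    {A : Set (Sp d)} (hA : MeasurableSet A) (hb : Bornology.IsBounded A) :
    ((∫ y in A, f y : ℝ) : ℂ) = ∫ ξ, indHat A ξ * ftR f ξ := by
  have h := VectorFourier.integral_fourierIntegral_smul_eq_flip (L := innerₗ (Sp d))
    Real.continuous_fourierChar continuous_inner (μ := volume) (ν := volume)
    (𝓕⁻ (toSchwartzR h1 h2)).integrable (integrable_indicator_one hA hb)
  have e1 : VectorFourier.fourierIntegral Real.fourierChar volume (innerₗ (Sp d))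
      (⇑(𝓕⁻ (toSchwartzR h1 h2) : SchwartzMap (Sp d) ℂ)) = fun v => (f v : ℂ) := by
    have h2 : (⇑(𝓕 (𝓕⁻ (toSchwartzR h1 h2) : SchwartzMap (Sp d) ℂ) : SchwartzMap (Sp d) ℂ)) =
        fun v => (f v : ℂ) := by
      rw [FourierTransform.fourier_fourierInv_eq]; rfl
    rw [SchwartzMap.fourier_coe] at h2
    exact h2
  have e2 : VectorFourier.fourierIntegral Real.fourierChar volume (innerₗ (Sp d)).flip
      (A.indicator fun _ : Sp d => (1 : ℂ)) = 𝓕 (A.indicator fun _ : Sp d => (1 : ℂ)) := by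
    rw [flip_innerₗ]; rfl
  have e3 : ∀ ξ, (𝓕⁻ (toSchwartzR h1 h2) : SchwartzMap (Sp d) ℂ) ξ = ftR f (-ξ) := by
    intro ξ
    rw [SchwartzMap.fourierInv_coe, Real.fourierInv_eq_fourier_neg]
    rfl
  have e4 : ∀ ξ, 𝓕 (A.indicator fun _ : Sp d => (1 : ℂ)) ξ = indHat A (-ξ) := by
    intro ξ
    rw [indHat, Real.fourierInv_eq_fourier_neg, neg_neg]
  rw [e1, e2] at h
  rw [← integral_complex_ofReal, ← integral_indicator hA,
    ← integral_neg_eq_self fun ξ => indHat A ξ * ftR f ξ]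
  refine Eq.trans ?_ (h.trans ?_)
  · congr 1 with p
    by_cases hp : p ∈ A <;> simp [indicator, hp]
  · congr 1 with ξ
    rw [e3, e4, smul_eq_mul, mul_comm]

/-- The action of an indicator function on a test function, in the spectral space. -/
theorem integral_rect_test (h0 : 0 < α) (hd : α < d) {φ : ℝ × Sp d → ℝ} (hφ : IsTest φ)
    (R : Rect d) :
    ((∫ z in R.toSet, φ z : ℝ) : ℂ) = ∫ z, rectHat α R z * testHat α φ z ∂(lam d) := by
  have := nontrivial_Sp h0 hd
  rw [integral_prod _ (integrable_mul_of_memLp (memLp_rectHat h0 hd R) (hφ.memLp_testHat h0 hd))]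
  have hi : Integrable φ := by
    exact hφ.1.continuous.integrable_of_hasCompactSupport hφ.2
  rw [Rect.toSet, Measure.volume_eq_prod, setIntegral_prod _ (by
    rw [← Measure.volume_eq_prod]; exact hi.integrableOn), integral_Icc_eq_integral_Ioc,
    ← integral_complex_ofReal, ← integral_indicator measurableSet_Ioc,
    ← integral_indicator measurableSet_Ioi]
  congr 1 with s
  by_cases h1 : s ∈ Ioi (0 : ℝ)
  · rw [indicator_of_mem h1]
    have e : ∀ᵐ ζ : Sp d, rectHat α R (s, ζ) * testHat α φ (s, ζ) =
        (Iic R.time).indicator 1 s * (indHat R.base ζ * ftR (fun y => φ (s, y)) ζ) := by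
      filter_upwards [Measure.ae_ne volume (0 : Sp d)] with ζ hζ
      have hn : ((‖ζ‖ ^ (-(α / 2)) : ℝ) : ℂ) ≠ 0 := by
        have := norm_pos_iff.2 hζ
        exact_mod_cast (by positivity : (0 : ℝ) < ‖ζ‖ ^ (-(α / 2))).ne'
      have he : ((Real.exp s : ℝ) : ℂ) ≠ 0 := by exact_mod_cast (Real.exp_pos s).ne'
      simp only [rectHat, testHat, sliceHat, wt]
      by_cases h2 : s ∈ Iic R.time
      · simp only [indicator_of_mem h2, Pi.one_apply, Complex.ofReal_mul]
        field_simp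
      · simp only [indicator_of_notMem h2]
        simp
    rw [integral_congr_ae e, integral_const_mul, ← setIntegral_test_eq (hφ.contDiff_slice s)
      (hφ.hasCompactSupport_slice s) R.measurable_base R.bounded_base]
    by_cases h2 : s ∈ Iic R.time
    · rw [indicator_of_mem h2, indicator_of_mem (show s ∈ Ioc 0 R.time from ⟨h1, h2⟩)]
      simp
    · rw [indicator_of_notMem h2, indicator_of_notMem fun h => h2 h.2]
      simp
  · rw [indicator_of_notMem h1, indicator_of_notMem fun h => h1 h.1]

theorem memLp_prod_testHat (h0 : 0 < α) (hd : α < d) {n : ℕ} {φ : Fin n → ℝ × Sp d → ℝ}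
    (hφ : ∀ i, IsTest (φ i)) :
    MemLp (fun z : Fin n → ℝ × Sp d => ∏ i, testHat α (φ i) (z i)) 2 (Measure.pi fun _ => lam d) :=
  memLp_prod_pi fun i => (hφ i).memLp_testHat h0 hd

/-- The action of an elementary function on test functions, in the spectral space. -/
theorem action_eq_integral {H : ℝ} (ha : Admissible d α H) {n : ℕ} (e : Elem d n)
    {φ : Fin n → ℝ × Sp d → ℝ} (hφ : ∀ i, IsTest (φ i)) :
    ((e.action φ : ℝ) : ℂ) = ∫ z, ha.hat n e z * ∏ i, testHat α (φ i) (z i)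
      ∂(Measure.pi fun _ => lam d) := by
  have h1 : ∫ z, ha.hat n e z * ∏ i, testHat α (φ i) (z i) ∂(Measure.pi fun _ => lam d) =
      ∫ z, ∑ R ∈ e.support, (e R : ℂ) * (rectsHat α R z * ∏ i, testHat α (φ i) (z i))
        ∂(Measure.pi fun _ => lam d) := by
    refine integral_congr_ae ?_
    filter_upwards [coeFn_hatL ha e] with z hz
    rw [hz, Finsupp.sum, Finset.sum_mul]
    simp only [mul_assoc]
  rw [h1, integral_finsetSum _ fun R _ => (integrable_mul_of_memLp
    (memLp_rectsHat ha.pos ha.upper R) (memLp_prod_testHat ha.pos ha.upper hφ)).const_mul _,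
    Elem.action, Finsupp.sum]
  push_cast
  refine Finset.sum_congr rfl fun R _ => ?_
  rw [integral_const_mul]
  congr 1
  simp only [rectsHat, ← Finset.prod_mul_distrib]
  rw [integral_fintype_prod_eq_prod (fun i z => rectHat α (R i) z * testHat α (φ i) z)]
  exact Finset.prod_congr rfl fun i _ => integral_rect_test ha.pos ha.upper (hφ i) (R i)

end TestTransform

/-! ### Wave convolutions as Fourier integrals -/

section WaveConv

variable {d : ℕ} {α H : ℝ}

/-- The character `r ↦ e^{2π i r}`. -/
def chr (r : ℝ) : ℂ := Complex.exp ((2 * Real.pi * r : ℝ) * Complex.I)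

theorem norm_chr (r : ℝ) : ‖chr r‖ = 1 := norm_exp_ofReal_mul_I _

theorem chr_add (r s : ℝ) : chr (r + s) = chr r * chr s := by
  rw [chr, chr, chr, ← Complex.exp_add]
  congr 1
  push_cast
  ring

theorem conj_chr (r : ℝ) : (starRingEnd ℂ) (chr r) = chr (-r) := by
  rw [chr, chr, ← Complex.exp_conj, map_mul, Complex.conj_ofReal, Complex.conj_I]
  congr 1
  push_cast
  ring

theorem continuous_chr : Continuous chr := by
  unfold chr
  fun_prop

theorem ftR_eq_chr (f : Sp d → ℝ) (ξ : Sp d) : ftR f ξ = ∫ y, chr (-⟪y, ξ⟫) * f y := by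
  rw [ftR_eq]
  simp only [chr]
  congr 1 with y
  congr 4
  ring

theorem fHat_eq_chr (n : ℕ) (t : ℝ) (x : Sp d) (z : Fin n → ℝ × Sp d) :
    fHat α n t x z = amp α n z t * chr ⟪x, freqSum z⟫ := rfl

/-- The convolution with the wave kernel as a Fourier integral. -/
theorem waveConv_coe (t : ℝ) (g : Sp d → ℝ) (x : Sp d) :
    (waveConv t g x : ℂ) = ∫ ξ, chr ⟪ξ, x⟫ * (waveMult t ξ * ftR g ξ) := by
  have h1 : 𝓕⁻ (fun ξ : Sp d => ((t * Real.sinc (2 * Real.pi * t * ‖ξ‖) : ℝ) : ℂ) *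
      𝓕 (fun y : Sp d => (g y : ℂ)) ξ) x = ∫ ξ, chr ⟪ξ, x⟫ * (waveMult t ξ * ftR g ξ) := by
    rw [Real.fourierInv_eq']
    rfl
  rw [waveConv, h1]
  refine Complex.conj_eq_iff_re.1 ?_
  rw [← integral_conj, ← integral_neg_eq_self]
  congr 1 with ξ
  rw [map_mul, conj_chr, map_mul, Complex.conj_ofReal, ← ftR_neg, neg_neg, waveMult_neg,
    inner_neg_left, neg_neg]

theorem abs_waveMult_le_self {t : ℝ} (ht : 0 ≤ t) (ξ : Sp d) : |waveMult t ξ| ≤ t := by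
  rw [waveMult, abs_mul, abs_of_nonneg ht]
  exact mul_le_of_le_one_right ht (Real.abs_sinc_le_one _)

theorem wt_zero (z : ℝ × Sp d) : wt 0 z = Real.exp z.1 := by simp [wt]

/-- Setting `α = 0` removes the Riesz weight from `amp`. At fixed times the amplitude is then
bounded in the frequencies, and the rapid decay of the test functions gives integrability. -/
theorem abs_amp_zero_le : ∀ (n : ℕ) (z : Fin n → ℝ × Sp d) {t T : ℝ}, t ≤ T → 0 ≤ T →
    |amp 0 n z t| ≤ T ^ n * ∏ i, Real.exp (z i).1
  | 0, _, _, _, _, _ => by simp [amp]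
  | n + 1, z, t, T, h, hT => by
    rw [amp]
    split_ifs with h1
    · have h2 := abs_amp_zero_le n (fun i => z i.castSucc) (h1.2.le.trans h) hT
      have h3 : |waveMult (t - (z (Fin.last n)).1) (freqSum z)| ≤ T :=
        (abs_waveMult_le_self (by linarith) _).trans (by linarith)
      rw [abs_mul, abs_mul, wt_zero, abs_of_pos (Real.exp_pos _), Fin.prod_univ_castSucc]
      calc _ ≤ T * Real.exp (z (Fin.last n)).1 *
            (T ^ n * ∏ i : Fin n, Real.exp (z i.castSucc).1) := by gcongr
        _ = _ := by ring
    · rw [abs_zero]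
      positivity

theorem amp_eq_amp_zero : ∀ (n : ℕ) (z : Fin n → ℝ × Sp d) (t : ℝ),
    amp α n z t = amp 0 n z t * ∏ i, ‖(z i).2‖ ^ (-(α / 2))
  | 0, _, _ => by simp [amp]
  | n + 1, z, t => by
    rw [amp, amp]
    split_ifs with h1
    · rw [amp_eq_amp_zero n, Fin.prod_univ_castSucc, wt_zero, wt]
      ring
    · rw [zero_mul]

end WaveConv

/-! ### The kernel at fixed times -/

section FixedTimes

variable {d : ℕ} {α H : ℝ}

/-- The transform of `f_n` at fixed times, tested against functions of the space variables. -/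
def fixedHat {n : ℕ} (τ : Fin n → ℝ) (f : Fin n → Sp d → ℝ) (t : ℝ) (ξ : Fin n → Sp d) : ℂ :=
  amp 0 n (fun i => (τ i, ξ i)) t * ∏ i, (ftR (f i) (ξ i) / Real.exp (τ i))

theorem integrable_fixedHat {n : ℕ} (τ : Fin n → ℝ) {f : Fin n → Sp d → ℝ}
    (h1 : ∀ i, ContDiff ℝ (⊤ : ℕ∞) (f i)) (h2 : ∀ i, HasCompactSupport (f i)) (t : ℝ) :
    Integrable (fixedHat τ f t) := by
  have hp : Integrable (fun ξ : Fin n → Sp d => ∏ i, (ftR (f i) (ξ i) / Real.exp (τ i))) := by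
    rw [volume_pi]
    exact Integrable.fintype_prod (f := fun i ζ => ftR (f i) ζ / (Real.exp (τ i) : ℂ))
      fun i => (integrable_ftR (h1 i) (h2 i)).div_const _
  refine hp.bdd_mul (c := (max t 0) ^ n * ∏ i, Real.exp (τ i)) ?_ (Eventually.of_forall fun ξ => ?_)
  · exact (Complex.measurable_ofReal.comp ((measurable_amp n).comp
      (f := fun ξ : Fin n → Sp d => ((fun i => (τ i, ξ i)), t)) (by fun_prop))).aestronglyMeasurable
  · rw [Complex.norm_real]
    exact abs_amp_zero_le n _ (le_max_left _ _) (le_max_right _ _)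

/-- Multiplying by a superposition of characters superposes translates of the transform; Fubini
applies because `A` and `f` are integrable and characters have modulus `1`. -/
theorem ftR_mul_chr {n : ℕ} {A : (Fin n → Sp d) → ℂ} (hA : Integrable A) {f h : Sp d → ℝ}
    (h1 : ContDiff ℝ (⊤ : ℕ∞) f) (h2 : HasCompactSupport f)
    (hh : ∀ y, (h y : ℂ) = ∫ ξ, A ξ * chr ⟪y, ∑ i, ξ i⟫) (η : Sp d) :
    ftR (fun y => f y * h y) η = ∫ ξ, A ξ * ftR f (η - ∑ i, ξ i) := by
  rw [ftR_eq_chr]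
  push_cast
  simp only [hh, ← integral_const_mul]
  rw [integral_integral_swap]
  · congr 1 with ξ
    rw [ftR_eq_chr, ← integral_const_mul]
    congr 1 with y
    rw [inner_sub_right, neg_sub, sub_eq_add_neg, chr_add]
    ring
  · have hc : Continuous fun p : Sp d × (Fin n → Sp d) => chr (-⟪p.1, η⟫) *
        chr ⟪p.1, ∑ i, p.2 i⟫ := by
      have := continuous_chr
      fun_prop
    have hi := ((integrable_ofReal_test h1 h2).mul_prod hA).bdd_mul (c := 1)
      hc.aestronglyMeasurable (Eventually.of_forall fun p => by
        rw [norm_mul, norm_chr, norm_chr, mul_one])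
    refine hi.congr (Eventually.of_forall fun p => ?_)
    simp only [Function.uncurry]
    ring

/-- One step of the recursion defining `kernelAt`. Translating the output frequency by the sum of
the earlier ones makes the multiplier act at the new partial sum; for Fubini it is enough that the
multiplier is bounded by `t`. -/
theorem waveConv_mul_chr {n : ℕ} {A : (Fin n → Sp d) → ℂ} (hA : Integrable A) {f h : Sp d → ℝ}
    (h1 : ContDiff ℝ (⊤ : ℕ∞) f) (h2 : HasCompactSupport f)
    (hh : ∀ y, (h y : ℂ) = ∫ ξ, A ξ * chr ⟪y, ∑ i, ξ i⟫) {t : ℝ} (ht : 0 ≤ t) (x : Sp d) :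
    (waveConv t (fun y => f y * h y) x : ℂ) = ∫ ξ, ∫ ζ, A ξ * (chr ⟪x, ∑ i, ξ i + ζ⟫ *
      (waveMult t (∑ i, ξ i + ζ) * ftR f ζ)) := by
  rw [waveConv_coe]
  simp only [ftR_mul_chr hA h1 h2 hh, ← integral_const_mul]
  have hm : Continuous fun η : Sp d => waveMult t η :=
    continuous_waveMult.comp (Continuous.prodMk_right t)
  have hmC : Continuous fun η : Sp d => (waveMult t η : ℂ) := Complex.continuous_ofReal.comp hm
  have hch := continuous_chr
  have hft := continuous_ftR h1 h2
  rw [integral_integral_swap]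
  · congr 1 with ξ
    rw [← integral_add_left_eq_self _ (∑ i, ξ i)]
    congr 1 with ζ
    rw [add_sub_cancel_left, real_inner_comm]
    ring
  · have hi : Integrable (fun p : Sp d × (Fin n → Sp d) => A p.2 * ftR f (p.1 - ∑ i, p.2 i))
        (volume.prod volume) := by
      have hms : AEStronglyMeasurable (fun p : Sp d × (Fin n → Sp d) =>
          A p.2 * ftR f (p.1 - ∑ i, p.2 i)) (volume.prod volume) := by
        refine hA.1.comp_snd.mul (Continuous.aestronglyMeasurable ?_)
        exact hft.comp (by fun_prop)
      refine (integrable_prod_iff' hms).2 ⟨Eventually.of_forall fun ξ => ?_, ?_⟩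
      · have := (integrable_ftR h1 h2).comp_sub_right (∑ i, ξ i)
        exact this.const_mul (A ξ)
      · have : (fun ξ : Fin n → Sp d => ∫ η, ‖A ξ * ftR f (η - ∑ i, ξ i)‖) =
            fun ξ => ‖A ξ‖ * ∫ η, ‖ftR f η‖ := by
          ext ξ
          simp only [norm_mul]
          rw [integral_const_mul, integral_sub_right_eq_self (fun η => ‖ftR f η‖)]
        rw [this]
        exact hA.norm.mul_const _
    have hi2 := hi.bdd_mul (c := t) (f := fun p : Sp d × (Fin n → Sp d) =>
      chr ⟪p.1, x⟫ * (waveMult t p.1 : ℂ)) (Continuous.aestronglyMeasurable (by fun_prop))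
      (Eventually.of_forall fun p => by
        rw [norm_mul, norm_chr, one_mul, Complex.norm_real]
        exact abs_waveMult_le_self ht _)
    refine hi2.congr (Eventually.of_forall fun p => ?_)
    simp only [Function.uncurry]
    ring

theorem fixedHat_snocF {n : ℕ} {τ : Fin (n + 1) → ℝ} (f : Fin (n + 1) → Sp d → ℝ) {t : ℝ}
    (h : 0 < τ (Fin.last n) ∧ τ (Fin.last n) < t) (ξ : Fin n → Sp d) (ζ : Sp d) :
    fixedHat τ f t (snocF ξ ζ) =
      fixedHat (fun i => τ i.castSucc) (fun i => f i.castSucc) (τ (Fin.last n)) ξ *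
        (waveMult (t - τ (Fin.last n)) (∑ i, ξ i + ζ) * ftR (f (Fin.last n)) ζ) := by
  have he : (Real.exp (τ (Fin.last n)) : ℂ) ≠ 0 := by
    exact_mod_cast (Real.exp_pos _).ne'
  simp only [fixedHat, amp, Fin.prod_univ_castSucc, Fin.snoc_last, Fin.snoc_castSucc, if_pos h,
    freqSum, Fin.sum_univ_castSucc, wt_zero]
  push_cast
  rw [← Complex.ofReal_exp]
  field_simp

/-- The action of `f_n` at fixed times as an integral over frequencies. -/
theorem kernelAt_eq : ∀ (n : ℕ) {τ : Fin n → ℝ} {f : Fin n → Sp d → ℝ} {t : ℝ},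
    StrictMono τ → (∀ i, 0 < τ i ∧ τ i < t) → (∀ i, ContDiff ℝ (⊤ : ℕ∞) (f i)) →
    (∀ i, HasCompactSupport (f i)) → ∀ x : Sp d,
    (kernelAt n τ f t x : ℂ) = ∫ ξ, fixedHat τ f t ξ * chr ⟪x, ∑ i, ξ i⟫
  | 0, τ, f, t, _, _, _, _, x => by
    simp [kernelAt, fixedHat, amp, chr, volume_pi, measureReal_def]
  | n + 1, τ, f, t, hτ, ht, h1, h2, x => by
    have ih := kernelAt_eq n (τ := fun i => τ i.castSucc) (f := fun i => f i.castSucc)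
      (t := τ (Fin.last n)) (fun i j hij => hτ (Fin.castSucc_lt_castSucc_iff.2 hij))
      (fun i => ⟨(ht _).1, hτ (Fin.castSucc_lt_last i)⟩) (fun i => h1 _) (fun i => h2 _)
    rw [kernelAt, waveConv_mul_chr (integrable_fixedHat _ (fun i => h1 _) (fun i => h2 _) _)
      (h1 _) (h2 _) ih (sub_nonneg.2 (ht _).2.le), volume_pi, volume_pi, integral_snoc,
      integral_prod]
    · congr 1 with ξ
      congr 1 with ζ
      simp only [fixedHat_snocF f (ht (Fin.last n)), Fin.sum_univ_castSucc, Fin.snoc_last,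
        Fin.snoc_castSucc]
      ring
    · have hi := (integrable_fixedHat τ h1 h2 t).mul_bdd (c := 1)
        (g := fun ξ : Fin (n + 1) → Sp d => chr ⟪x, ∑ i, ξ i⟫)
        (by have := continuous_chr; exact Continuous.aestronglyMeasurable (by fun_prop))
        (Eventually.of_forall fun ξ => (norm_chr _).le)
      rw [volume_pi, ← (measurePreserving_snoc (volume : Measure (Sp d)) n).integrable_comp_emb
        (snocEquiv _ n).measurableEmbedding] at hi
      refine hi.congr (Eventually.of_forall fun p => ?_)
      simp only [Function.comp_apply, snocEquiv_apply]

end FixedTimes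

/-! ### The distribution `f_n` and its multiple integral -/

section KernelAction

variable {d : ℕ} {α H : ℝ}

/-- For a function that vanishes unless all times are positive, `lam` may be replaced by Lebesgue
measure, whose product then splits into a tuple of times and a tuple of frequencies. -/
theorem integral_pi_lam {n : ℕ} {F : (Fin n → ℝ × Sp d) → ℂ}
    (h0 : ∀ z, ¬ (∀ i, 0 < (z i).1) → F z = 0)
    (hF : Integrable F (Measure.pi fun _ => lam d)) :
    ∫ z, F z ∂(Measure.pi fun _ => lam d) =
      ∫ τ : Fin n → ℝ, ∫ ξ : Fin n → Sp d, F fun i => (τ i, ξ i) := by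
  have e : (Measure.pi fun _ : Fin n => lam d) =
      (volume : Measure (Fin n → ℝ × Sp d)).restrict (univ.pi fun _ => Ioi 0 ×ˢ univ) := by
    rw [volume_pi, Measure.restrict_pi_pi]
    congr 1 with i
    rw [Measure.volume_eq_prod, ← Measure.prod_restrict, Measure.restrict_univ]
  have hs : ∀ z, z ∉ (univ.pi fun _ : Fin n => Ioi (0 : ℝ) ×ˢ (univ : Set (Sp d))) → F z = 0 := by
    intro z hz
    refine h0 z fun h => hz fun i _ => ⟨h i, mem_univ _⟩
  rw [e] at hF ⊢
  have hF2 : Integrable F :=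
    (integrableOn_iff_integrable_of_support_subset (fun z hz => by
      by_contra h
      exact hz (hs z h))).1 hF
  rw [setIntegral_eq_integral_of_forall_compl_eq_zero hs]
  have hmp := (volume_measurePreserving_arrowProdEquivProdArrow ℝ (Sp d) (Fin n)).symm
  rw [← hmp.integral_comp (MeasurableEquiv.measurableEmbedding _),
    Measure.volume_eq_prod, integral_prod]
  · rfl
  · rw [← Measure.volume_eq_prod]
    exact (hmp.integrable_comp_emb (MeasurableEquiv.measurableEmbedding _)).2 hF2

/-- The action of `f_n(·,t,x)` on test functions, in the spectral space. -/
theorem kernel_eq (ha : Admissible d α H) (n : ℕ) (t : ℝ) (x : Sp d)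
    {φ : Fin n → ℝ × Sp d → ℝ} (hφ : ∀ i, IsTest (φ i)) :
    ((kernel n t x φ : ℝ) : ℂ) = ∫ z, fHat α n t x z * ∏ i, testHat α (φ i) (z i)
      ∂(Measure.pi fun _ => lam d) := by
  have := nontrivial_Sp ha.pos ha.upper
  set S : Set (Fin n → ℝ) := {τ : Fin n → ℝ | StrictMono τ ∧ ∀ i, 0 < τ i ∧ τ i < t} with hS
  have hSm : MeasurableSet S := by
    have e : S = (⋂ i, ⋂ j, ⋂ (_ : i < j), {τ : Fin n → ℝ | τ i < τ j}) ∩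
        ⋂ i, {τ : Fin n → ℝ | 0 < τ i ∧ τ i < t} := by
      ext τ
      simp only [hS, mem_inter_iff, mem_iInter, mem_ofPred_eq]
      rfl
    rw [e]
    refine MeasurableSet.inter (MeasurableSet.iInter fun i => MeasurableSet.iInter fun j =>
      MeasurableSet.iInter fun _ => measurableSet_lt (by fun_prop) (by fun_prop)) ?_
    refine MeasurableSet.iInter fun i => ?_
    exact (measurableSet_lt (f := fun _ : Fin n → ℝ => (0 : ℝ)) (g := fun τ => τ i)
      (by fun_prop) (by fun_prop)).inter (measurableSet_lt (f := fun τ : Fin n → ℝ => τ i)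
        (g := fun _ => t) (by fun_prop) (by fun_prop))
  rw [integral_pi_lam (fun z hz => ?_) (integrable_mul_of_memLp (memLp_fHat ha n t x)
    (memLp_prod_testHat ha.pos ha.upper hφ)), kernel, ← integral_complex_ofReal,
    ← integral_indicator hSm]
  · congr 1 with τ
    by_cases h : τ ∈ S
    · rw [indicator_of_mem h, kernelAt_eq n h.1 h.2 (fun i => (hφ i).contDiff_slice _)
        (fun i => (hφ i).hasCompactSupport_slice _)]
      refine integral_congr_ae ?_
      have hne : ∀ᵐ ξ : Fin n → Sp d, ∀ i, ξ i ≠ 0 := by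
        rw [ae_all_iff]
        intro i
        exact (Measure.quasiMeasurePreserving_eval (fun _ : Fin n => (volume : Measure (Sp d)))
          i).ae (Measure.ae_ne volume 0)
      filter_upwards [hne] with ξ hξ
      have e : ∀ i, ftR (fun y => φ i (τ i, y)) (ξ i) / (Real.exp (τ i) : ℂ) =
          ((‖ξ i‖ ^ (-(α / 2)) : ℝ) : ℂ) * testHat α (φ i) (τ i, ξ i) := by
        intro i
        have hn : ((‖ξ i‖ ^ (-(α / 2)) : ℝ) : ℂ) ≠ 0 := by
          have := norm_pos_iff.2 (hξ i)
          exact_mod_cast (by positivity : (0 : ℝ) < ‖ξ i‖ ^ (-(α / 2))).ne'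
        have he : ((Real.exp (τ i) : ℝ) : ℂ) ≠ 0 := by exact_mod_cast (Real.exp_pos _).ne'
        simp only [testHat, sliceHat, wt, Complex.ofReal_mul]
        field_simp
      simp only [fixedHat, e, fHat_eq_chr, amp_eq_amp_zero (α := α), Finset.prod_mul_distrib,
        freqSum]
      push_cast
      ring
    · rw [indicator_of_notMem h]
      have : ∀ ξ : Fin n → Sp d, fHat α n t x (fun i => (τ i, ξ i)) = 0 := by
        intro ξ
        rw [fHat, amp_eq_zero n (fun i => (τ i, ξ i)) h]
        simp
      simp [this]
  · rw [fHat, amp_eq_zero n z fun h => hz fun i => (h.2 i).1]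
    simp

variable {Ω : Type*} [MeasurableSpace Ω] {P : Measure Ω} [IsProbabilityMeasure P]
  {W : Rect d → Ω → ℝ}

/-- The multiple integrals `I_n(f_n(·,t,x))`. -/
def chaos (hW : IsNoise H α W P) (ha : Admissible d α H) (n : ℕ) (t : ℝ) (x : Sp d) : Lp ℝ 2 P :=
  wienerOp hW ha n (fSpec ha n t x)

/-- The action on test functions is a continuous linear functional of the transform, both for
elementary functions and for `fHat`, so convergence in `SpecL2` implies convergence as
distributions. -/
theorem isMultipleIntegral_chaos (hW : IsNoise H α W P) (ha : Admissible d α H) (n : ℕ) (t : ℝ)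
    (x : Sp d) : IsMultipleIntegral H α W P n (kernel n t x) (chaos hW ha n t x) := by
  refine isMultipleIntegral_wienerOp hW ha (fSpec_mem_closure ha n t x) fun φ hφ e he => ?_
  have hΘ := memLp_prod_testHat ha.pos ha.upper hφ
  have hΘc : MemLp (fun z : Fin n → ℝ × Sp d => (starRingEnd ℂ) (∏ i, testHat α (φ i) (z i))) 2
      (Measure.pi fun _ => lam d) := hΘ.star
  have key : ∀ {f : (Fin n → ℝ × Sp d) → ℂ} (hf : MemLp f 2 (Measure.pi fun _ => lam d)) {a : ℝ},
      (a : ℂ) = ∫ z, f z * ∏ i, testHat α (φ i) (z i) ∂(Measure.pi fun _ => lam d) →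
      a = ⟪hΘc.toLp, hf.toLp⟫ := by
    intro f hf a h
    rw [inner_toLp_complex, ← Complex.ofReal_re a, h]
    congr 2 with z
    rw [Complex.conj_conj, mul_comm]
  have h1 : ∀ k, (e k).action φ = ⟪hΘc.toLp, ha.hat n (e k)⟫ := by
    intro k
    have := key (Lp.memLp (ha.hat n (e k))) (action_eq_integral ha (e k) hφ)
    rwa [Lp.toLp_coeFn] at this
  rw [key (memLp_fHat ha n t x) (kernel_eq ha n t x hφ)]
  simp only [h1]
  exact tendsto_const_nhds.inner he

end KernelAction

/-! ### Contraction of the last variable -/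

section Contract

variable {X : Type*} [MeasurableSpace X] {μ : Measure X}

theorem norm_toLp_sq {f : X → ℂ} (hf : MemLp f 2 μ) : ‖hf.toLp‖ ^ 2 = ∫ x, ‖f x‖ ^ 2 ∂μ := by
  rw [← real_inner_self_eq_norm_sq, inner_toLp_complex]
  have : ∀ x, (starRingEnd ℂ) (f x) * f x = ((‖f x‖ ^ 2 : ℝ) : ℂ) := by
    intro x
    rw [Complex.conj_mul']
    push_cast
    rfl
  simp only [this]
  rw [integral_complex_ofReal, Complex.ofReal_re]

theorem norm_Lp_sq (f : Lp ℂ 2 μ) : ‖f‖ ^ 2 = ∫ x, ‖f x‖ ^ 2 ∂μ := by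
  have := norm_toLp_sq (Lp.memLp f)
  rwa [Lp.toLp_coeFn] at this

variable [SigmaFinite μ] {n : ℕ}

/-- Integration of the last variable against a function. -/
def contractFun (μ : Measure X) (θ : X → ℂ) (f : (Fin (n + 1) → X) → ℂ) (z : Fin n → X) : ℂ :=
  ∫ w, f (snocF z w) * θ w ∂μ

theorem memLp_contractFun {θ : X → ℂ} (hθ : MemLp θ 2 μ) {f : (Fin (n + 1) → X) → ℂ}
    (hf : MemLp f 2 (Measure.pi fun _ => μ)) :
    MemLp (contractFun μ θ f) 2 (Measure.pi fun _ => μ) :=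
  (memLp_contract (memLp_snoc.2 hf) hθ).1

theorem contractFun_congr {θ : X → ℂ} {f g : (Fin (n + 1) → X) → ℂ}
    (h : f =ᵐ[Measure.pi fun _ => μ] g) :
    contractFun μ θ f =ᵐ[Measure.pi fun _ => μ] contractFun μ θ g := by
  filter_upwards [Measure.ae_ae_of_ae_prod (ae_snoc.1 h)] with z hz
  refine integral_congr_ae ?_
  filter_upwards [hz] with w hw
  rw [hw]

theorem integral_norm_contractFun_le {θ : X → ℂ} (hθ : MemLp θ 2 μ) {f : (Fin (n + 1) → X) → ℂ}
    (hf : MemLp f 2 (Measure.pi fun _ => μ)) :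
    ∫ z, ‖contractFun μ θ f z‖ ^ 2 ∂(Measure.pi fun _ => μ) ≤
      (∫ z, ‖f z‖ ^ 2 ∂(Measure.pi fun _ => μ)) * ∫ w, ‖θ w‖ ^ 2 ∂μ := by
  rw [integral_snoc]
  exact (memLp_contract (memLp_snoc.2 hf) hθ).2

theorem contractFun_add {θ : X → ℂ} (hθ : MemLp θ 2 μ) {f g : (Fin (n + 1) → X) → ℂ}
    (hf : MemLp f 2 (Measure.pi fun _ => μ)) (hg : MemLp g 2 (Measure.pi fun _ => μ)) :
    contractFun μ θ (f + g) =ᵐ[Measure.pi fun _ => μ]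
      contractFun μ θ f + contractFun μ θ g := by
  filter_upwards [ae_memLp_slice (memLp_snoc.2 hf), ae_memLp_slice (memLp_snoc.2 hg)] with z h1 h2
  simp only [contractFun, Pi.add_apply, add_mul]
  exact integral_add (integrable_mul_of_memLp h1 hθ) (integrable_mul_of_memLp h2 hθ)

/-- Integration of the last variable against a function, as an operator. -/
def contractL {θ : X → ℂ} (hθ : MemLp θ 2 μ) (n : ℕ) :
    Lp ℂ 2 (Measure.pi fun _ : Fin (n + 1) => μ) →L[ℝ] Lp ℂ 2 (Measure.pi fun _ : Fin n => μ) :=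
  LinearMap.mkContinuous
    { toFun := fun f => (memLp_contractFun hθ (Lp.memLp f)).toLp
      map_add' := fun f g => by
        rw [← MemLp.toLp_add, MemLp.toLp_eq_toLp_iff]
        exact (contractFun_congr (Lp.coeFn_add f g)).trans
          (contractFun_add hθ (Lp.memLp f) (Lp.memLp g))
      map_smul' := fun c f => by
        rw [RingHom.id_apply, ← MemLp.toLp_const_smul, MemLp.toLp_eq_toLp_iff]
        refine (contractFun_congr (Lp.coeFn_smul c f)).trans (Eventually.of_forall fun z => ?_)
        simp only [contractFun, Pi.smul_apply, smul_mul_assoc, integral_smul] }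
    (√(∫ w, ‖θ w‖ ^ 2 ∂μ)) fun f => by
      refine abs_le_of_sq_le_sq' ?_ (by positivity) |>.2
      rw [LinearMap.coe_mk, AddHom.coe_mk, norm_toLp_sq, mul_pow,
        Real.sq_sqrt (integral_nonneg fun _ => by positivity), norm_Lp_sq, mul_comm]
      exact integral_norm_contractFun_le hθ (Lp.memLp f)

theorem contractL_toLp {θ : X → ℂ} (hθ : MemLp θ 2 μ) {f : (Fin (n + 1) → X) → ℂ}
    (hf : MemLp f 2 (Measure.pi fun _ => μ)) :
    contractL hθ n hf.toLp = (memLp_contractFun hθ hf).toLp := by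
  change (memLp_contractFun hθ (Lp.memLp hf.toLp)).toLp = _
  rw [MemLp.toLp_eq_toLp_iff]
  exact contractFun_congr hf.coeFn_toLp

end Contract

/-! ### Testing the last variable of a chaos process -/

section Action

variable {d : ℕ} {α H : ℝ} {Ω : Type*} [MeasurableSpace Ω] {P : Measure Ω}
  [IsProbabilityMeasure P] {W : Rect d → Ω → ℝ}

theorem contractL_hat_single (ha : Admissible d α H) {n : ℕ} {φ : ℝ × Sp d → ℝ} (hφ : IsTest φ)
    (R : Fin (n + 1) → Rect d) (a : ℝ) :
    contractL (hφ.memLp_testHat ha.pos ha.upper) n (ha.hat (n + 1) (Finsupp.single R a)) =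
      ha.hat n (Finsupp.single (fun i => R i.castSucc)
        (a * ∫ z in (R (Fin.last n)).toSet, φ z)) := by
  simp only [Admissible.hat, hatL, Finsupp.linearCombination_single, map_smul, mul_smul]
  congr 1
  rw [contractL_toLp, ← MemLp.toLp_const_smul, MemLp.toLp_eq_toLp_iff]
  refine Eventually.of_forall fun z => ?_
  simp only [contractFun, rectsHat, prod_snocF (fun i => rectHat α (R i)), Pi.smul_apply,
    mul_assoc]
  rw [integral_const_mul, ← integral_rect_test ha.pos ha.upper hφ, Complex.real_smul, mul_comm]

theorem compLpL_compLp_toSpanSingleton {K : Type*} [NormedAddCommGroup K] [NormedSpace ℝ K]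
    (L : K →L[ℝ] ℝ) (h : K) (X : Lp ℝ 2 P) :
    L.compLpL 2 P ((ContinuousLinearMap.toSpanSingleton ℝ h).compLp X) = L h • X := by
  ext1
  filter_upwards [L.coeFn_compLpL (p := 2) (μ := P)
    ((ContinuousLinearMap.toSpanSingleton ℝ h).compLp X),
    (ContinuousLinearMap.toSpanSingleton ℝ h).coeFn_compLp X, Lp.coeFn_smul (L h) X] with ω h1 h2 h3
  rw [h1, h2, h3, ContinuousLinearMap.toSpanSingleton_apply, map_smul, Pi.smul_apply, smul_eq_mul,
    smul_eq_mul, mul_comm]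

theorem compLpL_smul {K : Type*} [NormedAddCommGroup K] [NormedSpace ℝ K]
    (L : K →L[ℝ] ℝ) (a : ℝ) (X : Lp K 2 P) : L.compLpL 2 P (a • X) = a • L.compLpL 2 P X :=
  map_smul _ a X

theorem compLpL_skorL (hW : IsNoise H α W P) (ha : Admissible d α H) {n : ℕ}
    {φ : ℝ × Sp d → ℝ} (hφ : IsTest φ) {L : HP W P →L[ℝ] ℝ} (hL : IsAction W P φ L)
    (R : Fin (n + 1) → Rect d) (a : ℝ) :
    L.compLpL 2 P (skorL hW n (Finsupp.single R a)) =
      wienerOp hW ha n (contractL (hφ.memLp_testHat ha.pos ha.upper) n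
        (ha.hat (n + 1) (Finsupp.single R a))) := by
  rw [contractL_hat_single ha hφ, wienerOp_hat, skorL, wienerL, Finsupp.linearCombination_single,
    Finsupp.linearCombination_single]
  refine (compLpL_smul L a _).trans ?_
  rw [compLpL_compLp_toSpanSingleton, mul_smul, hL _ (R (Fin.last n)) (coeFn_noiseVec hW _)]

theorem eqOn_closure_range {V F : Type*} [NormedAddCommGroup V]
    [NormedSpace ℝ V] [NormedAddCommGroup F] [NormedSpace ℝ F] {ι : Type*}
    (e : (ι →₀ ℝ) →ₗ[ℝ] V) (S T : V →L[ℝ] F)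
    (h : ∀ i a, S (e (Finsupp.single i a)) = T (e (Finsupp.single i a))) {f : V}
    (hf : f ∈ closure (range e)) : S f = T f := by
  refine (isClosed_eq S.continuous T.continuous).closure_subset_iff.2 ?_ hf
  rintro _ ⟨x, rfl⟩
  change S (e x) = T (e x)
  induction x using Finsupp.induction_linear with
  | zero => simp only [map_zero]
  | add e1 e2 h1 h2 => simp only [map_add, h1, h2]
  | single i a => exact h i a

/-- The composition of an action on a test function with an operator valued in `L²(Ω; K)`. -/
def actionComp {V K : Type*} [NormedAddCommGroup V] [NormedSpace ℝ V] [NormedAddCommGroup K]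
    [NormedSpace ℝ K] (L : K →L[ℝ] ℝ) (S : V →L[ℝ] Lp K 2 P) : V →L[ℝ] Lp ℝ 2 P :=
  (L.compLpL 2 P).comp S

/-- Testing the last variable against `φ` commutes with the Wiener integration of the first `n`.
Both sides are bounded operators in `f` that agree on simple tensors, where each multiplies
`I_n(1_{R_1} ⊗ ⋯ ⊗ 1_{R_n})` by the integral of `φ` over the last rectangle. -/
theorem compLpL_skorOp (hW : IsNoise H α W P) (ha : Admissible d α H) {n : ℕ}
    {φ : ℝ × Sp d → ℝ} (hφ : IsTest φ) {L : HP W P →L[ℝ] ℝ} (hL : IsAction W P φ L)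
    {f : SpecL2 d (n + 1)} (hf : f ∈ closure (range (ha.hat (n + 1)))) :
    L.compLpL 2 P (skorOp hW ha n f) =
      wienerOp hW ha n (contractL (hφ.memLp_testHat ha.pos ha.upper) n f) := by
  refine eqOn_closure_range (ha.hat (n + 1)) (actionComp (K := HP W P) L (skorOp hW ha n))
    ((wienerOp hW ha n).comp (contractL (hφ.memLp_testHat ha.pos ha.upper) n)) (fun R a => ?_) hf
  refine Eq.trans ?_ (compLpL_skorL hW ha hφ hL R a)
  exact congrArg (fun X : Lp (HP W P) 2 P => L.compLpL 2 P X) (skorOp_hat hW ha _)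

end Action

/-! ### Bochner integrals in `L²` -/

section BochnerL2

variable {X Z : Type*} [MeasurableSpace X] [MeasurableSpace Z] {μ : Measure X} {ν : Measure Z}

/-- The Bochner integral in `L²` is the pointwise integral. -/
theorem integral_smul_toLp [SFinite μ] [SFinite ν] {k : Z → ℝ} (hk : Integrable k ν)
    {g : Z → X → ℂ} (hg : ∀ p, MemLp (g p) 2 μ) (hgm : Measurable fun q : Z × X => g q.1 q.2)
    {b : X → ℝ} (hb : MemLp b 2 μ) (hle : ∀ᵐ p ∂ν, ∀ z, ‖g p z‖ ≤ b z) {F : X → ℂ}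
    (hF : MemLp F 2 μ) (hFe : ∀ z, ∫ p, k p • g p z ∂ν = F z)
    (hint : Integrable (fun p => k p • (hg p).toLp) ν) :
    ∫ p, k p • (hg p).toLp ∂ν = hF.toLp := by
  -- The identity is tested against an arbitrary `h`; a dominating function `b` independent of the
  -- parameter makes the joint integrand integrable, so Fubini's theorem exchanges the two
  -- integrals.
  refine ext_inner_left ℝ fun h => ?_
  have hh : MemLp h 2 μ := Lp.memLp h
  have hcm : MemLp (fun z => (starRingEnd ℂ) (h z)) 2 μ := hh.star
  have e : h = hh.toLp := (Lp.toLp_coeFn h hh).symm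
  rw [← integral_inner hint, e, inner_toLp_complex]
  have hjm : AEStronglyMeasurable (fun q : Z × X => (starRingEnd ℂ) (h q.2) * (k q.1 • g q.1 q.2))
      (ν.prod μ) :=
    hcm.1.comp_snd.mul (hk.1.comp_fst.smul hgm.aestronglyMeasurable)
  have hj : Integrable (fun q : Z × X => (starRingEnd ℂ) (h q.2) * (k q.1 • g q.1 q.2))
      (ν.prod μ) := by
    have h1 : Integrable (fun z => ‖h z‖ * b z) μ := MemLp.integrable_mul (p := 2) (q := 2)
      hh.norm hb
    refine (hk.norm.mul_prod h1).mono' hjm ?_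
    have h2 : ∀ᵐ q : Z × X ∂(ν.prod μ), ∀ z, ‖g q.1 z‖ ≤ b z :=
      Measure.quasiMeasurePreserving_fst.ae hle
    filter_upwards [h2] with q hq
    rw [norm_mul, norm_smul, RCLike.norm_conj]
    calc ‖h q.2‖ * (‖k q.1‖ * ‖g q.1 q.2‖) ≤ ‖h q.2‖ * (‖k q.1‖ * b q.2) := by
          gcongr
          exact hq _
      _ = _ := by ring
  have h3 : ∀ p, ⟪hh.toLp, k p • (hg p).toLp⟫ =
      (∫ z, (starRingEnd ℂ) (h z) * (k p • g p z) ∂μ).re := by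
    intro p
    rw [← MemLp.toLp_const_smul, inner_toLp_complex]
    rfl
  simp only [h3]
  have h4 := integral_re hj.integral_prod_left
  refine h4.trans ?_
  rw [integral_integral_swap hj]
  simp only [integral_const_mul, hFe]
  rfl

end BochnerL2

/-! ### The mollified wave kernel -/

section RegularizedKernel

variable {d : ℕ}

/-- The rescaled mollifier. -/
def mollify (ψ : Sp d → ℝ) (ε : ℝ) (y : Sp d) : ℝ := (ε ^ d)⁻¹ * ψ (ε⁻¹ • y)

theorem contDiff_mollify {ψ : Sp d → ℝ} (hψ : IsMollifier ψ) (ε : ℝ) :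
    ContDiff ℝ (⊤ : ℕ∞) (mollify ψ ε) :=
  contDiff_const.mul (hψ.1.comp (contDiff_id.const_smul ε⁻¹))

theorem hasCompactSupport_mollify {ψ : Sp d → ℝ} (hψ : IsMollifier ψ) {ε : ℝ} (hε : 0 < ε) :
    HasCompactSupport (mollify ψ ε) := by
  have : HasCompactSupport fun y : Sp d => ψ (ε⁻¹ • y) := hψ.2.1.comp_smul (inv_ne_zero hε.ne')
  exact this.mul_left

theorem ftR_mollify (ψ : Sp d → ℝ) {ε : ℝ} (hε : 0 < ε) (η : Sp d) :
    ftR (mollify ψ ε) η = ftR ψ (ε • η) := by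
  rw [ftR_eq_chr, ftR_eq_chr]
  have h := Measure.integral_comp_inv_smul_of_nonneg (volume : Measure (Sp d))
    (fun y => chr (-⟪y, ε • η⟫) * ψ y) hε.le
  rw [finrank_Sp] at h
  have e : ∀ y, chr (-⟪y, η⟫) * (mollify ψ ε y : ℂ) =
      (((ε ^ d)⁻¹ : ℝ) : ℂ) * (chr (-⟪ε⁻¹ • y, ε • η⟫) * ψ (ε⁻¹ • y)) := by
    intro y
    rw [inner_smul_left, inner_smul_right, mollify]
    simp only [conj_trivial]
    rw [inv_mul_cancel_left₀ hε.ne']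
    push_cast
    ring
  simp only [e]
  rw [integral_const_mul, h, Complex.real_smul, ← mul_assoc, ← Complex.ofReal_mul,
    inv_mul_cancel₀ (by positivity), Complex.ofReal_one, one_mul]

theorem norm_ftR_mollifier_le {ψ : Sp d → ℝ} (hψ : IsMollifier ψ) (η : Sp d) : ‖ftR ψ η‖ ≤ 1 := by
  rw [ftR_eq_chr]
  refine (norm_integral_le_integral_norm _).trans_eq ?_
  simp only [norm_mul, norm_chr, one_mul, Complex.norm_real]
  rw [← hψ.2.2.2]
  congr 1 with y
  exact Real.norm_of_nonneg (hψ.2.2.1 y)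

theorem ftR_mollifier_zero {ψ : Sp d → ℝ} (hψ : IsMollifier ψ) : ftR ψ 0 = 1 := by
  rw [ftR_eq_chr]
  have : chr 0 = 1 := by simp [chr]
  simp only [inner_zero_right, neg_zero, this, one_mul]
  rw [integral_complex_ofReal, hψ.2.2.2, Complex.ofReal_one]

theorem waveReg_eq (ψ : Sp d → ℝ) (ε τ : ℝ) (x : Sp d) :
    waveReg ψ ε τ x = waveConv τ (mollify ψ ε) x := rfl

/-- The bound depends on `ε`, which is harmless: it serves only for integrability at a fixed `ε`.
Uniformity in `ε` is recovered later, on the Fourier side. -/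
theorem abs_waveReg_le {ψ : Sp d → ℝ} (hψ : IsMollifier ψ) {ε : ℝ} (hε : 0 < ε) {τ : ℝ}
    (hτ : 0 ≤ τ) (x : Sp d) : |waveReg ψ ε τ x| ≤ τ * ∫ η, ‖ftR (mollify ψ ε) η‖ := by
  rw [waveReg_eq, ← Real.norm_eq_abs, ← Complex.norm_real, waveConv_coe, ← integral_const_mul]
  refine norm_integral_le_of_norm_le ((integrable_ftR (contDiff_mollify hψ ε)
    (hasCompactSupport_mollify hψ hε)).norm.const_mul _) (Eventually.of_forall fun η => ?_)
  rw [norm_mul, norm_chr, one_mul, norm_mul, Complex.norm_real]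
  gcongr
  exact abs_waveMult_le_self hτ _

theorem measurable_waveReg {ψ : Sp d → ℝ} (hψ : IsMollifier ψ) {ε : ℝ} (hε : 0 < ε) :
    Measurable fun p : ℝ × Sp d => waveReg ψ ε p.1 p.2 := by
  have e : (fun p : ℝ × Sp d => waveReg ψ ε p.1 p.2) = fun p : ℝ × Sp d =>
      (∫ ξ, chr ⟪ξ, p.2⟫ * (waveMult p.1 ξ * ftR (mollify ψ ε) ξ)).re := by
    ext p
    rw [← waveConv_coe, Complex.ofReal_re, waveReg_eq]
  rw [e]
  have h1 : Continuous fun q : (ℝ × Sp d) × Sp d => waveMult q.1.1 q.2 :=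
    continuous_waveMult.comp (g := fun p : ℝ × Sp d => waveMult p.1 p.2)
      (f := fun q : (ℝ × Sp d) × Sp d => (q.1.1, q.2)) (by fun_prop)
  have h2 := continuous_ftR (contDiff_mollify hψ ε) (hasCompactSupport_mollify hψ hε)
  have h3 := continuous_chr
  have h : Continuous fun q : (ℝ × Sp d) × Sp d =>
      chr ⟪q.2, q.1.2⟫ * (waveMult q.1.1 q.2 * ftR (mollify ψ ε) q.2) := by fun_prop
  exact Complex.measurable_re.comp (h.stronglyMeasurable.integral_prod_right
    (f := fun (p : ℝ × Sp d) ξ => chr ⟪ξ, p.2⟫ * (waveMult p.1 ξ * ftR (mollify ψ ε) ξ))).measurable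

/-- Fourier representation of the regularized kernel times a modulated test function. -/
theorem integral_waveReg_mul_chr {ψ : Sp d → ℝ} (hψ : IsMollifier ψ) {ε : ℝ} (hε : 0 < ε) {τ : ℝ}
    (hτ : 0 ≤ τ) {f : Sp d → ℝ} (h1 : ContDiff ℝ (⊤ : ℕ∞) f) (h2 : HasCompactSupport f)
    (x σ : Sp d) :
    ∫ y, ((waveReg ψ ε τ (x - y) * f y : ℝ) : ℂ) * chr ⟪y, σ⟫ =
      ∫ ζ, chr ⟪x, σ + ζ⟫ * (waveMult τ (σ + ζ) * ftR ψ (ε • (σ + ζ)) * ftR f ζ) := by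
  have hg := integrable_ftR (contDiff_mollify hψ ε) (hasCompactSupport_mollify hψ hε)
  have e : ∀ y, ((waveReg ψ ε τ (x - y) * f y : ℝ) : ℂ) * chr ⟪y, σ⟫ =
      ∫ η, chr ⟪x, η⟫ * (waveMult τ η * ftR (mollify ψ ε) η) * (chr (-⟪y, η - σ⟫) * f y) := by
    intro y
    rw [Complex.ofReal_mul, waveReg_eq, waveConv_coe, mul_assoc, ← integral_mul_const]
    congr 1 with η
    rw [inner_sub_right, inner_sub_right, neg_sub, sub_eq_add_neg, sub_eq_add_neg, chr_add, chr_add,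
      real_inner_comm η x, real_inner_comm η y]
    ring
  simp only [e]
  rw [integral_integral_swap]
  · rw [← integral_add_left_eq_self _ σ]
    congr 1 with ζ
    rw [integral_const_mul, ← ftR_eq_chr, add_sub_cancel_left, ftR_mollify ψ hε]
    ring
  · have hm : Continuous fun η : Sp d => waveMult τ η :=
      continuous_waveMult.comp (Continuous.prodMk_right τ)
    have hmC : Continuous fun η : Sp d => (waveMult τ η : ℂ) := Complex.continuous_ofReal.comp hm
    have hch := continuous_chr
    have hi := ((integrable_ofReal_test h1 h2).mul_prod hg).bdd_mul (c := τ)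
      (f := fun p : Sp d × Sp d => chr ⟪x, p.2⟫ * waveMult τ p.2 * chr (-⟪p.1, p.2 - σ⟫))
      (Continuous.aestronglyMeasurable (by fun_prop)) (Eventually.of_forall fun p => by
        rw [norm_mul, norm_mul, norm_chr, norm_chr, one_mul, mul_one, Complex.norm_real]
        exact abs_waveMult_le_self hτ _)
    refine hi.congr (Eventually.of_forall fun p => ?_)
    simp only [Function.uncurry]
    ring

theorem volume_restrict_Ioo_prod (t : ℝ) :
    (volume : Measure (ℝ × Sp d)).restrict (Ioo 0 t ×ˢ univ) =
      (volume.restrict (Ioo 0 t)).prod volume := by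
  rw [Measure.volume_eq_prod, ← Measure.prod_restrict, Measure.restrict_univ]

theorem IsTest.integrableOn_sliceHat {φ : ℝ × Sp d → ℝ} (hφ : IsTest φ) (t : ℝ) :
    IntegrableOn (sliceHat φ) (Ioo 0 t ×ˢ univ) := by
  obtain ⟨C, hC0, hC⟩ := hφ.exists_sliceHat_le (d + 1)
  rw [IntegrableOn, volume_restrict_Ioo_prod]
  have h1 : Integrable (fun ζ : Sp d => (1 + ‖ζ‖) ^ (-((d + 1 : ℕ) : ℝ))) :=
    integrable_one_add_norm (by rw [finrank_Sp]; push_cast; linarith)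
  have h2 : Integrable (fun _ : ℝ => C) (volume.restrict (Ioo 0 t)) := integrable_const _
  exact (h2.mul_prod h1).mono' hφ.measurable_sliceHat.aestronglyMeasurable
    (Eventually.of_forall fun z => hC z)

theorem IsTest.integrable {φ : ℝ × Sp d → ℝ} (hφ : IsTest φ) : Integrable φ :=
  hφ.1.continuous.integrable_of_hasCompactSupport hφ.2

theorem integrableOn_waveReg_mul {ψ : Sp d → ℝ} (hψ : IsMollifier ψ) {ε : ℝ} (hε : 0 < ε)
    {φ : ℝ × Sp d → ℝ} (hφ : IsTest φ) {t : ℝ} (x : Sp d) :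
    IntegrableOn (fun p : ℝ × Sp d => waveReg ψ ε (t - p.1) (x - p.2) * φ p)
      (Ioo 0 t ×ˢ univ) := by
  refine hφ.integrable.integrableOn.bdd_mul (c := t * ∫ η, ‖ftR (mollify ψ ε) η‖) ?_ ?_
  · exact ((measurable_waveReg hψ hε).comp (f := fun p : ℝ × Sp d => (t - p.1, x - p.2))
      (by fun_prop)).aestronglyMeasurable
  · refine (ae_restrict_iff' (measurableSet_Ioo.prod MeasurableSet.univ)).2
      (Eventually.of_forall fun p hp => ?_)
    rw [Real.norm_eq_abs]
    refine (abs_waveReg_le hψ hε (by linarith [hp.1.2]) _).trans ?_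
    gcongr
    linarith [hp.1.1]

end RegularizedKernel

/-! ### Convergence of the regularized products in each chaos -/

section RegularizedProduct

variable {d : ℕ} {α H : ℝ}

/-- The integrand of the regularized product. -/
def prodIntegrand (α : ℝ) {n : ℕ} (φ : ℝ × Sp d → ℝ) (t : ℝ) (x : Sp d)
    (z : Fin n → ℝ × Sp d) (p : ℝ × Sp d) : ℂ :=
  amp α n z p.1 * (chr ⟪x, freqSum z + p.2⟫ *
    (waveMult (t - p.1) (freqSum z + p.2) * sliceHat φ p))

theorem measurable_prodIntegrand {n : ℕ} {φ : ℝ × Sp d → ℝ} (hφ : IsTest φ) (t : ℝ) (x : Sp d) :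
    Measurable fun q : (Fin n → ℝ × Sp d) × (ℝ × Sp d) => prodIntegrand α φ t x q.1 q.2 := by
  unfold prodIntegrand
  have h1 : Measurable fun q : (Fin n → ℝ × Sp d) × (ℝ × Sp d) => amp α n q.1 q.2.1 :=
    (measurable_amp n).comp (measurable_fst.prodMk measurable_snd.fst)
  have h2 : Measurable fun q : (Fin n → ℝ × Sp d) × (ℝ × Sp d) => freqSum q.1 + q.2.2 :=
    (measurable_freqSum.comp measurable_fst).add measurable_snd.snd
  have h3 : Measurable fun q : (Fin n → ℝ × Sp d) × (ℝ × Sp d) =>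
      waveMult (t - q.2.1) (freqSum q.1 + q.2.2) :=
    continuous_waveMult.measurable.comp (f := fun q : (Fin n → ℝ × Sp d) × (ℝ × Sp d) =>
      (t - q.2.1, freqSum q.1 + q.2.2)) (by fun_prop)
  have h4 := continuous_chr.measurable
  have h5 := hφ.measurable_sliceHat
  fun_prop

theorem norm_prodIntegrand_le {n : ℕ} (φ : ℝ × Sp d → ℝ) {t : ℝ} (x : Sp d)
    (z : Fin n → ℝ × Sp d) {p : ℝ × Sp d} (hp : p ∈ Ioo 0 t ×ˢ (univ : Set (Sp d))) :
    ‖prodIntegrand α φ t x z p‖ ≤ ampBound α n z t * t * ‖sliceHat φ p‖ := by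
  have h1 := hp.1.1
  have h2 := hp.1.2
  rw [prodIntegrand, norm_mul, norm_mul, norm_mul, norm_chr, one_mul, Complex.norm_real,
    Complex.norm_real, mul_assoc]
  gcongr
  · exact ampBound_nonneg _ _ _
  · exact (abs_amp_le n z _).trans (ampBound_mono z h2.le)
  · exact (abs_waveMult_le_self (by linarith) _).trans (by linarith)

/-- The transform of the regularized product. -/
def regProd (α : ℝ) {n : ℕ} (ψ : Sp d → ℝ) (ε : ℝ) (φ : ℝ × Sp d → ℝ) (t : ℝ) (x : Sp d)
    (z : Fin n → ℝ × Sp d) : ℂ :=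
  ∫ p in Ioo 0 t ×ˢ univ, prodIntegrand α φ t x z p * ftR ψ (ε • (freqSum z + p.2))

/-- The bound on the transforms of the regularized products. -/
def prodConst (φ : ℝ × Sp d → ℝ) (t : ℝ) : ℝ := t * ∫ p in Ioo 0 t ×ˢ univ, ‖sliceHat φ p‖

theorem prodConst_nonneg (φ : ℝ × Sp d → ℝ) {t : ℝ} (ht : 0 ≤ t) : 0 ≤ prodConst φ t :=
  mul_nonneg ht (integral_nonneg fun _ => norm_nonneg _)

variable {ψ : Sp d → ℝ} {φ : ℝ × Sp d → ℝ}

theorem norm_regIntegrand_le (hψ : IsMollifier ψ) {n : ℕ} (ε : ℝ) {t : ℝ} (x : Sp d)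
    (z : Fin n → ℝ × Sp d) {p : ℝ × Sp d} (hp : p ∈ Ioo 0 t ×ˢ (univ : Set (Sp d))) :
    ‖prodIntegrand α φ t x z p * ftR ψ (ε • (freqSum z + p.2))‖ ≤
      ampBound α n z t * t * ‖sliceHat φ p‖ := by
  rw [norm_mul]
  exact (mul_le_of_le_one_right (norm_nonneg _) (norm_ftR_mollifier_le hψ _)).trans
    (norm_prodIntegrand_le φ x z hp)

theorem norm_regProd_le (hψ : IsMollifier ψ) (hφ : IsTest φ) {n : ℕ} (ε t : ℝ)
    (x : Sp d) (z : Fin n → ℝ × Sp d) :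
    ‖regProd α ψ ε φ t x z‖ ≤ prodConst φ t * ampBound α n z t := by
  have e : prodConst φ t * ampBound α n z t =
      ∫ p in Ioo 0 t ×ˢ univ, ampBound α n z t * t * ‖sliceHat φ p‖ := by
    rw [integral_const_mul, prodConst]; ring
  rw [e]
  exact norm_integral_le_of_norm_le ((hφ.integrableOn_sliceHat t).norm.const_mul _)
    ((ae_restrict_iff' (measurableSet_Ioo.prod MeasurableSet.univ)).2
      (Eventually.of_forall fun p hp => norm_regIntegrand_le hψ ε x z hp))

theorem measurable_regIntegrand (hψ : IsMollifier ψ) (hφ : IsTest φ) {n : ℕ} (ε t : ℝ)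
    (x : Sp d) : Measurable fun q : (Fin n → ℝ × Sp d) × (ℝ × Sp d) =>
      prodIntegrand α φ t x q.1 q.2 * ftR ψ (ε • (freqSum q.1 + q.2.2)) := by
  have h1 := measurable_prodIntegrand (α := α) (n := n) hφ t x
  have h2 := (continuous_ftR hψ.1 hψ.2.1).measurable
  have h3 : Measurable fun q : (Fin n → ℝ × Sp d) × (ℝ × Sp d) => ε • (freqSum q.1 + q.2.2) :=
    ((measurable_freqSum.comp measurable_fst).add measurable_snd.snd).const_smul ε
  exact h1.mul (h2.comp h3)

theorem memLp_regProd (ha : Admissible d α H) (hψ : IsMollifier ψ) (hφ : IsTest φ) (n : ℕ)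
    (ε t : ℝ) (x : Sp d) :
    MemLp (regProd (n := n) α ψ ε φ t x) 2 (Measure.pi fun _ => lam d) := by
  refine ((memLp_ampBound ha n t).const_mul (prodConst φ t)).of_le ?_
    (Eventually.of_forall fun z => (norm_regProd_le hψ hφ ε t x z).trans (le_abs_self _))
  exact ((measurable_regIntegrand hψ hφ ε t x).stronglyMeasurable.integral_prod_right
    (f := fun z p => prodIntegrand α φ t x z p *
      ftR ψ (ε • (freqSum z + p.2)))).aestronglyMeasurable

/-- The contraction of the transform of `f_{n+1}` with a test function. -/
theorem contractFun_fHat (ha : Admissible d α H) (n : ℕ) (t : ℝ) (x : Sp d)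
    (z : Fin n → ℝ × Sp d) :
    contractFun (lam d) (testHat α φ) (fHat α (n + 1) t x) z =
      ∫ p in Ioo 0 t ×ˢ univ, prodIntegrand α φ t x z p := by
  have := nontrivial_Sp ha.pos ha.upper
  have hS : MeasurableSet (Ioo 0 t ×ˢ (univ : Set (Sp d))) := measurableSet_Ioo.prod .univ
  have e1 : (volume : Measure (ℝ × Sp d)).restrict (Ioo 0 t ×ˢ univ) =
      (lam d).restrict (Ioo 0 t ×ˢ univ) := by
    rw [volume_restrict_Ioo_prod, ← Measure.prod_restrict, Measure.restrict_univ,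
      Measure.restrict_restrict measurableSet_Ioo, inter_eq_left.2 Ioo_subset_Ioi_self]
  rw [e1, ← integral_indicator hS, contractFun]
  refine integral_congr_ae ?_
  have hne : ∀ᵐ p : ℝ × Sp d ∂(lam d), p.2 ≠ 0 :=
    Measure.quasiMeasurePreserving_snd.ae (Measure.ae_ne volume 0)
  filter_upwards [hne] with p hp
  have hw : (wt α p : ℂ) ≠ 0 := by
    have := norm_pos_iff.2 hp
    have h : 0 < wt α p := by unfold wt; positivity
    exact_mod_cast h.ne'
  by_cases h : p ∈ Ioo 0 t ×ˢ (univ : Set (Sp d))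
  · rw [indicator_of_mem h, fHat_eq_chr, amp_snocF, if_pos (show 0 < p.1 ∧ p.1 < t from h.1), freqSum_snocF, testHat,
      prodIntegrand]
    push_cast
    field_simp
  · rw [indicator_of_notMem h, fHat_eq_chr, amp_snocF,
      if_neg (show ¬ (0 < p.1 ∧ p.1 < t) from fun h2 => h ⟨h2, mem_univ _⟩)]
    simp

/-- Mollification only inserts the factor `ftR ψ (ε • ·)`, which is at most `1` in modulus and tends
to `ftR ψ 0 = 1`. The limit is therefore the same for every mollifier. -/
theorem tendsto_regProd (ha : Admissible d α H) (hψ : IsMollifier ψ) (hφ : IsTest φ) {n : ℕ}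
    (t : ℝ) (x : Sp d) (z : Fin n → ℝ × Sp d) :
    Tendsto (fun ε => regProd α ψ ε φ t x z) (𝓝[>] 0)
      (𝓝 (contractFun (lam d) (testHat α φ) (fHat α (n + 1) t x) z)) := by
  rw [contractFun_fHat ha]
  refine tendsto_integral_filter_of_dominated_convergence
    (fun p => ampBound α n z t * t * ‖sliceHat φ p‖) (Eventually.of_forall fun ε => ?_)
    (Eventually.of_forall fun ε => ?_) ((hφ.integrableOn_sliceHat t).norm.const_mul _)
    (Eventually.of_forall fun p => ?_)
  · exact ((measurable_regIntegrand hψ hφ ε t x).comp measurable_prodMk_left).aestronglyMeasurable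
  · exact (ae_restrict_iff' (measurableSet_Ioo.prod MeasurableSet.univ)).2
      (Eventually.of_forall fun p hp => norm_regIntegrand_le hψ ε x z hp)
  · have h1 : Tendsto (fun ε : ℝ => ftR ψ (ε • (freqSum z + p.2))) (𝓝[>] 0) (𝓝 1) := by
      have h2 : Continuous fun ε : ℝ => ftR ψ (ε • (freqSum z + p.2)) :=
        (continuous_ftR hψ.1 hψ.2.1).comp (by fun_prop)
      have h3 := h2.tendsto 0
      rw [zero_smul, ftR_mollifier_zero hψ] at h3
      exact h3.mono_left nhdsWithin_le_nhds
    simpa using h1.const_mul (prodIntegrand α φ t x z p)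

/-- The regularized product, tested against `φ`, in the spectral space. -/
theorem integral_waveReg_fHat (hψ : IsMollifier ψ) (hφ : IsTest φ) {n : ℕ}
    {ε : ℝ} (hε : 0 < ε) (t : ℝ) (x : Sp d) (z : Fin n → ℝ × Sp d) :
    ∫ p in Ioo 0 t ×ˢ univ, (waveReg ψ ε (t - p.1) (x - p.2) * φ p) • fHat α n p.1 p.2 z =
      regProd α ψ ε φ t x z := by
  have hS : MeasurableSet (Ioo 0 t ×ˢ (univ : Set (Sp d))) := measurableSet_Ioo.prod .univ
  have hi1 : Integrable (fun p : ℝ × Sp d =>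
      (waveReg ψ ε (t - p.1) (x - p.2) * φ p) • fHat α n p.1 p.2 z)
      ((volume.restrict (Ioo 0 t)).prod volume) := by
    rw [← volume_restrict_Ioo_prod]
    refine (integrableOn_waveReg_mul hψ hε hφ x).smul_bdd (ampBound α n z t)
      (continuous_fHat z).aestronglyMeasurable ?_
    exact (ae_restrict_iff' hS).2 (Eventually.of_forall fun p hp => norm_fHat_le hp.1.2.le _ _)
  have hi2 : Integrable (fun p : ℝ × Sp d =>
      prodIntegrand α φ t x z p * ftR ψ (ε • (freqSum z + p.2)))
      ((volume.restrict (Ioo 0 t)).prod volume) := by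
    rw [← volume_restrict_Ioo_prod]
    exact ((hφ.integrableOn_sliceHat t).norm.const_mul _).mono'
      ((measurable_regIntegrand hψ hφ ε t x).comp measurable_prodMk_left).aestronglyMeasurable
      ((ae_restrict_iff' hS).2
        (Eventually.of_forall fun p hp => norm_regIntegrand_le hψ ε x z hp))
  rw [regProd, volume_restrict_Ioo_prod, integral_prod _ hi1, integral_prod _ hi2]
  refine setIntegral_congr_fun measurableSet_Ioo fun s hs => ?_
  have h := integral_waveReg_mul_chr hψ hε (sub_nonneg.2 hs.2.le) (hφ.contDiff_slice s)
    (hφ.hasCompactSupport_slice s) x (freqSum z)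
  calc ∫ y, (waveReg ψ ε (t - s) (x - y) * φ (s, y)) • fHat α n s y z
      = amp α n z s * ∫ y, ((waveReg ψ ε (t - s) (x - y) * φ (s, y) : ℝ) : ℂ) *
          chr ⟪y, freqSum z⟫ := by
        rw [← integral_const_mul]
        congr 1 with y
        rw [fHat_eq_chr, Complex.real_smul]
        ring
    _ = _ := by
        rw [h, ← integral_const_mul]
        congr 1 with ζ
        simp only [prodIntegrand, sliceHat]
        ring

theorem integrableOn_waveReg_fSpec (ha : Admissible d α H) (hψ : IsMollifier ψ) (hφ : IsTest φ)
    (n : ℕ) {ε : ℝ} (hε : 0 < ε) (t : ℝ) (x : Sp d) :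
    IntegrableOn (fun p : ℝ × Sp d =>
      (waveReg ψ ε (t - p.1) (x - p.2) * φ p) • fSpec ha n p.1 p.2) (Ioo 0 t ×ˢ univ) := by
  refine (integrableOn_waveReg_mul hψ hε hφ x).smul_bdd
    (√(ampSq d α n (max t 0)).toReal) (continuous_fSpec ha n).aestronglyMeasurable ?_
  exact (ae_restrict_iff' (measurableSet_Ioo.prod .univ)).2 (Eventually.of_forall fun p hp =>
    norm_fSpec_le ha (hp.1.2.le.trans (le_max_left _ _)) ENNReal.toReal_nonneg
      (ampSq_le_toReal ha n t) _)

theorem integral_waveReg_fSpec (ha : Admissible d α H) (hψ : IsMollifier ψ) (hφ : IsTest φ)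
    (n : ℕ) {ε : ℝ} (hε : 0 < ε) (t : ℝ) (x : Sp d) :
    ∫ p in Ioo 0 t ×ˢ univ, (waveReg ψ ε (t - p.1) (x - p.2) * φ p) • fSpec ha n p.1 p.2 =
      (memLp_regProd ha hψ hφ n ε t x).toLp := by
  refine integral_smul_toLp (integrableOn_waveReg_mul hψ hε hφ x)
    (g := fun p : ℝ × Sp d => fHat α n p.1 p.2) (fun p => memLp_fHat ha n p.1 p.2)
    ((measurable_fHat n).comp measurable_swap) (memLp_ampBound ha n t) ?_ _
    (integral_waveReg_fHat hψ hφ hε t x) (integrableOn_waveReg_fSpec ha hψ hφ n hε t x)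
  exact (ae_restrict_iff' (measurableSet_Ioo.prod .univ)).2
    (Eventually.of_forall fun p hp z => norm_fHat_le hp.1.2.le _ _)

theorem tendsto_regProd_toLp (ha : Admissible d α H) (hψ : IsMollifier ψ) (hφ : IsTest φ)
    (n : ℕ) (t : ℝ) (x : Sp d) :
    Tendsto (fun ε => (memLp_regProd ha hψ hφ n ε t x).toLp) (𝓝[>] 0)
      (𝓝 (contractL (hφ.memLp_testHat ha.pos ha.upper) n (fSpec ha (n + 1) t x))) := by
  rw [fSpec, contractL_toLp]
  exact tendsto_toLp_of_dominated _ _ ((memLp_ampBound ha n t).const_mul (prodConst φ t))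
    (Eventually.of_forall fun ε => Eventually.of_forall fun z => norm_regProd_le hψ hφ ε t x z)
    (Eventually.of_forall fun z => tendsto_regProd ha hψ hφ t x z)

end RegularizedProduct

/-! ### Series in `L²` -/

section LpSeries

variable {Ω : Type*} [MeasurableSpace Ω] {P : Measure Ω} {K : Type*} [NormedAddCommGroup K]

theorem hasSum_Lp_of_bound [CompleteSpace K] {f : ℕ → Lp K 2 P} {c : ℕ → ℝ} (hc : Summable c)
    (h : ∀ n, ‖f n‖ ≤ c n) : HasSum f (∑' n, f n) :=
  (Summable.of_norm_bounded hc h).hasSum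

theorem hasSum_compLpL [NormedSpace ℝ K] (L : K →L[ℝ] ℝ) {f : ℕ → Lp K 2 P} {F : Lp K 2 P}
    (h : HasSum f F) : HasSum (fun n => L.compLpL 2 P (f n)) (L.compLpL 2 P F) :=
  (L.compLpL 2 P).hasSum h

theorem hasSum_inner_Lp [InnerProductSpace ℝ K] (g : Lp K 2 P) {f : ℕ → Lp K 2 P} {F : Lp K 2 P}
    (h : HasSum f F) : HasSum (fun n => ⟪g, f n⟫) ⟪g, F⟫ :=
  (innerSL ℝ g).hasSum h

theorem integral_inner_eq_inner_toLp [InnerProductSpace ℝ K] {f g : Ω → K} (hf : MemLp f 2 P)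
    (hg : MemLp g 2 P) : ∫ ω, ⟪f ω, g ω⟫ ∂P = ⟪hf.toLp, hg.toLp⟫ := by
  rw [L2.inner_def]
  refine integral_congr_ae ?_
  filter_upwards [hf.coeFn_toLp, hg.coeFn_toLp] with ω h1 h2
  rw [h1, h2]

theorem toL2_eq {X : Ω → ℝ} (hX : MemLp X 2 P) : toL2 P X = hX.toLp := dif_pos hX

theorem toL2_eq_of_ae {X : Ω → ℝ} {Y : Lp ℝ 2 P} (h : X =ᵐ[P] Y) : toL2 P X = Y := by
  have hX : MemLp X 2 P := (memLp_congr_ae h).2 (Lp.memLp Y)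
  rw [toL2_eq hX, ← Lp.toLp_coeFn Y (Lp.memLp Y), MemLp.toLp_eq_toLp_iff]
  exact h

end LpSeries

/-! ### The chaos series solves the equation -/

section Solution

variable {Ω : Type*} [MeasurableSpace Ω] {P : Measure Ω} [IsProbabilityMeasure P]
  {d : ℕ} {H α : ℝ} {W : Rect d → Ω → ℝ}

/-- The factor `n!` in the norm of the multiple integral cancels against the denominator in the
bound of `ampSq`. A single summable sequence controls everything dominated by `ampBound α n · T`:
the terms of the solution, the regularized products (through the factor `M`) and the terms of the
product process. -/
theorem exists_chaos_bound (hW : IsNoise H α W P) (ha : Admissible d α H) {T : ℝ} (hT : 0 ≤ T) :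
    ∃ c : ℕ → ℝ, Summable c ∧
      (∀ (n : ℕ) (M : ℝ) (f : (Fin n → ℝ × Sp d) → ℂ) (hf : MemLp f 2 (Measure.pi fun _ => lam d)),
        0 ≤ M → (∀ z, ‖f z‖ ≤ M * ampBound α n z T) → ‖wienerOp hW ha n hf.toLp‖ ≤ M * c n) ∧
      ∀ (n : ℕ) (f : (Fin (n + 1) → ℝ × Sp d) → ℂ) (hf : MemLp f 2 (Measure.pi fun _ => lam d)),
        (∀ z, ‖f z‖ ≤ ampBound α (n + 1) z T) → ‖skorOp hW ha n hf.toLp‖ ≤ c (n + 1) := by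
  have hD := specConst_nonneg hW ha
  obtain ⟨b, hb, hle, hs⟩ := exists_ampSq_bound ha hT hD
  refine ⟨fun n => √(specConst hW ha ^ n * b n), hs, fun n M f hf hM h => ?_, fun n f hf h => ?_⟩
  · have hb' : 0 ≤ b n / n.factorial := div_nonneg (hb n) (by positivity)
    obtain ⟨_, h2⟩ := memLp_of_le_ampBound hM hb' (hle n) hf.1 h
    calc ‖wienerOp hW ha n hf.toLp‖
        ≤ √(n.factorial * specConst hW ha ^ n) * (M * √(b n / n.factorial)) :=
          (norm_wienerOp_le hW ha _).trans (by gcongr)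
      _ = M * (√(n.factorial * specConst hW ha ^ n) * √(b n / n.factorial)) := by ring
      _ = M * √(specConst hW ha ^ n * b n) := by
          rw [← Real.sqrt_mul (by positivity)]
          congr 2
          field_simp
  · have hb' : 0 ≤ b (n + 1) / (n + 1).factorial := div_nonneg (hb _) (by positivity)
    obtain ⟨_, h2⟩ := memLp_of_le_ampBound zero_le_one hb' (hle (n + 1)) hf.1
      (by simpa only [one_mul] using h)
    rw [one_mul] at h2
    calc ‖skorOp hW ha n hf.toLp‖
        ≤ √(n.factorial * specConst hW ha ^ (n + 1)) * √(b (n + 1) / (n + 1).factorial) :=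
          (norm_skorOp_le hW ha _).trans (by gcongr)
      -- `skorOp` integrates one variable fewer and costs only `n!`; weakening this to `(n+1)!`
      -- allows the same sequence `c` to be used.
      _ ≤ √((n + 1).factorial * specConst hW ha ^ (n + 1)) * √(b (n + 1) / (n + 1).factorial) := by
          gcongr
          exact Nat.le_succ n
      _ = √(specConst hW ha ^ (n + 1) * b (n + 1)) := by
          rw [← Real.sqrt_mul (by positivity)]
          congr 1
          field_simp

theorem exists_norm_chaos_le (hW : IsNoise H α W P) (ha : Admissible d α H) (T : ℝ) :
    ∃ c : ℕ → ℝ, Summable c ∧ ∀ n t x, t ≤ T → ‖chaos hW ha n t x‖ ≤ c n := by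
  obtain ⟨c, hc, h, -⟩ := exists_chaos_bound hW ha (le_max_right T 0)
  refine ⟨c, hc, fun n t x ht => ?_⟩
  have := h n 1 _ (memLp_fHat ha n t x) zero_le_one fun z => by
    rw [one_mul]
    exact norm_fHat_le (ht.trans (le_max_left _ _)) x z
  rwa [one_mul] at this

theorem exists_norm_skorOp_fSpec_le (hW : IsNoise H α W P) (ha : Admissible d α H) (t : ℝ) :
    ∃ c : ℕ → ℝ, Summable c ∧ ∀ n x, ‖skorOp hW ha n (fSpec ha (n + 1) t x)‖ ≤ c n := by
  obtain ⟨c, hc, -, h⟩ := exists_chaos_bound hW ha (le_max_right t 0)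
  exact ⟨fun n => c (n + 1), (summable_nat_add_iff 1).2 hc, fun n x =>
    h n _ (memLp_fHat ha (n + 1) t x) fun z => norm_fHat_le (le_max_left _ _) x z⟩

/-- The solution as an element of `L²(Ω)`. -/
def solLp (hW : IsNoise H α W P) (ha : Admissible d α H) (t : ℝ) (x : Sp d) : Lp ℝ 2 P :=
  ∑' n, chaos hW ha n t x

theorem hasSum_chaos (hW : IsNoise H α W P) (ha : Admissible d α H) (t : ℝ) (x : Sp d) :
    HasSum (fun n => chaos hW ha n t x) (solLp hW ha t x) := by
  obtain ⟨c, hc, h⟩ := exists_norm_chaos_le hW ha t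
  exact hasSum_Lp_of_bound hc fun n => h n t x le_rfl

theorem norm_solLp_le (hW : IsNoise H α W P) (ha : Admissible d α H) (T : ℝ) :
    ∃ C : ℝ, ∀ t x, t ≤ T → ‖solLp hW ha t x‖ ≤ C := by
  obtain ⟨c, hc, h⟩ := exists_norm_chaos_le hW ha T
  exact ⟨∑' n, c n, fun t x ht => tsum_of_norm_bounded hc.hasSum fun n => h n t x ht⟩

theorem continuous_chaos (hW : IsNoise H α W P) (ha : Admissible d α H) (n : ℕ) :
    Continuous fun p : ℝ × Sp d => chaos hW ha n p.1 p.2 :=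
  (wienerOp hW ha n).continuous.comp (continuous_fSpec ha n)

/-- The series converges uniformly for `t ≤ T`. Continuity provides the strong measurability
required by the Bochner integrals in the definition of the product. -/
theorem continuousOn_solLp (hW : IsNoise H α W P) (ha : Admissible d α H) (T : ℝ) :
    ContinuousOn (fun p : ℝ × Sp d => solLp hW ha p.1 p.2) (Iic T ×ˢ univ) := by
  obtain ⟨c, hc, h⟩ := exists_norm_chaos_le hW ha T
  exact continuousOn_tsum (fun n => (continuous_chaos hW ha n).continuousOn) hc
    fun n p hp => h n p.1 p.2 hp.1

/-- The series `solLp` starts at `n = 0`, so this identifies the constant `1` of the equation with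
its zeroth term. -/
theorem coeFn_chaos_zero (hW : IsNoise H α W P) (ha : Admissible d α H) (t : ℝ) (x : Sp d) :
    chaos hW ha 0 t x =ᵐ[P] fun _ => 1 := by
  have e : fSpec ha 0 t x = ha.hat 0 (Finsupp.single (fun i => i.elim0) 1) := by
    simp only [Admissible.hat, hatL, Finsupp.linearCombination_single, one_smul]
    rw [fSpec, MemLp.toLp_eq_toLp_iff]
    refine Eventually.of_forall fun z => ?_
    simp [fHat, amp, freqSum, rectsHat]
  rw [chaos, e, wienerOp_hat]
  refine (coeFn_wienerL hW 0 _).trans (Eventually.of_forall fun ω => ?_)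
  simp [Elem.wienerInt, wick]

theorem aestronglyMeasurable_solLp (hW : IsNoise H α W P) (ha : Admissible d α H) {t : ℝ}
    (ht : 0 ≤ t) (x : Sp d) : AEStronglyMeasurable[pastSigma W t] (solLp hW ha t x) P := by
  have hcl := isClosed_aestronglyMeasurable (F := ℝ) (p := 2) (μ := P) (pastSigma_le hW t)
  have h0 : ∀ n, AEStronglyMeasurable[pastSigma W t] (chaos hW ha n t x) P := fun n =>
    aestronglyMeasurable_wienerOp hW ha (fSpec_mem_closure ha n t x) ht (fSpec_supp ha n t x)
  refine hcl.mem_of_tendsto (hasSum_chaos hW ha t x) (Eventually.of_forall fun s => ?_)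
  induction s using Finset.cons_induction with
  | empty =>
    rw [Finset.sum_empty]
    exact (stronglyMeasurable_const (b := (0 : ℝ))).aestronglyMeasurable.congr
      (Lp.coeFn_zero ℝ 2 P).symm
  | cons i s hi ih =>
    rw [Finset.sum_cons]
    exact ((h0 i).add ih).congr (Lp.coeFn_add _ _).symm

open Classical in
/-- The solution of the stochastic wave equation. -/
def solution (hW : IsNoise H α W P) (ha : Admissible d α H) (t : ℝ) (x : Sp d) : Ω → ℝ :=
  -- A representative measurable for the past of `t` is selected, since adaptedness is required
  -- exactly and not just up to null sets.
  if ht : 0 < t then (aestronglyMeasurable_solLp hW ha ht.le x).mk _ else fun _ => 1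

theorem solution_ae_eq (hW : IsNoise H α W P) (ha : Admissible d α H) {t : ℝ} (ht : 0 < t)
    (x : Sp d) : solution hW ha t x =ᵐ[P] solLp hW ha t x := by
  rw [solution, dif_pos ht]
  exact (aestronglyMeasurable_solLp hW ha ht.le x).ae_eq_mk.symm

theorem measurable_solution (hW : IsNoise H α W P) (ha : Admissible d α H) {t : ℝ} (ht : 0 < t)
    (x : Sp d) : Measurable[pastSigma W t] (solution hW ha t x) := by
  rw [solution, dif_pos ht]
  exact (aestronglyMeasurable_solLp hW ha ht.le x).stronglyMeasurable_mk.measurable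

theorem memLp_solution (hW : IsNoise H α W P) (ha : Admissible d α H) {t : ℝ} (ht : 0 < t)
    (x : Sp d) : MemLp (solution hW ha t x) 2 P :=
  (memLp_congr_ae (solution_ae_eq hW ha ht x)).2 (Lp.memLp _)

theorem toL2_solution (hW : IsNoise H α W P) (ha : Admissible d α H) {t : ℝ} (ht : 0 < t)
    (x : Sp d) : toL2 P (solution hW ha t x) = solLp hW ha t x :=
  toL2_eq_of_ae (solution_ae_eq hW ha ht x)

theorem toL2_solution_sub_one (hW : IsNoise H α W P) (ha : Admissible d α H) {t : ℝ} (ht : 0 < t)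
    (x : Sp d) : toL2 P (fun ω => solution hW ha t x ω - 1) =
      solLp hW ha t x - chaos hW ha 0 t x := by
  refine toL2_eq_of_ae ?_
  filter_upwards [solution_ae_eq hW ha ht x, coeFn_chaos_zero hW ha t x,
    Lp.coeFn_sub (solLp hW ha t x) (chaos hW ha 0 t x)] with ω h1 h2 h3
  rw [h3, Pi.sub_apply, h1, h2]

theorem hasSum_chaos_succ (hW : IsNoise H α W P) (ha : Admissible d α H) {t : ℝ} (ht : 0 < t)
    (x : Sp d) : HasSum (fun n => chaos hW ha (n + 1) t x)
      (toL2 P fun ω => solution hW ha t x ω - 1) := by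
  rw [toL2_solution_sub_one hW ha ht]
  have := (hasSum_nat_add_iff' 1).2 (hasSum_chaos hW ha t x)
  simpa using this

/-- The process `G(t-·,x-*) u`. -/
def prodProcess (hW : IsNoise H α W P) (ha : Admissible d α H) (t : ℝ) (x : Sp d) :
    Lp (HP W P) 2 P := ∑' n, skorOp hW ha n (fSpec ha (n + 1) t x)

theorem hasSum_prodProcess (hW : IsNoise H α W P) (ha : Admissible d α H) (t : ℝ) (x : Sp d) :
    HasSum (fun n => skorOp hW ha n (fSpec ha (n + 1) t x)) (prodProcess hW ha t x) := by
  have : CompleteSpace (HP W P) := (Submodule.isClosed_topologicalClosure _).completeSpace_coe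
  obtain ⟨c, hc, h⟩ := exists_norm_skorOp_fSpec_le hW ha t
  exact hasSum_Lp_of_bound (K := HP W P) hc fun n => h n x

theorem isSkorohod_solution (hW : IsNoise H α W P) (ha : Admissible d α H) {t : ℝ} (ht : 0 < t)
    (x : Sp d) :
    IsSkorohod W P (prodProcess hW ha t x) (fun ω => solution hW ha t x ω - 1) := by
  have hm : MemLp (fun ω => solution hW ha t x ω - 1) 2 P :=
    (memLp_solution hW ha ht x).sub (memLp_const 1)
  refine ⟨Lp.memLp _, hm, ?_, fun F DF hF => ?_⟩
  · have h1 : Measurable[fullSigma W] (solution hW ha t x) :=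
      (measurable_solution hW ha ht x).mono (pastSigma_le_fullSigma t) le_rfl
    exact (Measurable.stronglyMeasurable (h1.sub_const 1)).aestronglyMeasurable
  · have h1 := hasSum_inner_Lp hF.1.toLp (hasSum_chaos_succ hW ha ht x)
    have h2 := hasSum_inner_Lp (K := HP W P) hF.2.1.toLp (hasSum_prodProcess hW ha t x)
    -- Duality holds chaos by chaos, `I_{n+1}(f_{n+1})` being the Skorohod integral of `skorOp
    -- f_{n+1}`. Both series of inner products converge, so their sums agree.
    have h3 : ∀ n, ⟪hF.1.toLp, chaos hW ha (n + 1) t x⟫ =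
        ⟪hF.2.1.toLp, skorOp hW ha n (fSpec ha (n + 1) t x)⟫ := fun n =>
      skorOp_duality hW ha (fSpec_mem_closure ha (n + 1) t x) hF
    simp only [h3] at h1
    have h4 := h1.unique h2
    rw [toL2_eq hm, ← integral_inner_eq_inner_toLp] at h4
    have h5 : ∫ ω, F ω * (solution hW ha t x ω - 1) ∂P =
        ∫ ω, ⟪F ω, solution hW ha t x ω - 1⟫ ∂P := by
      congr 1 with ω
      exact mul_comm _ _
    rw [h5, h4, L2.inner_def]
    refine integral_congr_ae ?_
    filter_upwards [hF.2.1.coeFn_toLp] with ω h6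
    rw [h6]

/-- Expand `u` in chaoses. The regularized product tested against `φ` has `I_n` of `regProd` as its
`n`-th term, which tends to `I_n` of the contraction of `f_{n+1}` with `φ`. By `compLpL_skorOp` this
is the action of `φ` on the `n`-th term of `prodProcess`. -/
theorem isWaveProduct_solution (hW : IsNoise H α W P) (ha : Admissible d α H) {t : ℝ} (ht : 0 < t)
    (x : Sp d) : IsWaveProduct W P (solution hW ha) t x (prodProcess hW ha t x) := by
  intro ψ hψ φ hφ
  have hS : MeasurableSet (Ioo 0 t ×ˢ (univ : Set (Sp d))) := measurableSet_Ioo.prod .univ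
  have hu : ∀ ε : ℝ, EqOn (fun z : ℝ × Sp d =>
      (waveReg ψ ε (t - z.1) (x - z.2) * φ z) • toL2 P (solution hW ha z.1 z.2))
      (fun z => (waveReg ψ ε (t - z.1) (x - z.2) * φ z) • solLp hW ha z.1 z.2)
      (Ioo 0 t ×ˢ univ) := fun ε z hz => by
    simp only [toL2_solution hW ha hz.1.1]
  obtain ⟨C, hC⟩ := norm_solLp_le hW ha t
  have hle : ∀ {q : ℝ × Sp d → Prop}, (∀ p : ℝ × Sp d, p.1 ≤ t → q p) →
      ∀ᵐ p ∂(volume.restrict (Ioo 0 t ×ˢ (univ : Set (Sp d)))), q p := fun h =>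
    (ae_restrict_iff' hS).2 (Eventually.of_forall fun p hp => h p hp.1.2.le)
  refine ⟨fun ε hε => ?_, ?_⟩
  · rw [integrableOn_congr_fun (hu ε) hS]
    refine (integrableOn_waveReg_mul hψ hε hφ x).smul_bdd C ?_ (hle fun p hp => hC p.1 p.2 hp)
    exact ((continuousOn_solLp hW ha t).mono
      (prod_mono (fun s hs => hs.2.le) le_rfl)).aestronglyMeasurable hS
  obtain ⟨L, hL⟩ := exists_isAction hW ha.pos ha.upper ha.H_lower ha.H_upper hφ
  have hcoe := L.coeFn_compLpL (p := 2) (μ := P) (prodProcess hW ha t x)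
  refine ⟨L, hL, (memLp_congr_ae hcoe).1 (Lp.memLp _), ?_⟩
  -- Applying `L` pointwise in `ω` is, up to null sets, applying the induced operator on `L²(Ω;
  -- HP)`, which commutes with the sum of the series.
  rw [toL2_eq_of_ae (hcoe.symm)]
  have hlim : L.compLpL 2 P (prodProcess hW ha t x) = ∑' n, wienerOp hW ha n
      (contractL (hφ.memLp_testHat ha.pos ha.upper) n (fSpec ha (n + 1) t x)) := by
    refine ((hasSum_compLpL (K := HP W P) L (hasSum_prodProcess hW ha t x)).tsum_eq.symm).trans ?_
    exact tsum_congr fun n => compLpL_skorOp hW ha hφ hL (fSpec_mem_closure ha (n + 1) t x)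
  rw [hlim]
  obtain ⟨c, hc, hcle, -⟩ := exists_chaos_bound hW ha ht.le
  have hreg : ∀ ε n, ‖wienerOp hW ha n (memLp_regProd ha hψ hφ n ε t x).toLp‖ ≤
      prodConst φ t * c n := fun ε n =>
    hcle n _ _ _ (prodConst_nonneg φ ht.le) (norm_regProd_le hψ hφ ε t x)
  have hchaos : ∀ n (p : ℝ × Sp d), p.1 ≤ t → ‖chaos hW ha n p.1 p.2‖ ≤ c n := fun n p hp => by
    have := hcle n 1 _ (memLp_fHat ha n p.1 p.2) zero_le_one fun z => by
      rw [one_mul]; exact norm_fHat_le hp p.2 z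
    rwa [one_mul] at this
  have heq : ∀ ε : ℝ, 0 < ε → ∫ z in Ioo 0 t ×ˢ univ,
      (waveReg ψ ε (t - z.1) (x - z.2) * φ z) • toL2 P (solution hW ha z.1 z.2) =
      ∑' n, wienerOp hW ha n (memLp_regProd ha hψ hφ n ε t x).toLp := by
    intro ε hε
    rw [setIntegral_congr_fun hS (hu ε)]
    have hk := integrableOn_waveReg_mul hψ hε hφ (t := t) x
    have hn : ∀ n, ∫ p in Ioo 0 t ×ˢ univ, (waveReg ψ ε (t - p.1) (x - p.2) * φ p) •
        chaos hW ha n p.1 p.2 = wienerOp hW ha n (memLp_regProd ha hψ hφ n ε t x).toLp := by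
      intro n
      rw [← integral_waveReg_fSpec ha hψ hφ n hε t x, ← ContinuousLinearMap.integral_comp_comm _
        (integrableOn_waveReg_fSpec ha hψ hφ n hε t x)]
      simp only [map_smul, chaos]
    have hF : ∀ n, Integrable (fun p : ℝ × Sp d => (waveReg ψ ε (t - p.1) (x - p.2) * φ p) •
        chaos hW ha n p.1 p.2) (volume.restrict (Ioo 0 t ×ˢ univ)) := fun n =>
      hk.smul_bdd (c n) (continuous_chaos hW ha n).aestronglyMeasurable (hle (hchaos n))
    have hsum : Summable fun n => ∫ p in Ioo 0 t ×ˢ univ,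
        ‖(waveReg ψ ε (t - p.1) (x - p.2) * φ p) • chaos hW ha n p.1 p.2‖ := by
      refine Summable.of_nonneg_of_le (fun n => integral_nonneg fun _ => norm_nonneg _)
        (fun n => ?_) (hc.mul_left (∫ p in Ioo 0 t ×ˢ univ,
          ‖waveReg ψ ε (t - p.1) (x - p.2) * φ p‖))
      rw [← integral_mul_const]
      refine integral_mono_ae (hF n).norm (hk.norm.mul_const _) ?_
      filter_upwards [hle (hchaos n)] with p hp
      rw [norm_smul]
      gcongr
    refine Eq.trans ?_ ((hasSum_integral_of_summable_integral_norm hF hsum).tsum_eq.symm.trans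
      (tsum_congr hn))
    congr 1 with p : 1
    exact ((hasSum_chaos hW ha p.1 p.2).const_smul _).tsum_eq.symm
  -- Dominated convergence for the series: the terms are bounded by `prodConst φ t * c n` whatever
  -- `ε`, so convergence in each chaos is enough.
  refine Tendsto.congr' (f₁ := fun ε => ∑' n, wienerOp hW ha n
    (memLp_regProd ha hψ hφ n ε t x).toLp) ?_ ?_
  · filter_upwards [self_mem_nhdsWithin] with ε hε
    exact (heq ε hε).symm
  · refine tendsto_tsum_of_dominated_convergence (hc.mul_left (prodConst φ t)) (fun n => ?_)
      (Eventually.of_forall fun ε n => hreg ε n)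
    exact ((wienerOp hW ha n).continuous.tendsto _).comp (tendsto_regProd_toLp ha hψ hφ n t x)

theorem isSolution_solution (hW : IsNoise H α W P) (ha : Admissible d α H) :
    IsSolution W P (solution hW ha) where
  initial x ω := by rw [solution, dif_neg (lt_irrefl 0)]
  square_integrable t ht x := memLp_solution hW ha ht x
  adapted t ht x := measurable_solution hW ha ht x
  equation t ht x :=
    ⟨prodProcess hW ha t x, isWaveProduct_solution hW ha ht x, isSkorohod_solution hW ha ht x⟩

theorem exists_second_moment_bound (hW : IsNoise H α W P) (ha : Admissible d α H) (T : ℝ) :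
    ∃ C : ℝ, ∀ t ∈ Icc 0 T, ∀ x, ∫ ω, solution hW ha t x ω ^ 2 ∂P ≤ C := by
  obtain ⟨C, hC⟩ := norm_solLp_le hW ha T
  refine ⟨max (C ^ 2) 1, fun t ht x => ?_⟩
  rcases ht.1.eq_or_lt with h | h
  · rw [solution, dif_neg (by rw [← h]; exact lt_irrefl 0)]
    simp
  · refine le_trans ?_ (le_max_left _ _)
    have e : ∫ ω, solution hW ha t x ω ^ 2 ∂P = ‖solLp hW ha t x‖ ^ 2 := by
      rw [← real_inner_self_eq_norm_sq, L2.inner_def]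
      refine integral_congr_ae ?_
      filter_upwards [solution_ae_eq hW ha h x] with ω hω
      rw [hω, pow_two]
      rfl
    rw [e]
    exact pow_le_pow_left₀ (norm_nonneg _) (hC t x ht.2) 2

end Solution

end FracWave

end

theorem proposition3p4 {Ω : Type*} [MeasurableSpace Ω] (P : MeasureTheory.Measure Ω)
    [MeasureTheory.IsProbabilityMeasure P] (d : ℕ) (α H : ℝ)
    (hα_pos : 0 < α) (hα_lower : (d : ℝ) - 2 < α) (hα_upper : α < d)
    (hH_lower : 1 / 2 < H) (hH_upper : H < 1)
    (W : FracWave.Rect d → Ω → ℝ) (hW : FracWave.IsNoise H α W P) :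
    ∃ J : ℕ → ℝ → FracWave.Sp d → MeasureTheory.Lp ℝ 2 P,
      (∀ t, 0 < t → ∀ x,
        (∀ n, 1 ≤ n →
          FracWave.IsMultipleIntegral H α W P n (FracWave.kernel n t x) (J n t x)) ∧
        Summable (fun n => J (n + 1) t x)) ∧
      ∃ u : ℝ → FracWave.Sp d → Ω → ℝ,
        FracWave.IsSolution W P u ∧
        (∀ t, 0 < t → ∀ x,
          HasSum (fun n => J (n + 1) t x) (FracWave.toL2 P (fun ω => u t x ω - 1))) ∧
        ∀ T : ℝ, ∃ C : ℝ, ∀ t ∈ Set.Icc 0 T, ∀ x, ∫ ω, u t x ω ^ 2 ∂P ≤ C := by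
  have ha : FracWave.Admissible d α H := ⟨hα_pos, hα_lower, hα_upper, hH_lower, hH_upper⟩
  refine ⟨FracWave.chaos hW ha, fun t ht x => ⟨fun n _ =>
    FracWave.isMultipleIntegral_chaos hW ha n t x,
    (FracWave.hasSum_chaos_succ hW ha ht x).summable⟩, FracWave.solution hW ha,
    FracWave.isSolution_solution hW ha,
    fun t ht x => FracWave.hasSum_chaos_succ hW ha ht x,
    FracWave.exists_second_moment_bound hW ha⟩
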